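/- Let $\Omega\subset\mathbb R^2$ be a bounded polygon (the region inside a simple closed polygonal curve; in particular simply connected) and $\mathcal T_h$ a conforming triangulation of $\Omega$. Let $k\ge 3$ and $\ell\ge k-1$, let $\mathbb S$ be the symmetric $2\times2$ matrices, $\boldsymbol{RT}=\{a+bx:\ a\in\mathbb R^2,\ b\in\mathbb R\}$, $\operatorname{curl}\phi=(\partial_2\phi,-\partial_1\phi)^{\intercal}$, $x^\perp=(x_2,-x_1)^{\intercal}$; $\operatorname{curl}$ of a vector and $\operatorname{div}$ of a matrix field are taken row-wise. On an edge $e$ of a triangle, $n=(n_1,n_2)^{\intercal}$ is a unit normal and $t=(-n_2,n_1)^{\intercal}$; $\mathbb P_{-1}=\{0\}$. On each triangle $K$ the coordinate $x$ is taken with respect to an arbitrary fixed origin (which may depend on $K$). Put $$\Sigma_{\ell,k}(K)=\operatorname{sym}\operatorname{curl}\mathbb P_{\ell+1}(K;\mathbb R^2)\oplus xx^{\intercal}\,\mathbb P_{k-2}(K),$$ with the degrees of freedom 1. $\tau(\delta)$ at the vertices $\delta$ of $K$; 2. $(n^{\intercal}\tau n,q)_e$ for $q\in\mathbb P_{\ell-2}(e)$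 and the edges $e$ of $K$; 3. $(\partial_t(t^{\intercal}\tau n)+n^{\intercal}\operatorname{div}\tau,q)_e$ for $q\in\mathbb P_{\ell-1}(e)$ and the edges $e$ of $K$; 4. $(\tau,\varsigma)_K$ for $\varsigma\in\nabla^2\mathbb P_{k-2}(K)\oplus\operatorname{sym}(x^\perp\otimes\mathbb P_{\ell-2}(K;\mathbb R^2))$; and let $\mathbb P_{\ell+1}(K;\mathbb R^2)$ carry the Hermite degrees of freedom 5. $v(\delta),\nabla v(\delta)$ at the vertices of $K$; 6. $(v,q)_e$ for $q\in\mathbb P_{\ell-3}(e;\mathbb R^2)$ and the edges $e$ of $K$; 7. $(v,q)_K$ for $q\in\mathbb P_{\ell-2}(K;\mathbb R^2)$. Let $V_h$ be the set of $v\in H^1(\Omega;\mathbb R^2)$ with $v|_K\in\mathbb P_{\ell+1}(K;\mathbb R^2)$ for all $K\in\mathcal T_h$ and single-valued 5–6; $\Sigma_h$ the set of $\tau\in L^2(\Omega;\mathbb S)$ with $\tau|_K\in\Sigma_{\ell,k}(K)$ for all $K$ and single-valued 1–3; and $\mathcal Q_h$ the set of $q\in L^2(\Omega)$ with $q|_K\in\mathbb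 P_{k-2}(K)$ for all $K$. For $\tau\in H^2(K;\mathbb S)$ let $\Pi_K\tau\in\Sigma_{\ell,k}(K)$ be the interpolant with the same degrees of freedom 1–4 as $\tau$. For $v\in H^3(K;\mathbb R^2)$ let $\tilde I_Kv\in\mathbb P_{\ell+1}(K;\mathbb R^2)$ be the interpolant with the same degrees of freedom 5–7 as $v$, and let $I_Kv=\tilde I_Kv+\tilde v$, where $\tilde v\in\mathbb P_{\ell+1}(K;\mathbb R^2)$ has vanishing 5–6 and satisfies $\operatorname{sym}\operatorname{curl}\tilde v=\Pi_K(\operatorname{sym}\operatorname{curl}v)-\operatorname{sym}\operatorname{curl}\tilde I_Kv$. Let $\Pi_h$, $I_h$, $Q_h$ be defined on each $K$ by $\Pi_K$, $I_K$ and the $L^2(K)$-orthogonal projection onto $\mathbb P_{k-2}(K)$. Then the finite element complex $$\boldsymbol{RT}\xrightarrow{\ \subset\ }V_h\xrightarrow{\operatorname{sym}\operatorname{curl}}\Sigma_h\xrightarrow{\operatorname{div}\operatorname{div}}\mathcal Q_h\to0$$ is well defined (with weak derivatives on $\Omega$) and exact. Moreover the interpolation operators $I_h:H^3(\Omega;\mathbb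 R^2)\to V_h$, $\Pi_h:H^2(\Omega;\mathbb S)\to\Sigma_h$ and $Q_h:L^2(\Omega)\to\mathcal Q_h$ are well defined (the local interpolants and projections exist and are unique), and they form a commutative diagram from the complex $$\boldsymbol{RT}\xrightarrow{\ \subset\ }H^3(\Omega;\mathbb R^2)\xrightarrow{\operatorname{sym}\operatorname{curl}}H^2(\Omega;\mathbb S)\xrightarrow{\operatorname{div}\operatorname{div}}L^2(\Omega)\to0$$ to the finite element complex: $I_hr=r$ for $r\in\boldsymbol{RT}$, $\operatorname{sym}\operatorname{curl}(I_hv)=\Pi_h(\operatorname{sym}\operatorname{curl}v)$ for $v\in H^3(\Omega;\mathbb R^2)$, and $\operatorname{div}\operatorname{div}(\Pi_h\tau)=Q_h(\operatorname{div}\operatorname{div}\tau)$ for $\tau\in H^2(\Omega;\mathbb S)$. -/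

import Mathlib

open MeasureTheory Filter Topology
open scoped ContDiff

noncomputable section

namespace DivDiv

/-! ### The plane, fields on it, polynomials -/

/-- The Euclidean plane. -/
abbrev Plane := EuclideanSpace ℝ (Fin 2)

abbrev ScalarField := Plane → ℝ
/-- Vector fields, given by their two components. -/
abbrev VectorField := Fin 2 → Plane → ℝ
/-- Tensor (2×2 matrix) fields, given by their entries. -/
abbrev TensorField := Fin 2 → Fin 2 → Plane → ℝ

/-- Real polynomials in the two coordinates. -/
abbrev Poly := MvPolynomial (Fin 2) ℝ

/-- The polynomials of total degree at most `m`. -/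
abbrev polyDeg (m : ℕ) : Submodule ℝ Poly := MvPolynomial.restrictTotalDegree (Fin 2) ℝ m

/-- The function of a polynomial. -/
def ev (p : Poly) : ScalarField := fun x => MvPolynomial.eval (fun i => x i) p

/-- The `m`-th coordinate vector. -/
def unitVec (m : Fin 2) : Plane := EuclideanSpace.single m 1

/-- The classical partial derivative in the `m`-th coordinate. -/
def partialD (m : Fin 2) (φ : ScalarField) : ScalarField := fun x => fderiv ℝ φ x (unitVec m)

/-! ### Differential expressions

In both expressions below `D m i` stands for the partial derivative `∂ₘ vᵢ` of a vector field `v`;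
they are used for (weak) derivatives and for derivatives of polynomials. -/

/-- The row-wise curl: row `i` is `(∂₂ vᵢ, -∂₁ vᵢ)`. -/
def curlOf {R : Type*} [AddCommGroup R] (D : Fin 2 → Fin 2 → R) (i j : Fin 2) : R :=
  ![D 1 i, -D 0 i] j

/-- The symmetric part of the row-wise curl. -/
def symCurlOf {R : Type*} [AddCommGroup R] [Module ℝ R] (D : Fin 2 → Fin 2 → R) (i j : Fin 2) : R :=
  (1 / 2 : ℝ) • (curlOf D i j + curlOf D j i)

/-- `sym curl` of a polynomial vector field. -/
def symCurlPoly (v : Fin 2 → Poly) : Fin 2 → Fin 2 → Poly :=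
  symCurlOf fun m i => MvPolynomial.pderiv m (v i)

/-! ### Sobolev spaces and weak differential operators -/

/-- Test functions on `U`: smooth with compact support inside `U`. -/
def IsTest (U : Set Plane) (φ : ScalarField) : Prop :=
  ContDiff ℝ ∞ φ ∧ HasCompactSupport φ ∧ tsupport φ ⊆ U

/-- Membership in `L²(U)`. -/
def MemL2 (U : Set Plane) (u : ScalarField) : Prop := MemLp u 2 (volume.restrict U)

/-- `u, g ∈ L²(U)` and `g` is the weak partial derivative `∂ₘ u` on `U`. -/
def HasWeakPartial (U : Set Plane) (m : Fin 2) (u g : ScalarField) : Prop :=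
  MemL2 U u ∧ MemL2 U g ∧
    ∀ φ, IsTest U φ → ∫ x in U, u x * partialD m φ x = -∫ x in U, g x * φ x

/-- Membership in the Sobolev space `Hʳ(U)`. -/
def MemH (U : Set Plane) : ℕ → ScalarField → Prop
  | 0, u => MemL2 U u
  | r + 1, u => ∃ g : Fin 2 → ScalarField, ∀ m, HasWeakPartial U m u (g m) ∧ MemH U r (g m)

/-- `Hʳ(U; ℝ²)`. -/
def MemHVec (U : Set Plane) (r : ℕ) (v : VectorField) : Prop := ∀ i, MemH U r (v i)

/-- `Hʳ(U; 𝕊)`, with `𝕊` the symmetric 2×2 matrices. -/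
def MemHSym (U : Set Plane) (r : ℕ) (τ : TensorField) : Prop :=
  (∀ i j, MemH U r (τ i j)) ∧ ∀ i j, τ i j =ᵐ[volume.restrict U] τ j i

/-- `τ = sym curl v` on `U`, in the sense of weak derivatives. -/
def IsSymCurl (U : Set Plane) (v : VectorField) (τ : TensorField) : Prop :=
  ∃ D : Fin 2 → Fin 2 → ScalarField, (∀ m i, HasWeakPartial U m (v i) (D m i)) ∧
    ∀ i j, τ i j =ᵐ[volume.restrict U] symCurlOf D i j

/-- `τ, q` are square integrable on `U` and `q = div div τ` in the sense of distributions, that is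
`τ ∈ H(div div, U)` with `div div τ = q`. -/
def IsDivDiv (U : Set Plane) (τ : TensorField) (q : ScalarField) : Prop :=
  (∀ i j, MemL2 U (τ i j)) ∧ MemL2 U q ∧
    ∀ φ, IsTest U φ →
      ∫ x in U, ∑ i, ∑ j, τ i j x * partialD i (partialD j φ) x = ∫ x in U, q x * φ x

/-! ### Polygons and triangulations -/

/-- A bounded polygon. That the boundary is made of finitely many segments is contained in the
existence of a triangulation (`Triangulation.IsMeshOf`); for sets that have one, the conditions here
say exactly that `Ω` is the region inside one simple closed polygonal curve: `Ω` is simply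
connected, has no slits or punctures (`regular`), and does not touch itself at a boundary point
(`one_sided`). -/
structure IsPolygon (Ω : Set Plane) : Prop where
  isOpen : IsOpen Ω
  bounded : Bornology.IsBounded Ω
  simplyConnected : SimplyConnectedSpace Ω
  regular : interior (closure Ω) = Ω
  one_sided : ∀ x ∈ frontier Ω, ∀ᶠ r in 𝓝[>] (0 : ℝ), IsConnected (Ω ∩ Metric.ball x r)

/-- The closed triangle with vertex set `K`. -/
def hull (K : Finset Plane) : Set Plane := convexHull ℝ (K : Set Plane)

/-- A conforming triangulation: finitely many nondegenerate triangles, given by their vertex sets,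
any two of which intersect in their common vertex, their common edge, or not at all. -/
structure Triangulation where
  cells : Finset (Finset Plane)
  card_eq : ∀ K ∈ cells, K.card = 3
  indep : ∀ K ∈ cells, AffineIndependent ℝ ((↑) : K → Plane)
  inter : ∀ K ∈ cells, ∀ L ∈ cells,
    hull K ∩ hull L = convexHull ℝ ((K : Set Plane) ∩ (L : Set Plane))

/-- The triangles of `M` cover the closure of `Ω` exactly. -/
def Triangulation.IsMeshOf (M : Triangulation) (Ω : Set Plane) : Prop :=
  closure Ω = ⋃ K ∈ M.cells, hull K

/-! ### Edges

The edge with end points `a, b` is oriented from `a` to `b` and parametrised by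
`s ↦ a + s (b - a)`, `s ∈ [0, 1]`. Functions on it are functions of `s`, and the polynomials of
degree at most `m` on it are those in `s` of degree less than `m + 1`. -/

/-- The unit tangent `t`. -/
def tangent (a b : Plane) : Plane := (dist a b)⁻¹ • (b - a)

/-- The unit normal `n` with `t = (-n₂, n₁)`. -/
def normal (a b : Plane) : Fin 2 → ℝ := ![tangent a b 1, -tangent a b 0]

/-- The point with parameter `s`. -/
def edgePt (a b : Plane) (s : ℝ) : Plane := AffineMap.lineMap a b s

/-- The line integral `∫ₑ f q` of a function `f` against a polynomial `q` on the edge. -/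
def edgeMoment (a b : Plane) (f : ℝ → ℝ) (q : Polynomial ℝ) : ℝ :=
  dist a b * ∫ s in (0 : ℝ)..1, f s * q.eval s

/-- `nᵀ T n` for a matrix `T`. -/
def normalNormal (a b : Plane) (T : Fin 2 → Fin 2 → ℝ) : ℝ :=
  ∑ i, ∑ j, normal a b i * T i j * normal a b j

/-- `∂ₜ(tᵀ τ n) + nᵀ div τ`, where `D m i j` stands for `∂ₘ τᵢⱼ`. -/
def shear (a b : Plane) (D : Fin 2 → Fin 2 → Fin 2 → ℝ) : ℝ :=
  (∑ m, ∑ i, ∑ j, tangent a b m * tangent a b i * normal a b j * D m i j) +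
    ∑ i, ∑ j, normal a b i * D j i j

/-- The trace of a polynomial tensor on an edge: `nᵀ p n`. -/
def polyNN (a b : Plane) (p : Fin 2 → Fin 2 → Poly) (s : ℝ) : ℝ :=
  normalNormal a b fun i j => ev (p i j) (edgePt a b s)

/-- The trace of a polynomial tensor on an edge: `∂ₜ(tᵀ p n) + nᵀ div p`. -/
def polyShear (a b : Plane) (p : Fin 2 → Fin 2 → Poly) (s : ℝ) : ℝ :=
  shear a b fun m i j => ev (MvPolynomial.pderiv m (p i j)) (edgePt a b s)

/-! ### Point values and traces of Sobolev functions -/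

/-- `g` is the representative of `u` that is continuous on the closed triangle `K`. -/
def IsContRep (K : Finset Plane) (u g : ScalarField) : Prop :=
  ContinuousOn g (hull K) ∧ u =ᵐ[volume.restrict (hull K)] g

/-- `g ∈ L²(e)` is the trace of `u ∈ H¹(K)` on the edge `e` from `a` to `b`: smooth functions
`φₙ` converge to `u` in `H¹(K)` while their restrictions to `e` converge to `g` in `L²(e)`. -/
def IsEdgeTrace (K : Finset Plane) (a b : Plane) (u : ScalarField) (g : ℝ → ℝ) : Prop :=
  MemLp g 2 (volume.restrict (Set.Icc (0 : ℝ) 1)) ∧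
  ∃ w : Fin 2 → ScalarField, (∀ m, HasWeakPartial (interior (hull K)) m u (w m)) ∧
  ∃ φ : ℕ → ScalarField, (∀ n, ContDiff ℝ ∞ (φ n)) ∧
    Tendsto (fun n => eLpNorm (fun x => φ n x - u x) 2 (volume.restrict (interior (hull K))))
      atTop (𝓝 0) ∧
    (∀ m, Tendsto (fun n => eLpNorm (fun x => partialD m (φ n) x - w m x) 2
      (volume.restrict (interior (hull K)))) atTop (𝓝 0)) ∧
    Tendsto (fun n => eLpNorm (fun s => φ n (edgePt a b s) - g s) 2
      (volume.restrict (Set.Icc (0 : ℝ) 1))) atTop (𝓝 0)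

/-! ### The spaces on one triangle

`c` is the origin of the coordinate `x` used in the Koszul type operators on the triangle. -/

/-- The `i`-th component of `x - c`. -/
def coord (c : Plane) (i : Fin 2) : Poly := MvPolynomial.X i - MvPolynomial.C (c i)

/-- The `i`-th component of `(x - c)^⊥`, where `(x₁, x₂)^⊥ = (x₂, -x₁)`. -/
def coordPerp (c : Plane) : Fin 2 → Poly := ![coord c 1, -coord c 0]

/-- The space `sym curl ℙ_{ℓ+1}(ℝ²) + x xᵀ ℙ_{k-2}` of shape functions. -/
def SigmaLocal (ℓ k : ℕ) (c : Plane) : Set (Fin 2 → Fin 2 → Poly) :=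
  {p | ∃ v : Fin 2 → Poly, (∀ i, v i ∈ polyDeg (ℓ + 1)) ∧ ∃ q ∈ polyDeg (k - 2),
    ∀ i j, p i j = symCurlPoly v i j + coord c i * coord c j * q}

/-- The space `∇² ℙ_{k-2} + sym(x^⊥ ⊗ ℙ_{ℓ-2}(ℝ²))` of interior moments. -/
def InteriorTests (ℓ k : ℕ) (c : Plane) : Set (Fin 2 → Fin 2 → Poly) :=
  {ς | ∃ q ∈ polyDeg (k - 2), ∃ w : Fin 2 → Poly, (∀ i, w i ∈ polyDeg (ℓ - 2)) ∧
    ∀ i j, ς i j = MvPolynomial.pderiv i (MvPolynomial.pderiv j q) +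
      (1 / 2 : ℝ) • (coordPerp c i * w j + coordPerp c j * w i)}

/-- The polynomials in `ℙ_{ℓ+1}(K; ℝ²)` whose vertex values, vertex gradients and edge moments of
degree at most `ℓ - 3` vanish. -/
def VBubble (ℓ : ℕ) (K : Finset Plane) : Set (Fin 2 → Poly) :=
  {p | (∀ i, p i ∈ polyDeg (ℓ + 1)) ∧
    (∀ δ ∈ K, ∀ i, ev (p i) δ = 0 ∧ ∀ m, ev (MvPolynomial.pderiv m (p i)) δ = 0) ∧
    ∀ a ∈ K, ∀ b ∈ K, a ≠ b → ∀ q ∈ Polynomial.degreeLT ℝ (ℓ - 2), ∀ i,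
      edgeMoment a b (fun s => ev (p i) (edgePt a b s)) q = 0}

/-! ### Interpolation on one triangle -/

/-- `p` is the nodal interpolant in `SigmaLocal` of the symmetric tensor field `τ ∈ H²(K; 𝕊)`:
vertex values, the edge moments of `nᵀ τ n` and of `∂ₜ(tᵀ τ n) + nᵀ div τ`, and the interior moments
agree. Here `T` is the continuous representative of `τ`, `D m i j` is the weak derivative
`∂ₘ τᵢⱼ`, and `G m i j` its trace on the edge. -/
def IsSigmaInterp (ℓ k : ℕ) (c : Plane) (K : Finset Plane) (τ : TensorField)
    (p : Fin 2 → Fin 2 → Poly) : Prop :=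
  p ∈ SigmaLocal ℓ k c ∧
  ∃ (T : TensorField) (D : Fin 2 → Fin 2 → Fin 2 → ScalarField),
    (∀ i j, IsContRep K (τ i j) (T i j)) ∧
    (∀ m i j, HasWeakPartial (interior (hull K)) m (τ i j) (D m i j)) ∧
    (∀ δ ∈ K, ∀ i j, ev (p i j) δ = T i j δ) ∧
    (∀ a ∈ K, ∀ b ∈ K, a ≠ b →
      (∀ q ∈ Polynomial.degreeLT ℝ (ℓ - 1), edgeMoment a b (polyNN a b p) q =
        edgeMoment a b (fun s => normalNormal a b fun i j => T i j (edgePt a b s)) q) ∧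
      ∃ G : Fin 2 → Fin 2 → Fin 2 → ℝ → ℝ, (∀ m i j, IsEdgeTrace K a b (D m i j) (G m i j)) ∧
        ∀ q ∈ Polynomial.degreeLT ℝ ℓ, edgeMoment a b (polyShear a b p) q =
          edgeMoment a b (fun s => shear a b fun m i j => G m i j s) q) ∧
    ∀ ς ∈ InteriorTests ℓ k c,
      ∫ x in hull K, ∑ i, ∑ j, ev (p i j) x * ev (ς i j) x =
        ∫ x in hull K, ∑ i, ∑ j, τ i j x * ev (ς i j) x

/-- `p` is the Hermite interpolant of degree `ℓ + 1` of `v ∈ H³(K; ℝ²)`: vertex values, vertex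
gradients, edge moments of degree at most `ℓ - 3` and interior moments of degree at most `ℓ - 2`
agree. `V` and `D m i` are the continuous representatives of `v` and of `∂ₘ vᵢ`. -/
def IsHermiteInterp (ℓ : ℕ) (K : Finset Plane) (v : VectorField) (p : Fin 2 → Poly) : Prop :=
  (∀ i, p i ∈ polyDeg (ℓ + 1)) ∧
  ∃ (V : VectorField) (D : Fin 2 → Fin 2 → ScalarField),
    (∀ i, IsContRep K (v i) (V i)) ∧
    (∀ m i, HasWeakPartial (interior (hull K)) m (v i) (D m i) ∧ ContinuousOn (D m i) (hull K)) ∧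
    (∀ δ ∈ K, ∀ i, ev (p i) δ = V i δ ∧ ∀ m, ev (MvPolynomial.pderiv m (p i)) δ = D m i δ) ∧
    (∀ a ∈ K, ∀ b ∈ K, a ≠ b → ∀ q ∈ Polynomial.degreeLT ℝ (ℓ - 2), ∀ i,
      edgeMoment a b (fun s => ev (p i) (edgePt a b s)) q =
        edgeMoment a b (fun s => V i (edgePt a b s)) q) ∧
    ∀ q ∈ polyDeg (ℓ - 2), ∀ i,
      ∫ x in hull K, ev (p i) x * ev q x = ∫ x in hull K, v i x * ev q x

/-- `p` is the modified interpolant `I_K v = Ĩ_K v + ṽ`: `Ĩ_K v` is the Hermite interpolant, and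
`ṽ` in the bubble space satisfies `sym curl ṽ = Π_K (sym curl v) - sym curl (Ĩ_K v)`. -/
def IsVInterp (ℓ k : ℕ) (c : Plane) (K : Finset Plane) (v : VectorField) (p : Fin 2 → Poly) :
    Prop :=
  ∃ (p₀ w : Fin 2 → Poly) (τ : TensorField) (σ : Fin 2 → Fin 2 → Poly),
    IsHermiteInterp ℓ K v p₀ ∧ IsSymCurl (interior (hull K)) v τ ∧ IsSigmaInterp ℓ k c K τ σ ∧
    w ∈ VBubble ℓ K ∧ symCurlPoly w = σ - symCurlPoly p₀ ∧ p = p₀ + w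

/-- `p` is the `L²(K)`-orthogonal projection of `q` onto the polynomials of degree at most `r`. -/
def IsL2Proj (r : ℕ) (K : Finset Plane) (q : ScalarField) (p : Poly) : Prop :=
  p ∈ polyDeg r ∧ ∀ z ∈ polyDeg r,
    ∫ x in hull K, ev p x * ev z x = ∫ x in hull K, q x * ev z x

/-- The operator `Π_K`. -/
def sigmaInterp (ℓ k : ℕ) (c : Plane) (K : Finset Plane) (τ : TensorField) : Fin 2 → Fin 2 → Poly :=
  Classical.epsilon (IsSigmaInterp ℓ k c K τ)

/-- The operator `I_K`. -/
def vInterp (ℓ k : ℕ) (c : Plane) (K : Finset Plane) (v : VectorField) : Fin 2 → Poly :=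
  Classical.epsilon (IsVInterp ℓ k c K v)

/-- The operator `Q_r^K`. -/
def l2Proj (r : ℕ) (K : Finset Plane) (q : ScalarField) : Poly :=
  Classical.epsilon (IsL2Proj r K q)

/-! ### Global spaces and operators -/

/-- The lowest order Raviart-Thomas space, `{a + b x}`. -/
def RT : Set VectorField := {v | ∃ (a : Fin 2 → ℝ) (b : ℝ), ∀ i x, v i x = a i + b * x i}

/-- The field that is the polynomial `p K` inside each triangle `K`. -/
def piecewise (M : Triangulation) (p : Finset Plane → Poly) : ScalarField :=
  fun x => ∑ K ∈ M.cells, (interior (hull K)).indicator (ev (p K)) x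

/-- The restriction of `u` to the triangle `K` is the polynomial `p`. -/
def EqOnCell (K : Finset Plane) (u : ScalarField) (p : Poly) : Prop :=
  u =ᵐ[volume.restrict (hull K)] ev p

/-- The space `V_h`. -/
def Vh (Ω : Set Plane) (M : Triangulation) (ℓ : ℕ) : Set VectorField :=
  {v | MemHVec Ω 1 v ∧
    ∃ p : Finset Plane → Fin 2 → Poly,
      (∀ K ∈ M.cells, ∀ i, p K i ∈ polyDeg (ℓ + 1) ∧ EqOnCell K (v i) (p K i)) ∧
      ∀ K ∈ M.cells, ∀ L ∈ M.cells,
        (∀ δ, δ ∈ K → δ ∈ L → ∀ i, ev (p K i) δ = ev (p L i) δ ∧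
          ∀ m, ev (MvPolynomial.pderiv m (p K i)) δ = ev (MvPolynomial.pderiv m (p L i)) δ) ∧
        ∀ a b, a ∈ K → a ∈ L → b ∈ K → b ∈ L → a ≠ b →
          ∀ q ∈ Polynomial.degreeLT ℝ (ℓ - 2), ∀ i,
            edgeMoment a b (fun s => ev (p K i) (edgePt a b s)) q =
              edgeMoment a b (fun s => ev (p L i) (edgePt a b s)) q}

/-- The space `Σ_h`; `c K` is the origin of the local coordinate on `K`. -/
def SigmaH (Ω : Set Plane) (M : Triangulation) (c : Finset Plane → Plane) (ℓ k : ℕ) :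
    Set TensorField :=
  {τ | (∀ i j, MemL2 Ω (τ i j)) ∧
    ∃ p : Finset Plane → Fin 2 → Fin 2 → Poly,
      (∀ K ∈ M.cells, p K ∈ SigmaLocal ℓ k (c K) ∧ ∀ i j, EqOnCell K (τ i j) (p K i j)) ∧
      ∀ K ∈ M.cells, ∀ L ∈ M.cells,
        (∀ δ, δ ∈ K → δ ∈ L → ∀ i j, ev (p K i j) δ = ev (p L i j) δ) ∧
        ∀ a b, a ∈ K → a ∈ L → b ∈ K → b ∈ L → a ≠ b →
          (∀ q ∈ Polynomial.degreeLT ℝ (ℓ - 1),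
            edgeMoment a b (polyNN a b (p K)) q = edgeMoment a b (polyNN a b (p L)) q) ∧
          ∀ q ∈ Polynomial.degreeLT ℝ ℓ,
            edgeMoment a b (polyShear a b (p K)) q = edgeMoment a b (polyShear a b (p L)) q}

/-- The space `𝒬_h` of piecewise polynomials of degree at most `k - 2`. -/
def Qh (Ω : Set Plane) (M : Triangulation) (k : ℕ) : Set ScalarField :=
  {q | MemL2 Ω q ∧ ∀ K ∈ M.cells, ∃ p ∈ polyDeg (k - 2), EqOnCell K q p}

/-- The operator `I_h`. -/
def interpV (M : Triangulation) (c : Finset Plane → Plane) (ℓ k : ℕ) (v : VectorField) :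
    VectorField :=
  fun i => piecewise M fun K => vInterp ℓ k (c K) K v i

/-- The operator `Π_h`. -/
def interpSigma (M : Triangulation) (c : Finset Plane → Plane) (ℓ k : ℕ) (τ : TensorField) :
    TensorField :=
  fun i j => piecewise M fun K => sigmaInterp ℓ k (c K) K τ i j

/-- The operator `Q_h`. -/
def projQ (M : Triangulation) (k : ℕ) (q : ScalarField) : ScalarField :=
  piecewise M fun K => l2Proj (k - 2) K q

end DivDiv

end

open DivDiv

open MeasureTheory Filter Topology
open scoped ContDiff

noncomputable section

namespace DivDiv

open scoped Polynomial
open MvPolynomial (pderiv)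
open Submodule (smul_mem)
open Fin (sum_univ_two)
open Bornology (IsBounded)
open intervalIntegral (integral_of_le integral_eq_sub_of_hasDerivAt integral_comp_sub_left
  integral_mono_on)
open Set (Icc Ioo mem_ofPred_eq indicator_of_notMem indicator_of_mem mem_iUnion inter_subset_left
  Ioo_subset_Icc_self)
open Polynomial (degreeLT derivative X eval_sub degreeLT_mono eval_smul mem_degreeLT)
open Finset (sum_congr sum_nonneg sum_add_distrib mul_sum sum_mul sum_comm sum_eq_zero
  sum_eq_zero_iff_of_nonneg sum_sub_distrib smul_sum sum_insert)

/-- The measure on the parameters of an edge. -/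
local notation "edgeVol" => (volume.restrict (Icc (0 : ℝ) 1))

/-- The area measure on a set. -/
local notation "vol" => Measure.restrict volume

/-- Tensor fields of polynomials. -/
local notation "TensorPoly" => Fin 2 → Fin 2 → Poly

/-- The open triangle. -/
local notation:max K:max "°" => interior (hull K)

variable {a b c x : Plane} {p q : Poly} {f g : ScalarField} {m n : ℕ} {r : ℝ}

/-! ### Polynomial functions and their derivatives -/

@[simp] lemma ev_add (p q : Poly) (x : Plane) : ev (p + q) x = ev p x + ev q x := by simp [ev]
@[simp] lemma ev_sub (p q : Poly) (x : Plane) : ev (p - q) x = ev p x - ev q x := by simp [ev]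
@[simp] lemma ev_neg (p : Poly) (x : Plane) : ev (-p) x = -ev p x := by simp [ev]
@[simp] lemma ev_mul (p q : Poly) (x : Plane) : ev (p * q) x = ev p x * ev q x := by simp [ev]
@[simp] lemma ev_zero (x : Plane) : ev 0 x = 0 := by simp [ev]
@[simp] lemma ev_one (x : Plane) : ev 1 x = 1 := by simp [ev]
@[simp] lemma ev_C (r : ℝ) (x : Plane) : ev (MvPolynomial.C r) x = r := by simp [ev]
@[simp] lemma ev_X (i : Fin 2) (x : Plane) : ev (MvPolynomial.X i) x = x i := by simp [ev]
@[simp] lemma ev_smul (r : ℝ) (p : Poly) (x : Plane) : ev (r • p) x = r * ev p x := by simp [ev]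
@[simp] lemma ev_coord (c : Plane) (i : Fin 2) (x : Plane) : ev (coord c i) x = x i - c i := by
  simp [coord]
@[simp] lemma ev_sum {ι : Type*} (s : Finset ι) (p : ι → Poly) (x : Plane) :
    ev (∑ i ∈ s, p i) x = ∑ i ∈ s, ev (p i) x := by
  simp [ev]

lemma ev_injective (h : ∀ x, ev p x = ev q x) : p = q := by
  refine MvPolynomial.funext fun x => ?_
  simpa [ev] using h (WithLp.toLp 2 x)

lemma contDiff_ev (p : Poly) : ContDiff ℝ ∞ (ev p) := by
  induction p using MvPolynomial.induction_on with
  | C a =>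
    have : ev (MvPolynomial.C a) = fun _ => a := by ext; simp
    rw [this]; exact contDiff_const
  | add p q hp hq =>
    have : ev (p + q) = fun x => ev p x + ev q x := by ext x; simp
    rw [this]; exact hp.add hq
  | mul_X p i hp =>
    have : ev (p * MvPolynomial.X i) = fun x => ev p x * x i := by ext x; simp
    rw [this]; exact hp.mul (by fun_prop)

lemma continuous_ev (p : Poly) : Continuous (ev p) := (contDiff_ev p).continuous

lemma differentiable_ev (p : Poly) : Differentiable ℝ (ev p) :=
  (contDiff_ev p).differentiable (by simp)

@[simp] lemma unitVec_apply (m i : Fin 2) : unitVec m i = if i = m then 1 else 0 := by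
  simp [unitVec, PiLp.single_apply]

lemma partialD_const (m : Fin 2) (r : ℝ) : partialD m (fun _ => r) = 0 := by ext x; simp [partialD]

lemma partialD_add (m : Fin 2) (hf : DifferentiableAt ℝ f x) (hg : DifferentiableAt ℝ g x) :
    partialD m (fun y => f y + g y) x = partialD m f x + partialD m g x := by
  simp only [partialD]; rw [fderiv_fun_add hf hg]; rfl

lemma partialD_mul (m : Fin 2) (hf : DifferentiableAt ℝ f x) (hg : DifferentiableAt ℝ g x) :
    partialD m (fun y => f y * g y) x = partialD m f x * g x + f x * partialD m g x := by
  simp only [partialD]; rw [fderiv_fun_mul hf hg]; simp; ring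

lemma partialD_coord (m i : Fin 2) (x : Plane) :
    partialD m (fun y => y i) x = if i = m then 1 else 0 := by
  have : HasFDerivAt (fun y : Plane => y i) (EuclideanSpace.proj (𝕜 := ℝ) i) x :=
    (EuclideanSpace.proj (𝕜 := ℝ) i : Plane →L[ℝ] ℝ).hasFDerivAt
  simp [partialD, this.fderiv]

@[simp] lemma partialD_ev (m : Fin 2) (p : Poly) : partialD m (ev p) = ev (pderiv m p) := by
  ext x
  induction p using MvPolynomial.induction_on with
  | C a =>
    have : ev (MvPolynomial.C a) = fun _ => a := by ext; simp
    rw [this, partialD_const]; simp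
  | add p q hp hq =>
    have : ev (p + q) = fun x => ev p x + ev q x := by ext x; simp
    rw [this, partialD_add m (differentiable_ev p x) (differentiable_ev q x), hp, hq]; simp
  | mul_X p i hp =>
    have : ev (p * MvPolynomial.X i) = fun x => ev p x * x i := by ext x; simp
    rw [this, partialD_mul m (differentiable_ev p x) (by fun_prop), hp, partialD_coord]
    by_cases h : i = m
    · subst h; simp; ring
    · simp [MvPolynomial.pderiv_X_of_ne h, h]; ring

lemma pderiv_comm (i j : Fin 2) (p : Poly) : pderiv i (pderiv j p) = pderiv j (pderiv i p) := by
  induction p using MvPolynomial.induction_on with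
  | C a => simp
  | add p q hp hq => simp [hp, hq]
  | mul_X p k hp =>
    have hX : ∀ l m, pderiv l (pderiv m (MvPolynomial.X k : Poly)) = 0 := by
      intro l m
      rw [MvPolynomial.pderiv_X, Pi.single_apply]
      split_ifs <;> simp
    simp only [MvPolynomial.pderiv_mul, map_add, hp, hX]
    ring

lemma pderiv_smul (i : Fin 2) (r : ℝ) (p : Poly) : pderiv i (r • p) = r • pderiv i p := by simp

@[simp] lemma pderiv_coord (m i : Fin 2) (c : Plane) :
    pderiv m (coord c i) = if i = m then 1 else 0 := by
  by_cases h : i = m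
  · subst h; simp [coord]
  · simp [coord, h, MvPolynomial.pderiv_X_of_ne h]

/-! ### Degrees -/

lemma mem_polyDeg : p ∈ polyDeg m ↔ p.totalDegree ≤ m := MvPolynomial.mem_restrictTotalDegree _ _ _

lemma polyDeg_mono (h : m ≤ n) : polyDeg m ≤ polyDeg n := fun _ hp =>
  mem_polyDeg.2 ((mem_polyDeg.1 hp).trans h)

lemma mul_mem_polyDeg (hp : p ∈ polyDeg m) (hq : q ∈ polyDeg n) : p * q ∈ polyDeg (m + n) :=
  mem_polyDeg.2 ((MvPolynomial.totalDegree_mul _ _).trans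
    (add_le_add (mem_polyDeg.1 hp) (mem_polyDeg.1 hq)))

lemma C_mem_polyDeg (r : ℝ) (m : ℕ) : (MvPolynomial.C r : Poly) ∈ polyDeg m :=
  mem_polyDeg.2 (by simp)

lemma one_mem_polyDeg (m : ℕ) : (1 : Poly) ∈ polyDeg m := by simpa using C_mem_polyDeg 1 m

lemma X_mem_polyDeg (i : Fin 2) : (MvPolynomial.X i : Poly) ∈ polyDeg 1 := mem_polyDeg.2 (by simp)

lemma coord_mem_polyDeg (c : Plane) (i : Fin 2) : coord c i ∈ polyDeg 1 :=
  sub_mem (X_mem_polyDeg i) (C_mem_polyDeg _ _)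

lemma pderiv_mem_polyDeg (i : Fin 2) (hp : p ∈ polyDeg (m + 1)) : pderiv i p ∈ polyDeg m := by
  have hp' := hp
  rw [polyDeg, MvPolynomial.restrictTotalDegree, MvPolynomial.restrictSupport_eq_span] at hp'
  induction hp' using Submodule.span_induction with
  | mem x h =>
    obtain ⟨s, hs, rfl⟩ := h
    rw [MvPolynomial.pderiv_monomial, polyDeg, MvPolynomial.restrictTotalDegree,
      MvPolynomial.monomial_mem_restrictSupport]
    by_cases h0 : s i = 0
    · right; simp [h0]
    · left
      have e : (s - Finsupp.single i 1) + Finsupp.single i 1 = s :=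
        tsub_add_cancel_of_le (by simp; omega)
      have : (s.sum fun _ e => e) = ((s - Finsupp.single i 1).sum fun _ e => e) + 1 := by
        conv_lhs => rw [← e]
        rw [Finsupp.sum_add_index' (by simp) (by simp)]; simp
      simp only [mem_ofPred_eq] at hs ⊢
      omega
  | zero => simp
  | add x y hx hy h1 h2 =>
    simp only [map_add]
    refine add_mem (h1 ?_) (h2 ?_) <;>
      rwa [polyDeg, MvPolynomial.restrictTotalDegree, MvPolynomial.restrictSupport_eq_span]
  | smul a x hx h =>
    rw [pderiv_smul]
    refine smul_mem _ _ (h ?_)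
    rwa [polyDeg, MvPolynomial.restrictTotalDegree, MvPolynomial.restrictSupport_eq_span]

lemma mem_polyDeg_of_mul (hp : p.totalDegree = n) (hp0 : p ≠ 0) (h : p * q ∈ polyDeg (n + m)) :
    q ∈ polyDeg m := by
  by_cases hq : q = 0
  · subst hq; simp
  rw [mem_polyDeg, MvPolynomial.totalDegree_mul_of_isDomain hp0 hq, hp] at h
  exact mem_polyDeg.2 (by omega)

lemma finrank_polyDeg_eq (m : ℕ) :
    Module.finrank ℝ (polyDeg m) = ∑ i ∈ Finset.range (m + 1), (m + 1 - i) := by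
  refine (Module.finrank_eq_nat_card_basis (MvPolynomial.basisRestrictSupport ℝ
    {n : Fin 2 →₀ ℕ | (n.sum fun _ e => e) ≤ m})).trans ?_
  have e : {n : Fin 2 →₀ ℕ | (n.sum fun _ e => e) ≤ m} ≃
      ((Finset.range (m + 1)).sigma fun i => Finset.range (m + 1 - i)) :=
    { toFun := fun n => ⟨⟨n.1 0, n.1 1⟩, by
        have := n.2
        rw [mem_ofPred_eq, Finsupp.sum_fintype _ _ (by simp), sum_univ_two] at this
        simp; omega⟩
      invFun := fun n => ⟨Finsupp.equivFunOnFinite.symm ![n.1.1, n.1.2], by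
        have h := Finset.mem_sigma.1 n.2
        have h1 := Finset.mem_range.1 h.1
        have h2 := Finset.mem_range.1 h.2
        rw [mem_ofPred_eq, Finsupp.sum_fintype _ _ (by simp), sum_univ_two]
        change n.1.1 + n.1.2 ≤ m
        omega⟩
      left_inv := fun n => by ext i; fin_cases i <;> simp
      right_inv := fun n => by simp }
  rw [Nat.card_congr e, Nat.card_eq_fintype_card, Fintype.card_coe, Finset.card_sigma]
  simp

lemma finrank_polyDeg_succ (m : ℕ) :
    Module.finrank ℝ (polyDeg (m + 1)) = Module.finrank ℝ (polyDeg m) + (m + 2) := by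
  rw [finrank_polyDeg_eq, finrank_polyDeg_eq, Finset.sum_range_succ']
  simp

lemma finrank_polyDeg_add_three (m : ℕ) :
    Module.finrank ℝ (polyDeg (m + 3)) = Module.finrank ℝ (polyDeg m) + 3 * (m + 3) := by
  rw [finrank_polyDeg_succ, finrank_polyDeg_succ, finrank_polyDeg_succ]; ring

/-! ### Restriction to a line -/

/-- The restriction of a polynomial to the line through `a` and `b`, as a polynomial in the
parameter `s` of `a + s (b - a)`. -/
def restr (a b : Plane) : Poly →ₐ[ℝ] ℝ[X] :=
  MvPolynomial.aeval fun i => Polynomial.C (a i) + X * Polynomial.C (b i - a i)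

lemma edgePt_apply (a b : Plane) (s : ℝ) (i : Fin 2) : edgePt a b s i = a i + s * (b i - a i) := by
  simp [edgePt, AffineMap.lineMap_apply]; ring

@[simp] lemma edgePt_zero (a b : Plane) : edgePt a b 0 = a := by simp [edgePt]
@[simp] lemma edgePt_one (a b : Plane) : edgePt a b 1 = b := by simp [edgePt]

lemma edgePt_swap (a b : Plane) (s : ℝ) : edgePt b a s = edgePt a b (1 - s) := by
  ext i; simp only [edgePt_apply]; ring

lemma continuous_edgePt (a b : Plane) : Continuous (edgePt a b) := AffineMap.lineMap_continuous

@[simp] lemma eval_restr (a b : Plane) (p : Poly) (s : ℝ) :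
    (restr a b p).eval s = ev p (edgePt a b s) := by
  induction p using MvPolynomial.induction_on with
  | C r => simp [restr]
  | add p q hp hq => simp [hp, hq]
  | mul_X p i hp =>
    rw [map_mul, Polynomial.eval_mul, hp, ev_mul, ev_X, edgePt_apply]; simp [restr]

lemma derivative_restr (a b : Plane) (p : Poly) : derivative (restr a b p) =
      ∑ m, Polynomial.C (b m - a m) * restr a b (pderiv m p) := by
  induction p using MvPolynomial.induction_on with
  | C r => simp [restr]
  | add p q hp hq => simp only [map_add, hp, hq, mul_add, sum_add_distrib]
  | mul_X p i hp =>
    simp only [map_mul, Polynomial.derivative_mul, hp, MvPolynomial.pderiv_mul, map_add]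
    have hX : restr a b (MvPolynomial.X i) =
      Polynomial.C (a i) + X * Polynomial.C (b i - a i) := by simp [restr]
    rw [hX]
    fin_cases i <;> simp [MvPolynomial.pderiv_X, sum_univ_two] <;> ring

lemma natDegree_restr_le (a b : Plane) (hp : p ∈ polyDeg m) : (restr a b p).natDegree ≤ m := by
  rw [restr, MvPolynomial.aeval_def, MvPolynomial.eval₂_eq']
  refine Polynomial.natDegree_sum_le_of_forall_le _ _ fun d hd => ?_
  have h1 : d 0 + d 1 ≤ m := by
    have := (MvPolynomial.le_totalDegree hd).trans (mem_polyDeg.1 hp)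
    rwa [Finsupp.sum_fintype _ _ (by simp), sum_univ_two] at this
  have h2 (i : Fin 2) : (Polynomial.C (a i) + X * Polynomial.C (b i - a i)).natDegree ≤ 1 := by
    compute_degree
  have h3 (i : Fin 2) :
      ((Polynomial.C (a i) + X * Polynomial.C (b i - a i)) ^ d i).natDegree ≤ d i :=
    (Polynomial.natDegree_pow_le).trans (by nlinarith [h2 i])
  rw [Fin.prod_univ_two]
  refine (Polynomial.natDegree_C_mul_le _ _).trans ?_
  exact (Polynomial.natDegree_mul_le).trans ((add_le_add (h3 0) (h3 1)).trans h1)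

lemma restr_eq_zero_iff : restr a b p = 0 ↔ ∀ s, ev p (edgePt a b s) = 0 := by
  constructor
  · intro h s; rw [← eval_restr, h]; simp
  · intro h; exact Polynomial.funext fun s => by simp [h]

/-! ### The Euler operator -/

/-- The operator `q ↦ (x - c) · ∇ q + r q`. -/
def euler (c : Plane) (r : ℝ) (q : Poly) : Poly :=
  ∑ i, coord c i * pderiv i q + r • q

lemma euler_injective (hr : 0 < r) (h : euler c r q = 0) : q = 0 := by
  refine ev_injective fun y => ?_
  have h1 : X * derivative (restr c y q) + Polynomial.C r * restr c y q = 0 := by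
    rw [derivative_restr]
    refine Polynomial.funext fun s => ?_
    have := congrArg (fun p => ev p (edgePt c y s)) h
    simp [euler, sum_univ_two, edgePt_apply] at this ⊢
    linarith
  have h2 : restr c y q = 0 := by
    ext n
    have := congrArg (fun p => p.coeff n) h1
    cases n with
    | zero => simpa [hr.ne'] using this
    | succ n =>
      simp only [Polynomial.coeff_add, Polynomial.coeff_X_mul, Polynomial.coeff_derivative,
        Polynomial.coeff_C_mul, Polynomial.coeff_zero] at this ⊢
      have h3 : (restr c y q).coeff (n + 1) * ((n : ℝ) + 1 + r) = 0 := by linarith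
      rcases mul_eq_zero.1 h3 with h | h
      · exact h
      · have : (0 : ℝ) ≤ n := n.cast_nonneg
        linarith
  have := restr_eq_zero_iff.1 h2 1
  simpa using this

lemma euler_mem_polyDeg (c : Plane) (r : ℝ) (hq : q ∈ polyDeg m) : euler c r q ∈ polyDeg m := by
  refine add_mem (sum_mem fun i _ => ?_) (smul_mem _ _ hq)
  rcases m with _ | m
  · have : q.totalDegree = 0 := by have := mem_polyDeg.1 hq; omega
    rw [MvPolynomial.totalDegree_eq_zero_iff_eq_C.1 this]; simp
  · have := mul_mem_polyDeg (coord_mem_polyDeg c i) (pderiv_mem_polyDeg i hq)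
    rwa [add_comm] at this

/-- The second order part of `div div (x xᵀ q)`. -/
lemma divDiv_coord_mul (c : Plane) (q : Poly) :
    ∑ i, ∑ j, pderiv i (pderiv j (coord c i * coord c j * q)) = euler c 2 (euler c 3 q) := by
  refine ev_injective fun x => ?_
  simp [euler, sum_univ_two, pderiv_comm 1 0]
  ring

/-! ### Divisibility by the equation of a line -/

/-- The determinant of two vectors. -/
def det (d e : Plane) : ℝ := d 0 * e 1 - d 1 * e 0

/-- The affine polynomial that vanishes on the line through `a`, `b` and is `1` at `c`. -/
def baryPoly (a b c : Plane) : Poly :=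
  (det (b - a) (c - a))⁻¹ • ((b 0 - a 0) • coord a 1 - (b 1 - a 1) • coord a 0)

lemma ev_baryPoly (a b c x : Plane) :
    ev (baryPoly a b c) x = det (b - a) (x - a) / det (b - a) (c - a) := by
  simp [baryPoly, det]; ring

lemma baryPoly_dvd (hD : det (b - a) (c - a) ≠ 0) (h : restr a b p = 0) : baryPoly a b c ∣ p := by
  set S := baryPoly c a b with hS
  have hx : ∀ i, MvPolynomial.X i - (MvPolynomial.C (a i) + S * MvPolynomial.C (b i - a i)) =
      baryPoly a b c * MvPolynomial.C (c i - a i) := by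
    intro i
    refine ev_injective fun x => ?_
    have hD' : det (a - c) (b - c) = det (b - a) (c - a) := by simp [det]; ring
    simp only [ev_sub, ev_X, ev_add, ev_C, ev_mul, hS, ev_baryPoly, hD']
    field_simp
    fin_cases i <;> simp [det] <;> ring
  let I : Ideal Poly := Ideal.span {baryPoly a b c}
  let ψ : Poly →ₐ[ℝ] Poly := (Polynomial.aeval S).comp (restr a b)
  have key : (Ideal.Quotient.mkₐ ℝ I).comp ψ = Ideal.Quotient.mkₐ ℝ I := by
    refine MvPolynomial.algHom_ext fun i => ?_
    simp only [AlgHom.comp_apply, Ideal.Quotient.mkₐ_eq_mk]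
    symm
    rw [Ideal.Quotient.eq]
    have : ψ (MvPolynomial.X i) = MvPolynomial.C (a i) + S * MvPolynomial.C (b i - a i) := by
      simp [ψ, restr, MvPolynomial.algebraMap_eq]
    rw [this, hx]
    exact Ideal.mul_mem_right _ _ (Ideal.subset_span rfl)
  have h1 := congrArg (fun f => f p) key
  simp only [AlgHom.comp_apply, Ideal.Quotient.mkₐ_eq_mk] at h1
  have h2 : ψ p = 0 := by simp [ψ, h]
  rw [h2, map_zero] at h1
  exact Ideal.mem_span_singleton.1 (Ideal.Quotient.eq_zero_iff_mem.1 h1.symm)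

lemma baryPoly_ne_zero (hD : det (b - a) (c - a) ≠ 0) : baryPoly a b c ≠ 0 := by
  intro h
  have := ev_baryPoly a b c c
  rw [h, div_self hD] at this
  simp at this

lemma baryPoly_mem (a b c : Plane) : baryPoly a b c ∈ polyDeg 1 :=
  smul_mem _ _ (sub_mem (smul_mem _ _ (coord_mem_polyDeg _ _))
    (smul_mem _ _ (coord_mem_polyDeg _ _)))

lemma totalDegree_baryPoly (hD : det (b - a) (c - a) ≠ 0) : (baryPoly a b c).totalDegree = 1 := by
  refine le_antisymm (mem_polyDeg.1 (baryPoly_mem a b c)) ?_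
  by_contra h
  have h0 : (baryPoly a b c).totalDegree = 0 := by omega
  rw [MvPolynomial.totalDegree_eq_zero_iff_eq_C] at h0
  have h1 := ev_baryPoly a b c c
  have h2 := ev_baryPoly a b c a
  rw [h0, ev_C] at h1 h2
  rw [div_self hD] at h1
  rw [h1] at h2
  simp [det] at h2

/-- The cubic bubble of the triangle `abc`. -/
def bubble (a b c : Plane) : Poly := baryPoly a b c * (baryPoly b c a * baryPoly c a b)

lemma exists_eq_bubble_mul (hD : det (b - a) (c - a) ≠ 0) (hp : p ∈ polyDeg (m + 3))
    (h1 : restr a b p = 0) (h2 : restr b c p = 0) (h3 : restr c a p = 0) :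
    ∃ q ∈ polyDeg m, p = bubble a b c * q := by
  have hD2 : det (c - b) (a - b) ≠ 0 := by
    rwa [show det (c - b) (a - b) = det (b - a) (c - a) by simp [det]; ring]
  have hD3 : det (a - c) (b - c) ≠ 0 := by
    rwa [show det (a - c) (b - c) = det (b - a) (c - a) by simp [det]; ring]
  have ne : ∀ {x y u v w : Plane}, det (v - u) (y - u) ≠ 0 → restr x y (baryPoly u v w) = 0 →
      det (v - u) (w - u) = 0 := by
    intro x y u v w h h'
    have := restr_eq_zero_iff.1 h' 1
    rw [edgePt_one, ev_baryPoly, div_eq_zero_iff] at this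
    tauto
  have ne' : ∀ {x y u v w : Plane}, det (v - u) (x - u) ≠ 0 → restr x y (baryPoly u v w) = 0 →
      det (v - u) (w - u) = 0 := by
    intro x y u v w h h'
    have := restr_eq_zero_iff.1 h' 0
    rw [edgePt_zero, ev_baryPoly, div_eq_zero_iff] at this
    tauto
  obtain ⟨p1, rfl⟩ := baryPoly_dvd hD h1
  rw [map_mul, mul_eq_zero] at h2 h3
  have h2' := h2.resolve_left fun h => hD (ne hD h)
  have h3' := h3.resolve_left fun h => hD (ne' hD h)
  obtain ⟨p2, rfl⟩ := baryPoly_dvd hD2 h2'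
  rw [map_mul, mul_eq_zero] at h3'
  have h4 := h3'.resolve_left fun h => hD2 (ne hD2 h)
  obtain ⟨p3, rfl⟩ := baryPoly_dvd hD3 h4
  refine ⟨p3, ?_, by simp only [bubble]; ring⟩
  have e1 := mem_polyDeg_of_mul (m := m + 2) (totalDegree_baryPoly hD) (baryPoly_ne_zero hD)
    (by convert hp using 2; ring)
  have e2 := mem_polyDeg_of_mul (m := m + 1) (totalDegree_baryPoly hD2) (baryPoly_ne_zero hD2)
    (by convert e1 using 2; ring)
  exact mem_polyDeg_of_mul (m := m) (totalDegree_baryPoly hD3) (baryPoly_ne_zero hD3)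
    (by convert e2 using 2; ring)

variable {K : Finset Plane} {u w δ : Plane} {n : WithTop ℕ∞} {s : ℝ}

/-! ### Triangles and barycentric coordinates -/

/-- The vertices of the nondegenerate triangle `K` are `a`, `b`, `c`. -/
structure IsTriple (K : Finset Plane) (a b c : Plane) : Prop where
  coe : (K : Set Plane) = {a, b, c}
  det_ne : det (b - a) (c - a) ≠ 0

/-- The barycentric coordinate of `x` at the vertex `c` of the triangle `abc`. -/
def bary (a b c x : Plane) : ℝ := det (b - a) (x - a) / det (b - a) (c - a)

lemma det_cycle (a b c : Plane) : det (c - b) (a - b) = det (b - a) (c - a) := by simp [det]; ring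

lemma det_cycle' (a b c : Plane) : det (a - c) (b - c) = det (b - a) (c - a) := by simp [det]; ring

lemma det_swap (a b c : Plane) : det (a - b) (c - b) = -det (b - a) (c - a) := by simp [det]; ring

lemma det_flip (a b c : Plane) : det (c - a) (b - a) = -det (b - a) (c - a) := by simp [det]; ring

namespace IsTriple

variable (h : IsTriple K a b c)

include h

lemma rotate : IsTriple K b c a :=
  ⟨by rw [h.coe]; ext x; simp; tauto, by rw [det_cycle]; exact h.det_ne⟩

lemma swap : IsTriple K b a c :=
  ⟨by rw [h.coe]; ext x; simp; tauto, by rw [det_swap]; exact neg_ne_zero.2 h.det_ne⟩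

lemma mem_iff : x ∈ K ↔ x = a ∨ x = b ∨ x = c := by rw [← Finset.mem_coe, h.coe]; simp

lemma mem_fst : a ∈ K := h.mem_iff.2 (by simp)
lemma mem_snd : b ∈ K := h.mem_iff.2 (by simp)
lemma mem_trd : c ∈ K := h.mem_iff.2 (by simp)

lemma ne_fst_snd : a ≠ b := by
  rintro rfl; exact h.det_ne (by simp [det])

lemma ne_snd_trd : b ≠ c := h.rotate.ne_fst_snd
lemma ne_fst_trd : a ≠ c := h.rotate.rotate.ne_fst_snd.symm

lemma sum_eq {R : Type*} [AddCommMonoid R] (f : Plane → R) : ∑ x ∈ K, f x = f a + f b + f c := by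
  classical
  have : K = {a, b, c} := by ext x; rw [h.mem_iff]; simp
  rw [this, sum_insert, sum_insert, Finset.sum_singleton, add_assoc]
  · simpa using h.ne_snd_trd
  · simpa using ⟨h.ne_fst_snd, h.ne_fst_trd⟩

lemma bary_sum (x : Plane) : bary a b c x + bary b c a x + bary c a b x = 1 := by
  have h0 := h.det_ne
  simp only [bary, det_cycle a b c, det_cycle' a b c]
  rw [← add_div, ← add_div, div_eq_one_iff_eq h0]
  simp [det]; ring

lemma bary_comb (x : Plane) (i : Fin 2) :
    bary a b c x * c i + bary b c a x * a i + bary c a b x * b i = x i := by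
  have h0 := h.det_ne
  simp only [bary, det_cycle a b c, det_cycle' a b c]
  rw [div_mul_eq_mul_div, div_mul_eq_mul_div, div_mul_eq_mul_div, ← add_div, ← add_div,
    div_eq_iff h0]
  fin_cases i <;> simp [det] <;> ring

lemma bary_self : bary a b c c = 1 := div_self h.det_ne

end IsTriple

@[simp] lemma bary_fst (a b c : Plane) : bary a b c a = 0 := by simp [bary, det]
@[simp] lemma bary_snd (a b c : Plane) : bary a b c b = 0 := by simp [bary, det, mul_comm]

lemma continuous_bary (a b c : Plane) : Continuous (bary a b c) := by unfold bary det; fun_prop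

lemma bary_add_smul (a b c x d : Plane) (s : ℝ) :
    bary a b c (x + s • d) = bary a b c x + s * (det (b - a) d / det (b - a) (c - a)) := by
  simp [bary, det]; ring

lemma bary_lineMap (a b c x y : Plane) (s : ℝ) :
    bary a b c (AffineMap.lineMap x y s) = (1 - s) * bary a b c x + s * bary a b c y := by
  simp [bary, det, AffineMap.lineMap_apply]; ring

lemma bary_convexComb (a b c x y : Plane) {t : ℝ} (hst : s + t = 1) :
    bary a b c (s • x + t • y) = s * bary a b c x + t * bary a b c y := by
  obtain rfl : s = 1 - t := by linarith
  simp [bary, det]; ring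

lemma exists_isTriple (hc : K.card = 3) (hi : AffineIndependent ℝ ((↑) : K → Plane)) (ha : a ∈ K)
    (hb : b ∈ K) (hab : a ≠ b) : ∃ c, IsTriple K a b c := by
  classical
  have h1 : ((K.erase a).erase b).card = 1 := by
    rw [Finset.card_erase_of_mem (by simp [hb, hab.symm]), Finset.card_erase_of_mem ha, hc]
  obtain ⟨c, hcK⟩ := Finset.card_eq_one.1 h1
  have hK : K = {a, b, c} := by
    rw [← Finset.insert_erase ha, ← Finset.insert_erase (show b ∈ K.erase a by simp [hb, hab.symm]),
      hcK]
  have hac : c ∈ K ∧ c ≠ a ∧ c ≠ b := by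
    have : c ∈ (K.erase a).erase b := by simp [hcK]
    simp at this; tauto
  refine ⟨c, by rw [hK]; simp, fun hD => ?_⟩
  have h2 : AffineIndependent ℝ ![a, b, c] := by
    have := hi.comp_embedding (ι2 := Fin 3) ⟨![⟨a, ha⟩, ⟨b, hb⟩, ⟨c, hac.1⟩], by
      intro i j; fin_cases i <;> fin_cases j <;>
        simp [hab, hab.symm, hac.2.1, hac.2.2, hac.2.1.symm, hac.2.2.symm]⟩
    convert this using 1
    ext i; fin_cases i <;> rfl
  rw [affineIndependent_iff_not_collinear_set] at h2
  apply h2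
  rw [collinear_iff_of_mem (p₀ := a) (by simp)]
  refine ⟨b - a, ?_⟩
  have hab' : b 0 - a 0 ≠ 0 ∨ b 1 - a 1 ≠ 0 := by
    by_contra! h
    exact hab (by ext i; fin_cases i <;> simp <;> linarith)
  simp only [Set.mem_insert_iff, Set.mem_singleton_iff, forall_eq_or_imp, forall_eq]
  refine ⟨⟨0, by simp⟩, ⟨1, by simp⟩, ?_⟩
  simp [det] at hD
  rcases hab' with h | h
  · refine ⟨(c 0 - a 0) / (b 0 - a 0), ?_⟩
    ext i; fin_cases i
    · simp; field_simp; ring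
    · simp; field_simp; linarith
  · refine ⟨(c 1 - a 1) / (b 1 - a 1), ?_⟩
    ext i; fin_cases i
    · simp; field_simp; linarith
    · simp; field_simp; ring

lemma Triangulation.exists_isTriple (M : Triangulation) (hK : K ∈ M.cells) (ha : a ∈ K) (hb : b ∈ K)
    (hab : a ≠ b) : ∃ c, IsTriple K a b c :=
  DivDiv.exists_isTriple (M.card_eq K hK) (M.indep K hK) ha hb hab

lemma Triangulation.exists_isTriple_fst (M : Triangulation) (hK : K ∈ M.cells) (ha : a ∈ K) :
    ∃ b c, IsTriple K a b c := by
  obtain ⟨b, hb, hab⟩ := Finset.exists_mem_ne (by rw [M.card_eq K hK]; norm_num) a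
  obtain ⟨c, hc⟩ := M.exists_isTriple hK ha hb hab.symm
  exact ⟨b, c, hc⟩

lemma Triangulation.isTriple (M : Triangulation) (hK : K ∈ M.cells) :
    ∃ a b c, IsTriple K a b c := by
  obtain ⟨a, ha⟩ := Finset.card_pos.1 (by rw [M.card_eq K hK]; norm_num : 0 < K.card)
  exact ⟨a, M.exists_isTriple_fst hK ha⟩

lemma convex_hull (K : Finset Plane) : Convex ℝ (hull K) := convex_convexHull ℝ _

lemma isCompact_hull (K : Finset Plane) : IsCompact (hull K) :=
  K.finite_toSet.isCompact_convexHull (𝕜 := ℝ)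

lemma isClosed_hull (K : Finset Plane) : IsClosed (hull K) := (isCompact_hull K).isClosed

lemma measurableSet_hull (K : Finset Plane) : MeasurableSet (hull K) :=
  (isClosed_hull K).measurableSet

lemma vertex_mem_hull (h : δ ∈ K) : δ ∈ hull K := subset_convexHull _ _ (Finset.mem_coe.2 h)

lemma interior_hull_ae (K : Finset Plane) : K° =ᵐ[volume] hull K :=
  interior_ae_eq_of_null_frontier ((convex_hull K).addHaar_frontier _)

lemma restrict_interior_hull (K : Finset Plane) :
    (volume : Measure Plane).restrict K° = vol (hull K) :=
  Measure.restrict_congr_set (interior_hull_ae K)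

lemma edgePt_mem_hull (ha : a ∈ K) (hb : b ∈ K) (hs : s ∈ Icc (0 : ℝ) 1) : edgePt a b s ∈ hull K :=
  (convex_hull K).lineMap_mem (vertex_mem_hull ha) (vertex_mem_hull hb) hs

namespace IsTriple

variable (h : IsTriple K a b c)

include h

lemma mem_hull_iff : x ∈ hull K ↔ 0 ≤ bary a b c x ∧ 0 ≤ bary b c a x ∧ 0 ≤ bary c a b x := by
  constructor
  · intro hx
    have hconv : Convex ℝ {x | 0 ≤ bary a b c x ∧ 0 ≤ bary b c a x ∧ 0 ≤ bary c a b x} := by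
      intro x hx y hy s t hs ht hst
      simp only [mem_ofPred_eq, bary_convexComb _ _ _ _ _ hst] at hx hy ⊢
      obtain ⟨h1, h2, h3⟩ := hx
      obtain ⟨h4, h5, h6⟩ := hy
      exact ⟨by positivity, by positivity, by positivity⟩
    refine convexHull_min ?_ hconv hx
    rw [h.coe]
    rintro y (rfl | rfl | rfl)
    · simp [h.rotate.bary_self]
    · simp [h.rotate.rotate.bary_self]
    · simp [h.bary_self]
  · rintro ⟨h1, h2, h3⟩
    have e : x = bary a b c x • c + bary b c a x • a + bary c a b x • b := by
      ext i; simpa using (h.bary_comb x i).symm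
    have := (convex_hull K).sum_mem (t := Finset.univ) (w := ![bary a b c x, bary b c a x, bary c a b x])
      (z := ![c, a, b]) (by intro i _; fin_cases i <;> simpa)
      (by simpa [Fin.sum_univ_three] using h.bary_sum x)
      (by intro i _; fin_cases i <;> simp [vertex_mem_hull, h.mem_fst, h.mem_snd, h.mem_trd])
    rw [e]
    simpa [Fin.sum_univ_three] using this

lemma bary_pos_of_mem_interior (hx : x ∈ K°) : 0 < bary a b c x := by
  have hc : ContinuousAt (fun s : ℝ => x + s • (c - a)) 0 := by fun_prop
  have h1 : ∀ᶠ s in 𝓝 (0 : ℝ), x + s • (c - a) ∈ hull K :=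
    hc.eventually_mem (by simpa using mem_interior_iff_mem_nhds.1 hx)
  have h2 := (h1.filter_mono nhdsWithin_le_nhds : ∀ᶠ s in 𝓝[<] (0 : ℝ), _)
  obtain ⟨s, hs, hs0⟩ := (h2.and self_mem_nhdsWithin).exists
  have h3 := (h.mem_hull_iff.1 hs).1
  rw [bary_add_smul, div_self h.det_ne] at h3
  have : s < 0 := hs0
  linarith

lemma mem_interior_iff : x ∈ K° ↔ 0 < bary a b c x ∧ 0 < bary b c a x ∧ 0 < bary c a b x := by
  refine ⟨fun hx => ⟨h.bary_pos_of_mem_interior hx, h.rotate.bary_pos_of_mem_interior hx,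
    h.rotate.rotate.bary_pos_of_mem_interior hx⟩, fun ⟨h1, h2, h3⟩ => ?_⟩
  refine interior_maximal (t := {x | 0 < bary a b c x ∧ 0 < bary b c a x ∧ 0 < bary c a b x})
    (fun y hy => h.mem_hull_iff.2 ⟨hy.1.le, hy.2.1.le, hy.2.2.le⟩) ?_ ⟨h1, h2, h3⟩
  exact (isOpen_lt continuous_const (continuous_bary _ _ _)).inter
    ((isOpen_lt continuous_const (continuous_bary _ _ _)).inter
      (isOpen_lt continuous_const (continuous_bary _ _ _)))

lemma interior_nonempty : K°.Nonempty := by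
  refine ⟨a + (1 / 3 : ℝ) • (b - a) + (1 / 3 : ℝ) • (c - a), h.mem_interior_iff.2 ?_⟩
  have h1 := h.det_ne
  have e1 : det (b - a) (b - a) = 0 := by simp [det]; ring
  have e2 : det (c - b) (b - a) = -det (b - a) (c - a) := by simp [det]; ring
  have e3 : det (c - b) (c - a) = -det (b - a) (c - a) := by simp [det]; ring
  have e4 : det (a - c) (b - a) = det (b - a) (c - a) := by simp [det]; ring
  have e5 : det (a - c) (c - a) = 0 := by simp [det]; ring
  simp only [bary_add_smul, bary_fst, bary_snd, h.rotate.bary_self, det_cycle a b c,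
    det_cycle' a b c, e1, e2, e3, e4, e5, div_self h1, neg_div]
  norm_num

end IsTriple

/-! ### Orientation of the edges -/

/-- The side of the directed line from `a` to `b` on which the triangle `K` lies: `1` for the left
side and `-1` for the right side. -/
def orient (K : Finset Plane) (a b : Plane) : ℝ := Real.sign (∑ c ∈ K, det (b - a) (c - a))

/-- The vector `d`, rotated by a right angle to the right. -/
def rot (d : Plane) : Fin 2 → ℝ := ![d 1, -d 0]

@[simp] lemma rot_zero (d : Plane) : rot d 0 = d 1 := rfl
@[simp] lemma rot_one (d : Plane) : rot d 1 = -d 0 := rfl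

lemma IsTriple.orient_eq (h : IsTriple K a b c) :
    orient K a b = Real.sign (det (b - a) (c - a)) := by
  rw [orient, h.sum_eq]
  congr 1
  simp [det]; ring

@[simp] lemma orient_self (K : Finset Plane) (a : Plane) : orient K a a = 0 := by simp [orient, det]

/-! ### Affine change of variables -/

/-- The affine map `(s, t) ↦ a + s u + t w`. -/
def affMap (a u w : Plane) (p : ℝ × ℝ) : Plane := a + p.1 • u + p.2 • w

lemma continuous_affMap (a u w : Plane) : Continuous (affMap a u w) := by unfold affMap; fun_prop

/-- The linear map `y ↦ y₀ u + y₁ w`. -/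
def pairMap (u w : Plane) : Plane →ₗ[ℝ] Plane :=
  Matrix.toLin (EuclideanSpace.basisFun (Fin 2) ℝ).toBasis (EuclideanSpace.basisFun (Fin 2) ℝ).toBasis
    !![u 0, w 0; u 1, w 1]

lemma pairMap_apply (u w y : Plane) : pairMap u w y = y 0 • u + y 1 • w := by
  ext i
  fin_cases i <;>
    simp [pairMap, Matrix.toLin_apply, Matrix.mulVec, dotProduct, sum_univ_two] <;> ring

lemma det_pairMap (u w : Plane) : LinearMap.det (pairMap u w) = det u w := by
  rw [pairMap, LinearMap.det_toLin, Matrix.det_fin_two]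
  simp [det]; ring

lemma map_affMap (a : Plane) (h : det u w ≠ 0) :
    Measure.map (affMap a u w) volume = ENNReal.ofReal |(det u w)⁻¹| • (volume : Measure Plane) := by
  have e1 := (volume_preserving_finTwoArrow ℝ).symm
  have e2 := (EuclideanSpace.volume_preserving_symm_measurableEquiv_toLp (Fin 2)).symm
  have hf : affMap a u w = (fun y => a + y) ∘ (pairMap u w) ∘
      ((MeasurableEquiv.toLp 2 (Fin 2 → ℝ)) ∘ (MeasurableEquiv.finTwoArrow (α := ℝ)).symm) := by
    ext p i
    simp [affMap, pairMap_apply, add_assoc]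
  have hm : Measurable (pairMap u w) := (LinearMap.continuous_of_finiteDimensional _).measurable
  rw [hf, ← Measure.map_map (by fun_prop) (by fun_prop), ← Measure.map_map hm (by fun_prop),
    ← Measure.map_map (by fun_prop) (by fun_prop), e1.map_eq]
  erw [e2.map_eq]
  rw [Measure.map_linearMap_addHaar_eq_smul_addHaar _ (by rwa [det_pairMap]), det_pairMap,
    Measure.map_smul, map_add_left_eq_self]

lemma measurableEmbedding_affMap (a : Plane) (h : det u w ≠ 0) :
    MeasurableEmbedding (affMap a u w) := by
  refine (continuous_affMap a u w).measurableEmbedding ?_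
  rintro ⟨s, t⟩ ⟨s', t'⟩ he
  have h0 := congrArg (fun y : Plane => y 0) he
  have h1 := congrArg (fun y : Plane => y 1) he
  simp [affMap] at h0 h1
  simp only [det] at h
  ext
  · have : (s - s') * (u 0 * w 1 - u 1 * w 0) = 0 := by linear_combination w 1 * h0 - w 0 * h1
    simpa [h, sub_eq_zero] using this
  · have : (t - t') * (u 0 * w 1 - u 1 * w 0) = 0 := by linear_combination u 0 * h1 - u 1 * h0
    simpa [h, sub_eq_zero] using this

lemma setIntegral_affMap (a : Plane) (h : det u w ≠ 0) (f : Plane → ℝ) (S : Set Plane) :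
    ∫ x in S, f x = |det u w| * ∫ p in affMap a u w ⁻¹' S, f (affMap a u w p) := by
  have := (measurableEmbedding_affMap a h).setIntegral_map (μ := volume) f S
  rw [map_affMap a h, Measure.restrict_smul, integral_smul_measure] at this
  rw [← this, ENNReal.toReal_ofReal (abs_nonneg _), smul_eq_mul, ← mul_assoc, ← abs_mul,
    mul_inv_cancel₀ h]
  simp

lemma IsTriple.preimage_hull (h : IsTriple K a b c) :
    affMap a (b - a) (c - a) ⁻¹' hull K = {p | 0 ≤ p.1 ∧ 0 ≤ p.2 ∧ p.1 + p.2 ≤ 1} := by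
  ext ⟨s, t⟩
  have h1 := h.det_ne
  have e1 : det (b - a) (b - a) = 0 := by simp [det]; ring
  have e2 : det (c - b) (b - a) = -det (b - a) (c - a) := by simp [det]; ring
  have e3 : det (c - b) (c - a) = -det (b - a) (c - a) := by simp [det]; ring
  have e4 : det (a - c) (b - a) = det (b - a) (c - a) := by simp [det]; ring
  have e5 : det (a - c) (c - a) = 0 := by simp [det]; ring
  simp only [Set.mem_preimage, affMap, h.mem_hull_iff, bary_add_smul, bary_fst, bary_snd,
    h.rotate.bary_self, det_cycle a b c, det_cycle' a b c, e1, e2, e3, e4, e5, div_self h1,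
    neg_div, zero_div, mem_ofPred_eq]
  constructor
  · rintro ⟨h1, h2, h3⟩; refine ⟨?_, ?_, ?_⟩ <;> linarith
  · rintro ⟨h1, h2, h3⟩; refine ⟨?_, ?_, ?_⟩ <;> linarith

lemma setIntegral_simplex {g : ℝ × ℝ → ℝ} (hg : Continuous g) :
    ∫ p in {p : ℝ × ℝ | 0 ≤ p.1 ∧ 0 ≤ p.2 ∧ p.1 + p.2 ≤ 1}, g p =
      ∫ t in (0 : ℝ)..1, ∫ s in (0 : ℝ)..(1 - t), g (s, t) := by
  set S := {p : ℝ × ℝ | 0 ≤ p.1 ∧ 0 ≤ p.2 ∧ p.1 + p.2 ≤ 1} with hS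
  have hSc : IsClosed S := (isClosed_le continuous_const continuous_fst).inter
      ((isClosed_le continuous_const continuous_snd).inter
        (isClosed_le (continuous_fst.add continuous_snd) continuous_const))
  have hSm : MeasurableSet S := hSc.measurableSet
  have hSk : IsCompact S := by
    refine (isCompact_Icc (a := ((0 : ℝ), (0 : ℝ))) (b := (1, 1))).of_isClosed_subset hSc ?_
    rintro ⟨s, t⟩ ⟨h1, h2, h3⟩
    simp only at h1 h2 h3
    exact ⟨⟨h1, h2⟩, ⟨by simp only; linarith, by simp only; linarith⟩⟩
  have hi : Integrable (S.indicator g) :=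
    (integrable_indicator_iff hSm).2 (hg.continuousOn.integrableOn_compact hSk)
  rw [← integral_indicator hSm, Measure.volume_eq_prod, integral_prod_symm _ (by
    rwa [← Measure.volume_eq_prod])]
  rw [integral_of_le zero_le_one, ← integral_Icc_eq_integral_Ioc,
    ← integral_indicator measurableSet_Icc]
  congr 1
  ext t
  by_cases ht : t ∈ Icc (0 : ℝ) 1
  · rw [indicator_of_mem ht, integral_of_le (by linarith [ht.2]),
      ← integral_Icc_eq_integral_Ioc, ← integral_indicator measurableSet_Icc]
    congr 1
    ext s
    have : (s, t) ∈ S ↔ s ∈ Icc (0 : ℝ) (1 - t) := by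
      simp only [hS, mem_ofPred_eq, Set.mem_Icc]
      constructor
      · rintro ⟨h1, h2, h3⟩; exact ⟨h1, by linarith⟩
      · rintro ⟨h1, h2⟩; exact ⟨h1, ht.1, by linarith⟩
    by_cases h : s ∈ Icc (0 : ℝ) (1 - t)
    · rw [indicator_of_mem h, indicator_of_mem (this.2 h)]
    · rw [indicator_of_notMem h, indicator_of_notMem (mt this.1 h)]
  · rw [indicator_of_notMem ht]
    have : ∀ s, S.indicator g (s, t) = 0 := fun s => indicator_of_notMem (by
      rintro ⟨h1, h2, h3⟩
      exact ht ⟨h2, by simp only at h1 h2 h3; linarith⟩) _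
    simp [this]

/-! ### Green's formula -/

lemma hasDerivAt_comp_line {d : Plane} (hf : DifferentiableAt ℝ f (x + s • d)) :
    HasDerivAt (fun s : ℝ => f (x + s • d)) (∑ m, d m * partialD m f (x + s • d)) s := by
  have h1 : HasDerivAt (fun s : ℝ => x + s • d) d s := by
    simpa using ((hasDerivAt_id s).smul_const d).const_add x
  have h2 := hf.hasFDerivAt.comp_hasDerivAt s h1
  refine h2.congr_deriv ?_
  have : fderiv ℝ f (x + s • d) d = fderiv ℝ f (x + s • d) (∑ m, d m • unitVec m) := by
    congr 1
    ext i; fin_cases i <;> simp [sum_univ_two]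
  rw [this, map_sum]
  simp [partialD]

lemma edgePt_eq (a b : Plane) (s : ℝ) : edgePt a b s = a + s • (b - a) := by
  ext i; simp [edgePt_apply]

lemma continuous_partialD (hf : ContDiff ℝ n f) (hn : 1 ≤ n) (m : Fin 2) :
    Continuous (partialD m f) :=
  (hf.continuous_fderiv (by exact fun h => by simp [h] at hn)).clm_apply continuous_const

lemma IsTriple.integral_partialD_dir (h : IsTriple K a b c) (hf : ContDiff ℝ 1 f) :
    ∫ x in hull K, ∑ m, (b - a) m * partialD m f x = |det (b - a) (c - a)| *
      ((∫ s in (0 : ℝ)..1, f (edgePt b c s)) - ∫ s in (0 : ℝ)..1, f (edgePt a c s)) := by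
  have hd : Continuous fun x => ∑ m, (b - a) m * partialD m f x := by
    refine continuous_finsetSum _ fun m _ => continuous_const.mul (continuous_partialD hf le_rfl m)
  rw [setIntegral_affMap a h.det_ne, h.preimage_hull,
    setIntegral_simplex (g := fun p => ∑ m, (b - a) m * partialD m f (affMap a (b - a) (c - a) p))
      (hd.comp (continuous_affMap _ _ _)), ← intervalIntegral.integral_sub]
  rotate_left
  · exact (hf.continuous.comp (continuous_edgePt _ _)).intervalIntegrable _ _
  · exact (hf.continuous.comp (continuous_edgePt _ _)).intervalIntegrable _ _
  congr 1
  refine intervalIntegral.integral_congr fun t _ => ?_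
  have e : ∀ s, affMap a (b - a) (c - a) (s, t) = (a + t • (c - a)) + s • (b - a) := by
    intro s; simp [affMap]; abel
  simp only [e]
  rw [integral_eq_sub_of_hasDerivAt (f := fun s => f ((a + t • (c - a)) + s • (b - a)))
    (fun s _ => hasDerivAt_comp_line (hf.differentiable (by simp) _))
    ((hd.comp (by fun_prop)).intervalIntegrable _ _)]
  congr 2
  · ext i; simp [edgePt_apply]; ring
  · ext i; simp [edgePt_apply]

lemma integral_edgePt_swap (f : ScalarField) (a b : Plane) :
    ∫ s in (0 : ℝ)..1, f (edgePt b a s) = ∫ s in (0 : ℝ)..1, f (edgePt a b s) := by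
  simp only [edgePt_swap a b]
  rw [integral_comp_sub_left (fun s => f (edgePt a b s))]
  simp

/-- Green's formula on a triangle. -/
lemma IsTriple.green (h : IsTriple K a b c) (hf : ContDiff ℝ 1 f) (m : Fin 2) :
    ∫ x in hull K, partialD m f x = 1 / 2 * ∑ a ∈ K, ∑ b ∈ K,
      orient K a b * (rot (b - a) m * ∫ s in (0 : ℝ)..1, f (edgePt a b s)) := by
  have hI : ∀ m, IntegrableOn (fun x => partialD m f x) (hull K) := fun m =>
    (continuous_partialD hf le_rfl m).continuousOn.integrableOn_compact (isCompact_hull K)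
  have h1 := h.integral_partialD_dir hf
  have h2 := h.swap.rotate.integral_partialD_dir hf
  simp only [sum_univ_two] at h1 h2
  rw [integral_add ((hI 0).const_mul _) ((hI 1).const_mul _), integral_const_mul,
    integral_const_mul] at h1 h2
  have h0 := h.det_ne
  rw [h.sum_eq]
  simp only [h.sum_eq, orient_self]
  rw [h.orient_eq, h.rotate.orient_eq, h.rotate.rotate.orient_eq, h.swap.orient_eq,
    h.rotate.swap.orient_eq, h.rotate.rotate.swap.orient_eq]
  rw [integral_edgePt_swap f a b, integral_edgePt_swap f b c, integral_edgePt_swap f a c]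
  rw [integral_edgePt_swap f b c, det_flip, abs_neg] at h2
  have e3 : det (b - c) (a - c) = -det (b - a) (c - a) := by simp [det]; ring
  rw [det_swap a b c, det_cycle a b c, det_cycle' a b c, det_flip a b c, e3, Real.sign_neg]
  have hs : |det (b - a) (c - a)| = Real.sign (det (b - a) (c - a)) * det (b - a) (c - a) := by
    rcases lt_or_gt_of_ne h0 with h | h
    · rw [Real.sign_of_neg h, abs_of_neg h]; ring
    · rw [Real.sign_of_pos h, abs_of_pos h]; ring
  rw [hs] at h1 h2
  refine mul_left_cancel₀ h0 ?_
  simp only [det, PiLp.sub_apply] at h1 h2 ⊢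
  fin_cases m
  · simp only [Fin.zero_eta, rot_zero, PiLp.sub_apply]
    linear_combination (c 1 - a 1) * h1 - (b 1 - a 1) * h2
  · simp only [Fin.mk_one, rot_one, PiLp.sub_apply]
    linear_combination (b 0 - a 0) * h2 - (c 0 - a 0) * h1

variable {M : Triangulation} {L : Finset Plane} {S Ω : Set Plane}

/-! ### The geometry of a mesh -/

section Mesh

lemma IsTriple.bary_eq_zero_of_mem_convexHull (h : IsTriple K a b c) (hS : S ⊆ K) (hc : c ∉ S)
    (hx : x ∈ convexHull ℝ S) : bary a b c x = 0 := by
  have hconv : Convex ℝ {x | bary a b c x = 0} := by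
    intro x hx y hy s t _ _ hst
    simp only [mem_ofPred_eq, bary_convexComb _ _ _ _ _ hst] at hx hy ⊢
    simp [hx, hy]
  refine convexHull_min (fun y hy => ?_) hconv hx
  rcases h.mem_iff.1 (Finset.mem_coe.1 (hS hy)) with rfl | rfl | rfl
  · simp
  · simp
  · exact absurd hy hc

lemma Triangulation.mem_of_bary_ne_zero (hK : K ∈ M.cells) (hL : L ∈ M.cells) (h : IsTriple K a b c)
    (hx : x ∈ hull K) (hx' : x ∈ hull L) (h0 : bary a b c x ≠ 0) : c ∈ L := by
  by_contra hc
  have h1 : x ∈ convexHull ℝ ((K : Set Plane) ∩ L) := by rw [← M.inter K hK L hL]; exact ⟨hx, hx'⟩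
  exact h0 (h.bary_eq_zero_of_mem_convexHull inter_subset_left (fun h => hc h.2) h1)

lemma Triangulation.eq_of_subset (hK : K ∈ M.cells) (hL : L ∈ M.cells) (h : IsTriple K a b c)
    (ha : a ∈ L) (hb : b ∈ L) (hc : c ∈ L) : L = K := by
  refine (Finset.eq_of_subset_of_card_le (fun x hx => ?_) ?_).symm
  · rcases h.mem_iff.1 hx with rfl | rfl | rfl <;> assumption
  · rw [M.card_eq K hK, M.card_eq L hL]

lemma Triangulation.mem_of_vertex_mem_hull (hK : K ∈ M.cells) (hL : L ∈ M.cells) (hδ : δ ∈ K)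
    (hδL : δ ∈ hull L) : δ ∈ L := by
  obtain ⟨b, c, h⟩ := M.exists_isTriple_fst hK hδ
  exact M.mem_of_bary_ne_zero hK hL h.rotate (vertex_mem_hull hδ) hδL (by simp [h.rotate.bary_self])

lemma Triangulation.eq_of_mem_interior (hK : K ∈ M.cells) (hL : L ∈ M.cells) (hx : x ∈ K°)
    (hx' : x ∈ hull L) : L = K := by
  obtain ⟨a, b, c, h⟩ := M.isTriple hK
  obtain ⟨h1, h2, h3⟩ := h.mem_interior_iff.1 hx
  have hx'' := interior_subset hx
  exact M.eq_of_subset hK hL h (M.mem_of_bary_ne_zero hK hL h.rotate hx'' hx' h2.ne')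
    (M.mem_of_bary_ne_zero hK hL h.rotate.rotate hx'' hx' h3.ne')
    (M.mem_of_bary_ne_zero hK hL h hx'' hx' h1.ne')

/-- Triangles that meet in a common point have a common vertex. -/
lemma Triangulation.exists_common_vertex (hK : K ∈ M.cells) (hx : x ∈ hull K) :
    ∃ δ ∈ K, ∀ L ∈ M.cells, x ∈ hull L → δ ∈ L := by
  obtain ⟨a, b, c, h⟩ := M.isTriple hK
  have hs := h.bary_sum x
  by_cases h1 : bary a b c x = 0
  · by_cases h2 : bary b c a x = 0
    · exact ⟨b, h.mem_snd, fun L hL hxL => M.mem_of_bary_ne_zero hK hL h.rotate.rotate hx hxL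
        (by rw [h1, h2] at hs; linarith)⟩
    · exact ⟨a, h.mem_fst, fun L hL hxL => M.mem_of_bary_ne_zero hK hL h.rotate hx hxL h2⟩
  · exact ⟨c, h.mem_trd, fun L hL hxL => M.mem_of_bary_ne_zero hK hL h hx hxL h1⟩

lemma Triangulation.eventually_mem_hull_imp (M : Triangulation) (x : Plane) :
    ∀ᶠ y in 𝓝 x, ∀ L ∈ M.cells, y ∈ hull L → x ∈ hull L := by
  rw [Filter.eventually_all_finset]
  intro L _
  by_cases h : x ∈ hull L
  · exact Eventually.of_forall fun _ _ => h
  · filter_upwards [(isClosed_hull L).isOpen_compl.mem_nhds h] with y hy hy'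
    exact absurd hy' hy

lemma subset_iUnion_hull (hM : M.IsMeshOf Ω) (hx : x ∈ Ω) : ∃ K ∈ M.cells, x ∈ hull K := by
  have : x ∈ closure Ω := subset_closure hx
  rw [hM] at this
  simpa using this

lemma hull_subset_closure (hM : M.IsMeshOf Ω) (hK : K ∈ M.cells) : hull K ⊆ closure Ω := by
  rw [hM]; exact Set.subset_biUnion_of_mem (u := hull) hK

variable (hΩ : IsPolygon Ω) (hM : M.IsMeshOf Ω)

include hΩ hM

lemma interior_hull_subset (hK : K ∈ M.cells) : K° ⊆ Ω := by
  rw [← hΩ.regular]; exact interior_mono (hull_subset_closure hM hK)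

lemma restrict_eq_sum : (volume : Measure Plane).restrict Ω = ∑ K ∈ M.cells, vol (hull K) := by
  have h1 : Ω =ᵐ[volume] ⋃ K : M.cells, hull (K : Finset Plane) := by
    have hle : (⋃ K : M.cells, interior (hull (K : Finset Plane))) =ᵐ[volume]
        ⋃ K : M.cells, hull (K : Finset Plane) :=
      Filter.EventuallyEq.countable_iUnion fun K => interior_hull_ae K
    refine Filter.EventuallyLE.antisymm (LE.le.eventuallyLE ?_)
      (hle.symm.le.trans (LE.le.eventuallyLE ?_))
    · intro x hx
      obtain ⟨K, hK, hxK⟩ := subset_iUnion_hull hM hx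
      exact mem_iUnion.2 ⟨⟨K, hK⟩, hxK⟩
    · exact Set.iUnion_subset fun K => interior_hull_subset hΩ hM K.2
  rw [Measure.restrict_congr_set h1, Measure.restrict_iUnion_ae, Measure.sum_fintype,
    Finset.sum_coe_sort M.cells fun K => vol (hull K)]
  · intro K L hKL
    have hd : Disjoint (interior (hull (K : Finset Plane))) (hull (L : Finset Plane)) := by
      rw [Set.disjoint_left]
      intro x hx hx'
      exact hKL (Subtype.ext (M.eq_of_mem_interior K.2 L.2 hx hx').symm)
    exact hd.aedisjoint.congr (interior_hull_ae K).symm (ae_eq_refl _)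
  · exact fun K => (measurableSet_hull _).nullMeasurableSet

lemma ae_restrict_iff_cells {p : Plane → Prop} :
    (∀ᵐ x ∂vol Ω, p x) ↔ ∀ K ∈ M.cells, ∀ᵐ x ∂vol (hull K), p x := by
  rw [restrict_eq_sum hΩ hM, ← Finset.sum_coe_sort, ← Measure.sum_fintype, Measure.ae_sum_iff]
  simp

lemma integral_eq_sum_cells {f : Plane → ℝ} (hf : ∀ K ∈ M.cells, IntegrableOn f (hull K)) :
    ∫ x in Ω, f x = ∑ K ∈ M.cells, ∫ x in hull K, f x := by
  rw [restrict_eq_sum hΩ hM, integral_finsetSum_measure hf]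

/-! ### Edges of a mesh -/

omit hΩ hM in
lemma edgePt_eq_iff_bary (h : IsTriple K a b c) (s : ℝ) :
    bary a b c (edgePt a b s) = 0 ∧ bary b c a (edgePt a b s) = 1 - s ∧
      bary c a b (edgePt a b s) = s := by
  simp only [edgePt, bary_lineMap, bary_fst, bary_snd, h.rotate.bary_self,
    h.rotate.rotate.bary_self]
  simp

omit hΩ hM in
lemma IsTriple.eventually_mem_hull (h : IsTriple K a b c) (hs : s ∈ Ioo (0 : ℝ) 1) :
    ∀ᶠ y in 𝓝 (edgePt a b s), 0 ≤ bary a b c y → y ∈ hull K := by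
  obtain ⟨-, h2, h3⟩ := edgePt_eq_iff_bary h s
  have e2 := (continuous_bary b c a).continuousAt.eventually_const_lt
    (show 0 < bary b c a (edgePt a b s) by rw [h2]; linarith [hs.2])
  have e3 := (continuous_bary c a b).continuousAt.eventually_const_lt
    (show 0 < bary c a b (edgePt a b s) by rw [h3]; exact hs.1)
  filter_upwards [e2, e3] with y hy2 hy3 hy1
  exact h.mem_hull_iff.2 ⟨hy1, hy2.le, hy3.le⟩

omit hΩ hM in
/-- Two triangles with a common edge lie on opposite sides of it. -/
lemma Triangulation.det_mul_det_neg (hK : K ∈ M.cells) (hL : L ∈ M.cells) (hne : L ≠ K) {d : Plane}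
    (h : IsTriple K a b c) (h' : IsTriple L a b d) :
    det (b - a) (c - a) * det (b - a) (d - a) < 0 := by
  by_contra hcon
  have hpos : 0 < det (b - a) (c - a) * det (b - a) (d - a) :=
    lt_of_le_of_ne (not_lt.1 hcon) (mul_ne_zero h.det_ne h'.det_ne).symm
  have hr : 0 < det (b - a) (c - a) / det (b - a) (d - a) := by
    rcases pos_and_pos_or_neg_and_neg_of_mul_pos hpos with ⟨h1, h2⟩ | ⟨h1, h2⟩
    · positivity
    · exact div_pos_of_neg_of_neg h1 h2
  have hh : (1 / 2 : ℝ) ∈ Ioo (0 : ℝ) 1 := by norm_num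
  have ht : Tendsto (fun r : ℝ => edgePt a b (1 / 2) + r • (c - a)) (𝓝[>] 0)
      (𝓝 (edgePt a b (1 / 2))) := by
    have : ContinuousAt (fun r : ℝ => edgePt a b (1 / 2) + r • (c - a)) 0 := by fun_prop
    simpa [ContinuousAt] using this.tendsto.mono_left nhdsWithin_le_nhds
  obtain ⟨r, ⟨h1, h2⟩, hr0⟩ := (((ht.eventually (h.eventually_mem_hull hh)).and
    (ht.eventually (h'.eventually_mem_hull hh))).and self_mem_nhdsWithin).exists
  have hr0 : 0 < r := hr0
  have e1 : bary a b c (edgePt a b (1 / 2) + r • (c - a)) = r := by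
    rw [bary_add_smul, (edgePt_eq_iff_bary h _).1, div_self h.det_ne]; ring
  have e2 : 0 ≤ bary a b d (edgePt a b (1 / 2) + r • (c - a)) := by
    rw [bary_add_smul, (edgePt_eq_iff_bary h' _).1]; positivity
  exact hne (M.eq_of_subset hK hL h h'.mem_fst h'.mem_snd
    (M.mem_of_bary_ne_zero hK hL h (h1 (by rw [e1]; exact hr0.le)) (h2 e2)
      (by rw [e1]; exact hr0.ne')))

omit hΩ hM in
lemma Triangulation.orient_neg (hK : K ∈ M.cells) (hL : L ∈ M.cells) (hne : L ≠ K) (hab : a ≠ b)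
    (haK : a ∈ K) (hbK : b ∈ K) (haL : a ∈ L) (hbL : b ∈ L) : orient L a b = -orient K a b := by
  obtain ⟨c, h⟩ := M.exists_isTriple hK haK hbK hab
  obtain ⟨d, h'⟩ := M.exists_isTriple hL haL hbL hab
  have := M.det_mul_det_neg hK hL hne h h'
  rw [h.orient_eq, h'.orient_eq]
  rcases lt_or_gt_of_ne h.det_ne with h1 | h1
  · have h2 : 0 < det (b - a) (d - a) := by nlinarith
    rw [Real.sign_of_neg h1, Real.sign_of_pos h2]; norm_num
  · have h2 : det (b - a) (d - a) < 0 := by nlinarith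
    rw [Real.sign_of_neg h2, Real.sign_of_pos h1]

omit hΩ hM in
lemma IsTriple.orient_ne_zero (h : IsTriple K a b c) : orient K a b ≠ 0 := by
  rw [h.orient_eq, Ne, Real.sign_eq_zero_iff]; exact h.det_ne

omit hΩ hM in
lemma Triangulation.eventually_mem_union (hK : K ∈ M.cells) (hL : L ∈ M.cells) (hne : L ≠ K)
    (hab : a ≠ b) (haK : a ∈ K) (hbK : b ∈ K) (haL : a ∈ L) (hbL : b ∈ L)
    (hs : s ∈ Ioo (0 : ℝ) 1) : edgePt a b s ∈ interior (hull K ∪ hull L) := by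
  obtain ⟨c, h⟩ := M.exists_isTriple hK haK hbK hab
  obtain ⟨d, h'⟩ := M.exists_isTriple hL haL hbL hab
  have hneg := M.det_mul_det_neg hK hL hne h h'
  rw [mem_interior_iff_mem_nhds]
  filter_upwards [h.eventually_mem_hull hs, h'.eventually_mem_hull hs] with y h1 h2
  by_cases h3 : 0 ≤ bary a b c y
  · exact Or.inl (h1 h3)
  · right
    apply h2
    push Not at h3
    simp only [bary] at h3 ⊢
    rcases div_neg_iff.1 h3 with ⟨h4, h5⟩ | ⟨h4, h5⟩
    · exact div_nonneg h4.le (by nlinarith)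
    · exact div_nonneg_of_nonpos h4.le (by nlinarith)

lemma edgePt_mem_of_shared (hK : K ∈ M.cells) (hL : L ∈ M.cells) (hne : L ≠ K) (hab : a ≠ b)
    (haK : a ∈ K) (hbK : b ∈ K) (haL : a ∈ L) (hbL : b ∈ L) (hs : s ∈ Ioo (0 : ℝ) 1) :
    edgePt a b s ∈ Ω := by
  rw [← hΩ.regular]
  exact interior_mono (Set.union_subset (hull_subset_closure hM hK) (hull_subset_closure hM hL))
    (M.eventually_mem_union hK hL hne hab haK hbK haL hbL hs)

/-- A boundary edge does not meet the domain. -/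
lemma edgePt_notMem_of_unshared (hK : K ∈ M.cells) (hab : a ≠ b) (haK : a ∈ K) (hbK : b ∈ K)
    (h1 : ∀ L ∈ M.cells, a ∈ L → b ∈ L → L = K) (hs : s ∈ Icc (0 : ℝ) 1) :
    edgePt a b s ∉ Ω := by
  intro hx
  have hopen : IsOpen (edgePt a b ⁻¹' Ω) := hΩ.isOpen.preimage (continuous_edgePt a b)
  have hcl : s ∈ closure (Ioo (0 : ℝ) 1) := by rwa [closure_Ioo (by norm_num)]
  obtain ⟨r, hr, hr'⟩ := mem_closure_iff.1 hcl _ hopen hx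
  obtain ⟨c, h⟩ := M.exists_isTriple hK haK hbK hab
  obtain ⟨-, e2, e3⟩ := edgePt_eq_iff_bary h r
  have hxK : edgePt a b r ∈ hull K := edgePt_mem_hull haK hbK ⟨hr'.1.le, hr'.2.le⟩
  have ht : Tendsto (fun r' : ℝ => edgePt a b r + r' • (c - a)) (𝓝[<] 0) (𝓝 (edgePt a b r)) := by
    have : ContinuousAt (fun r' : ℝ => edgePt a b r + r' • (c - a)) 0 := by fun_prop
    simpa [ContinuousAt] using this.tendsto.mono_left nhdsWithin_le_nhds
  obtain ⟨r', ⟨hy1, hy2⟩, hr0⟩ := (((ht.eventually (M.eventually_mem_hull_imp _)).and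
    (ht.eventually (hΩ.isOpen.mem_nhds hr))).and self_mem_nhdsWithin).exists
  have hr0 : r' < 0 := hr0
  obtain ⟨L, hL, hyL⟩ := subset_iUnion_hull hM hy2
  have hxL := hy1 L hL hyL
  obtain rfl := h1 L hL
    (M.mem_of_bary_ne_zero hK hL h.rotate hxK hxL (by rw [e2]; linarith [hr'.2]))
    (M.mem_of_bary_ne_zero hK hL h.rotate.rotate hxK hxL (by rw [e3]; exact hr'.1.ne'))
  have := (h.mem_hull_iff.1 hyL).1
  rw [bary_add_smul, (edgePt_eq_iff_bary h _).1, div_self h.det_ne] at this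
  linarith

/-- Single-valued edge contributions that vanish on the boundary edges add up to zero. -/
lemma sum_orient_mul_eq_zero {F : Finset Plane → Plane → Plane → ℝ} (h1 : ∀ K ∈ M.cells, ∀ L ∈
    M.cells, ∀ a b, a ∈ K → a ∈ L → b ∈ K → b ∈ L → a ≠ b → F K a b = F L a b) (h2 : ∀ K ∈ M.cells,
    ∀ a ∈ K, ∀ b ∈ K, a ≠ b → (∀ s ∈ Icc (0 : ℝ) 1, edgePt a b s ∉ Ω) → F K a b = 0) :
    ∑ K ∈ M.cells, ∑ a ∈ K, ∑ b ∈ K, orient K a b * F K a b = 0 := by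
  classical
  set V := M.cells.biUnion id with hV
  have hsub : ∀ K ∈ M.cells, K ⊆ V := fun K hK x hx => Finset.mem_biUnion.2 ⟨K, hK, hx⟩
  have e : ∀ K ∈ M.cells, ∑ a ∈ K, ∑ b ∈ K, orient K a b * F K a b =
      ∑ a ∈ V, ∑ b ∈ V, if a ∈ K ∧ b ∈ K then orient K a b * F K a b else 0 := by
    intro K hK
    rw [← Finset.sum_subset (hsub K hK)]
    · refine sum_congr rfl fun a ha => ?_
      rw [← Finset.sum_subset (hsub K hK)]
      · exact sum_congr rfl fun b hb => by simp [ha, hb]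
      · intro b _ hb; simp [hb]
    · intro a _ ha; simp [ha]
  rw [sum_congr rfl e, sum_comm]
  refine sum_eq_zero fun a _ => ?_
  rw [sum_comm]
  refine sum_eq_zero fun b _ => ?_
  by_cases hab : a = b
  · subst hab; simp
  rw [← Finset.sum_filter]
  set N := M.cells.filter fun K => a ∈ K ∧ b ∈ K with hN
  have hmem : ∀ K, K ∈ N ↔ K ∈ M.cells ∧ a ∈ K ∧ b ∈ K := fun K => by simp [hN]
  rcases N.eq_empty_or_nonempty with h0 | ⟨K, hK⟩
  · rw [h0]; simp
  obtain ⟨hKc, haK, hbK⟩ := (hmem K).1 hK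
  by_cases hL : ∃ L ∈ N, L ≠ K
  · obtain ⟨L, hL, hne⟩ := hL
    obtain ⟨hLc, haL, hbL⟩ := (hmem L).1 hL
    have hNe : N = {K, L} := by
      ext P
      simp only [Finset.mem_insert, Finset.mem_singleton]
      constructor
      · intro hP
        obtain ⟨hPc, haP, hbP⟩ := (hmem P).1 hP
        by_contra! hcon
        have o1 := M.orient_neg hKc hPc hcon.1 hab haK hbK haP hbP
        have o2 := M.orient_neg hLc hPc hcon.2 hab haL hbL haP hbP
        have o3 := M.orient_neg hKc hLc hne hab haK hbK haL hbL
        obtain ⟨c, h⟩ := M.exists_isTriple hKc haK hbK hab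
        exact h.orient_ne_zero (by linarith)
      · rintro (rfl | rfl) <;> assumption
    rw [hNe, Finset.sum_pair hne.symm, M.orient_neg hKc hLc hne hab haK hbK haL hbL,
      h1 K hKc L hLc a b haK haL hbK hbL hab]
    ring
  · push Not at hL
    refine sum_eq_zero fun P hP => ?_
    rw [hL P hP, h2 K hKc a haK b hbK hab fun s hs =>
      edgePt_notMem_of_unshared hΩ hM hKc hab haK hbK
        (fun L hLc haL hbL => hL L ((hmem L).2 ⟨hLc, haL, hbL⟩)) hs, mul_zero]

/-! ### Connectedness -/

omit hΩ hM in
lemma isPreconnected_ball_diff_singleton (x : Plane) (hr : 0 < r) :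
    IsPreconnected (Metric.ball x r \ {x}) := by
  have h1 : IsPreconnected ({0}ᶜ : Set Plane) := (isConnected_compl_singleton_of_one_lt_rank (by
      rw [← Module.finrank_eq_rank ℝ Plane, finrank_euclideanSpace_fin]
      exact_mod_cast one_lt_two) 0).isPreconnected
  have hc : Continuous fun z : Plane => x + (r / (1 + ‖z‖)) • z := by
    have : ∀ z : Plane, 1 + ‖z‖ ≠ 0 := fun z => by positivity
    fun_prop (disch := assumption)
  convert h1.image _ hc.continuousOn using 1
  ext y
  simp only [Set.mem_sdiff, Metric.mem_ball, Set.mem_singleton_iff, Set.mem_image, Set.mem_compl_iff]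
  constructor
  · rintro ⟨h2, h3⟩
    have hy : 0 < ‖y - x‖ := norm_pos_iff.2 (sub_ne_zero.2 h3)
    rw [dist_eq_norm] at h2
    have hd : 0 < r - ‖y - x‖ := by linarith
    refine ⟨(r - ‖y - x‖)⁻¹ • (y - x), by simp [hd.ne', sub_eq_zero, h3], ?_⟩
    rw [norm_smul, Real.norm_of_nonneg (by positivity), smul_smul]
    have : r / (1 + (r - ‖y - x‖)⁻¹ * ‖y - x‖) * (r - ‖y - x‖)⁻¹ = 1 := by field_simp; ring
    rw [this]; simp
  · rintro ⟨z, hz, rfl⟩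
    have hz' : 0 < ‖z‖ := norm_pos_iff.2 hz
    constructor
    · rw [dist_eq_norm, add_sub_cancel_left, norm_smul, Real.norm_of_nonneg (by positivity),
        div_mul_eq_mul_div, div_lt_iff₀ (by positivity)]
      nlinarith
    · simp only [add_eq_left, smul_eq_zero, hz, or_false]
      positivity

omit hΩ hM in
lemma mem_closure_interior_hull (hK : K ∈ M.cells) (hx : x ∈ hull K) : x ∈ closure K° := by
  obtain ⟨a, b, c, h⟩ := M.isTriple hK
  rw [(convex_hull K).closure_interior_eq_closure_of_nonempty_interior h.interior_nonempty]
  exact subset_closure hx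

/-- A quantity that is the same on any two triangles with a common edge at the vertex `δ` is the
same on all triangles at `δ`. -/
lemma eq_of_common_vertex {α : Type*} {F : Finset Plane → α} (hF : ∀ K ∈ M.cells, ∀ L ∈ M.cells, δ ∈
    K → δ ∈ L → ∀ b, b ∈ K → b ∈ L → b ≠ δ → F K = F L) (hK : K ∈ M.cells) (hL : L ∈ M.cells)
    (hδK : δ ∈ K) (hδL : δ ∈ L) : F K = F L := by
  obtain ⟨r₀, hr₀, hball⟩ := Metric.eventually_nhds_iff_ball.1 (M.eventually_mem_hull_imp δ)
  obtain ⟨r, hr, Y, hY, hYΩ, hδY, hYs, hYb⟩ : ∃ r > 0, ∃ Y : Set Plane, IsPreconnected Y ∧ Y ⊆ Ω ∧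
      δ ∉ Y ∧ (Ω ∩ Metric.ball δ r) \ {δ} ⊆ Y ∧ Y ⊆ Metric.ball δ r₀ := by
    by_cases hδ : δ ∈ Ω
    · obtain ⟨r₁, hr₁, h₁⟩ := Metric.isOpen_iff.1 hΩ.isOpen δ hδ
      have hr : 0 < min r₀ r₁ := lt_min hr₀ hr₁
      refine ⟨min r₀ r₁, hr, _, isPreconnected_ball_diff_singleton δ hr, ?_, by simp, ?_, ?_⟩
      · exact fun y hy => h₁ (Metric.ball_subset_ball (min_le_right _ _) hy.1)
      · exact fun y hy => ⟨hy.1.2, hy.2⟩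
      · exact fun y hy => Metric.ball_subset_ball (min_le_left _ _) hy.1
    · have hfr : δ ∈ frontier Ω := by
        rw [hΩ.isOpen.frontier_eq]
        exact ⟨hull_subset_closure hM hK (vertex_mem_hull hδK), hδ⟩
      obtain ⟨r, ⟨h1, h2⟩, h3⟩ := (((hΩ.one_sided δ hfr).and (Ioo_mem_nhdsGT hr₀)).and
        self_mem_nhdsWithin).exists
      refine ⟨r, h3, _, h1.isPreconnected, inter_subset_left, fun h => hδ h.1, Set.sdiff_subset, ?_⟩
      exact fun y hy => Metric.ball_subset_ball h2.2.le hy.2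
  have hne : ∀ P ∈ M.cells, δ ∈ P → (Y ∩ hull P).Nonempty := by
    intro P hP hδP
    obtain ⟨y, hy, hyP⟩ := mem_closure_iff.1 (mem_closure_interior_hull hP (vertex_mem_hull hδP)) _
      Metric.isOpen_ball (Metric.mem_ball_self hr)
    refine ⟨y, hYs ⟨⟨interior_hull_subset hΩ hM hP hyP, hy⟩, ?_⟩, interior_subset hyP⟩
    rintro rfl
    obtain ⟨b, c, h⟩ := M.exists_isTriple_fst hP hδP
    have := (h.mem_interior_iff.1 hyP).1
    simp at this
  by_contra hcon
  classical
  let C (q : Prop → Prop) : Set Plane :=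
    ⋃ P ∈ (M.cells.filter fun P => δ ∈ P ∧ q (F P = F K)), hull P
  have hCc : ∀ q, IsClosed (C q) := fun q =>
    (Finset.finite_toSet _).isClosed_biUnion fun P _ => isClosed_hull P
  have hCm : ∀ q y, y ∈ C q ↔ ∃ P ∈ M.cells, (δ ∈ P ∧ q (F P = F K)) ∧ y ∈ hull P := by
    intro q y
    simp only [C, mem_iUnion, Finset.mem_filter, exists_prop, and_assoc]
  obtain ⟨y, hy, hy1, hy2⟩ := isPreconnected_closed_iff.1 hY (C id) (C Not) (hCc _) (hCc _) (by
      intro y hy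
      obtain ⟨P, hP, hyP⟩ := subset_iUnion_hull hM (hYΩ hy)
      have hδP := M.mem_of_vertex_mem_hull hK hP hδK (hball y (hYb hy) P hP hyP)
      by_cases h : F P = F K
      · exact Or.inl ((hCm _ _).2 ⟨P, hP, ⟨hδP, h⟩, hyP⟩)
      · exact Or.inr ((hCm _ _).2 ⟨P, hP, ⟨hδP, h⟩, hyP⟩))
    (by
      obtain ⟨y, h1, h2⟩ := hne K hK hδK
      exact ⟨y, h1, (hCm _ _).2 ⟨K, hK, ⟨hδK, rfl⟩, h2⟩⟩)
    (by
      obtain ⟨y, h1, h2⟩ := hne L hL hδL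
      exact ⟨y, h1, (hCm _ _).2 ⟨L, hL, ⟨hδL, fun h => hcon h.symm⟩, h2⟩⟩)
  obtain ⟨P, hP, ⟨hδP, hFP⟩, hyP⟩ := (hCm _ _).1 hy1
  obtain ⟨Q, hQ, ⟨hδQ, hFQ⟩, hyQ⟩ := (hCm _ _).1 hy2
  have hyPQ : y ∈ convexHull ℝ ((P : Set Plane) ∩ Q) := by
    rw [← M.inter P hP Q hQ]; exact ⟨hyP, hyQ⟩
  by_cases hb : ∃ b, b ∈ P ∧ b ∈ Q ∧ b ≠ δ
  · obtain ⟨b, hbP, hbQ, hb⟩ := hb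
    exact hFQ ((hF Q hQ P hP hδQ hδP b hbQ hbP hb).trans hFP)
  · push Not at hb
    have : ((P : Set Plane) ∩ Q) ⊆ {δ} := fun z hz => hb z hz.1 hz.2
    have h3 := convexHull_mono this hyPQ
    rw [convexHull_singleton] at h3
    exact hδY (h3 ▸ hy)

/-- A quantity that is the same on any two triangles with a common vertex is constant. -/
lemma eq_of_mesh {α : Type*} {F : Finset Plane → α}
    (hF : ∀ K ∈ M.cells, ∀ L ∈ M.cells, ∀ δ, δ ∈ K → δ ∈ L → F K = F L) (hK : K ∈ M.cells)
    (hL : L ∈ M.cells) : F K = F L := by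
  classical
  have := hΩ.simplyConnected
  have hconn : IsPreconnected (closure Ω) :=
    (isPreconnected_iff_preconnectedSpace.2 inferInstance).closure
  by_contra hcon
  let C (q : Prop → Prop) : Set Plane := ⋃ P ∈ (M.cells.filter fun P => q (F P = F K)), hull P
  have hCc : ∀ q, IsClosed (C q) := fun q =>
    (Finset.finite_toSet _).isClosed_biUnion fun P _ => isClosed_hull P
  have hCm : ∀ q y, y ∈ C q ↔ ∃ P ∈ M.cells, q (F P = F K) ∧ y ∈ hull P := by
    intro q y
    simp only [C, mem_iUnion, Finset.mem_filter, exists_prop, and_assoc]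
  have hne : ∀ P ∈ M.cells, ∃ y ∈ closure Ω, y ∈ hull P := by
    intro P hP
    obtain ⟨a, b, c, h⟩ := M.isTriple hP
    exact ⟨a, hull_subset_closure hM hP (vertex_mem_hull h.mem_fst), vertex_mem_hull h.mem_fst⟩
  obtain ⟨y, hy, hy1, hy2⟩ := isPreconnected_closed_iff.1 hconn (C id) (C Not) (hCc _) (hCc _) (by
      intro y hy
      rw [hM] at hy
      simp only [mem_iUnion, exists_prop] at hy
      obtain ⟨P, hP, hyP⟩ := hy
      by_cases h : F P = F K
      · exact Or.inl ((hCm _ _).2 ⟨P, hP, h, hyP⟩)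
      · exact Or.inr ((hCm _ _).2 ⟨P, hP, h, hyP⟩))
    (by
      obtain ⟨y, h1, h2⟩ := hne K hK
      exact ⟨y, h1, (hCm _ _).2 ⟨K, hK, rfl, h2⟩⟩)
    (by
      obtain ⟨y, h1, h2⟩ := hne L hL
      exact ⟨y, h1, (hCm _ _).2 ⟨L, hL, fun h => hcon h.symm, h2⟩⟩)
  obtain ⟨P, hP, hFP, hyP⟩ := (hCm _ _).1 hy1
  obtain ⟨Q, hQ, hFQ, hyQ⟩ := (hCm _ _).1 hy2
  obtain ⟨δ, hδP, hδ⟩ := M.exists_common_vertex hP hyP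
  exact hFQ ((hF Q hQ P hP δ (hδ Q hQ hyQ) hδP).trans hFP)

end Mesh

/-! ### Trivialisation of cocycles over simply connected spaces -/

/-- A cocycle on a finite closed cover of a simply connected space is a coboundary. -/
lemma exists_potential_of_cocycle {X : Type*} [TopologicalSpace X] [SimplyConnectedSpace X]
    [LocallyPathConnectedSpace X] {ι : Type*} [Finite ι] {H : ι → Set X} (hc : ∀ i, IsClosed (H i))
    (hcov : ∀ x, ∃ i, x ∈ H i) {G : Type*} [AddCommGroup G] {j : ι → ι → G}
    (hj : ∀ x i k l, x ∈ H i → x ∈ H k → x ∈ H l → j i k + j k l = j i l) :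
    ∃ R : X → ι → G, (∀ x i k, x ∈ H i → x ∈ H k → R x k = R x i + j i k) ∧
      ∀ i, ∀ x ∈ H i, ∀ᶠ y in 𝓝 x, y ∈ H i → R y i = R x i := by
  let : TopologicalSpace G := ⊥
  have : DiscreteTopology G := ⟨rfl⟩
  choose κ hκ using hcov
  have hst : ∀ x, ∀ᶠ y in 𝓝 x, ∀ i, y ∈ H i → x ∈ H i := by
    intro x
    rw [Filter.eventually_all]
    intro i
    by_cases h : x ∈ H i
    · exact Eventually.of_forall fun _ _ => h
    · filter_upwards [(hc i).isOpen_compl.mem_nhds h] with y hy hy'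
      exact absurd hy' hy
  have hjs : ∀ x i, x ∈ H i → j i i = 0 := fun x i h => by
    have := hj x i i i h h h
    simpa using this
  let Z : FiberBundleCore X X G :=
    { baseSet := fun x => {y | ∀ i, y ∈ H i → x ∈ H i}
      isOpen_baseSet := fun x => by
        rw [isOpen_iff_mem_nhds]
        intro y hy
        filter_upwards [hst y] with z hz i hi using hy i (hz i hi)
      indexAt := id
      mem_baseSet_at := fun x i hi => hi
      coordChange := fun x x' y g => g + (j (κ x) (κ y) + j (κ y) (κ x'))
      coordChange_self := fun x y hy g => by
        have h1 := hy _ (hκ y)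
        rw [hj x _ _ _ (hκ x) h1 (hκ x), hjs x _ (hκ x), add_zero]
      continuousOn_coordChange := fun x x' => by
        refine ContinuousOn.mono (s := {p : X × G | (∀ i, p.1 ∈ H i → x ∈ H i) ∧
          (∀ i, p.1 ∈ H i → x' ∈ H i)}) ?_
          (fun p hp => show (∀ i, p.1 ∈ H i → x ∈ H i) ∧ (∀ i, p.1 ∈ H i → x' ∈ H i) from
            ⟨hp.1.1, hp.1.2⟩)
        rintro ⟨y, g⟩ ⟨hy, hy'⟩
        simp only at hy hy'
        refine ContinuousAt.continuousWithinAt ?_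
        refine ContinuousAt.congr (f := fun p : X × G => p.2 + (j (κ x) (κ y) + j (κ y) (κ x'))) (by
            refine ContinuousAt.comp (g := fun g : G => g + (j (κ x) (κ y) + j (κ y) (κ x')))
              continuous_of_discreteTopology.continuousAt continuous_snd.continuousAt) ?_
        filter_upwards [continuous_fst.continuousAt.eventually (hst y)] with p hp
        congr 1
        have h1 := hp _ (hκ p.1)
        rw [hj x _ _ _ (hκ x) (hy _ (hκ y)) (hy _ h1) |>.symm,
          hj x' _ _ _ (hy' _ h1) (hy' _ (hκ y)) (hκ x') |>.symm]
        have h2 := hj y _ _ _ (hκ y) h1 (hκ y)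
        rw [hjs y _ (hκ y)] at h2
        calc _ = j (κ x) (κ y) + 0 + j (κ y) (κ x') := by abel
          _ = _ := by rw [← h2]; abel
      coordChange_comp := fun x x' x'' y hy g => by
        have h1 := hj x' _ _ _ (hy.1.2 _ (hκ y)) (hκ x') (hy.1.2 _ (hκ y))
        rw [hjs y _ (hκ y)] at h1
        calc _ = g + (j (κ x) (κ y) + j (κ y) (κ x'')) + (j (κ y) (κ x') + j (κ x') (κ y)) := by abel
          _ = _ := by rw [h1, add_zero] }
  have hcov : IsCoveringMap (Bundle.TotalSpace.proj : Bundle.TotalSpace G Z.Fiber → X) :=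
    FiberBundle.isCoveringMap
  obtain ⟨x₀⟩ : Nonempty X := inferInstance
  obtain ⟨σ, ⟨-, hσ⟩, -⟩ := hcov.existsUnique_continuousMap_lifts (ContinuousMap.id X) x₀
    (⟨x₀, (0 : G)⟩ : Bundle.TotalSpace G Z.Fiber) rfl
  have hσ' : ∀ x, (σ x).1 = x := fun x => congrFun hσ x
  let g : X → G := fun x => (σ x).2
  have hg : ∀ x, ∀ᶠ y in 𝓝 x, g y + j (κ y) (κ x) = g x := by
    intro x
    have h1 : ContinuousAt (fun y => (Z.localTrivAt x (σ y)).2) x := by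
      refine continuous_snd.continuousAt.comp ?_
      refine ContinuousAt.comp (g := Z.localTrivAt x) (f := σ) ?_ σ.continuous.continuousAt
      refine (Z.localTrivAt x).continuousAt ?_
      rw [Z.mem_localTrivAt_source, hσ']
      exact Z.mem_localTrivAt_baseSet x
    have h3 : ∀ y, (Z.localTrivAt x (σ y)).2 = g y + (j (κ y) (κ y) + j (κ y) (κ x)) := by
      intro y
      have := Z.localTrivAt_snd x (σ y)
      rw [this]
      simp only [Z, hσ', id, g]
    have h2 := h1.eventually_mem (mem_nhds_discrete.2 (Set.mem_singleton _))
    filter_upwards [h2] with y hy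
    rw [Set.mem_singleton_iff, h3, h3, hjs y _ (hκ y), hjs x _ (hκ x)] at hy
    simpa using hy
  refine ⟨fun x i => g x + j (κ x) i, ?_, ?_⟩
  · intro x i k hi hk
    rw [add_assoc, hj x _ _ _ (hκ x) hi hk]
  · intro i x hi
    filter_upwards [hg x, hst x] with y hy hy' hyi
    rw [← hy, add_assoc, hj x _ _ _ (hy' _ (hκ y)) (hκ x) hi]

section Mesh

lemma exists_potential_of_mesh_cocycle (hΩ : IsPolygon Ω) (hM : M.IsMeshOf Ω) {G : Type*}
    [AddCommGroup G] {j : Finset Plane → Finset Plane → G} (hj : ∀ K ∈ M.cells, ∀ L ∈ M.cells, ∀ P ∈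
    M.cells, ∀ δ, δ ∈ K → δ ∈ L → δ ∈ P → j K L + j L P = j K P) :
    ∃ r : Finset Plane → G, ∀ K ∈ M.cells, ∀ L ∈ M.cells, ∀ δ, δ ∈ K → δ ∈ L →
      r L = r K + j K L := by
  classical
  have := hΩ.simplyConnected
  have : LocallyPathConnectedSpace Ω := hΩ.isOpen.locallyPathConnectedSpace
  obtain ⟨R, hR1, hR2⟩ := exists_potential_of_cocycle (X := Ω) (ι := M.cells)
    (H := fun K => {x : Ω | (x : Plane) ∈ hull (K : Finset Plane)})
    (fun K => (isClosed_hull _).preimage continuous_subtype_val)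
    (fun x => by
      obtain ⟨K, hK, hx⟩ := subset_iUnion_hull hM x.2
      exact ⟨⟨K, hK⟩, hx⟩)
    (j := fun K L => j K L)
    (fun x K L P hK hL hP => by
      obtain ⟨δ, hδK, hδ⟩ := M.exists_common_vertex K.2 hK
      exact hj K K.2 L L.2 P P.2 δ hδK (hδ L L.2 hL) (hδ P P.2 hP))
  have hconst : ∀ K : M.cells, ∃ g : G, ∀ x : Ω, (x : Plane) ∈ hull (K : Finset Plane) →
      R x K = g := by
    intro K
    obtain ⟨a, b, c, h⟩ := M.isTriple K.2
    obtain ⟨y₀, hy₀⟩ := h.interior_nonempty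
    have hsub := interior_hull_subset hΩ hM K.2
    have hpre : IsPreconnected {x : Ω | (x : Plane) ∈ interior (hull (K : Finset Plane))} := by
      rw [← Topology.IsInducing.subtypeVal.isPreconnected_image]
      have : (Subtype.val '' {x : Ω | (x : Plane) ∈ interior (hull (K : Finset Plane))}) =
          interior (hull (K : Finset Plane)) := by
        ext y; constructor
        · rintro ⟨z, hz, rfl⟩; exact hz
        · intro hy; exact ⟨⟨y, hsub hy⟩, hy, rfl⟩
      rw [this]
      exact (convex_hull _).interior.isPreconnected
    have hint : ∀ x : Ω, (x : Plane) ∈ interior (hull (K : Finset Plane)) →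
        R x K = R ⟨y₀, hsub hy₀⟩ K := by
      intro x hx
      let _ : TopologicalSpace G := ⊥
      have : DiscreteTopology G := ⟨rfl⟩
      refine hpre.constant (f := fun x => R x K) (fun z hz => ?_) hx hy₀
      refine (continuousAt_const (y := R z K)).continuousWithinAt.congr_of_eventuallyEq ?_ rfl
      filter_upwards [self_mem_nhdsWithin, nhdsWithin_le_nhds (hR2 K z (show (z : Plane) ∈ hull _ from
        interior_subset hz))] with w hw hw'
      exact hw' (show (w : Plane) ∈ hull _ from interior_subset hw)
    refine ⟨R ⟨y₀, hsub hy₀⟩ K, fun x hx => ?_⟩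
    obtain ⟨U, hU, hUo, hxU⟩ := eventually_nhds_iff.1 (hR2 K x hx)
    obtain ⟨V, hVo, rfl⟩ := isOpen_induced_iff.1 hUo
    obtain ⟨y, hyV, hy⟩ := mem_closure_iff.1 (mem_closure_interior_hull K.2 hx) V hVo hxU
    rw [← hU ⟨y, hsub hy⟩ hyV (show y ∈ hull _ from interior_subset hy)]
    exact hint _ hy
  choose g hg using hconst
  have hshare : ∀ K (hK : K ∈ M.cells) L (hL : L ∈ M.cells), ∀ a b, a ∈ K → a ∈ L → b ∈ K → b ∈ L →
      b ≠ a → g ⟨L, hL⟩ = g ⟨K, hK⟩ + j K L := by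
    intro K hK L hL a b haK haL hbK hbL hab
    by_cases hKL : L = K
    · subst hKL
      have := hj L hL L hL L hL a haL haL haL
      have h0 : j L L = 0 := by simpa using this
      simp [h0]
    have hmid : (1 / 2 : ℝ) ∈ Ioo (0 : ℝ) 1 := by norm_num
    have hx := edgePt_mem_of_shared hΩ hM hK hL hKL hab.symm haK hbK haL hbL hmid
    have hxK := edgePt_mem_hull haK hbK (Ioo_subset_Icc_self hmid)
    have hxL := edgePt_mem_hull haL hbL (Ioo_subset_Icc_self hmid)
    rw [← hg ⟨L, hL⟩ ⟨_, hx⟩ hxL, ← hg ⟨K, hK⟩ ⟨_, hx⟩ hxK]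
    exact hR1 ⟨_, hx⟩ ⟨K, hK⟩ ⟨L, hL⟩ hxK hxL
  refine ⟨fun K => if hK : K ∈ M.cells then g ⟨K, hK⟩ else 0, fun K hK L hL δ hδK hδL => ?_⟩
  have key := eq_of_common_vertex hΩ hM
    (F := fun P => if hP : P ∈ M.cells then g ⟨P, hP⟩ + j P L else 0) (δ := δ)
    (fun P hP Q hQ hδP hδQ b hbP hbQ hb => by
      simp only [hP, hQ, dif_pos]
      rw [hshare P hP Q hQ δ b hδP hδQ hbP hbQ hb, add_assoc, hj P hP Q hQ L hL δ hδP hδQ hδL])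
    hK hL hδK hδL
  have h0 : j L L = 0 := by simpa using hj L hL L hL L hL δ hδL hδL hδL
  simp only [hK, hL, dif_pos, h0, add_zero] at key ⊢
  exact key.symm

end Mesh

variable {v : Fin 2 → Poly} {φ : ScalarField} {τ : TensorField}

/-! ### Tangents and normals -/

section Edge

lemma dist_sq_eq (a b : Plane) : dist a b ^ 2 = (b 0 - a 0) ^ 2 + (b 1 - a 1) ^ 2 := by
  rw [dist_comm, EuclideanSpace.dist_eq, Real.sq_sqrt (by positivity)]
  simp [sum_univ_two, Real.dist_eq]

lemma dist_mul_tangent (hab : a ≠ b) (i : Fin 2) : dist a b * tangent a b i = b i - a i := by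
  have := (dist_pos.2 hab).ne'
  simp [tangent]
  field_simp

lemma tangent_unit (hab : a ≠ b) : tangent a b 0 ^ 2 + tangent a b 1 ^ 2 = 1 := by
  have h := (dist_pos.2 hab).ne'
  have h2 := dist_sq_eq a b
  simp only [tangent, PiLp.smul_apply, PiLp.sub_apply, smul_eq_mul]
  field_simp
  linarith

@[simp] lemma normal_zero (a b : Plane) : normal a b 0 = tangent a b 1 := rfl
@[simp] lemma normal_one (a b : Plane) : normal a b 1 = -tangent a b 0 := rfl

lemma tangent_swap (a b : Plane) : tangent b a = -tangent a b := by
  simp [tangent, dist_comm b a, ← smul_neg]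

lemma normal_swap (a b : Plane) (i : Fin 2) : normal b a i = -normal a b i := by
  fin_cases i <;> simp [tangent_swap a b]

lemma dist_mul_normal (hab : a ≠ b) (i : Fin 2) : dist a b * normal a b i = rot (b - a) i := by
  fin_cases i <;> simp [dist_mul_tangent hab]

/-! ### Traces of `sym curl` on an edge -/

lemma normalNormal_symCurlOf (a b : Plane) (D : Fin 2 → Fin 2 → ℝ) :
    normalNormal a b (symCurlOf D) = ∑ m, ∑ i, tangent a b m * normal a b i * D m i := by
  simp [normalNormal, symCurlOf, curlOf, sum_univ_two]
  ring

lemma shear_symCurlOf (hab : a ≠ b) (H : Fin 2 → Fin 2 → Fin 2 → ℝ) (hH : ∀ i, H 0 1 i = H 1 0 i) :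
    shear a b (fun m => symCurlOf (H m)) =
      ∑ m, ∑ l, ∑ i, tangent a b m * tangent a b l * tangent a b i * H m l i := by
  have hu := tangent_unit hab
  simp [shear, symCurlOf, curlOf, sum_univ_two, hH]
  generalize tangent a b 0 = t₀ at *
  generalize tangent a b 1 = t₁ at *
  linear_combination (-1 / 2 : ℝ) * (t₀ * (H 0 0 0 + H 1 0 1) + t₁ * (H 1 0 0 + H 1 1 1)) * hu

lemma normalNormal_swap (a b : Plane) (T : Fin 2 → Fin 2 → ℝ) :
    normalNormal b a T = normalNormal a b T := by
  simp [normalNormal, normal_swap a b]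

lemma shear_swap (a b : Plane) (D : Fin 2 → Fin 2 → Fin 2 → ℝ) : shear b a D = -shear a b D := by
  simp [shear, normal_swap a b, tangent_swap a b, sum_univ_two]
  ring

lemma polyNN_swap (a b : Plane) (p : TensorPoly) (s : ℝ) :
    polyNN b a p s = polyNN a b p (1 - s) := by
  simp [polyNN, normalNormal_swap a b, edgePt_swap a b]

lemma polyShear_swap (a b : Plane) (p : TensorPoly) (s : ℝ) :
    polyShear b a p s = -polyShear a b p (1 - s) := by
  simp [polyShear, shear_swap a b, edgePt_swap a b]

lemma normalNormal_sub (a b : Plane) (S T : Fin 2 → Fin 2 → ℝ) :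
    normalNormal a b (fun i j => S i j - T i j) = normalNormal a b S - normalNormal a b T := by
  simp [normalNormal, sum_univ_two]; ring

lemma shear_sub (a b : Plane) (S T : Fin 2 → Fin 2 → Fin 2 → ℝ) :
    shear a b (fun m i j => S m i j - T m i j) = shear a b S - shear a b T := by
  simp [shear, sum_univ_two]; ring

lemma polyNN_sub (a b : Plane) (p q : TensorPoly) (s : ℝ) :
    polyNN a b (p - q) s = polyNN a b p s - polyNN a b q s := by
  simp [polyNN, ← normalNormal_sub]

lemma polyShear_sub (a b : Plane) (p q : TensorPoly) (s : ℝ) :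
    polyShear a b (p - q) s = polyShear a b p s - polyShear a b q s := by
  simp [polyShear, ← shear_sub]

/-- The trace `nᵀ p n` as a polynomial in the parameter of the edge. -/
def nnPoly (a b : Plane) (p : TensorPoly) : ℝ[X] :=
  restr a b (∑ i, ∑ j, (normal a b i * normal a b j) • p i j)

lemma eval_nnPoly (a b : Plane) (p : TensorPoly) (s : ℝ) :
    (nnPoly a b p).eval s = polyNN a b p s := by
  simp [nnPoly, polyNN, normalNormal, sum_univ_two]; ring

/-- The trace `∂ₜ(tᵀ p n) + nᵀ div p` as a polynomial in the parameter of the edge. -/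
def shearPoly (a b : Plane) (p : TensorPoly) : ℝ[X] :=
  restr a b ((∑ m, ∑ i, ∑ j, (tangent a b m * tangent a b i * normal a b j) • pderiv m (p i j)) +
    ∑ i, ∑ j, normal a b i • pderiv j (p i j))

lemma eval_shearPoly (a b : Plane) (p : TensorPoly) (s : ℝ) :
    (shearPoly a b p).eval s = polyShear a b p s := by
  simp [shearPoly, polyShear, shear, sum_univ_two]

lemma polyNN_symCurlPoly (hab : a ≠ b) (v : Fin 2 → Poly) (s : ℝ) :
    dist a b * polyNN a b (symCurlPoly v) s =
      (derivative (∑ i, normal a b i • restr a b (v i))).eval s := by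
  have h : polyNN a b (symCurlPoly v) s = ∑ m, ∑ i, tangent a b m * normal a b i *
      ev (pderiv m (v i)) (edgePt a b s) := by
    rw [← normalNormal_symCurlOf, polyNN]
    congr 1
    ext i j
    fin_cases i <;> fin_cases j <;> simp [symCurlPoly, symCurlOf, curlOf] <;> ring
  rw [h]
  simp [sum_univ_two, derivative_restr, ← dist_mul_tangent hab]
  ring

lemma polyShear_symCurlPoly (hab : a ≠ b) (v : Fin 2 → Poly) (s : ℝ) :
    dist a b ^ 2 * polyShear a b (symCurlPoly v) s = (derivative (derivative
        (∑ i, tangent a b i • restr a b (v i)))).eval s := by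
  have h : polyShear a b (symCurlPoly v) s =
      ∑ m, ∑ l, ∑ i, tangent a b m * tangent a b l * tangent a b i *
      ev (pderiv m (pderiv l (v i))) (edgePt a b s) := by
    rw [← shear_symCurlOf hab _ fun i => by rw [pderiv_comm], polyShear]
    congr 1
    ext m i j
    fin_cases i <;> fin_cases j <;> simp [symCurlPoly, symCurlOf, curlOf] <;> ring
  rw [h]
  simp [sum_univ_two, derivative_restr, ← dist_mul_tangent hab]
  ring

/-! ### Raviart-Thomas fields -/

/-- The polynomial field `x ↦ g₁ + g₂ x`. -/
def rtPoly (g : (Fin 2 → ℝ) × ℝ) (i : Fin 2) : Poly :=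
  MvPolynomial.C (g.1 i) + g.2 • MvPolynomial.X i

/-- The Raviart-Thomas field with the same value and the same `∂₁ v₁` at `δ` as `v`. -/
def rtJet (v : Fin 2 → Poly) (δ : Plane) : (Fin 2 → ℝ) × ℝ :=
  (fun i => ev (v i) δ - ev (pderiv 0 (v 0)) δ * δ i, ev (pderiv 0 (v 0)) δ)

@[simp] lemma ev_rtPoly (g : (Fin 2 → ℝ) × ℝ) (i : Fin 2) (x : Plane) :
    ev (rtPoly g i) x = g.1 i + g.2 * x i := by simp [rtPoly]

@[simp] lemma pderiv_rtPoly (g : (Fin 2 → ℝ) × ℝ) (m i : Fin 2) :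
    pderiv m (rtPoly g i) = if m = i then MvPolynomial.C g.2 else 0 := by
  refine ev_injective fun x => ?_
  by_cases h : m = i
  · subst h; simp [rtPoly]
  · simp [rtPoly, h, MvPolynomial.pderiv_X_of_ne (Ne.symm h)]

lemma rtPoly_mem_polyDeg (g : (Fin 2 → ℝ) × ℝ) (i : Fin 2) (m : ℕ) : rtPoly g i ∈ polyDeg (m + 1) :=
  add_mem (C_mem_polyDeg _ _) (smul_mem _ _ (polyDeg_mono (by omega) (X_mem_polyDeg i)))

lemma symCurlPoly_add (v w : Fin 2 → Poly) :
    symCurlPoly (v + w) = symCurlPoly v + symCurlPoly w := by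
  ext1 i; ext1 j
  refine ev_injective fun x => ?_
  fin_cases i <;> fin_cases j <;> simp [symCurlPoly, symCurlOf, curlOf] <;> ring

lemma symCurlPoly_sub (v w : Fin 2 → Poly) :
    symCurlPoly (v - w) = symCurlPoly v - symCurlPoly w := by
  ext1 i; ext1 j
  refine ev_injective fun x => ?_
  fin_cases i <;> fin_cases j <;> simp [symCurlPoly, symCurlOf, curlOf] <;> ring

@[simp] lemma symCurlPoly_rtPoly (g : (Fin 2 → ℝ) × ℝ) : symCurlPoly (rtPoly g) = 0 := by
  ext1 i; ext1 j
  refine ev_injective fun x => ?_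
  fin_cases i <;> fin_cases j <;> simp [symCurlPoly, symCurlOf, curlOf]

lemma rtJet_add (v w : Fin 2 → Poly) (δ : Plane) : rtJet (v + w) δ = rtJet v δ + rtJet w δ := by
  ext
  · simp [rtJet]; ring
  · simp [rtJet]

@[simp] lemma rtJet_rtPoly (g : (Fin 2 → ℝ) × ℝ) (δ : Plane) : rtJet (rtPoly g) δ = g := by
  ext
  · simp [rtJet]
  · simp [rtJet]

/-- Where `sym curl v` vanishes, the gradient of `v` is a multiple of the identity. -/
lemma pderiv_eq_of_symCurlPoly_eq_zero (h : ∀ i j, ev (symCurlPoly v i j) δ = 0) (m i : Fin 2) :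
    ev (pderiv m (v i)) δ = if m = i then (rtJet v δ).2 else 0 := by
  have h00 := h 0 0
  have h01 := h 0 1
  have h11 := h 1 1
  simp [symCurlPoly, symCurlOf, curlOf] at h00 h01 h11
  fin_cases m <;> fin_cases i <;> simp [rtJet] <;> linarith

lemma ev_eq_of_rtJet (v : Fin 2 → Poly) (δ : Plane) (i : Fin 2) :
    ev (v i) δ = (rtJet v δ).1 i + (rtJet v δ).2 * δ i := by
  simp [rtJet]

lemma polynomial_eq_C_of_derivative {f : ℝ[X]} (h : derivative f = 0) :
    f = Polynomial.C (f.eval 0) := by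
  have := Polynomial.derivative_eq_zero.1 h
  rw [Polynomial.natDegree_eq_zero] at this
  obtain ⟨c, rfl⟩ := this
  simp

/-- A field whose `sym curl` has vanishing edge data is a Raviart-Thomas field on the edge. -/
lemma edge_rigid (hab : a ≠ b) (hnn : ∀ s, polyNN a b (symCurlPoly v) s = 0)
    (hsh : ∀ s, polyShear a b (symCurlPoly v) s = 0) (ha : ∀ i j, ev (symCurlPoly v i j) a = 0)
    (hb : ∀ i j, ev (symCurlPoly v i j) b = 0) :
    rtJet v a = rtJet v b ∧ ∀ i s, ev (v i) (edgePt a b s) =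
      (rtJet v a).1 i + (rtJet v a).2 * edgePt a b s i := by
  have hu := tangent_unit hab
  have hd := (dist_pos.2 hab).ne'
  set N : ℝ[X] := ∑ i, normal a b i • restr a b (v i) with hN
  set T : ℝ[X] := ∑ i, tangent a b i • restr a b (v i) with hT
  have hN' : derivative N = 0 := Polynomial.funext fun s => by
    rw [hN, ← polyNN_symCurlPoly hab, hnn]; simp
  have hT' : derivative (derivative T) = 0 := Polynomial.funext fun s => by
    rw [hT, ← polyShear_symCurlPoly hab, hsh]; simp
  have hT1 : ∀ s, (derivative T).eval s = (derivative T).eval 0 := by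
    intro s; rw [polynomial_eq_C_of_derivative hT']; simp
  have hTe : ∀ s, (∀ i j, ev (symCurlPoly v i j) (edgePt a b s) = 0) →
      (derivative T).eval s = dist a b * (rtJet v (edgePt a b s)).2 := by
    intro s hs
    have h := pderiv_eq_of_symCurlPoly_eq_zero hs
    simp [hT, sum_univ_two, derivative_restr, h, ← dist_mul_tangent hab]
    linear_combination (dist a b * (rtJet v (edgePt a b s)).2) * hu
  have e0 := hTe 0 (by simpa using ha)
  have e1 := hTe 1 (by simpa using hb)
  rw [edgePt_zero] at e0
  rw [edgePt_one, hT1, e0] at e1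
  have hβ : (rtJet v a).2 = (rtJet v b).2 := mul_left_cancel₀ hd e1
  have hNs : ∀ s, N.eval s = N.eval 0 := by
    intro s; rw [polynomial_eq_C_of_derivative hN']; simp
  have hTs : ∀ s, T.eval s = T.eval 0 + s * (dist a b * (rtJet v a).2) := by
    intro s
    have h1 : derivative (T - X * Polynomial.C (dist a b * (rtJet v a).2)) = 0 := by
      refine Polynomial.funext fun s => ?_
      rw [map_sub, eval_sub, hT1, e0]; simp
    have h2 := congrArg (Polynomial.eval s) (polynomial_eq_C_of_derivative h1)
    simp at h2
    linarith
  have key : ∀ i s, ev (v i) (edgePt a b s) = ev (v i) a + (rtJet v a).2 * (s * (b i - a i)) := by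
    intro i s
    have h1 := hNs s
    have h2 := hTs s
    simp [hN, hT, sum_univ_two] at h1 h2
    rw [← dist_mul_tangent hab i]
    fin_cases i
    · simp only [Fin.zero_eta]
      linear_combination tangent a b 1 * h1 + tangent a b 0 * h2 -
        (ev (v 0) (edgePt a b s) - ev (v 0) a) * hu
    · simp only [Fin.mk_one]
      linear_combination -tangent a b 0 * h1 + tangent a b 1 * h2 -
        (ev (v 1) (edgePt a b s) - ev (v 1) a) * hu
  refine ⟨Prod.ext (funext fun i => ?_) hβ, fun i s => ?_⟩
  · have h1 := key i 1
    have h2 := ev_eq_of_rtJet v b i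
    have h3 := ev_eq_of_rtJet v a i
    rw [edgePt_one] at h1
    rw [← hβ] at h2
    linarith
  · rw [key, ev_eq_of_rtJet v a i, edgePt_apply]; ring

/-- The kernel of `sym curl` consists of the Raviart-Thomas fields. -/
lemma eq_rtPoly_of_symCurlPoly_eq_zero (h : symCurlPoly v = 0) : ∃ g, v = rtPoly g := by
  refine ⟨rtJet v 0, funext fun i => ev_injective fun x => ?_⟩
  by_cases hx : (0 : Plane) = x
  · subst hx; rw [ev_eq_of_rtJet v 0 i, ev_rtPoly]
  · have := (edge_rigid hx (v := v) (by simp [h, polyNN, normalNormal])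
      (by simp [h, polyShear, shear]) (by simp [h]) (by simp [h])).2 i 1
    rwa [edgePt_one, ← ev_rtPoly] at this

end Edge

/-! ### Green's formula for `div div` -/

/-- The boundary term of Green's formula for `div div` on the edge from `a` to `b`. -/
def edgeTerm (a b : Plane) (τ : TensorField) (φ : ScalarField) : ℝ :=
  dist a b * (∫ s in (0 : ℝ)..1, (normalNormal a b (fun i j => τ i j (edgePt a b s)) *
      ∑ i, normal a b i * partialD i φ (edgePt a b s) -
    shear a b (fun m i j => partialD m (τ i j) (edgePt a b s)) * φ (edgePt a b s))) +
  ((∑ i, ∑ j, tangent a b i * τ i j b * normal a b j) * φ b -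
    (∑ i, ∑ j, tangent a b i * τ i j a * normal a b j) * φ a)

lemma hasDerivAt_edgePt (hab : a ≠ b) (hf : Differentiable ℝ f) (s : ℝ) :
    HasDerivAt (fun s => f (edgePt a b s))
      (dist a b * ∑ m, tangent a b m * partialD m f (edgePt a b s)) s := by
  simp only [edgePt_eq]
  refine (hasDerivAt_comp_line (hf _)).congr_deriv ?_
  rw [mul_sum]
  refine sum_congr rfl fun m _ => ?_
  rw [← mul_assoc, dist_mul_tangent hab]; rfl

lemma contDiff_partialD (hf : ContDiff ℝ (n + 1) f) (m : Fin 2) : ContDiff ℝ n (partialD m f) :=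
  (hf.fderiv_right le_rfl).clm_apply contDiff_const

lemma edge_byParts (hab : a ≠ b) (hτ : ∀ i j, ContDiff ℝ 2 (τ i j)) (hφ : ContDiff ℝ 2 φ) :
    dist a b * ∫ s in (0 : ℝ)..1,
      ((∑ i, ∑ j, normal a b j * (τ i j (edgePt a b s) * partialD i φ (edgePt a b s))) -
        ∑ i, ∑ j, normal a b i * (partialD j (τ i j) (edgePt a b s) * φ (edgePt a b s))) =
      edgeTerm a b τ φ := by
  have hu := tangent_unit hab
  have c1 : ∀ i j, Continuous (τ i j) := fun i j => (hτ i j).continuous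
  have c2 : ∀ m i j, Continuous (partialD m (τ i j)) := fun m i j =>
    continuous_partialD (hτ i j) (by norm_num) m
  have c3 : ∀ m, Continuous (partialD m φ) := fun m => continuous_partialD hφ (by norm_num) m
  have c4 := hφ.continuous
  have ce := continuous_edgePt a b
  set g : ScalarField := fun x => (∑ i, ∑ j, tangent a b i * τ i j x * normal a b j) * φ x with hg
  have hτd : ∀ i j, Differentiable ℝ (τ i j) := fun i j => (hτ i j).differentiable (by norm_num)
  have hφd : Differentiable ℝ φ := hφ.differentiable (by norm_num)
  have hder : ∀ s, HasDerivAt (fun s => g (edgePt a b s))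
      (dist a b * ((∑ m, ∑ i, ∑ j, tangent a b m * tangent a b i * normal a b j *
          partialD m (τ i j) (edgePt a b s)) * φ (edgePt a b s) +
        (∑ i, ∑ j, tangent a b i * τ i j (edgePt a b s) * normal a b j) *
          ∑ m, tangent a b m * partialD m φ (edgePt a b s))) s := by
    intro s
    have h1 : HasDerivAt (fun s => ∑ i, ∑ j, tangent a b i * τ i j (edgePt a b s) * normal a b j)
        (∑ i, ∑ j, tangent a b i *
          (dist a b * ∑ m, tangent a b m * partialD m (τ i j) (edgePt a b s)) * normal a b j) s :=
      HasDerivAt.fun_sum fun i _ => HasDerivAt.fun_sum fun j _ =>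
        ((hasDerivAt_edgePt hab (hτd i j) s).const_mul _).mul_const _
    refine (h1.mul (hasDerivAt_edgePt hab hφd s)).congr_deriv ?_
    simp [sum_univ_two]; ring
  have cD : Continuous fun s => ((∑ m, ∑ i, ∑ j, tangent a b m * tangent a b i * normal a b j *
          partialD m (τ i j) (edgePt a b s)) * φ (edgePt a b s) +
        (∑ i, ∑ j, tangent a b i * τ i j (edgePt a b s) * normal a b j) *
          ∑ m, tangent a b m * partialD m φ (edgePt a b s)) :=
    ((continuous_finsetSum _ fun m _ => continuous_finsetSum _ fun i _ =>
      continuous_finsetSum _ fun j _ => continuous_const.mul ((c2 m i j).comp ce)).mul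
        (c4.comp ce)).add
    ((continuous_finsetSum _ fun i _ => continuous_finsetSum _ fun j _ =>
      (continuous_const.mul ((c1 i j).comp ce)).mul continuous_const).mul
        (continuous_finsetSum _ fun m _ => continuous_const.mul ((c3 m).comp ce)))
  have cN : Continuous fun s => normalNormal a b (fun i j => τ i j (edgePt a b s)) :=
    continuous_finsetSum _ fun i _ => continuous_finsetSum _ fun j _ =>
      (continuous_const.mul ((c1 i j).comp ce)).mul continuous_const
  have cS : Continuous fun s => shear a b (fun m i j => partialD m (τ i j) (edgePt a b s)) :=
    (continuous_finsetSum _ fun m _ => continuous_finsetSum _ fun i _ =>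
      continuous_finsetSum _ fun j _ => continuous_const.mul ((c2 m i j).comp ce)).add
    (continuous_finsetSum _ fun i _ => continuous_finsetSum _ fun j _ =>
      continuous_const.mul ((c2 j i j).comp ce))
  have hftc := integral_eq_sub_of_hasDerivAt (a := 0) (b := 1)
    (fun s _ => hder s) (Continuous.intervalIntegrable (continuous_const.mul cD) _ _)
  rw [edgeTerm]
  have e : (∑ i, ∑ j, tangent a b i * τ i j b * normal a b j) * φ b -
      (∑ i, ∑ j, tangent a b i * τ i j a * normal a b j) * φ a =
      g (edgePt a b 1) - g (edgePt a b 0) := by simp [hg]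
  rw [e, ← hftc, intervalIntegral.integral_const_mul, ← mul_add, ← intervalIntegral.integral_add]
  rotate_left
  · exact ((cN.mul (continuous_finsetSum _ fun i _ => continuous_const.mul ((c3 i).comp ce))).sub
      (cS.mul (c4.comp ce))).intervalIntegrable _ _
  · exact cD.intervalIntegrable _ _
  congr 1
  refine intervalIntegral.integral_congr fun s _ => ?_
  simp [normalNormal, shear, sum_univ_two]
  generalize tangent a b 0 = t₀ at *
  generalize tangent a b 1 = t₁ at *
  generalize τ 0 0 (edgePt a b s) = x00
  generalize τ 0 1 (edgePt a b s) = x01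
  generalize τ 1 0 (edgePt a b s) = x10
  generalize τ 1 1 (edgePt a b s) = x11
  generalize partialD 0 φ (edgePt a b s) = f0
  generalize partialD 1 φ (edgePt a b s) = f1
  linear_combination (-(t₁ * x00 - t₀ * x01) * f0 - (t₁ * x10 - t₀ * x11) * f1) * hu

/-- Green's formula for `div div` on a triangle. -/
lemma IsTriple.green_divDiv {c : Plane} (h : IsTriple K a b c) (hτ : ∀ i j, ContDiff ℝ 2 (τ i j))
    (hφ : ContDiff ℝ 2 φ) :
    (∫ x in hull K, ∑ i, ∑ j, τ i j x * partialD i (partialD j φ) x) -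
      ∫ x in hull K, (∑ i, ∑ j, partialD i (partialD j (τ i j)) x) * φ x =
    1 / 2 * ∑ a ∈ K, ∑ b ∈ K, orient K a b * edgeTerm a b τ φ := by
  have hφ1 : ∀ m, ContDiff ℝ 1 (partialD m φ) := fun m => contDiff_partialD (by rwa [one_add_one_eq_two]) m
  have hτ1 : ∀ m i j, ContDiff ℝ 1 (partialD m (τ i j)) := fun m i j =>
    contDiff_partialD (by rw [one_add_one_eq_two]; exact hτ i j) m
  have hτ0 : ∀ i j, ContDiff ℝ 1 (τ i j) := fun i j => (hτ i j).of_le (by norm_num)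
  have hφ0 : ContDiff ℝ 1 φ := hφ.of_le (by norm_num)
  have cint : ∀ {f : Plane → ℝ}, Continuous f → IntegrableOn f (hull K) := fun hf =>
    hf.continuousOn.integrableOn_compact (isCompact_hull K)
  have cφ2 : ∀ m l, Continuous (partialD m (partialD l φ)) := fun m l =>
    continuous_partialD (hφ1 l) le_rfl m
  have cτ2 : ∀ m l i j, Continuous (partialD m (partialD l (τ i j))) := fun m l i j =>
    continuous_partialD (hτ1 l i j) le_rfl m
  have cφ1 : ∀ m, Continuous (partialD m φ) := fun m => (hφ1 m).continuous
  have cτ1 : ∀ m i j, Continuous (partialD m (τ i j)) := fun m i j => (hτ1 m i j).continuous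
  have cτ : ∀ i j, Continuous (τ i j) := fun i j => (hτ i j).continuous
  have cφ := hφ.continuous
  have hpt : ∀ x, (∑ i, ∑ j, τ i j x * partialD i (partialD j φ) x) -
      (∑ i, ∑ j, partialD i (partialD j (τ i j)) x) * φ x =
      ∑ i, ∑ j, (partialD j (fun y => τ i j y * partialD i φ y) x -
        partialD i (fun y => partialD j (τ i j) y * φ y) x) := by
    intro x
    have hsym : partialD 0 (partialD 1 φ) x = partialD 1 (partialD 0 φ) x := by
      have h2 := (hφ.contDiffAt (x := x)).isSymmSndFDerivAt (by simp)
      have h3 : ∀ m l, partialD m (partialD l φ) x = fderiv ℝ (fderiv ℝ φ) x (unitVec m) (unitVec l) := by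
        intro m l
        have hd : DifferentiableAt ℝ (fderiv ℝ φ) x :=
          ((hφ.fderiv_right (m := 1) (by norm_num)).differentiable (by norm_num)) x
        change fderiv ℝ (fun y => fderiv ℝ φ y (unitVec l)) x (unitVec m) = _
        rw [fderiv_clm_apply hd (differentiableAt_const _)]
        simp
      rw [h3, h3]; exact h2 _ _
    have e1 : ∀ i j, partialD j (fun y => τ i j y * partialD i φ y) x =
        partialD j (τ i j) x * partialD i φ x + τ i j x * partialD j (partialD i φ) x := fun i j =>
      partialD_mul j ((hτ0 i j).differentiable (by norm_num) x)
        ((hφ1 i).differentiable (by norm_num) x)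
    have e2 : ∀ i j, partialD i (fun y => partialD j (τ i j) y * φ y) x =
        partialD i (partialD j (τ i j)) x * φ x + partialD j (τ i j) x * partialD i φ x := fun i j =>
      partialD_mul i ((hτ1 j i j).differentiable (by norm_num) x)
        (hφ0.differentiable (by norm_num) x)
    simp only [e1, e2, sum_univ_two, hsym]
    ring
  have cA : Continuous fun x => ∑ i, ∑ j, τ i j x * partialD i (partialD j φ) x :=
    continuous_finsetSum _ fun i _ => continuous_finsetSum _ fun j _ => (cτ i j).mul (cφ2 i j)
  have cB : Continuous fun x => (∑ i, ∑ j, partialD i (partialD j (τ i j)) x) * φ x :=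
    (continuous_finsetSum _ fun i _ => continuous_finsetSum _ fun j _ => cτ2 i j i j).mul cφ
  rw [← integral_sub (cint cA) (cint cB), integral_congr_ae (Eventually.of_forall hpt)]
  have hc1 : ∀ i j, ContDiff ℝ 1 fun y => τ i j y * partialD i φ y := fun i j =>
    (hτ0 i j).mul (hφ1 i)
  have hc2 : ∀ i j, ContDiff ℝ 1 fun y => partialD j (τ i j) y * φ y := fun i j =>
    (hτ1 j i j).mul hφ0
  have i1 : ∀ i j, IntegrableOn (partialD j (fun y => τ i j y * partialD i φ y)) (hull K) :=
    fun i j => cint (continuous_partialD (hc1 i j) le_rfl j)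
  have i2 : ∀ i j, IntegrableOn (partialD i (fun y => partialD j (τ i j) y * φ y)) (hull K) :=
    fun i j => cint (continuous_partialD (hc2 i j) le_rfl i)
  have i3 : ∀ i j, IntegrableOn (fun x => partialD j (fun y => τ i j y * partialD i φ y) x -
      partialD i (fun y => partialD j (τ i j) y * φ y) x) (hull K) := fun i j => (i1 i j).sub (i2 i j)
  rw [integral_finsetSum _ fun i _ => integrable_finsetSum _ fun j _ => i3 i j]
  have step : ∀ i, ∫ x in hull K, ∑ j, (partialD j (fun y => τ i j y * partialD i φ y) x -
        partialD i (fun y => partialD j (τ i j) y * φ y) x) =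
      ∑ j, ((∫ x in hull K, partialD j (fun y => τ i j y * partialD i φ y) x) -
        ∫ x in hull K, partialD i (fun y => partialD j (τ i j) y * φ y) x) := by
    intro i
    rw [integral_finsetSum _ fun j _ => i3 i j]
    exact sum_congr rfl fun j _ => integral_sub (i1 i j) (i2 i j)
  simp only [step, h.green (hc1 _ _), h.green (hc2 _ _), ← mul_sub, ← mul_sum, ← sum_sub_distrib]
  congr 1
  rw [sum_congr rfl fun i _ => sum_comm, sum_comm]
  refine sum_congr rfl fun a' _ => ?_
  rw [sum_congr rfl fun i _ => sum_comm, sum_comm]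
  refine sum_congr rfl fun b' _ => ?_
  by_cases hab : a' = b'
  · subst hab; simp
  rw [← edge_byParts hab hτ hφ]
  simp only [← mul_sum]
  congr 1
  rw [← intervalIntegral.integral_const_mul]
  have ce := continuous_edgePt a' b'
  have j1 : ∀ i j, IntervalIntegrable (fun s => τ i j (edgePt a' b' s) * partialD i φ (edgePt a' b' s))
      volume 0 1 := fun i j => (((cτ i j).comp ce).mul ((cφ1 i).comp ce)).intervalIntegrable _ _
  have j2 : ∀ i j, IntervalIntegrable
      (fun s => partialD j (τ i j) (edgePt a' b' s) * φ (edgePt a' b' s)) volume 0 1 :=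
    fun i j => (((cτ1 j i j).comp ce).mul (cφ.comp ce)).intervalIntegrable _ _
  simp only [sum_univ_two, ← dist_mul_normal hab]
  simp only [← intervalIntegral.integral_const_mul]
  simp only [← intervalIntegral.integral_sub ((j1 _ _).const_mul _) ((j2 _ _).const_mul _)]
  simp only [← intervalIntegral.integral_add (((j1 _ _).const_mul _).sub ((j2 _ _).const_mul _))
    (((j1 _ _).const_mul _).sub ((j2 _ _).const_mul _))]
  rw [← intervalIntegral.integral_add]
  rotate_left
  · exact ((((j1 _ _).const_mul _).sub ((j2 _ _).const_mul _)).add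
      (((j1 _ _).const_mul _).sub ((j2 _ _).const_mul _)))
  · exact ((((j1 _ _).const_mul _).sub ((j2 _ _).const_mul _)).add
      (((j1 _ _).const_mul _).sub ((j2 _ _).const_mul _)))
  refine intervalIntegral.integral_congr fun s _ => ?_
  ring

variable {u w : Fin 2 → Poly} {U : Set Plane} {p p' : TensorPoly} {k n ℓ : ℕ}

/-! ### Univariate polynomials determined by moments -/

open Polynomial in
lemma polynomial_eq_zero_of_integral {w g : ℝ[X]} (hw : ∀ s ∈ Ioo (0 : ℝ) 1, 0 < w.eval s)
    (h : ∫ s in (0 : ℝ)..1, (w * g).eval s * g.eval s = 0) : g = 0 := by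
  have hc : Continuous fun s => (w * g).eval s * g.eval s := by fun_prop
  rw [integral_of_le zero_le_one, integral_Ioc_eq_integral_Ioo,
    setIntegral_eq_zero_iff_of_nonneg_ae] at h
  · have h2 := Measure.eqOn_open_of_ae_eq h isOpen_Ioo hc.continuousOn continuousOn_const
    refine Polynomial.eq_zero_of_infinite_isRoot _ ((Set.Ioo_infinite (zero_lt_one' ℝ)).mono
      fun s hs => ?_)
    have h3 := h2 hs
    have h4 := (hw s hs).ne'
    simpa [h4] using h3
  · filter_upwards [ae_restrict_mem measurableSet_Ioo] with s hs
    have := hw s hs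
    simp only [Polynomial.eval_mul, Pi.zero_apply]
    nlinarith [mul_self_nonneg (g.eval s)]
  · exact (hc.continuousOn.integrableOn_compact isCompact_Icc).mono_set Ioo_subset_Icc_self

open Polynomial in
lemma polynomial_eq_zero_of_moments {f : ℝ[X]} (hf : f ∈ degreeLT ℝ n)
    (h : ∀ q ∈ degreeLT ℝ n, ∫ s in (0 : ℝ)..1, f.eval s * q.eval s = 0) : f = 0 :=
  polynomial_eq_zero_of_integral (w := 1) (by simp) (by simpa using h f hf)

open Polynomial in
lemma exists_eq_mul_of_roots {f : ℝ[X]} (hf : f ∈ degreeLT ℝ (n + 2)) (h0 : f.eval 0 = 0)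
    (h1 : f.eval 1 = 0) : ∃ g ∈ degreeLT ℝ n, f = (X * (1 - X)) * g := by
  obtain ⟨f1, rfl⟩ := dvd_iff_isRoot.2 (show f.IsRoot 1 from h1)
  have h2 : f1.IsRoot 0 := by simpa using h0
  obtain ⟨f2, rfl⟩ := dvd_iff_isRoot.2 h2
  refine ⟨-f2, ?_, by simp; ring⟩
  by_cases hz : f2 = 0
  · simp [hz]
  rw [mem_degreeLT] at hf ⊢
  rw [degree_mul, degree_mul, degree_X_sub_C, degree_X_sub_C, degree_eq_natDegree hz] at hf
  rw [degree_neg, degree_eq_natDegree hz]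
  norm_cast at hf ⊢
  omega

open Polynomial in
lemma polynomial_eq_zero_of_moments_roots {f : ℝ[X]} (hf : f ∈ degreeLT ℝ (n + 2))
    (h0 : f.eval 0 = 0) (h1 : f.eval 1 = 0)
    (h : ∀ q ∈ degreeLT ℝ n, ∫ s in (0 : ℝ)..1, f.eval s * q.eval s = 0) : f = 0 := by
  obtain ⟨g, hg, rfl⟩ := exists_eq_mul_of_roots hf h0 h1
  have : g = 0 := polynomial_eq_zero_of_integral (w := X * (1 - X)) (fun s hs => by
    simp only [eval_mul, eval_X, eval_sub, eval_one]
    exact mul_pos hs.1 (by linarith [hs.2])) (h g hg)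
  simp [this]

open Polynomial in
lemma polynomial_eq_zero_of_moments_double_roots {f : ℝ[X]} (hf : f ∈ degreeLT ℝ (n + 4))
    (h0 : f.eval 0 = 0) (h1 : f.eval 1 = 0) (h0' : (derivative f).eval 0 = 0)
    (h1' : (derivative f).eval 1 = 0)
    (h : ∀ q ∈ degreeLT ℝ n, ∫ s in (0 : ℝ)..1, f.eval s * q.eval s = 0) : f = 0 := by
  obtain ⟨g, hg, rfl⟩ := exists_eq_mul_of_roots (n := n + 2) hf h0 h1
  obtain ⟨g, hg', rfl⟩ := exists_eq_mul_of_roots hg (by simpa using h0') (by simpa using h1')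
  have : g = 0 := polynomial_eq_zero_of_integral (w := (X * (1 - X)) * (X * (1 - X)))
    (fun s hs => by
      have : 0 < s * (1 - s) := mul_pos hs.1 (by linarith [hs.2])
      simp only [eval_mul, eval_X, eval_sub, eval_one]
      positivity) (by simpa [mul_assoc] using h g hg')
  simp [this]

/-! ### Polynomials that vanish on a triangle -/

lemma poly_eq_zero_of_isOpen (hU : IsOpen U) (hne : U.Nonempty) {p : Poly} (h : ∀ x ∈ U, ev p x = 0)
    : p = 0 := by
  obtain ⟨x, hx⟩ := hne
  refine ev_injective fun y => ?_
  have h1 : restr x y p = 0 := by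
    have h2 : ∀ᶠ s in 𝓝 (0 : ℝ), edgePt x y s ∈ U :=
      (continuous_edgePt x y).continuousAt.eventually_mem (hU.mem_nhds (by simpa))
    have h3 : {s : ℝ | edgePt x y s ∈ U}.Infinite := infinite_of_mem_nhds 0 h2
    exact Polynomial.eq_zero_of_infinite_isRoot _ (h3.mono fun s hs => by simpa using h _ hs)
  have := restr_eq_zero_iff.1 h1 1
  simpa using this

lemma eq_zero_of_integral_hull {f : Plane → ℝ} (hf : Continuous f) (h0 : ∀ x ∈ K°, 0 ≤ f x)
    (h : ∫ x in hull K, f x = 0) : ∀ x ∈ K°, f x = 0 := by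
  rw [← restrict_interior_hull, setIntegral_eq_zero_iff_of_nonneg_ae] at h
  · exact Measure.eqOn_open_of_ae_eq h isOpen_interior hf.continuousOn continuousOn_const
  · filter_upwards [ae_restrict_mem isOpen_interior.measurableSet] with x hx using h0 x hx
  · exact (hf.continuousOn.integrableOn_compact (isCompact_hull K)).mono_set interior_subset

namespace IsTriple

variable (h : IsTriple K a b c)

include h

lemma poly_eq_zero_of_interior {p : Poly} (hp : ∀ x ∈ K°, ev p x = 0) : p = 0 :=
  poly_eq_zero_of_isOpen isOpen_interior h.interior_nonempty hp

lemma poly_eq_zero_of_integral_sq {p : Poly} (hp : ∫ x in hull K, ev p x * ev p x = 0) : p = 0 :=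
  h.poly_eq_zero_of_interior fun x hx => by
    have := eq_zero_of_integral_hull ((continuous_ev p).mul (continuous_ev p))
      (fun x _ => mul_self_nonneg _) hp x hx
    simpa using this

lemma poly_ext_ae {p : Poly} (hpq : ev p =ᵐ[vol (hull K)] ev q) : p = q := by
  rw [← restrict_interior_hull] at hpq
  have := Measure.eqOn_open_of_ae_eq hpq isOpen_interior (continuous_ev p).continuousOn
    (continuous_ev q).continuousOn
  exact sub_eq_zero.1 (h.poly_eq_zero_of_interior fun x hx => by rw [ev_sub, this hx, sub_self])

lemma bubble_pos (hx : x ∈ K°) : 0 < ev (bubble a b c) x := by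
  obtain ⟨h1, h2, h3⟩ := h.mem_interior_iff.1 hx
  simp only [bubble, ev_mul, ev_baryPoly]
  simp only [bary] at h1 h2 h3
  positivity

lemma eq_zero_of_bubble_moments (hu : ∀ i, u i ∈ polyDeg (n + 3)) (h1 : ∀ i, restr a b (u i) = 0)
    (h2 : ∀ i, restr b c (u i) = 0) (h3 : ∀ i, restr c a (u i) = 0) (hm : ∀ w : Fin 2 → Poly, (∀ i,
    w i ∈ polyDeg n) → ∫ x in hull K, ∑ i, ev (u i) x * ev (w i) x = 0) : u = 0 := by
  choose w hw huw using fun i => exists_eq_bubble_mul h.det_ne (hu i) (h1 i) (h2 i) (h3 i)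
  have hc : Continuous fun x => ∑ i, ev (u i) x * ev (w i) x :=
    continuous_finsetSum _ fun i _ => (continuous_ev _).mul (continuous_ev _)
  have hpos : ∀ x ∈ K°, ∀ i, 0 ≤ ev (u i) x * ev (w i) x := by
    intro x hx i
    have := h.bubble_pos hx
    rw [huw i, ev_mul, mul_assoc]
    exact mul_nonneg this.le (mul_self_nonneg _)
  have hz := eq_zero_of_integral_hull hc (fun x hx => sum_nonneg fun i _ => hpos x hx i) (hm w hw)
  funext i
  have hwi : w i = 0 := h.poly_eq_zero_of_interior fun x hx => by
    have h4 := (sum_eq_zero_iff_of_nonneg fun i _ => hpos x hx i).1 (hz x hx) i (Finset.mem_univ i)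
    rw [huw i, ev_mul] at h4
    have := (h.bubble_pos hx).ne'
    simpa [this] using h4
  rw [huw i, hwi]; simp

end IsTriple

/-! ### Degrees of the traces -/

lemma mem_degreeLT_succ_of_natDegree {f : ℝ[X]} (h : f.natDegree ≤ n) : f ∈ degreeLT ℝ (n + 1) := by
  rw [mem_degreeLT]
  exact (Polynomial.degree_le_natDegree).trans_lt (by exact_mod_cast Nat.lt_succ_of_le h)

lemma restr_mem_degreeLT {p : Poly} (a b : Plane) (hp : p ∈ polyDeg m) :
    restr a b p ∈ degreeLT ℝ (m + 1) :=
  mem_degreeLT_succ_of_natDegree (natDegree_restr_le a b hp)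

lemma coord_mul_pderiv_mem (c : Plane) (i j : Fin 2) (hq : q ∈ polyDeg m) :
    coord c i * pderiv j q ∈ polyDeg m := by
  rcases m with _ | m
  · have : q.totalDegree = 0 := by have := mem_polyDeg.1 hq; omega
    rw [MvPolynomial.totalDegree_eq_zero_iff_eq_C.1 this]; simp
  · have := mul_mem_polyDeg (coord_mem_polyDeg c i) (pderiv_mem_polyDeg j hq)
    rwa [add_comm] at this

lemma symCurlPoly_mem (hv : ∀ i, v i ∈ polyDeg (m + 1)) (i j : Fin 2) :
    symCurlPoly v i j ∈ polyDeg m := by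
  have h : ∀ m' i', pderiv m' (v i') ∈ polyDeg m := fun m' i' =>
    pderiv_mem_polyDeg m' (hv i')
  have h2 : ∀ i j, curlOf (fun m i => pderiv m (v i)) i j ∈ polyDeg m := by
    intro i j
    fin_cases j
    · exact h 1 i
    · exact Submodule.neg_mem _ (h 0 i)
  exact smul_mem _ _ (add_mem (h2 i j) (h2 j i))

lemma nnPoly_mem (hk : 3 ≤ k) (hℓ : k ≤ ℓ + 1) (hp : p ∈ SigmaLocal ℓ k c) (hab : a ≠ b) :
    nnPoly a b p ∈ degreeLT ℝ (ℓ + 1) := by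
  obtain ⟨v, hv, q, hq, hpe⟩ := hp
  set r : ℝ := ∑ i, normal a b i * (a i - c i) with hr
  have e : nnPoly a b p = restr a b (∑ i, ∑ j, (normal a b i * normal a b j) • symCurlPoly v i j) +
      (r * r) • restr a b q := by
    refine Polynomial.funext fun s => ?_
    simp [nnPoly, hpe, sum_univ_two, edgePt_apply, hr, ← dist_mul_tangent hab]
    ring
  rw [e]
  refine add_mem (restr_mem_degreeLT a b ?_) (smul_mem _ _ ?_)
  · exact sum_mem fun i _ => sum_mem fun j _ =>
      smul_mem _ _ (symCurlPoly_mem hv i j)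
  · exact restr_mem_degreeLT a b (polyDeg_mono (by omega) hq)

lemma shearPoly_mem (hk : 3 ≤ k) (hℓ : k ≤ ℓ + 1) (hp : p ∈ SigmaLocal ℓ k c) (hab : a ≠ b) :
    shearPoly a b p ∈ degreeLT ℝ ℓ := by
  obtain ⟨ℓ, rfl⟩ : ∃ m, ℓ = m + 1 := ⟨ℓ - 1, by omega⟩
  obtain ⟨v, hv, q, hq, hpe⟩ := hp
  have hu := tangent_unit hab
  set r : ℝ := ∑ i, normal a b i * (a i - c i) with hr
  set q' : Poly := q + (∑ i, ∑ j, (tangent a b i * tangent a b j) •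
    (coord c i * pderiv j q)) + euler c 3 q with hq'
  set p' : Poly := (∑ m, ∑ i, ∑ j, (tangent a b m * tangent a b i * normal a b j) •
      pderiv m (symCurlPoly v i j)) +
    ∑ i, ∑ j, normal a b i • pderiv j (symCurlPoly v i j) with hp'
  have e : shearPoly a b p = restr a b p' + r • restr a b q' := by
    refine Polynomial.funext fun s => ?_
    simp [shearPoly, hpe, sum_univ_two, edgePt_apply, hr, ← dist_mul_tangent hab, hq', hp', euler]
    generalize tangent a b 0 = t₀ at *
    generalize tangent a b 1 = t₁ at *
    generalize ev q (edgePt a b s) = x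
    generalize ev (pderiv 0 q) (edgePt a b s) = x0
    generalize ev (pderiv 1 q) (edgePt a b s) = x1
    linear_combination (x * (t₁ * (a 0 - c 0) - t₀ * (a 1 - c 1))) * hu
  rw [e]
  refine add_mem (restr_mem_degreeLT a b ?_) (smul_mem _ _ (restr_mem_degreeLT a b ?_))
  · have h : ∀ m i j, pderiv m (symCurlPoly v i j) ∈ polyDeg ℓ := fun m i j =>
      pderiv_mem_polyDeg m (symCurlPoly_mem hv i j)
    exact add_mem (sum_mem fun m _ => sum_mem fun i _ =>
      sum_mem fun j _ => smul_mem _ _ (h m i j))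
      (sum_mem fun i _ => sum_mem fun j _ =>
        smul_mem _ _ (h j i j))
  · have hq : q ∈ polyDeg ℓ := polyDeg_mono (by omega) hq
    exact add_mem (add_mem hq (sum_mem fun i _ =>
      sum_mem fun j _ => smul_mem _ _ (coord_mul_pderiv_mem c i j hq)))
      (euler_mem_polyDeg c 3 hq)

lemma polyNN_eq_of_moments (hab : a ≠ b) (hp : nnPoly a b p ∈ degreeLT ℝ (n + 2))
    (hp' : nnPoly a b p' ∈ degreeLT ℝ (n + 2)) (ha : ∀ i j, ev (p i j) a = ev (p' i j) a)
    (hb : ∀ i j, ev (p i j) b = ev (p' i j) b) (h : ∀ q ∈ degreeLT ℝ n, edgeMoment a b (polyNN a b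
    p) q = edgeMoment a b (polyNN a b p') q) (s : ℝ) : polyNN a b p s = polyNN a b p' s := by
  have hd := (dist_pos.2 hab).ne'
  have : nnPoly a b p - nnPoly a b p' = 0 := by
    refine polynomial_eq_zero_of_moments_roots (sub_mem hp hp') ?_ ?_ fun q hq => ?_
    · rw [eval_sub, eval_nnPoly, eval_nnPoly]; simp [polyNN, ha]
    · rw [eval_sub, eval_nnPoly, eval_nnPoly]; simp [polyNN, hb]
    · have h1 := mul_left_cancel₀ hd (h q hq)
      simp only [← eval_nnPoly] at h1
      simp only [eval_sub, sub_mul]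
      rw [intervalIntegral.integral_sub (Continuous.intervalIntegrable (by fun_prop) _ _)
        (Continuous.intervalIntegrable (by fun_prop) _ _), h1, sub_self]
  rw [← eval_nnPoly, ← eval_nnPoly, sub_eq_zero.1 this]

lemma polyShear_eq_of_moments (hab : a ≠ b) (hp : shearPoly a b p ∈ degreeLT ℝ n)
    (hp' : shearPoly a b p' ∈ degreeLT ℝ n) (h : ∀ q ∈ degreeLT ℝ n, edgeMoment a b (polyShear a b
    p) q = edgeMoment a b (polyShear a b p') q) (s : ℝ) :
    polyShear a b p s = polyShear a b p' s := by
  have hd := (dist_pos.2 hab).ne'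
  have : shearPoly a b p - shearPoly a b p' = 0 := by
    refine polynomial_eq_zero_of_moments (sub_mem hp hp') fun q hq => ?_
    have h1 := mul_left_cancel₀ hd (h q hq)
    simp only [← eval_shearPoly] at h1
    simp only [eval_sub, sub_mul]
    rw [intervalIntegral.integral_sub (Continuous.intervalIntegrable (by fun_prop) _ _)
      (Continuous.intervalIntegrable (by fun_prop) _ _), h1, sub_self]
  rw [← eval_shearPoly, ← eval_shearPoly, sub_eq_zero.1 this]

/-! ### The interior moments -/

/-- The operator `w ↦ rot sym(x^⊥ ⊗ w)`. -/
def rotSymPerp (c : Plane) (w : Fin 2 → Poly) (i : Fin 2) : Poly :=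
  (1 / 2 : ℝ) • (coordPerp c i * (pderiv 0 (w 1) - pderiv 1 (w 0)) - euler c 3 (w i))

/-- The tensor `sym(x^⊥ ⊗ w)`. -/
def symPerp (c : Plane) (w : Fin 2 → Poly) (i j : Fin 2) : Poly :=
  (1 / 2 : ℝ) • (coordPerp c i * w j + coordPerp c j * w i)

lemma rotSymPerp_mem (c : Plane) (hw : ∀ i, w i ∈ polyDeg n) (i : Fin 2) :
    rotSymPerp c w i ∈ polyDeg n := by
  refine smul_mem _ _ (sub_mem ?_ (euler_mem_polyDeg c 3 (hw i)))
  rw [mul_sub]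
  have h : ∀ j l, coordPerp c i * pderiv j (w l) ∈ polyDeg n := by
    intro j l
    fin_cases i
    · exact coord_mul_pderiv_mem c 1 j (hw l)
    · have := Submodule.neg_mem _ (coord_mul_pderiv_mem c 0 j (hw l))
      rwa [← neg_mul] at this
  exact sub_mem (h 0 1) (h 1 0)

lemma rotSymPerp_injective (h : rotSymPerp c w = 0) : w = 0 := by
  have h0 := fun x => congrArg (fun p => ev p x) (congrFun h 0)
  have h1 := fun x => congrArg (fun p => ev p x) (congrFun h 1)
  simp [rotSymPerp, coordPerp, euler, sum_univ_two] at h0 h1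
  have hS : coord c 0 * w 0 + coord c 1 * w 1 = 0 := by
    refine euler_injective (c := c) (r := 2) (by norm_num) (ev_injective fun x => ?_)
    simp [euler, sum_univ_two]
    linear_combination -(x 0 - c 0) * h0 x - (x 1 - c 1) * h1 x
  have d0 := fun x => congrArg (fun p => ev (pderiv 0 p) x) hS
  have d1 := fun x => congrArg (fun p => ev (pderiv 1 p) x) hS
  simp at d0 d1
  funext i
  refine euler_injective (c := c) (r := 2) (by norm_num) (ev_injective fun x => ?_)
  fin_cases i
  · simp [euler, sum_univ_two]
    linear_combination (-1 / 2 : ℝ) * h0 x + (1 / 2 : ℝ) * d0 x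
  · simp [euler, sum_univ_two]
    linear_combination (-1 / 2 : ℝ) * h1 x + (1 / 2 : ℝ) * d1 x

lemma rotSymPerp_surjective (n : ℕ) (c : Plane) (hu : ∀ i, u i ∈ polyDeg n) :
    ∃ w : Fin 2 → Poly, (∀ i, w i ∈ polyDeg n) ∧ rotSymPerp c w = u := by
  let L : (Fin 2 → polyDeg n) →ₗ[ℝ] (Fin 2 → polyDeg n) :=
    { toFun := fun w i => ⟨rotSymPerp c (fun j => w j) i, rotSymPerp_mem c (fun j => (w j).2) i⟩
      map_add' := fun w w' => by
        ext1 i; refine Subtype.ext (ev_injective fun x => ?_)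
        simp [rotSymPerp, euler, sum_univ_two]; ring
      map_smul' := fun r w => by
        ext1 i; refine Subtype.ext (ev_injective fun x => ?_)
        simp [rotSymPerp, euler, sum_univ_two]; ring }
  have hinj : Function.Injective L := by
    rw [← LinearMap.ker_eq_bot, LinearMap.ker_eq_bot']
    intro w hw
    have h1 : rotSymPerp c (fun j => (w j : Poly)) = 0 := by
      ext1 i; exact congrArg Subtype.val (congrFun hw i)
    ext1 i; exact Subtype.ext (congrFun (rotSymPerp_injective h1) i)
  obtain ⟨w, hw⟩ := (LinearMap.injective_iff_surjective.1 hinj) fun i => ⟨u i, hu i⟩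
  exact ⟨fun i => w i, fun i => (w i).2, funext fun i => congrArg Subtype.val (congrFun hw i)⟩

/-- The second derivatives of a polynomial. -/
def hessPoly (q : Poly) (i j : Fin 2) : Poly := pderiv i (pderiv j q)

lemma hessPoly_mem_tests (c : Plane) (hq : q ∈ polyDeg (k - 2)) :
    hessPoly q ∈ InteriorTests ℓ k c :=
  ⟨q, hq, 0, by simp, by simp [hessPoly]⟩

lemma symPerp_mem_tests (c : Plane) (hw : ∀ i, w i ∈ polyDeg (ℓ - 2)) :
    symPerp c w ∈ InteriorTests ℓ k c :=
  ⟨0, by simp, w, hw, by simp [symPerp]⟩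

/-- Integration by parts for `sym curl u` if `u` vanishes on the edges. -/
lemma IsTriple.integral_symCurlPoly_symPerp (h : IsTriple K a b c) (c₀ : Plane)
    (hu : ∀ a ∈ K, ∀ b ∈ K, a ≠ b → ∀ i, restr a b (u i) = 0) (w : Fin 2 → Poly) :
    ∫ x in hull K, ∑ i, ∑ j, ev (symCurlPoly u i j) x * ev (symPerp c₀ w i j) x =
      ∫ x in hull K, ∑ i, ev (u i) x * ev (rotSymPerp c₀ w i) x := by
  have hgreen : ∀ m i (p : Poly), ∫ x in hull K, ev (pderiv m (u i * p)) x = 0 := by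
    intro m i p
    have h1 := h.green ((contDiff_ev (u i * p)).of_le (by simp)) m
    rw [partialD_ev] at h1
    rw [h1, sum_eq_zero, mul_zero]
    intro a' ha'
    refine sum_eq_zero fun b' hb' => ?_
    by_cases hab : a' = b'
    · subst hab; simp
    have := restr_eq_zero_iff.1 (hu a' ha' b' hb' hab i)
    simp [this]
  have cint : ∀ p : Poly, IntegrableOn (ev p) (hull K) := fun p =>
    (continuous_ev p).continuousOn.integrableOn_compact (isCompact_hull K)
  set P : Poly := ∑ i, ∑ j, symCurlPoly u i j * symPerp c₀ w i j with hP
  set Q : Poly := ∑ i, u i * rotSymPerp c₀ w i with hQ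
  have e : P = Q + (pderiv 1 (u 0 * symPerp c₀ w 0 0) + pderiv 1 (u 1 * symPerp c₀ w 1 0) -
      pderiv 0 (u 0 * symPerp c₀ w 0 1) -
      pderiv 0 (u 1 * symPerp c₀ w 1 1)) := by
    refine ev_injective fun x => ?_
    simp [hP, hQ, symCurlPoly, symCurlOf, curlOf, symPerp, rotSymPerp, euler, coordPerp,
      sum_univ_two]
    ring
  have e1 : ∀ x, ∑ i, ∑ j, ev (symCurlPoly u i j) x * ev (symPerp c₀ w i j) x = ev P x := by
    intro x; simp [hP]
  have e2 : ∀ x, ∑ i, ev (u i) x * ev (rotSymPerp c₀ w i) x = ev Q x := by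
    intro x; simp [hQ]
  simp only [e1, e2]
  have hadd : ∀ p q : Poly, ∫ x in hull K, ev (p + q) x =
      (∫ x in hull K, ev p x) + ∫ x in hull K, ev q x := fun p q => by
    simp only [ev_add]; exact integral_add (cint p) (cint q)
  have hsub : ∀ p q : Poly, ∫ x in hull K, ev (p - q) x =
      (∫ x in hull K, ev p x) - ∫ x in hull K, ev q x := fun p q => by
    simp only [ev_sub]; exact integral_sub (cint p) (cint q)
  rw [e, hadd, hsub, hsub, hadd, hgreen, hgreen, hgreen, hgreen]
  simp

/-! ### Unisolvence of the tensor element -/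

lemma contDiff_two_ev (p : Poly) : ContDiff ℝ 2 (ev p) := (contDiff_ev p).of_le (by
    have h : ((2 : ℕ) : WithTop ℕ∞) ≤ ((⊤ : ℕ∞) : WithTop ℕ∞) := WithTop.coe_le_coe.2 le_top
    exact h)

/-- The polynomial `div div p`. -/
def divDivPoly (p : TensorPoly) : Poly :=
  ∑ i, ∑ j, pderiv i (pderiv j (p i j))

lemma divDivPoly_symCurlPoly (v : Fin 2 → Poly) : divDivPoly (symCurlPoly v) = 0 := by
  refine ev_injective fun x => ?_
  simp [divDivPoly, symCurlPoly, symCurlOf, curlOf, sum_univ_two, pderiv_comm 1 0]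
  ring

lemma divDivPoly_eq (hp : ∀ i j, p i j = symCurlPoly v i j + coord c i * coord c j * q) :
    divDivPoly p = euler c 2 (euler c 3 q) := by
  rw [← divDiv_coord_mul]
  have := divDivPoly_symCurlPoly v
  simp only [divDivPoly] at this ⊢
  simp only [hp, map_add, sum_add_distrib, this, zero_add]

lemma divDivPoly_mem (hp : p ∈ SigmaLocal ℓ k c) : divDivPoly p ∈ polyDeg (k - 2) := by
  obtain ⟨v, hv, q, hq, hpe⟩ := hp
  rw [divDivPoly_eq hpe]
  exact euler_mem_polyDeg c 2 (euler_mem_polyDeg c 3 hq)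

lemma exists_symCurlPoly_of_divDivPoly_eq_zero (hp : p ∈ SigmaLocal ℓ k c) (h : divDivPoly p = 0) :
    ∃ v : Fin 2 → Poly, (∀ i, v i ∈ polyDeg (ℓ + 1)) ∧ p = symCurlPoly v := by
  obtain ⟨v, hv, q, hq, hpe⟩ := hp
  rw [divDivPoly_eq hpe] at h
  have hq0 : q = 0 := euler_injective (by norm_num) (euler_injective (by norm_num) h)
  exact ⟨v, hv, funext fun i => funext fun j => by rw [hpe, hq0]; simp⟩

lemma symCurlPoly_mem_sigmaLocal (c : Plane) (hv : ∀ i, v i ∈ polyDeg (ℓ + 1)) :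
    symCurlPoly v ∈ SigmaLocal ℓ k c :=
  ⟨v, hv, 0, by simp, by simp⟩

lemma edgeTerm_ev (a b : Plane) (p : TensorPoly) (φ : ScalarField) :
    edgeTerm a b (fun i j => ev (p i j)) φ = dist a b * (∫ s in (0 : ℝ)..1, (polyNN a b p s *
        ∑ i, normal a b i * partialD i φ (edgePt a b s) -
        polyShear a b p s * φ (edgePt a b s))) +
      ((∑ i, ∑ j, tangent a b i * ev (p i j) b * normal a b j) * φ b -
        (∑ i, ∑ j, tangent a b i * ev (p i j) a * normal a b j) * φ a) := by
  simp [edgeTerm, polyNN, polyShear]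

lemma IsTriple.green_divDivPoly (h : IsTriple K a b c) (p : TensorPoly) (hφ : ContDiff ℝ 2 φ) :
    (∫ x in hull K, ∑ i, ∑ j, ev (p i j) x * partialD i (partialD j φ) x) -
      ∫ x in hull K, ev (divDivPoly p) x * φ x =
    1 / 2 * ∑ a ∈ K, ∑ b ∈ K, orient K a b * edgeTerm a b (fun i j => ev (p i j)) φ := by
  rw [← h.green_divDiv (fun i j => contDiff_two_ev _) hφ]
  simp [divDivPoly]

/-- A tensor with vanishing boundary degrees of freedom and vanishing moments is zero. -/
lemma IsTriple.sigma_unisolvent (h : IsTriple K a b c) (c₀ : Plane) (hk : 3 ≤ k) (hℓ : k ≤ ℓ + 1)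
    (hp : p ∈ SigmaLocal ℓ k c₀) (hvert : ∀ δ ∈ K, ∀ i j, ev (p i j) δ = 0)
    (hnn : ∀ a ∈ K, ∀ b ∈ K, a ≠ b → ∀ s, polyNN a b p s = 0)
    (hsh : ∀ a ∈ K, ∀ b ∈ K, a ≠ b → ∀ s, polyShear a b p s = 0) (hint : ∀ ς ∈ InteriorTests ℓ k c₀,
    ∫ x in hull K, ∑ i, ∑ j, ev (p i j) x * ev (ς i j) x = 0) : p = 0 := by
  have hdd : divDivPoly p = 0 := by
    set d := divDivPoly p with hd
    have h1 := h.green_divDivPoly p (contDiff_two_ev d)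
    have h2 := hint _ (hessPoly_mem_tests c₀ (divDivPoly_mem hp))
    simp only [partialD_ev] at h1
    simp only [hessPoly, ← hd] at h2
    rw [h2, sum_eq_zero] at h1
    · exact h.poly_eq_zero_of_integral_sq (by linarith)
    · intro a' ha'
      refine sum_eq_zero fun b' hb' => ?_
      by_cases hab : a' = b'
      · subst hab; simp
      rw [edgeTerm_ev]
      simp [hnn a' ha' b' hb' hab, hsh a' ha' b' hb' hab, hvert a' ha', hvert b' hb']
  obtain ⟨v, hv, rfl⟩ := exists_symCurlPoly_of_divDivPoly_eq_zero hp hdd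
  have hr : ∀ a' ∈ K, ∀ b' ∈ K, a' ≠ b' → rtJet v a' = rtJet v b' ∧ ∀ i s,
      ev (v i) (edgePt a' b' s) = (rtJet v a').1 i + (rtJet v a').2 * edgePt a' b' s i :=
    fun a' ha' b' hb' hab => edge_rigid hab (hnn a' ha' b' hb' hab) (hsh a' ha' b' hb' hab)
      (hvert a' ha') (hvert b' hb')
  set g := rtJet v a with hg
  have hga : ∀ a' ∈ K, rtJet v a' = g := by
    intro a' ha'
    by_cases hab : a' = a
    · rw [hab]
    · exact (hr a' ha' a h.mem_fst hab).1
  have hu : ∀ a' ∈ K, ∀ b' ∈ K, a' ≠ b' → ∀ i, restr a' b' ((v - rtPoly g) i) = 0 := by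
    intro a' ha' b' hb' hab i
    rw [restr_eq_zero_iff]
    intro s
    rw [Pi.sub_apply, ev_sub, (hr a' ha' b' hb' hab).2, ev_rtPoly, hga a' ha', sub_self]
  obtain ⟨n, rfl⟩ : ∃ n, ℓ = n + 2 := ⟨ℓ - 2, by omega⟩
  have hv0 : v - rtPoly g = 0 := by
    refine h.eq_zero_of_bubble_moments (n := n) (fun i => sub_mem (hv i) (rtPoly_mem_polyDeg g i _))
      (hu a h.mem_fst b h.mem_snd h.ne_fst_snd) (hu b h.mem_snd c h.mem_trd h.ne_snd_trd)
      (hu c h.mem_trd a h.mem_fst h.ne_fst_trd.symm) fun w hw => ?_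
    obtain ⟨w', hw', rfl⟩ := rotSymPerp_surjective n c₀ hw
    rw [← h.integral_symCurlPoly_symPerp c₀ hu w', symCurlPoly_sub, symCurlPoly_rtPoly, sub_zero]
    exact hint _ (symPerp_mem_tests c₀ hw')
  rw [sub_eq_zero.1 hv0, symCurlPoly_rtPoly]

/-- A polynomial with vanishing Hermite degrees of freedom on an edge vanishes there. -/
lemma hermite_edge (hab : a ≠ b) {p : Poly} (hp : p ∈ polyDeg (n + 3)) (ha : ev p a = 0)
    (hb : ev p b = 0) (ha' : ∀ m, ev (pderiv m p) a = 0) (hb' : ∀ m, ev (pderiv m p) b = 0)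
    (h : ∀ q ∈ degreeLT ℝ n, edgeMoment a b (fun s => ev p (edgePt a b s)) q = 0) :
    restr a b p = 0 := by
  have hd := (dist_pos.2 hab).ne'
  refine polynomial_eq_zero_of_moments_double_roots (n := n) (restr_mem_degreeLT a b hp)
    (by simpa) (by simpa) ?_ ?_ fun q hq => ?_
  · rw [derivative_restr]; simp [ha']
  · rw [derivative_restr]; simp [hb']
  · have := h q hq
    simp only [edgeMoment, mul_eq_zero, hd, false_or] at this
    simpa using this

/-! ### Existence for the local elements -/

/-- The bilinear form `∫₀¹ f q`. -/
def lineForm : ℝ[X] →ₗ[ℝ] ℝ[X] →ₗ[ℝ] ℝ :=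
  LinearMap.mk₂ ℝ (fun f q => ∫ s in (0 : ℝ)..1, f.eval s * q.eval s) (fun f g q => by
      simp only [Polynomial.eval_add, add_mul]
      exact intervalIntegral.integral_add ((f.continuous.mul q.continuous).intervalIntegrable _ _)
        ((g.continuous.mul q.continuous).intervalIntegrable _ _))
    (fun r f q => by
      simp only [eval_smul, smul_eq_mul, mul_assoc]
      exact intervalIntegral.integral_const_mul _ _)
    (fun f g q => by
      simp only [Polynomial.eval_add, mul_add]
      exact intervalIntegral.integral_add ((f.continuous.mul g.continuous).intervalIntegrable _ _)
        ((f.continuous.mul q.continuous).intervalIntegrable _ _))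
    (fun r f q => by
      simp only [eval_smul, smul_eq_mul, mul_left_comm _ r]
      exact intervalIntegral.integral_const_mul _ _)

/-- The bilinear form `∫_K p q`. -/
def cellForm (K : Finset Plane) : Poly →ₗ[ℝ] Poly →ₗ[ℝ] ℝ :=
  have hi (p q : Poly) : Integrable (fun x => ev p x * ev q x) (vol (hull K)) :=
    ((continuous_ev p).mul (continuous_ev q)).continuousOn.integrableOn_compact (isCompact_hull K)
  LinearMap.mk₂ ℝ (fun p q => ∫ x in hull K, ev p x * ev q x) (fun f g q => by
      simp only [ev_add, add_mul]
      exact integral_add (hi f q) (hi g q))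
    (fun r f q => by
      simp only [ev_smul, mul_assoc]
      exact integral_const_mul _ _)
    (fun f g q => by
      simp only [ev_add, mul_add]
      exact integral_add (hi f g) (hi f q))
    (fun r f q => by
      simp only [ev_smul, mul_left_comm _ r]
      exact integral_const_mul _ _)

@[simp] lemma cellForm_apply (K : Finset Plane) (p q : Poly) :
    cellForm K p q = ∫ x in hull K, ev p x * ev q x := rfl

lemma integrable_ev_mul (K : Finset Plane) (p q : Poly) :
    Integrable (fun x => ev p x * ev q x) (vol (hull K)) :=
  ((continuous_ev p).mul (continuous_ev q)).continuousOn.integrableOn_compact (isCompact_hull K)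

/-- The bilinear form `∫_K p : ς`. -/
def tensorForm (K : Finset Plane) :
    TensorPoly →ₗ[ℝ] TensorPoly →ₗ[ℝ] ℝ :=
  LinearMap.mk₂ ℝ (fun p ς => ∑ i, ∑ j, cellForm K (p i j) (ς i j))
    (fun f g q => by simp only [Pi.add_apply, map_add, LinearMap.add_apply, sum_add_distrib])
    (fun r f q => by simp only [Pi.smul_apply, map_smul, LinearMap.smul_apply, smul_sum])
    (fun f g q => by simp only [Pi.add_apply, map_add, sum_add_distrib])
    (fun r f q => by simp only [Pi.smul_apply, map_smul, smul_sum])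

lemma tensorForm_apply (K : Finset Plane) (p ς : TensorPoly) :
    tensorForm K p ς = ∫ x in hull K, ∑ i, ∑ j, ev (p i j) x * ev (ς i j) x := by
  rw [integral_finsetSum _ fun i _ => integrable_finsetSum _ fun j _ => integrable_ev_mul K _ _]
  simp only [integral_finsetSum _ fun j _ => integrable_ev_mul K _ _]
  rfl

/-- `nnPoly` as a linear map. -/
def nnLin (a b : Plane) : TensorPoly →ₗ[ℝ] ℝ[X] where
  toFun := nnPoly a b
  map_add' p q := by simp [nnPoly, sum_add_distrib]
  map_smul' r p := by
    simp only [nnPoly, Pi.smul_apply, RingHom.id_apply, ← map_smul, smul_sum]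
    simp only [smul_comm r]

/-- `shearPoly` as a linear map. -/
def shearLin (a b : Plane) : TensorPoly →ₗ[ℝ] ℝ[X] where
  toFun := shearPoly a b
  map_add' p q := by
    simp only [shearPoly, Pi.add_apply, map_add, smul_add, sum_add_distrib]
    ring
  map_smul' r p := by
    simp only [shearPoly, Pi.smul_apply, pderiv_smul, RingHom.id_apply, ← map_smul, smul_add,
      smul_sum]
    simp only [smul_comm r]

/-- `hessPoly` as a linear map. -/
def hessLin : Poly →ₗ[ℝ] TensorPoly where
  toFun := hessPoly
  map_add' p q := by ext1 i; ext1 j; simp [hessPoly]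
  map_smul' r p := by ext1 i; ext1 j; simp [hessPoly]

/-- `symPerp` as a linear map. -/
def symPerpLin (c : Plane) : (Fin 2 → Poly) →ₗ[ℝ] TensorPoly where
  toFun := symPerp c
  map_add' p q := by ext1 i; ext1 j; simp only [symPerp, Pi.add_apply, ← smul_add]; congr 1; ring
  map_smul' r p := by
    ext1 i; ext1 j
    simp only [symPerp, Pi.smul_apply, RingHom.id_apply, smul_comm r, ← smul_add, mul_smul_comm]

/-- `sym curl` as a linear map. -/
def symCurlLin : (Fin 2 → Poly) →ₗ[ℝ] TensorPoly where
  toFun := symCurlPoly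
  map_add' := symCurlPoly_add
  map_smul' r v := by
    ext1 i; ext1 j
    refine ev_injective fun x => ?_
    fin_cases i <;> fin_cases j <;> simp [symCurlPoly, symCurlOf, curlOf] <;> ring

/-- The shape functions of the tensor element as a linear image. -/
def shapeLin (c : Plane) : (Fin 2 → Poly) × Poly →ₗ[ℝ] TensorPoly :=
  symCurlLin.coprod
    { toFun := fun q i j => coord c i * coord c j * q
      map_add' := fun p q => by ext1 i; ext1 j; simp [mul_add]
      map_smul' := fun r p => by ext1 i; ext1 j; simp }

lemma shapeLin_apply (c : Plane) (v : Fin 2 → Poly) (q : Poly) (i j : Fin 2) :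
    shapeLin c (v, q) i j = symCurlPoly v i j + coord c i * coord c j * q := rfl

lemma edgeMoment_polyNN (a b : Plane) (p : TensorPoly) (q : ℝ[X]) :
    edgeMoment a b (polyNN a b p) q = dist a b * lineForm (nnLin a b p) q := by
  simp only [edgeMoment, ← eval_nnPoly]; rfl

lemma edgeMoment_polyShear (a b : Plane) (p : TensorPoly) (q : ℝ[X]) :
    edgeMoment a b (polyShear a b p) q = dist a b * lineForm (shearLin a b p) q := by
  simp only [edgeMoment, ← eval_shearPoly]; rfl

lemma edgeMoment_swap (a b : Plane) (f : ℝ → ℝ) (q : ℝ[X]) :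
    edgeMoment b a (fun s => f (1 - s)) q = edgeMoment a b f (q.comp (1 - X)) := by
  simp only [edgeMoment, dist_comm b a, Polynomial.eval_comp, eval_sub,
    Polynomial.eval_one, Polynomial.eval_X]
  congr 1
  have := integral_comp_sub_left (a := 0) (b := 1) (fun s => f s * q.eval (1 - s)) 1
  simpa using this

lemma comp_one_sub_mem {q : ℝ[X]} (hq : q ∈ degreeLT ℝ n) : q.comp (1 - X) ∈ degreeLT ℝ n := by
  by_cases h0 : q = 0
  · simp [h0]
  rw [mem_degreeLT, ← Polynomial.natDegree_lt_iff_degree_lt h0] at hq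
  obtain ⟨m, rfl⟩ : ∃ m, n = m + 1 := ⟨n - 1, by omega⟩
  refine mem_degreeLT_succ_of_natDegree (Polynomial.natDegree_comp_le.trans ?_)
  have h1 : (1 - X : ℝ[X]).natDegree ≤ 1 := by simpa using Polynomial.natDegree_sub_le (1 : ℝ[X]) X
  nlinarith

/-- The pairing of jets that is used to fix the kernel of `sym curl`. -/
def jetForm : (Fin 2 → Poly) →ₗ[ℝ] Poly →ₗ[ℝ] ℝ :=
  LinearMap.mk₂ ℝ (fun v q => (rtJet v 0).1 0 * ev q 0 + ((rtJet v 0).1 1 * ev (pderiv 0 q) 0 +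
        (rtJet v 0).2 * ev (pderiv 1 q) 0))
    (fun f g q => by simp [rtJet]; ring)
    (fun r f q => by simp [rtJet]; ring)
    (fun f g q => by simp; ring)
    (fun r f q => by simp; ring)

lemma eq_zero_of_jetForm (h : ∀ q ∈ polyDeg 1, jetForm v q = 0) : rtJet v 0 = 0 := by
  have h0 := h 1 (one_mem_polyDeg 1)
  have h1 := h (MvPolynomial.X 0) (X_mem_polyDeg 0)
  have h2 := h (MvPolynomial.X 1) (X_mem_polyDeg 1)
  simp only [jetForm, LinearMap.mk₂_apply] at h0 h1 h2
  simp [MvPolynomial.pderiv_X] at h0 h1 h2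
  ext i
  · fin_cases i
    · simpa using h0
    · simpa using h1
  · simpa using h2

lemma IsTriple.forall_edge (h : IsTriple K a b c) {P : Plane → Plane → Prop}
    (hP : ∀ x y, P x y → P y x) (h1 : P a b) (h2 : P b c) (h3 : P c a) :
    ∀ x ∈ K, ∀ y ∈ K, x ≠ y → P x y := by
  intro x hx y hy hxy
  rcases h.mem_iff.1 hx with rfl | rfl | rfl <;> rcases h.mem_iff.1 hy with rfl | rfl | rfl <;>
    first | exact absurd rfl hxy | assumption | exact hP _ _ (by assumption)

lemma hessPoly_eq_zero {q : Poly} (hq : q ∈ polyDeg 1) : hessPoly q = 0 := by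
  ext1 i; ext1 j
  have h1 := mem_polyDeg.1 (pderiv_mem_polyDeg (m := 0) j hq)
  rw [Nat.le_zero, MvPolynomial.totalDegree_eq_zero_iff_eq_C] at h1
  rw [hessPoly, h1, MvPolynomial.pderiv_C]; rfl

lemma sigmaLocal_symm (hp : p ∈ SigmaLocal ℓ k c) (i j : Fin 2) : p i j = p j i := by
  obtain ⟨v, -, q, -, h⟩ := hp
  rw [h, h, symCurlPoly, symCurlOf, symCurlOf, add_comm (curlOf _ i j), mul_comm (coord c i)]

lemma sigmaLocal_polyNN_eq (hk : 3 ≤ k) (hℓ : k ≤ ℓ + 1) {c' : Plane} {p' : TensorPoly}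
    (hp : p ∈ SigmaLocal ℓ k c) (hp' : p' ∈ SigmaLocal ℓ k c') (hab : a ≠ b)
    (ha : ∀ i j, ev (p i j) a = ev (p' i j) a) (hb : ∀ i j, ev (p i j) b = ev (p' i j) b) (h : ∀ q ∈
    degreeLT ℝ (ℓ - 1), edgeMoment a b (polyNN a b p) q = edgeMoment a b (polyNN a b p') q) (s : ℝ)
    :
    polyNN a b p s = polyNN a b p' s := by
  have h1 := nnPoly_mem hk hℓ hp hab
  have h2 := nnPoly_mem hk hℓ hp' hab
  rw [show ℓ + 1 = ℓ - 1 + 2 by omega] at h1 h2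
  exact polyNN_eq_of_moments hab h1 h2 ha hb h s

lemma finrank_degreeLT (n : ℕ) : Module.finrank ℝ (degreeLT ℝ n) = n := by
  rw [(Polynomial.degreeLTEquiv ℝ n).finrank_eq]; simp

lemma exists_eq_of_mem {E : Type*} [AddCommGroup E] [Module ℝ E] {S : Submodule ℝ E}
    {F : Module.Dual ℝ S} {G : E →ₗ[ℝ] ℝ} (h : F = G ∘ₗ S.subtype) {x : E} (hx : x ∈ S) :
    F ⟨x, hx⟩ = G x := by rw [h]; rfl

open Module in
/-- The tensor element has a shape function with given degrees of freedom. -/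
lemma IsTriple.exists_sigma (h : IsTriple K a b c) (c₀ : Plane) (hk : 3 ≤ k) (hℓ : k ≤ ℓ + 1)
    (T : Plane → Fin 2 → Fin 2 → ℝ) (hT : ∀ δ i j, T δ i j = T δ j i)
    (N S : Plane → Plane → ℝ[X] →ₗ[ℝ] ℝ) (hN : ∀ a b q, N b a q = N a b (q.comp (1 - X)))
    (hS : ∀ a b q, S b a q = -S a b (q.comp (1 - X))) (Q : Poly →ₗ[ℝ] ℝ)
    (hQ : ∀ q ∈ polyDeg 1, Q q = 0) (W : (Fin 2 → Poly) →ₗ[ℝ] ℝ) :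
    ∃ p ∈ SigmaLocal ℓ k c₀, (∀ δ ∈ K, ∀ i j, ev (p i j) δ = T δ i j) ∧ (∀ x ∈ K, ∀ y ∈ K, x ≠ y →
        (∀ q ∈ degreeLT ℝ (ℓ - 1), edgeMoment x y (polyNN x y p) q = N x y q) ∧
        ∀ q ∈ degreeLT ℝ ℓ, edgeMoment x y (polyShear x y p) q = S x y q) ∧
      (∀ q ∈ polyDeg (k - 2), tensorForm K p (hessPoly q) = Q q) ∧
      ∀ w : Fin 2 → Poly, (∀ i, w i ∈ polyDeg (ℓ - 2)) → tensorForm K p (symPerp c₀ w) = W w := by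
  let ι : ((Fin 2 → polyDeg (ℓ + 1)) × polyDeg (k - 2)) →ₗ[ℝ] (Fin 2 → Poly) × Poly :=
    ((polyDeg (ℓ + 1)).subtype.compLeft (Fin 2)).prodMap (polyDeg (k - 2)).subtype
  let P := shapeLin c₀ ∘ₗ ι
  have hPmem : ∀ x, P x ∈ SigmaLocal ℓ k c₀ := fun x =>
    ⟨fun i => x.1 i, fun i => (x.1 i).2, x.2, x.2.2, fun i j => shapeLin_apply ..⟩
  let V : Fin 3 → Plane := ![a, b, c]
  let V' : Fin 3 → Plane := ![b, c, a]
  let I : Fin 3 → Fin 2 := ![0, 0, 1]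
  let J : Fin 3 → Fin 2 := ![0, 1, 1]
  let F1 : _ →ₗ[ℝ] (Fin 3 → Fin 3 → ℝ) :=
    { toFun := fun x n m => ev (P x (I m) (J m)) (V n)
      map_add' := fun x y => by ext n m; simp
      map_smul' := fun r x => by ext n m; simp }
  let F2 : _ →ₗ[ℝ] (Fin 3 → Dual ℝ (degreeLT ℝ (ℓ - 1))) :=
    LinearMap.pi fun n => dist (V n) (V' n) • (lineForm ∘ₗ nnLin (V n) (V' n) ∘ₗ P).compl₂
      (degreeLT ℝ (ℓ - 1)).subtype
  let F3 : _ →ₗ[ℝ] (Fin 3 → Dual ℝ (degreeLT ℝ ℓ)) :=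
    LinearMap.pi fun n => dist (V n) (V' n) • (lineForm ∘ₗ shearLin (V n) (V' n) ∘ₗ P).compl₂
      (degreeLT ℝ ℓ).subtype
  let F4 : _ →ₗ[ℝ] Dual ℝ (polyDeg (k - 2)) :=
    ((tensorForm K ∘ₗ P).compl₂ hessLin + jetForm ∘ₗ LinearMap.fst ℝ _ _ ∘ₗ ι).compl₂
      (polyDeg (k - 2)).subtype
  let F5 : _ →ₗ[ℝ] Dual ℝ (Fin 2 → polyDeg (ℓ - 2)) :=
    ((tensorForm K ∘ₗ P).compl₂ (symPerpLin c₀)).compl₂ ((polyDeg (ℓ - 2)).subtype.compLeft (Fin 2))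
  let Φ := F1.prod (F2.prod (F3.prod (F4.prod F5)))
  have hess0 : ∀ (p : TensorPoly), ∀ q ∈ polyDeg 1, tensorForm K p (hessPoly q) = 0 := by
    intro p q hq
    rw [hessPoly_eq_zero hq, map_zero]
  have dof : ∀ (T : Plane → Fin 2 → Fin 2 → ℝ), (∀ δ i j, T δ i j = T δ j i) →
      ∀ N S : Plane → Plane → ℝ[X] →ₗ[ℝ] ℝ,
      (∀ a b q, N b a q = N a b (q.comp (1 - X))) →
      (∀ a b q, S b a q = -S a b (q.comp (1 - X))) →
      ∀ x, (∀ n m, F1 x n m = T (V n) (I m) (J m)) →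
      (∀ n, F2 x n = N (V n) (V' n) ∘ₗ (degreeLT ℝ (ℓ - 1)).subtype) →
      (∀ n, F3 x n = S (V n) (V' n) ∘ₗ (degreeLT ℝ ℓ).subtype) →
      (∀ δ ∈ K, ∀ i j, ev (P x i j) δ = T δ i j) ∧
      (∀ x' ∈ K, ∀ y ∈ K, x' ≠ y →
        (∀ q ∈ degreeLT ℝ (ℓ - 1), edgeMoment x' y (polyNN x' y (P x)) q = N x' y q) ∧
        ∀ q ∈ degreeLT ℝ ℓ, edgeMoment x' y (polyShear x' y (P x)) q = S x' y q) := by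
    clear hT hN hS
    intro T hT N S hN hS x h1 h2 h3
    refine ⟨fun δ hδ => ?_, h.forall_edge ?_ ?_ ?_ ?_⟩
    · obtain ⟨n, rfl⟩ : ∃ n, δ = V n := by
        rcases h.mem_iff.1 hδ with rfl | rfl | rfl
        exacts [⟨0, rfl⟩, ⟨1, rfl⟩, ⟨2, rfl⟩]
      intro i j
      fin_cases i <;> fin_cases j
      · exact h1 n 0
      · exact h1 n 1
      · change ev (P x 1 0) (V n) = T (V n) 1 0
        rw [sigmaLocal_symm (hPmem x), hT]
        exact h1 n 1
      · exact h1 n 2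
    · rintro x' y' ⟨g1, g2⟩
      refine ⟨fun q hq => ?_, fun q hq => ?_⟩
      · rw [funext (polyNN_swap x' y' (P x)), edgeMoment_swap, hN, g1 _ (comp_one_sub_mem hq)]
      · rw [funext (polyShear_swap x' y' (P x)),
          edgeMoment_swap _ _ (fun s => -polyShear x' y' (P x) s), hS,
          ← g2 _ (comp_one_sub_mem hq)]
        simp [edgeMoment]
    all_goals
      refine ⟨fun q hq => ?_, fun q hq => ?_⟩
      · rw [edgeMoment_polyNN]
        first
        | exact exists_eq_of_mem (h2 0) hq
        | exact exists_eq_of_mem (h2 1) hq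
        | exact exists_eq_of_mem (h2 2) hq
      · rw [edgeMoment_polyShear]
        first
        | exact exists_eq_of_mem (h3 0) hq
        | exact exists_eq_of_mem (h3 1) hq
        | exact exists_eq_of_mem (h3 2) hq
  have F4_apply : ∀ x q, F4 x q = tensorForm K (P x) (hessPoly q) + jetForm (fun i => x.1 i) q :=
    fun x q => rfl
  have jet0 : ∀ x, (∀ q : polyDeg (k - 2), q.1 ∈ polyDeg 1 → F4 x q = 0) →
      rtJet (fun i => (x.1 i : Poly)) 0 = 0 := by
    intro x hx
    refine eq_zero_of_jetForm fun q hq => ?_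
    have := hx ⟨q, polyDeg_mono (by omega) hq⟩ hq
    rwa [F4_apply, hess0 _ _ hq, zero_add] at this
  have jet0' : ∀ v, rtJet v 0 = 0 → ∀ q, jetForm v q = 0 := by
    intro v hv q
    simp [jetForm, hv]
  have hinj : Function.Injective Φ := by
    rw [injective_iff_map_eq_zero]
    intro x hx
    have f1 : F1 x = 0 := congrArg Prod.fst hx
    have f2 : F2 x = 0 := congrArg (fun z => z.2.1) hx
    have f3 : F3 x = 0 := congrArg (fun z => z.2.2.1) hx
    have f4 : F4 x = 0 := congrArg (fun z => z.2.2.2.1) hx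
    have f5 : F5 x = 0 := congrArg (fun z => z.2.2.2.2) hx
    have hj := jet0 x (fun q _ => by rw [f4]; rfl)
    obtain ⟨d1, d2⟩ := dof 0 (by simp) 0 0 (by simp) (by simp) x (by simp [f1]) (by simp [f2])
      (by simp [f3])
    have hP0 : P x = 0 := by
      have hz : (0 : TensorPoly) ∈ SigmaLocal ℓ k c₀ :=
        ⟨0, by simp, 0, by simp, by simp [symCurlPoly, symCurlOf, curlOf]⟩
      refine h.sigma_unisolvent c₀ hk hℓ (hPmem x) d1 (fun x' hx' y hy hxy s => ?_)
        (fun x' hx' y hy hxy s => ?_) ?_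
      · have := sigmaLocal_polyNN_eq hk hℓ (hPmem x) hz hxy
          (fun i j => by simpa using d1 x' hx' i j)
          (fun i j => by simpa using d1 y hy i j) (fun q hq => by
            rw [(d2 x' hx' y hy hxy).1 q hq]; simp [edgeMoment, polyNN, normalNormal]) s
        rw [this]; simp [polyNN, normalNormal]
      · have := polyShear_eq_of_moments hxy (shearPoly_mem hk hℓ (hPmem x) hxy)
          (shearPoly_mem hk hℓ hz hxy) (fun q hq => by
            rw [(d2 x' hx' y hy hxy).2 q hq]; simp [edgeMoment, polyShear, shear]) s
        rw [this]; simp [polyShear, shear]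
      · rintro ς ⟨q, hq, w, hw, hς⟩
        have e : ς = hessPoly q + symPerp c₀ w := by ext1 i; ext1 j; exact hς i j
        rw [← tensorForm_apply, e, map_add]
        have g4 := F4_apply x ⟨q, hq⟩
        rw [f4, jet0' _ hj] at g4
        have g5 : F5 x (fun i => ⟨w i, hw i⟩) = tensorForm K (P x) (symPerp c₀ w) := rfl
        rw [f5] at g5
        rw [← g5]
        simpa using g4.symm
    have hq : (x.2 : Poly) = 0 := by
      have := divDivPoly_eq (v := fun i => x.1 i) (q := x.2) (c := c₀) (p := P x)
        fun i j => shapeLin_apply ..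
      rw [hP0] at this
      exact euler_injective (by norm_num) (euler_injective (c := c₀) (r := 2) (by norm_num)
        (this.symm.trans (by simp [divDivPoly])))
    have hv : symCurlPoly (fun i => (x.1 i : Poly)) = 0 := by
      ext1 i; ext1 j
      have := shapeLin_apply c₀ (fun i => x.1 i) x.2 i j
      rw [hq, mul_zero, add_zero] at this
      rw [← this]
      exact (congrArg (fun z => shapeLin c₀ ((fun i => (x.1 i : Poly)), z) i j) hq).symm.trans
        (congrFun (congrFun hP0 i) j)
    obtain ⟨g, hg⟩ := eq_rtPoly_of_symCurlPoly_eq_zero hv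
    rw [hg, rtJet_rtPoly] at hj
    refine Prod.ext (funext fun i => Subtype.ext ((congrFun hg i).trans ?_)) (Subtype.ext hq)
    simp [hj, rtPoly]
  have hsurj : Function.Surjective Φ := by
    have i1 : ∀ n, Module.Finite ℝ (degreeLT ℝ n) := fun n => inferInstance
    have i2 : ∀ n, Module.Finite ℝ (polyDeg n) := fun n => inferInstance
    have i3 : ∀ n, Module.Finite ℝ (Dual ℝ (degreeLT ℝ n)) := fun n => inferInstance
    have i4 : ∀ n, Module.Finite ℝ (Dual ℝ (polyDeg n)) := fun n => inferInstance
    have i5 : ∀ n, Module.Finite ℝ (Dual ℝ (Fin 2 → polyDeg n)) := fun n => inferInstance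
    refine (LinearMap.injective_iff_surjective_of_finrank_eq_finrank ?_).1 hinj
    obtain ⟨n, rfl⟩ : ∃ n, ℓ = n + 2 := ⟨ℓ - 2, by omega⟩
    have e1 : n + 2 - 1 = n + 1 := by omega
    have e2 : Module.finrank ℝ (polyDeg (n + 2 - 2)) = Module.finrank ℝ (polyDeg n) := rfl
    have e3 := finrank_polyDeg_add_three n
    simp only [Module.finrank_prod, Module.finrank_pi_fintype, Subspace.dual_finrank_eq,
      finrank_degreeLT, e1, e2, Finset.sum_const, Finset.card_univ, Fintype.card_fin, smul_eq_mul,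
      Module.finrank_self, e3]
    ring
  obtain ⟨x, hx⟩ := hsurj (fun n m => T (V n) (I m) (J m),
    fun n => N (V n) (V' n) ∘ₗ (degreeLT ℝ (ℓ - 1)).subtype,
    fun n => S (V n) (V' n) ∘ₗ (degreeLT ℝ ℓ).subtype,
    Q ∘ₗ (polyDeg (k - 2)).subtype, W ∘ₗ (polyDeg (ℓ - 2)).subtype.compLeft (Fin 2))
  have f1 := congrArg Prod.fst hx
  have f2 := congrArg (fun z => z.2.1) hx
  have f3 := congrArg (fun z => z.2.2.1) hx
  have f4 : F4 x = _ := congrArg (fun z => z.2.2.2.1) hx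
  have f5 : F5 x = _ := congrArg (fun z => z.2.2.2.2) hx
  have hj := jet0 x (fun q hq => by rw [f4]; exact hQ q hq)
  obtain ⟨d1, d2⟩ := dof T hT N S hN hS x (fun n m => congrFun (congrFun f1 n) m) (congrFun f2)
    (congrFun f3)
  refine ⟨P x, hPmem x, d1, d2, fun q hq => ?_, fun w hw => ?_⟩
  · have g4 := F4_apply x ⟨q, hq⟩
    rw [f4, jet0' _ hj, add_zero] at g4
    exact g4.symm
  · exact (DFunLike.congr_fun f5 fun i => ⟨w i, hw i⟩ :)

open Module in
/-- The scalar Hermite element has a shape function with given degrees of freedom. -/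
lemma IsTriple.exists_hermite (h : IsTriple K a b c) (hℓ : 2 ≤ ℓ) (V : Plane → ℝ)
    (D : Fin 2 → Plane → ℝ) (N : Plane → Plane → ℝ[X] →ₗ[ℝ] ℝ)
    (hN : ∀ a b q, N b a q = N a b (q.comp (1 - X))) (Q : Poly →ₗ[ℝ] ℝ) :
    ∃ p ∈ polyDeg (ℓ + 1), (∀ δ ∈ K, ev p δ = V δ ∧ ∀ m, ev (pderiv m p) δ = D m δ) ∧
      (∀ x ∈ K, ∀ y ∈ K, x ≠ y → ∀ q ∈ degreeLT ℝ (ℓ - 2),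
        edgeMoment x y (fun s => ev p (edgePt x y s)) q = N x y q) ∧
      ∀ q ∈ polyDeg (ℓ - 2), cellForm K p q = Q q := by
  obtain ⟨n, rfl⟩ : ∃ n, ℓ = n + 2 := ⟨ℓ - 2, by omega⟩
  rw [Nat.add_sub_cancel]
  let U : Fin 3 → Plane := ![a, b, c]
  let U' : Fin 3 → Plane := ![b, c, a]
  let F1 : polyDeg (n + 3) →ₗ[ℝ] (Fin 3 → ℝ) :=
    { toFun := fun x m => ev x.1 (U m)
      map_add' := fun x y => by ext n; simp
      map_smul' := fun r x => by ext n; simp }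
  let F2 : polyDeg (n + 3) →ₗ[ℝ] (Fin 3 → Fin 2 → ℝ) :=
    { toFun := fun x m i => ev (pderiv i x.1) (U m)
      map_add' := fun x y => by ext n m; simp
      map_smul' := fun r x => by ext n m; simp }
  let F3 : polyDeg (n + 3) →ₗ[ℝ] (Fin 3 → Dual ℝ (degreeLT ℝ n)) :=
    LinearMap.pi fun m => dist (U m) (U' m) • (lineForm ∘ₗ (restr (U m) (U' m)).toLinearMap ∘ₗ
      (polyDeg (n + 3)).subtype).compl₂ (degreeLT ℝ n).subtype
  let F4 : polyDeg (n + 3) →ₗ[ℝ] Dual ℝ (polyDeg n) :=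
    (cellForm K ∘ₗ (polyDeg (n + 3)).subtype).compl₂ (polyDeg n).subtype
  let Φ := F1.prod (F2.prod (F3.prod F4))
  have dof : ∀ (V : Plane → ℝ) (D : Fin 2 → Plane → ℝ) (N : Plane → Plane → ℝ[X] →ₗ[ℝ] ℝ),
      (∀ a b q, N b a q = N a b (q.comp (1 - X))) →
      ∀ x, (∀ m, F1 x m = V (U m)) → (∀ m i, F2 x m i = D i (U m)) →
      (∀ m, F3 x m = N (U m) (U' m) ∘ₗ (degreeLT ℝ n).subtype) →
      (∀ δ ∈ K, ev x.1 δ = V δ ∧ ∀ m, ev (pderiv m x.1) δ = D m δ) ∧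
      ∀ x' ∈ K, ∀ y ∈ K, x' ≠ y → ∀ q ∈ degreeLT ℝ n,
        edgeMoment x' y (fun s => ev x.1 (edgePt x' y s)) q = N x' y q := by
    clear hN
    intro V D N hN x h1 h2 h3
    refine ⟨fun δ hδ => ?_, h.forall_edge ?_ ?_ ?_ ?_⟩
    · obtain ⟨m, rfl⟩ : ∃ m, δ = U m := by
        rcases h.mem_iff.1 hδ with rfl | rfl | rfl
        exacts [⟨0, rfl⟩, ⟨1, rfl⟩, ⟨2, rfl⟩]
      exact ⟨h1 m, fun i => h2 m i⟩
    · intro x' y' g q hq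
      simp only [edgePt_swap x' y']
      rw [edgeMoment_swap x' y' (fun s => ev x.1 (edgePt x' y' s)), hN, g _ (comp_one_sub_mem hq)]
    all_goals
      intro q hq
      simp only [edgeMoment, ← eval_restr]
      first
      | exact exists_eq_of_mem (h3 0) hq
      | exact exists_eq_of_mem (h3 1) hq
      | exact exists_eq_of_mem (h3 2) hq
  have hinj : Function.Injective Φ := by
    rw [injective_iff_map_eq_zero]
    intro x hx
    have f1 : F1 x = 0 := congrArg Prod.fst hx
    have f2 : F2 x = 0 := congrArg (fun z => z.2.1) hx
    have f3 : F3 x = 0 := congrArg (fun z => z.2.2.1) hx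
    have f4 : F4 x = 0 := congrArg (fun z => z.2.2.2) hx
    obtain ⟨d1, d2⟩ := dof 0 0 0 (by simp) x (by simp [f1]) (by simp [f2]) (by simp [f3])
    have hr : ∀ x' ∈ K, ∀ y ∈ K, x' ≠ y → restr x' y x.1 = 0 := fun x' hx' y hy hxy =>
      hermite_edge hxy x.2 (d1 x' hx').1 (d1 y hy).1 (d1 x' hx').2 (d1 y hy).2
        fun q hq => (d2 x' hx' y hy hxy q hq).trans (by simp)
    have h0 := h.eq_zero_of_bubble_moments (n := n) (u := fun _ => x.1) (fun _ => x.2)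
      (fun _ => hr a h.mem_fst b h.mem_snd h.ne_fst_snd)
      (fun _ => hr b h.mem_snd c h.mem_trd h.ne_snd_trd)
      (fun _ => hr c h.mem_trd a h.mem_fst h.ne_fst_trd.symm) fun w hw => by
        rw [integral_finsetSum _ fun i _ => integrable_ev_mul K _ _]
        refine sum_eq_zero fun i _ => ?_
        exact (DFunLike.congr_fun f4 ⟨w i, hw i⟩ :)
    exact Subtype.ext (congrFun h0 0)
  have hsurj : Function.Surjective Φ := by
    have i1 : ∀ n, Module.Finite ℝ (degreeLT ℝ n) := fun n => inferInstance
    have i2 : ∀ n, Module.Finite ℝ (polyDeg n) := fun n => inferInstance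
    have i3 : ∀ n, Module.Finite ℝ (Dual ℝ (degreeLT ℝ n)) := fun n => inferInstance
    have i4 : ∀ n, Module.Finite ℝ (Dual ℝ (polyDeg n)) := fun n => inferInstance
    refine (LinearMap.injective_iff_surjective_of_finrank_eq_finrank ?_).1 hinj
    simp only [Module.finrank_prod, Module.finrank_pi_fintype, Subspace.dual_finrank_eq,
      finrank_degreeLT, Finset.sum_const, Finset.card_univ, Fintype.card_fin, smul_eq_mul,
      Module.finrank_self, finrank_polyDeg_add_three n]
    ring
  obtain ⟨x, hx⟩ := hsurj (fun m => V (U m), fun m i => D i (U m),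
    fun m => N (U m) (U' m) ∘ₗ (degreeLT ℝ n).subtype, Q ∘ₗ (polyDeg n).subtype)
  have f1 := congrArg Prod.fst hx
  have f2 := congrArg (fun z => z.2.1) hx
  have f3 := congrArg (fun z => z.2.2.1) hx
  have f4 : F4 x = _ := congrArg (fun z => z.2.2.2) hx
  obtain ⟨d1, d2⟩ := dof V D N hN x (congrFun f1) (fun m i => congrFun (congrFun f2 m) i)
    (congrFun f3)
  exact ⟨x.1, x.2, d1, d2, fun q hq => (DFunLike.congr_fun f4 ⟨q, hq⟩ :)⟩

open Module in
lemma IsTriple.exists_cellForm_eq (h : IsTriple K a b c) (n : ℕ) (Q : Poly →ₗ[ℝ] ℝ) :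
    ∃ p ∈ polyDeg n, ∀ q ∈ polyDeg n, cellForm K p q = Q q := by
  let F : polyDeg n →ₗ[ℝ] Dual ℝ (polyDeg n) :=
    (cellForm K ∘ₗ (polyDeg n).subtype).compl₂ (polyDeg n).subtype
  have hinj : Function.Injective F := by
    rw [injective_iff_map_eq_zero]
    intro x hx
    exact Subtype.ext (h.poly_eq_zero_of_integral_sq (DFunLike.congr_fun hx x :))
  have i2 : Module.Finite ℝ (polyDeg n) := inferInstance
  have hsurj : Function.Surjective F := (LinearMap.injective_iff_surjective_of_finrank_eq_finrank
      Subspace.dual_finrank_eq.symm).1 hinj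
  obtain ⟨x, hx⟩ := hsurj (Q ∘ₗ (polyDeg n).subtype)
  exact ⟨x.1, x.2, fun q hq => (DFunLike.congr_fun hx ⟨q, hq⟩ :)⟩

variable {m : Fin 2} {g' q q' u u' : ScalarField} {V : Set Plane} {v : VectorField}

/-! ### Weak derivatives -/

lemma IsTest.mono (h : U ⊆ V) (hφ : IsTest U φ) : IsTest V φ := ⟨hφ.1, hφ.2.1, hφ.2.2.trans h⟩

lemma tsupport_partialD_subset (m : Fin 2) (φ : ScalarField) :
    tsupport (partialD m φ) ⊆ tsupport φ := by
  refine closure_minimal (fun x hx => ?_) (isClosed_tsupport φ)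
  by_contra h
  have h1 := support_fderiv_subset (𝕜 := ℝ) (f := φ)
  refine h (h1 ?_)
  intro h0
  exact hx (by simp [partialD, h0])

lemma isTest_partialD (hφ : IsTest U φ) (m : Fin 2) : IsTest U (partialD m φ) :=
  ⟨contDiff_partialD (n := ∞) (by simpa using hφ.1) m,
    hφ.2.1.mono' ((subset_closure).trans (tsupport_partialD_subset m φ)),
    (tsupport_partialD_subset m φ).trans hφ.2.2⟩

lemma IsTest.continuous (hφ : IsTest U φ) : Continuous φ := hφ.1.continuous

lemma IsTest.memLp (hφ : IsTest U φ) (μ : Measure Plane) [IsFiniteMeasureOnCompacts μ] :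
    MemLp φ 2 μ :=
  hφ.continuous.memLp_of_hasCompactSupport hφ.2.1

lemma IsTest.eq_zero (hφ : IsTest U φ) (hx : x ∉ U) : φ x = 0 :=
  image_eq_zero_of_notMem_tsupport fun h => hx (hφ.2.2 h)

lemma IsTest.contDiff_two (hφ : IsTest U φ) : ContDiff ℝ 2 φ := hφ.1.of_le (by
    have h : ((2 : ℕ) : WithTop ℕ∞) ≤ ((⊤ : ℕ∞) : WithTop ℕ∞) := WithTop.coe_le_coe.2 le_top
    exact h)

lemma partialD_comm (hφ : ContDiff ℝ 2 φ) (i j : Fin 2) :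
    partialD i (partialD j φ) = partialD j (partialD i φ) := by
  funext x
  have hd : DifferentiableAt ℝ (fderiv ℝ φ) x :=
    ((hφ.fderiv_right (m := 1) (by rw [one_add_one_eq_two])).differentiable (by simp)) x
  have e : ∀ i j, partialD i (partialD j φ) x =
      fderiv ℝ (fderiv ℝ φ) x (unitVec i) (unitVec j) := fun i j => by
    change fderiv ℝ (fun y => fderiv ℝ φ y (unitVec j)) x (unitVec i) = _
    rw [fderiv_clm_apply hd (differentiableAt_const _)]
    simp
  rw [e, e]
  exact (hφ.contDiffAt.isSymmSndFDerivAt (by simp)) _ _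

lemma MemL2.integrable_mul (hu : MemL2 U u) (hφ : IsTest V φ) :
    IntegrableOn (fun x => u x * φ x) U :=
  MemLp.integrable_mul (p := 2) (q := 2) hu (hφ.memLp _)

lemma MemL2.mono (h : V ⊆ U) (hu : MemL2 U u) : MemL2 V u :=
  MemLp.mono_measure (Measure.restrict_mono_set _ h) hu

lemma MemL2.congr (hu : MemL2 U u) (h : u =ᵐ[vol U] u') : MemL2 U u' := (memLp_congr_ae h).1 hu

lemma memL2_of_continuousOn {K : Set Plane} (hK : IsCompact K) (hf : ContinuousOn f K) (hU : U ⊆ K)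
    : MemL2 U f := by
  have : IsFiniteMeasure ((volume : Measure Plane).restrict K) := ⟨by simpa using hK.measure_lt_top⟩
  obtain ⟨C, hC⟩ := hK.exists_bound_of_continuousOn hf
  have : MemL2 K f := MemLp.of_bound (hf.aestronglyMeasurable hK.measurableSet) C
    ((ae_restrict_iff' hK.measurableSet).2 (ae_of_all _ hC))
  exact this.mono hU

lemma setIntegral_eq_of_isTest (hU : MeasurableSet U) (hV : V ⊆ U) (hφ : IsTest V φ)
    (u : ScalarField) : ∫ x in V, u x * φ x = ∫ x in U, u x * φ x :=
  (setIntegral_eq_of_subset_of_forall_sdiff_eq_zero hU hV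
    fun x hx => by rw [hφ.eq_zero hx.2, mul_zero]).symm

lemma HasWeakPartial.mono (hU : MeasurableSet U) (h : V ⊆ U) (hu : HasWeakPartial U m u g) :
    HasWeakPartial V m u g :=
  ⟨hu.1.mono h, hu.2.1.mono h, fun φ hφ => by
    rw [setIntegral_eq_of_isTest hU h (isTest_partialD hφ m), setIntegral_eq_of_isTest hU h hφ]
    exact hu.2.2 φ (hφ.mono h)⟩

lemma HasWeakPartial.congr (hu : HasWeakPartial U m u g) (h : u =ᵐ[vol U] u') (h' : g =ᵐ[vol U] g')
    : HasWeakPartial U m u' g' := by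
  refine ⟨hu.1.congr h, hu.2.1.congr h', fun φ hφ => ?_⟩
  have e1 := integral_congr_ae (h.mul (ae_eq_refl (partialD m φ)))
  have e2 := integral_congr_ae (h'.mul (ae_eq_refl φ))
  exact e1.symm.trans ((hu.2.2 φ hφ).trans (congrArg Neg.neg e2))

lemma ae_eq_of_forall_isTest (hU : IsOpen U) {v : ScalarField} (hu : MemL2 U u) (hv : MemL2 U v)
    (h : ∀ φ, IsTest U φ → ∫ x in U, u x * φ x = ∫ x in U, v x * φ x) : u =ᵐ[vol U] v := by
  have hloc : LocallyIntegrableOn (fun x => u x - v x) U := by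
    rw [locallyIntegrableOn_iff hU.isLocallyClosed]
    intro k hk hkc
    have : IsFiniteMeasure ((volume : Measure Plane).restrict k) :=
      ⟨by simpa using hkc.measure_lt_top⟩
    exact ((hu.sub hv).mono_measure (Measure.restrict_mono_set _ hk)).integrable (by norm_num)
  have key := hU.ae_eq_zero_of_integral_contDiff_smul_eq_zero hloc fun φ h1 h2 h3 => by
    have ht : IsTest U φ := ⟨h1, h2, h3⟩
    have e : ∫ x, φ x • (u x - v x) = ∫ x in U, (u x - v x) * φ x := by
      rw [setIntegral_eq_integral_of_forall_compl_eq_zero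
        (fun x hx => by rw [ht.eq_zero hx, mul_zero])]
      simp only [smul_eq_mul, mul_comm]
    rw [e]
    simp only [sub_mul]
    rw [integral_sub (hu.integrable_mul ht) (hv.integrable_mul ht), h φ ht, sub_self]
  rw [Filter.EventuallyEq, ae_restrict_iff' hU.measurableSet]
  filter_upwards [key] with x hx hxU
  exact sub_eq_zero.1 (hx hxU)

lemma HasWeakPartial.unique (hU : IsOpen U) (h : HasWeakPartial U m u g)
    (h' : HasWeakPartial U m u g') : g =ᵐ[vol U] g' :=
  ae_eq_of_forall_isTest hU h.2.1 h'.2.1 fun φ hφ =>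
    neg_injective ((h.2.2 φ hφ).symm.trans (h'.2.2 φ hφ))

lemma integral_mul_partialD (hf : ContDiff ℝ 1 f) (hφ : IsTest V φ) (m : Fin 2) :
    ∫ x in V, f x * partialD m φ x = -∫ x in V, partialD m f x * φ x := by
  have e : ∀ {g ψ : ScalarField}, IsTest V ψ → ∫ x in V, g x * ψ x = ∫ x, g x * ψ x :=
    fun hψ => setIntegral_eq_integral_of_forall_compl_eq_zero
      (fun x hx => by rw [hψ.eq_zero hx, mul_zero])
  rw [e (isTest_partialD hφ m), e hφ]
  have hi : ∀ {g ψ : ScalarField}, Continuous g → IsTest V ψ → Integrable fun x => g x * ψ x :=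
    fun hg hψ => (hg.mul hψ.continuous).integrable_of_hasCompactSupport hψ.2.1.mul_left
  exact integral_mul_fderiv_eq_neg_fderiv_mul_of_integrable
    (hi (continuous_partialD hf le_rfl m) hφ) (hi hf.continuous (isTest_partialD hφ m)) (hi hf.continuous hφ)
    (fun x _ => (hf.differentiable (by simp)) x)
    (fun x _ => (hφ.1.differentiable (by simp)) x)

lemma hasWeakPartial_of_contDiff (hU : IsBounded U) (hf : ContDiff ℝ 1 f) (m : Fin 2) :
    HasWeakPartial U m f (partialD m f) :=
  ⟨memL2_of_continuousOn hU.isCompact_closure hf.continuous.continuousOn subset_closure,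
    memL2_of_continuousOn hU.isCompact_closure (continuous_partialD hf le_rfl m).continuousOn
      subset_closure, fun _ hφ => integral_mul_partialD hf hφ m⟩

lemma hasWeakPartial_ev (hU : IsBounded U) (p : Poly) (m : Fin 2) :
    HasWeakPartial U m (ev p) (ev (pderiv m p)) := by
  have := hasWeakPartial_of_contDiff hU ((contDiff_ev p).of_le (by simp)) m
  rwa [partialD_ev] at this

lemma isBounded_interior_hull (K : Finset Plane) : IsBounded K° :=
  (isCompact_hull K).isBounded.subset interior_subset

/-- On a triangle, a weak derivative of a polynomial is the derivative. -/
lemma HasWeakPartial.eqOnCell (hU : IsOpen U) (hK : K° ⊆ U) (h : HasWeakPartial U m u g) {p : Poly}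
    (hp : EqOnCell K u p) : EqOnCell K g (pderiv m p) := by
  have h1 := h.mono hU.measurableSet hK
  unfold EqOnCell at hp ⊢
  rw [← restrict_interior_hull] at hp ⊢
  exact (h1.congr hp (ae_eq_refl _)).unique isOpen_interior
    (hasWeakPartial_ev (isBounded_interior_hull K) p m)

/-! ### `div div` and `sym curl` in the weak sense -/

lemma isTest_partialD_three (hφ : IsTest U φ) (m i j : Fin 2) :
    partialD m (partialD i (partialD j φ)) = partialD i (partialD j (partialD m φ)) := by
  rw [partialD_comm (isTest_partialD hφ j).contDiff_two m i, partialD_comm hφ.contDiff_two m j]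

/-- `div div sym curl v = 0`. -/
lemma IsSymCurl.isDivDiv (h : IsSymCurl U v τ) : IsDivDiv U τ 0 := by
  obtain ⟨D, hD, hτ⟩ := h
  have hL : ∀ i j, MemL2 U (symCurlOf D i j) := by
    intro i j
    have h1 : ∀ i j, MemL2 U (curlOf D i j) := by
      intro i j
      fin_cases j
      · exact (hD 1 i).2.1
      · exact (hD 0 i).2.1.neg
    exact ((h1 i j).add (h1 j i)).const_smul _
  refine ⟨fun i j => (hL i j).congr (hτ i j).symm, ?_, fun φ hφ => ?_⟩
  · exact MemLp.zero
  · have e : ∫ x in U, ∑ i, ∑ j, τ i j x * partialD i (partialD j φ) x =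
        ∫ x in U, ∑ i, ∑ j, symCurlOf D i j x * partialD i (partialD j φ) x := by
      refine integral_congr_ae ?_
      filter_upwards [hτ 0 0, hτ 0 1, hτ 1 0, hτ 1 1] with x h1 h2 h3 h4
      simp [sum_univ_two, h1, h2, h3, h4]
    rw [e]
    have hT : ∀ i j, IsTest U (partialD i (partialD j φ)) := fun i j => isTest_partialD (isTest_partialD hφ j) i
    have hI : ∀ m i k l, IntegrableOn (fun x => D m i x * partialD k (partialD l φ) x) U :=
      fun m i k l => (hD m i).2.1.integrable_mul (hT k l)
    have e2 : ∀ x, ∑ i, ∑ j, symCurlOf D i j x * partialD i (partialD j φ) x =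
        (D 1 0 x * partialD 0 (partialD 0 φ) x - D 0 0 x * partialD 0 (partialD 1 φ) x) +
        (D 1 1 x * partialD 0 (partialD 1 φ) x - D 0 1 x * partialD 1 (partialD 1 φ) x) := by
      intro x
      simp only [sum_univ_two, partialD_comm hφ.contDiff_two 1 0]
      simp [symCurlOf, curlOf]
      ring
    simp only [e2]
    have hs : ∀ m i k l m' i' k' l', IntegrableOn (fun x => D m i x * partialD k (partialD l φ) x -
      D m' i' x * partialD k' (partialD l' φ) x) U := fun m i k l m' i' k' l' =>
        (hI m i k l).sub (hI m' i' k' l')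
    rw [integral_add (hs _ _ _ _ _ _ _ _) (hs _ _ _ _ _ _ _ _), integral_sub (hI _ _ _ _)
      (hI _ _ _ _), integral_sub (hI _ _ _ _) (hI _ _ _ _)]
    have h3 : ∀ m i k l, ∫ x in U, D m i x * partialD k (partialD l φ) x =
        -∫ x in U, v i x * partialD k (partialD l (partialD m φ)) x := fun m i k l => by
      rw [← isTest_partialD_three hφ m k l, (hD m i).2.2 _ (hT k l), neg_neg]
    have c2 := partialD_comm hφ.contDiff_two 1 0
    have c3 := partialD_comm (isTest_partialD hφ 1).contDiff_two 1 0
    simp only [h3, c2, c3]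
    simp

lemma IsDivDiv.mono (hU : MeasurableSet U) (h : V ⊆ U) (hτ : IsDivDiv U τ q) : IsDivDiv V τ q := by
  refine ⟨fun i j => (hτ.1 i j).mono h, hτ.2.1.mono h, fun φ hφ => ?_⟩
  rw [setIntegral_eq_of_isTest hU h hφ, ← hτ.2.2 φ (hφ.mono h)]
  refine (setIntegral_eq_of_subset_of_forall_sdiff_eq_zero hU h fun x hx => ?_).symm
  simp [(isTest_partialD (isTest_partialD hφ _) _).eq_zero hx.2]

lemma IsDivDiv.congr {τ' : TensorField} (h : IsDivDiv U τ q) (hτ : ∀ i j, τ i j =ᵐ[vol U] τ' i j)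
    (hq : q =ᵐ[vol U] q') : IsDivDiv U τ' q' := by
  refine ⟨fun i j => (h.1 i j).congr (hτ i j), h.2.1.congr hq, fun φ hφ => ?_⟩
  have e := integral_congr_ae (hq.mul (ae_eq_refl φ))
  refine (Eq.trans (integral_congr_ae ?_) (h.2.2 φ hφ)).trans e
  filter_upwards [hτ 0 0, hτ 0 1, hτ 1 0, hτ 1 1] with x h1 h2 h3 h4
  simp [sum_univ_two, h1, h2, h3, h4]

lemma IsDivDiv.unique (hU : IsOpen U) (h : IsDivDiv U τ q) (h' : IsDivDiv U τ q') :
    q =ᵐ[vol U] q' :=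
  ae_eq_of_forall_isTest hU h.2.1 h'.2.1 fun φ hφ => (h.2.2 φ hφ).symm.trans (h'.2.2 φ hφ)

lemma integral_hessian_of_contDiff (hτ : ∀ i j, ContDiff ℝ 2 (τ i j)) (hφ : IsTest U φ) :
    ∫ x in U, ∑ i, ∑ j, τ i j x * partialD i (partialD j φ) x =
      ∫ x in U, (∑ i, ∑ j, partialD i (partialD j (τ i j)) x) * φ x := by
  have hc : ∀ i j, ContDiff ℝ 1 (partialD i (τ i j)) := fun i j =>
    contDiff_partialD (by rw [one_add_one_eq_two]; exact hτ i j) i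
  have hi : ∀ {g ψ : ScalarField}, Continuous g → IsTest U ψ → IntegrableOn (fun x => g x * ψ x) U :=
    fun hg hψ => ((hg.mul hψ.continuous).integrable_of_hasCompactSupport
      hψ.2.1.mul_left).integrableOn
  simp only [sum_mul]
  rw [integral_finsetSum _ fun i _ => integrable_finsetSum _ fun j _ =>
    hi (hτ i j).continuous (isTest_partialD (isTest_partialD hφ j) i)]
  rw [integral_finsetSum _ fun i _ => integrable_finsetSum _ fun j _ =>
    hi (by rw [partialD_comm (hτ i j)]; exact continuous_partialD (hc i j) le_rfl j) hφ]
  refine sum_congr rfl fun i _ => ?_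
  rw [integral_finsetSum _ fun j _ => hi (hτ i j).continuous (isTest_partialD (isTest_partialD hφ j) i)]
  rw [integral_finsetSum _ fun j _ =>
    hi (by rw [partialD_comm (hτ i j)]; exact continuous_partialD (hc i j) le_rfl j) hφ]
  refine sum_congr rfl fun j _ => ?_
  rw [integral_mul_partialD ((hτ i j).of_le (by simp)) (isTest_partialD hφ j),
    integral_mul_partialD (hc i j) hφ, neg_neg, partialD_comm (hτ i j)]

lemma isDivDiv_ev (hU : IsBounded U) (p : TensorPoly) :
    IsDivDiv U (fun i j => ev (p i j)) (ev (divDivPoly p)) := by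
  refine ⟨fun i j => (hasWeakPartial_ev hU (p i j) 0).1, (hasWeakPartial_ev hU _ 0).1,
    fun φ hφ => ?_⟩
  rw [integral_hessian_of_contDiff (fun i j => contDiff_two_ev _) hφ]
  simp [divDivPoly]

lemma IsDivDiv.eqOnCell (hU : IsOpen U) (hK : K° ⊆ U) (h : IsDivDiv U τ q)
    (hp : ∀ i j, EqOnCell K (τ i j) (p i j)) : EqOnCell K q (divDivPoly p) := by
  have h1 := h.mono hU.measurableSet hK
  unfold EqOnCell at hp ⊢
  rw [← restrict_interior_hull] at hp ⊢
  exact (h1.congr hp (ae_eq_refl _)).unique isOpen_interior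
    (isDivDiv_ev (isBounded_interior_hull K) p)

variable {p : Finset Plane → Fin 2 → Poly} {D : TensorField} {r : VectorField}

/-! ### Cellwise polynomial fields -/

section Mesh

lemma EqOnCell.memL2 {p : Poly} (h : EqOnCell K u p) : MemL2 (hull K) u :=
  (memL2_of_continuousOn (isCompact_hull K) (continuous_ev p).continuousOn subset_rfl).congr h.symm

lemma EqOnCell.integrableOn_mul {p : Poly} (h : EqOnCell K u p) (hφ : Continuous φ) :
    IntegrableOn (fun x => u x * φ x) (hull K) := by
  have h1 : IntegrableOn (fun x => ev p x * φ x) (hull K) :=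
    ((continuous_ev p).mul hφ).continuousOn.integrableOn_compact (isCompact_hull K)
  exact h1.congr (h.symm.mul (ae_eq_refl φ))

lemma eqOnCell_piecewise (p : Finset Plane → Poly) (hK : K ∈ M.cells) :
    EqOnCell K (piecewise M p) (p K) := by
  unfold EqOnCell
  rw [← restrict_interior_hull]
  filter_upwards [ae_restrict_mem isOpen_interior.measurableSet] with x hx
  rw [piecewise, Finset.sum_eq_single_of_mem K hK, indicator_of_mem hx]
  intro L hL hLK
  exact indicator_of_notMem (fun h => hLK (M.eq_of_mem_interior hK hL hx (interior_subset h))) _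

lemma memLp_sum_measure {ι : Type*} (s : Finset ι) {μ : ι → Measure Plane}
    (h : ∀ i ∈ s, MemLp u 2 (μ i)) : MemLp u 2 (∑ i ∈ s, μ i) := by
  classical
  induction s using Finset.induction_on with
  | empty => simp
  | insert a s ha ih =>
    rw [sum_insert ha]
    have h1 := h a (Finset.mem_insert_self a s)
    have h2 := ih fun i hi => h i (Finset.mem_insert_of_mem hi)
    have hm : AEStronglyMeasurable u (μ a + ∑ i ∈ s, μ i) := h1.1.add_measure h2.1
    rw [memLp_two_iff_integrable_sq hm]
    exact ((memLp_two_iff_integrable_sq h1.1).1 h1).add_measure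
      ((memLp_two_iff_integrable_sq h2.1).1 h2)

variable (hΩ : IsPolygon Ω) (hM : M.IsMeshOf Ω)

include hΩ hM

lemma memL2_of_cells (h : ∀ K ∈ M.cells, MemL2 (hull K) u) : MemL2 Ω u := by
  unfold MemL2
  rw [restrict_eq_sum hΩ hM]
  exact memLp_sum_measure _ h

lemma ae_eq_of_cells {w : ScalarField} {p : Finset Plane → Poly}
    (hu : ∀ K ∈ M.cells, EqOnCell K u (p K)) (hw : ∀ K ∈ M.cells, EqOnCell K w (p K)) :
    u =ᵐ[vol Ω] w :=
  (ae_restrict_iff_cells hΩ hM).2 fun K hK => (hu K hK).trans (hw K hK).symm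

omit hΩ hM in
lemma partialD_mul_eq {f : ScalarField} (hf : Differentiable ℝ f) (hφ : Differentiable ℝ φ)
    (m : Fin 2) (x : Plane) :
    partialD m (fun x => f x * φ x) x = f x * partialD m φ x + partialD m f x * φ x := by
  have := partialD_mul (m := m) (hf x) (hφ x)
  rw [this]; ring

/-- A cellwise polynomial function with single-valued traces is weakly differentiable. -/
lemma hasWeakPartial_of_cells {g : ScalarField} {p : Finset Plane → Poly}
    (hu : ∀ K ∈ M.cells, EqOnCell K u (p K)) (hg : ∀ K ∈ M.cells, EqOnCell K g (pderiv m (p K)))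
    (htr : ∀ K ∈ M.cells, ∀ L ∈ M.cells, ∀ a b, a ∈ K → a ∈ L → b ∈ K → b ∈ L → a ≠ b → ∀ s, ev (p
    K) (edgePt a b s) = ev (p L) (edgePt a b s)) : HasWeakPartial Ω m u g := by
  refine ⟨memL2_of_cells hΩ hM fun K hK => (hu K hK).memL2,
    memL2_of_cells hΩ hM fun K hK => (hg K hK).memL2, fun φ hφ => ?_⟩
  have hφ1 : ContDiff ℝ 1 φ := hφ.1.of_le (by simp)
  rw [eq_neg_iff_add_eq_zero, integral_eq_sum_cells hΩ hM fun K hK =>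
    (hu K hK).integrableOn_mul (isTest_partialD hφ m).continuous,
    integral_eq_sum_cells hΩ hM fun K hK => (hg K hK).integrableOn_mul hφ.continuous,
    ← sum_add_distrib]
  have hcell : ∀ K ∈ M.cells, (∫ x in hull K, u x * partialD m φ x) + ∫ x in hull K, g x * φ x =
      1 / 2 * ∑ a ∈ K, ∑ b ∈ K, orient K a b * (rot (b - a) m * ∫ s in (0 : ℝ)..1,
        ev (p K) (edgePt a b s) * φ (edgePt a b s)) := by
    intro K hK
    obtain ⟨a, b, c, h⟩ := M.isTriple hK
    rw [← integral_add ((hu K hK).integrableOn_mul (isTest_partialD hφ m).continuous)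
      ((hg K hK).integrableOn_mul hφ.continuous)]
    rw [← h.green (f := fun x => ev (p K) x * φ x) (((contDiff_ev _).of_le (by simp)).mul hφ1) m]
    refine integral_congr_ae ?_
    filter_upwards [hu K hK, hg K hK] with x h1 h2
    rw [partialD_mul_eq (differentiable_ev _) (hφ1.differentiable (by simp)), h1, h2, partialD_ev]
  rw [sum_congr rfl hcell, ← mul_sum, sum_orient_mul_eq_zero hΩ hM
    (F := fun K a b => rot (b - a) m * ∫ s in (0 : ℝ)..1,
        ev (p K) (edgePt a b s) * φ (edgePt a b s)), mul_zero]
  · intro K hK L hL a b h1 h2 h3 h4 hab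
    simp only [htr K hK L hL a b h1 h2 h3 h4 hab]
  · intro K hK a ha b hb hab hout
    rw [intervalIntegral.integral_congr (g := fun _ => 0)]
    · simp
    · intro s hs
      rw [Set.uIcc_of_le zero_le_one] at hs
      simp [hφ.eq_zero (hout s hs)]

/-- A cellwise polynomial tensor with single-valued traces has a weak `div div`. -/
lemma isDivDiv_of_cells {p : Finset Plane → TensorPoly}
    (hτ : ∀ K ∈ M.cells, ∀ i j, EqOnCell K (τ i j) (p K i j))
    (hq : ∀ K ∈ M.cells, EqOnCell K q (divDivPoly (p K))) (hv : ∀ K ∈ M.cells, ∀ L ∈ M.cells, ∀ δ, δ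
    ∈ K → δ ∈ L → ∀ i j, ev (p K i j) δ = ev (p L i j) δ) (he : ∀ K ∈ M.cells, ∀ L ∈ M.cells, ∀ a b,
    a ∈ K → a ∈ L → b ∈ K → b ∈ L → a ≠ b → (∀ s, polyNN a b (p K) s = polyNN a b (p L) s) ∧ ∀ s,
    polyShear a b (p K) s = polyShear a b (p L) s) : IsDivDiv Ω τ q := by
  refine ⟨fun i j => memL2_of_cells hΩ hM fun K hK => (hτ K hK i j).memL2,
    memL2_of_cells hΩ hM fun K hK => (hq K hK).memL2, fun φ hφ => ?_⟩
  have hi : ∀ K ∈ M.cells, IntegrableOn (fun x => ∑ i, ∑ j, τ i j x *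
      partialD i (partialD j φ) x) (hull K) := fun K hK =>
    integrable_finsetSum _ fun i _ => integrable_finsetSum _ fun j _ =>
      (hτ K hK i j).integrableOn_mul (isTest_partialD (isTest_partialD hφ j) i).continuous
  rw [← sub_eq_zero, integral_eq_sum_cells hΩ hM hi, integral_eq_sum_cells hΩ hM fun K hK =>
    (hq K hK).integrableOn_mul hφ.continuous, ← sum_sub_distrib]
  have hcell : ∀ K ∈ M.cells, (∫ x in hull K, ∑ i, ∑ j, τ i j x * partialD i (partialD j φ) x) -
      ∫ x in hull K, q x * φ x = 1 / 2 * ∑ a ∈ K, ∑ b ∈ K, orient K a b *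
        edgeTerm a b (fun i j => ev (p K i j)) φ := by
    intro K hK
    obtain ⟨a, b, c, h⟩ := M.isTriple hK
    rw [← h.green_divDivPoly (p K) hφ.contDiff_two]
    congr 1
    · refine integral_congr_ae ?_
      filter_upwards [hτ K hK 0 0, hτ K hK 0 1, hτ K hK 1 0, hτ K hK 1 1] with x h1 h2 h3 h4
      simp [sum_univ_two, h1, h2, h3, h4]
    · exact integral_congr_ae ((hq K hK).mul (ae_eq_refl φ))
  rw [sum_congr rfl hcell, ← mul_sum, sum_orient_mul_eq_zero hΩ hM
    (F := fun K a b => edgeTerm a b (fun i j => ev (p K i j)) φ), mul_zero]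
  · intro K hK L hL a b h1 h2 h3 h4 hab
    simp only [edgeTerm_ev, (he K hK L hL a b h1 h2 h3 h4 hab).1,
      (he K hK L hL a b h1 h2 h3 h4 hab).2, hv K hK L hL a h1 h2, hv K hK L hL b h3 h4]
  · intro K hK a ha b hb hab hout
    have h0 : a ∉ Ω := by simpa using hout 0 (by simp)
    have h1 : b ∉ Ω := by simpa using hout 1 (by simp)
    rw [edgeTerm_ev, intervalIntegral.integral_congr (g := fun _ => 0)]
    · simp [hφ.eq_zero h0, hφ.eq_zero h1]
    · intro s hs
      rw [Set.uIcc_of_le zero_le_one] at hs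
      simp [hφ.eq_zero (hout s hs), (isTest_partialD hφ _).eq_zero (hout s hs)]

/-! ### The discrete complex -/

omit hΩ hM in
/-- The conditions on the polynomials of a field in `SigmaH`, with pointwise traces. -/
structure IsSigmaFamily (M : Triangulation) (c : Finset Plane → Plane) (ℓ k : ℕ)
    (p : Finset Plane → TensorPoly) : Prop where
  mem : ∀ K ∈ M.cells, p K ∈ SigmaLocal ℓ k (c K)
  vert : ∀ K ∈ M.cells, ∀ L ∈ M.cells, ∀ δ, δ ∈ K → δ ∈ L → ∀ i j, ev (p K i j) δ = ev (p L i j) δ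
  edge : ∀ K ∈ M.cells, ∀ L ∈ M.cells, ∀ a b, a ∈ K → a ∈ L → b ∈ K → b ∈ L → a ≠ b →
    (∀ s, polyNN a b (p K) s = polyNN a b (p L) s) ∧
      ∀ s, polyShear a b (p K) s = polyShear a b (p L) s

omit hΩ hM in
/-- The conditions on the polynomials of a field in `Vh`, with pointwise traces. -/
structure IsVFamily (M : Triangulation) (ℓ : ℕ) (p : Finset Plane → Fin 2 → Poly) : Prop where
  mem : ∀ K ∈ M.cells, ∀ i, p K i ∈ polyDeg (ℓ + 1)
  vert : ∀ K ∈ M.cells, ∀ L ∈ M.cells, ∀ δ, δ ∈ K → δ ∈ L → ∀ i, ev (p K i) δ = ev (p L i) δ ∧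
    ∀ m, ev (pderiv m (p K i)) δ = ev (pderiv m (p L i)) δ
  edge : ∀ K ∈ M.cells, ∀ L ∈ M.cells, ∀ a b, a ∈ K → a ∈ L → b ∈ K → b ∈ L → a ≠ b →
    ∀ i s, ev (p K i) (edgePt a b s) = ev (p L i) (edgePt a b s)

variable {c : Finset Plane → Plane}

lemma mem_sigmaH_iff (hk : 3 ≤ k) (hℓ : k ≤ ℓ + 1) :
    τ ∈ SigmaH Ω M c ℓ k ↔ ∃ p, IsSigmaFamily M c ℓ k p ∧
      ∀ K ∈ M.cells, ∀ i j, EqOnCell K (τ i j) (p K i j) := by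
  constructor
  · rintro ⟨-, p, h1, h2⟩
    refine ⟨p, ⟨fun K hK => (h1 K hK).1, fun K hK L hL => (h2 K hK L hL).1, ?_⟩,
      fun K hK => (h1 K hK).2⟩
    intro K hK L hL a b haK haL hbK hbL hab
    obtain ⟨h3, h4⟩ := (h2 K hK L hL).2 a b haK haL hbK hbL hab
    exact ⟨sigmaLocal_polyNN_eq hk hℓ (h1 K hK).1 (h1 L hL).1 hab
      ((h2 K hK L hL).1 a haK haL) ((h2 K hK L hL).1 b hbK hbL) h3,
      polyShear_eq_of_moments hab (shearPoly_mem hk hℓ (h1 K hK).1 hab)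
        (shearPoly_mem hk hℓ (h1 L hL).1 hab) h4⟩
  · rintro ⟨p, hp, hτ⟩
    refine ⟨fun i j => memL2_of_cells hΩ hM fun K hK => (hτ K hK i j).memL2, p,
      fun K hK => ⟨hp.mem K hK, hτ K hK⟩, fun K hK L hL => ⟨hp.vert K hK L hL, ?_⟩⟩
    intro a b haK haL hbK hbL hab
    obtain ⟨h3, h4⟩ := hp.edge K hK L hL a b haK haL hbK hbL hab
    exact ⟨fun q _ => by rw [funext h3], fun q _ => by rw [funext h4]⟩

omit hΩ hM in
lemma isVFamily_of_moments (hℓ : 2 ≤ ℓ) (h1 : ∀ K ∈ M.cells, ∀ i, p K i ∈ polyDeg (ℓ + 1)) (h2 : ∀ K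
    ∈ M.cells, ∀ L ∈ M.cells, ∀ δ, δ ∈ K → δ ∈ L → ∀ i, ev (p K i) δ = ev (p L i) δ ∧ ∀ m, ev
    (pderiv m (p K i)) δ = ev (pderiv m (p L i)) δ) (h3 : ∀ K ∈ M.cells, ∀ L ∈ M.cells, ∀ a b, a ∈ K
    → a ∈ L → b ∈ K → b ∈ L → a ≠ b → ∀ q ∈ degreeLT ℝ (ℓ - 2), ∀ i, edgeMoment a b (fun s => ev (p
    K i) (edgePt a b s)) q = edgeMoment a b (fun s => ev (p L i) (edgePt a b s)) q) :
    IsVFamily M ℓ p := by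
  refine ⟨h1, h2, fun K hK L hL a b haK haL hbK hbL hab i s => ?_⟩
  obtain ⟨n, rfl⟩ : ∃ n, ℓ = n + 2 := ⟨ℓ - 2, by omega⟩
  have ha := h2 K hK L hL a haK haL i
  have hb := h2 K hK L hL b hbK hbL i
  have := hermite_edge (n := n) hab (p := p K i - p L i)
    (sub_mem (h1 K hK i) (h1 L hL i)) (by simp [ha.1]) (by simp [hb.1])
    (by simp [ha.2]) (by simp [hb.2]) fun q hq => by
      have h3 := h3 K hK L hL a b haK haL hbK hbL hab q hq i
      simp only [← eval_restr] at h3 ⊢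
      change dist a b * lineForm _ q = dist a b * lineForm _ q at h3
      change dist a b * lineForm _ q = 0
      rw [map_sub, map_sub, LinearMap.sub_apply, mul_sub, h3, sub_self]
  have h4 := (restr_eq_zero_iff.1 this) s
  rwa [ev_sub, sub_eq_zero] at h4

lemma mem_vh_iff (hℓ : 2 ≤ ℓ) : v ∈ Vh Ω M ℓ ↔ ∃ p, IsVFamily M ℓ p ∧
      ∀ K ∈ M.cells, ∀ i, EqOnCell K (v i) (p K i) := by
  constructor
  · rintro ⟨-, p, h1, h2⟩
    exact ⟨p, isVFamily_of_moments hℓ (fun K hK i => (h1 K hK i).1)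
      (fun K hK L hL => (h2 K hK L hL).1) (fun K hK L hL => (h2 K hK L hL).2),
      fun K hK i => (h1 K hK i).2⟩
  · rintro ⟨p, hp, hv⟩
    refine ⟨fun i => ⟨fun m => piecewise M fun K => pderiv m (p K i), fun m => ?_⟩, p,
      fun K hK i => ⟨hp.mem K hK i, hv K hK i⟩, fun K hK L hL => ⟨hp.vert K hK L hL, ?_⟩⟩
    · have := hasWeakPartial_of_cells hΩ hM (m := m) (fun K hK => hv K hK i)
        (fun K hK => eqOnCell_piecewise (fun K => pderiv m (p K i)) hK)
        (fun K hK L hL a b h1 h2 h3 h4 hab => hp.edge K hK L hL a b h1 h2 h3 h4 hab i)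
      exact ⟨this, this.2.1⟩
    · intro a b haK haL hbK hbL hab q _ i
      simp only [hp.edge K hK L hL a b haK haL hbK hbL hab i]

omit hΩ hM in
lemma eqOnCell_symCurlOf {p : Fin 2 → Poly} (h : ∀ m i, EqOnCell K (D m i) (pderiv m (p i)))
    (i j : Fin 2) : EqOnCell K (symCurlOf D i j) (symCurlPoly p i j) := by
  unfold EqOnCell at h ⊢
  filter_upwards [h 0 0, h 0 1, h 1 0, h 1 1] with x h1 h2 h3 h4
  fin_cases i <;> fin_cases j <;> simp [symCurlOf, symCurlPoly, curlOf, h1, h2, h3, h4] <;> ring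

omit hΩ hM in
lemma IsSymCurl.eqOnCell (hU : IsOpen U) (hK : K° ⊆ U) (h : IsSymCurl U v τ) {p : Fin 2 → Poly}
    (hp : ∀ i, EqOnCell K (v i) (p i)) (i j : Fin 2) : EqOnCell K (τ i j) (symCurlPoly p i j) := by
  obtain ⟨D, hD, hτ⟩ := h
  have h1 := eqOnCell_symCurlOf (fun m i => (hD m i).eqOnCell hU hK (hp i)) i j
  have h2 := ae_mono (Measure.restrict_mono_set volume hK) (hτ i j)
  rw [restrict_interior_hull] at h2
  exact EventuallyEq.trans h2 h1

lemma isSymCurl_of_family (hp : IsVFamily M ℓ p) (hv : ∀ K ∈ M.cells, ∀ i, EqOnCell K (v i) (p K i))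
    (hτ : ∀ K ∈ M.cells, ∀ i j, EqOnCell K (τ i j) (symCurlPoly (p K) i j)) : IsSymCurl Ω v τ := by
  have hD : ∀ m i, ∀ K ∈ M.cells, EqOnCell K
      (piecewise M fun K => pderiv m (p K i)) (pderiv m (p K i)) :=
    fun m i K hK => eqOnCell_piecewise (fun K => pderiv m (p K i)) hK
  refine ⟨fun m i => piecewise M fun K => pderiv m (p K i), fun m i => ?_, fun i j => ?_⟩
  · exact hasWeakPartial_of_cells hΩ hM (m := m) (fun K hK => hv K hK i) (hD m i)
      (fun K hK L hL a b h1 h2 h3 h4 hab => hp.edge K hK L hL a b h1 h2 h3 h4 hab i)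
  · exact ae_eq_of_cells hΩ hM (fun K hK => hτ K hK i j)
      (fun K hK => eqOnCell_symCurlOf (fun m i => hD m i K hK) i j)

omit hΩ hM in
lemma IsVFamily.symCurlPoly (hp : IsVFamily M ℓ p) :
    IsSigmaFamily M c ℓ k fun K => symCurlPoly (p K) := by
  refine ⟨fun K hK => symCurlPoly_mem_sigmaLocal _ (hp.mem K hK), fun K hK L hL δ h1 h2 i j => ?_,
    fun K hK L hL a b h1 h2 h3 h4 hab => ?_⟩
  · have := fun i m => (hp.vert K hK L hL δ h1 h2 i).2 m
    fin_cases i <;> fin_cases j <;> simp [DivDiv.symCurlPoly, symCurlOf, curlOf, this]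
  · have hr : ∀ i, restr a b (p K i) = restr a b (p L i) := fun i => by
      rw [← sub_eq_zero, ← map_sub, restr_eq_zero_iff]
      intro s
      rw [ev_sub, hp.edge K hK L hL a b h1 h2 h3 h4 hab i, sub_self]
    have hd := (dist_pos.2 hab).ne'
    refine ⟨fun s => mul_left_cancel₀ hd ?_, fun s => mul_left_cancel₀ (pow_ne_zero 2 hd) ?_⟩
    · rw [polyNN_symCurlPoly hab, polyNN_symCurlPoly hab]
      simp only [hr]
    · rw [polyShear_symCurlPoly hab, polyShear_symCurlPoly hab]
      simp only [hr]

omit hΩ hM in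
lemma rtPoly_family (g : (Fin 2 → ℝ) × ℝ) : IsVFamily M ℓ fun _ => rtPoly g :=
  ⟨fun _ _ i => rtPoly_mem_polyDeg g i _, by simp, by simp⟩

omit hΩ hM in
lemma rt_eq_rtPoly (hr : r ∈ RT) : ∃ g, ∀ i, r i = ev (rtPoly g i) := by
  obtain ⟨a, b, h⟩ := hr
  exact ⟨(a, b), fun i => funext fun x => by rw [h, ev_rtPoly]⟩

omit hΩ hM in
lemma ev_rtPoly_mem (g : (Fin 2 → ℝ) × ℝ) : (fun i => ev (rtPoly g i)) ∈ RT :=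
  ⟨g.1, g.2, fun i x => ev_rtPoly g i x⟩

end Mesh

variable {p : Poly}

section Mesh

variable {c : Finset Plane → Plane}

variable (hΩ : IsPolygon Ω) (hM : M.IsMeshOf Ω)

include hΩ hM

lemma rt_subset_vh (hℓ : 2 ≤ ℓ) : RT ⊆ Vh Ω M ℓ := by
  intro r hr
  obtain ⟨g, hg⟩ := rt_eq_rtPoly hr
  exact (mem_vh_iff hΩ hM hℓ).2 ⟨_, rtPoly_family g, fun K _ i => by rw [hg]; exact ae_eq_refl _⟩

lemma exists_isSymCurl_of_mem_vh (hk : 3 ≤ k) (hℓ : k ≤ ℓ + 1) (hv : v ∈ Vh Ω M ℓ) :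
    ∃ τ ∈ SigmaH Ω M c ℓ k, IsSymCurl Ω v τ := by
  obtain ⟨p, hp, hvp⟩ := (mem_vh_iff hΩ hM (by omega)).1 hv
  have h : ∀ K ∈ M.cells, ∀ i j, EqOnCell K (piecewise M fun K => symCurlPoly (p K) i j)
      (symCurlPoly (p K) i j) :=
    fun K hK i j => eqOnCell_piecewise (fun K => symCurlPoly (p K) i j) hK
  exact ⟨fun i j => piecewise M fun K => symCurlPoly (p K) i j,
    (mem_sigmaH_iff hΩ hM hk hℓ).2 ⟨_, hp.symCurlPoly, h⟩, isSymCurl_of_family hΩ hM hp hvp h⟩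

lemma exists_isDivDiv_of_mem_sigmaH (hk : 3 ≤ k) (hℓ : k ≤ ℓ + 1) (hτ : τ ∈ SigmaH Ω M c ℓ k) :
    ∃ q ∈ Qh Ω M k, IsDivDiv Ω τ q := by
  obtain ⟨p, hp, hτp⟩ := (mem_sigmaH_iff hΩ hM hk hℓ).1 hτ
  have h : ∀ K ∈ M.cells, EqOnCell K (piecewise M fun K => divDivPoly (p K)) (divDivPoly (p K)) :=
    fun K hK => eqOnCell_piecewise (fun K => divDivPoly (p K)) hK
  have hd := isDivDiv_of_cells hΩ hM hτp h hp.vert hp.edge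
  exact ⟨_, ⟨hd.2.1, fun K hK => ⟨_, divDivPoly_mem (hp.mem K hK), h K hK⟩⟩, hd⟩

omit hΩ hM in
lemma eqOnCell_zero (hK : K ∈ M.cells) (h : EqOnCell K 0 p) : p = 0 := by
  obtain ⟨a, b, c, ht⟩ := M.isTriple hK
  refine (ht.poly_ext_ae (EventuallyEq.trans ?_ h)).symm
  exact ae_of_all _ fun x => by simp

lemma isSymCurl_zero_iff (hℓ : 2 ≤ ℓ) (hv : v ∈ Vh Ω M ℓ) :
    IsSymCurl Ω v 0 ↔ ∃ r ∈ RT, ∀ i, v i =ᵐ[vol Ω] r i := by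
  constructor
  · intro h
    obtain ⟨p, hp, hvp⟩ := (mem_vh_iff hΩ hM hℓ).1 hv
    have h1 : ∀ K ∈ M.cells, ∃ g, p K = rtPoly g := fun K hK =>
      eq_rtPoly_of_symCurlPoly_eq_zero (funext fun i => funext fun j => eqOnCell_zero hK
        (h.eqOnCell hΩ.isOpen (interior_hull_subset hΩ hM hK) (hvp K hK) i j))
    have h2 : ∃ g, ∀ K ∈ M.cells, p K = rtPoly g := by
      rcases M.cells.eq_empty_or_nonempty with h0 | ⟨K₀, hK₀⟩
      · exact ⟨0, by simp [h0]⟩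
      choose! g hg using h1
      refine ⟨g K₀, fun K hK => ?_⟩
      rw [hg K hK]
      congr 1
      refine eq_of_mesh hΩ hM (F := g) (fun K hK L hL δ h1 h2 => ?_) hK hK₀
      have hj : rtJet (p K) δ = rtJet (p L) δ := by
        have := hp.vert K hK L hL δ h1 h2
        simp [rtJet, this]
      rwa [hg K hK, hg L hL, rtJet_rtPoly, rtJet_rtPoly] at hj
    obtain ⟨g, hg⟩ := h2
    refine ⟨_, ev_rtPoly_mem g, fun i => (ae_restrict_iff_cells hΩ hM).2 fun K hK => ?_⟩
    have := hvp K hK i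
    rwa [hg K hK] at this
  · rintro ⟨r, hr, h⟩
    obtain ⟨g, hg⟩ := rt_eq_rtPoly hr
    refine isSymCurl_of_family (ℓ := ℓ) hΩ hM (rtPoly_family g) (fun K hK i => ?_)
      fun K hK i j => ?_
    · have := (ae_restrict_iff_cells hΩ hM).1 (h i) K hK
      simp only [hg] at this
      exact this
    · rw [symCurlPoly_rtPoly]
      exact ae_of_all _ fun x => by simp

/-- Exactness of the discrete complex at the tensor space. -/
lemma isDivDiv_zero_iff (hk : 3 ≤ k) (hℓ : k ≤ ℓ + 1) (hτ : τ ∈ SigmaH Ω M c ℓ k) :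
    IsDivDiv Ω τ 0 ↔ ∃ v ∈ Vh Ω M ℓ, IsSymCurl Ω v τ := by
  refine ⟨fun h => ?_, fun ⟨v, _, h⟩ => h.isDivDiv⟩
  obtain ⟨p, hp, hτp⟩ := (mem_sigmaH_iff hΩ hM hk hℓ).1 hτ
  have h1 : ∀ K ∈ M.cells, ∃ v : Fin 2 → Poly, (∀ i, v i ∈ polyDeg (ℓ + 1)) ∧
      p K = symCurlPoly v := fun K hK =>
    exists_symCurlPoly_of_divDivPoly_eq_zero (hp.mem K hK) (eqOnCell_zero hK
      (h.eqOnCell hΩ.isOpen (interior_hull_subset hΩ hM hK) (hτp K hK)))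
  choose! v hv hpv using h1
  have h0 : ∀ K ∈ M.cells, ∀ L ∈ M.cells, ∀ δ, δ ∈ K → δ ∈ L → ∀ i j,
      ev (symCurlPoly (v K - v L) i j) δ = 0 := fun K hK L hL δ hδK hδL i j => by
    rw [symCurlPoly_sub, ← hpv K hK, ← hpv L hL]
    simp [hp.vert K hK L hL δ hδK hδL i j]
  have hedge : ∀ K ∈ M.cells, ∀ L ∈ M.cells, ∀ a b, a ∈ K → a ∈ L → b ∈ K → b ∈ L → a ≠ b →
      rtJet (v K - v L) a = rtJet (v K - v L) b ∧ ∀ i s, ev ((v K - v L) i) (edgePt a b s) =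
        (rtJet (v K - v L) a).1 i + (rtJet (v K - v L) a).2 * edgePt a b s i := by
    intro K hK L hL a b haK haL hbK hbL hab
    obtain ⟨e1, e2⟩ := hp.edge K hK L hL a b haK haL hbK hbL hab
    refine edge_rigid hab (fun s => ?_) (fun s => ?_) (h0 K hK L hL a haK haL)
      (h0 K hK L hL b hbK hbL)
    · rw [symCurlPoly_sub, ← hpv K hK, ← hpv L hL, polyNN_sub, e1, sub_self]
    · rw [symCurlPoly_sub, ← hpv K hK, ← hpv L hL, polyShear_sub, e2, sub_self]
  classical
  let j : Finset Plane → Finset Plane → (Fin 2 → ℝ) × ℝ := fun K L =>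
    if h : ∃ δ, δ ∈ K ∧ δ ∈ L then rtJet (v K - v L) h.choose else 0
  have hj : ∀ K ∈ M.cells, ∀ L ∈ M.cells, ∀ δ, δ ∈ K → δ ∈ L → j K L = rtJet (v K - v L) δ := by
    intro K hK L hL δ hδK hδL
    have hex : ∃ δ, δ ∈ K ∧ δ ∈ L := ⟨δ, hδK, hδL⟩
    simp only [j, dif_pos hex]
    by_cases hne : hex.choose = δ
    · rw [hne]
    · exact (hedge K hK L hL _ δ hex.choose_spec.1 hex.choose_spec.2 hδK hδL hne).1
  obtain ⟨r, hr⟩ := exists_potential_of_mesh_cocycle hΩ hM (j := j)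
    fun K hK L hL P hP δ h1 h2 h3 => by
      rw [hj K hK L hL δ h1 h2, hj L hL P hP δ h2 h3, hj K hK P hP δ h1 h3, ← rtJet_add,
        sub_add_sub_cancel]
  have hw : IsVFamily M ℓ fun K => v K + rtPoly (r K) := by
    refine ⟨fun K hK i => add_mem (hv K hK i) (rtPoly_mem_polyDeg _ i _),
      fun K hK L hL δ h1 h2 i => ?_, fun K hK L hL a b h1 h2 h3 h4 hab i s => ?_⟩
    · rw [hr K hK L hL δ h1 h2, hj K hK L hL δ h1 h2]
      have e1 := ev_eq_of_rtJet (v K - v L) δ i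
      have e2 := fun m => pderiv_eq_of_symCurlPoly_eq_zero (h0 K hK L hL δ h1 h2) m i
      simp only [Pi.sub_apply, ev_sub, map_sub] at e1 e2
      refine ⟨?_, fun m => ?_⟩
      · simp only [Pi.add_apply, ev_add, ev_rtPoly, Prod.fst_add, Prod.snd_add]
        linear_combination e1
      · have e3 := e2 m
        simp only [Pi.add_apply, map_add, ev_add, pderiv_rtPoly, Prod.snd_add]
        split_ifs at e3 ⊢ <;> simp <;> linear_combination e3
    · rw [hr K hK L hL a h1 h2, hj K hK L hL a h1 h2]
      have e1 := (hedge K hK L hL a b h1 h2 h3 h4 hab).2 i s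
      simp only [Pi.sub_apply, ev_sub] at e1
      simp only [Pi.add_apply, ev_add, ev_rtPoly, Prod.fst_add, Prod.snd_add]
      linear_combination e1
  have hd : ∀ K ∈ M.cells, ∀ i, EqOnCell K (piecewise M fun K => (v K + rtPoly (r K)) i)
      ((v K + rtPoly (r K)) i) :=
    fun K hK i => eqOnCell_piecewise (fun K => (v K + rtPoly (r K)) i) hK
  refine ⟨fun i => piecewise M fun K => (v K + rtPoly (r K)) i,
    (mem_vh_iff hΩ hM (by omega)).2 ⟨_, hw, hd⟩, isSymCurl_of_family hΩ hM hw hd fun K hK i j => ?_⟩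
  rw [symCurlPoly_add, symCurlPoly_rtPoly, add_zero, ← hpv K hK]
  exact hτp K hK i j

end Mesh

variable {K₀ : Finset Plane} {q : Finset Plane → Poly} {m : ℕ}

/-! ### Surjectivity of `div div` on the discrete spaces -/

lemma eq_C_of_pderiv_eq_zero {p : Poly} (h : ∀ m, pderiv m p = 0) :
    p = MvPolynomial.C (ev p 0) := by
  refine ev_injective fun x => ?_
  have h1 : derivative (restr 0 x p) = 0 := by simp [derivative_restr, h]
  have h2 := congrArg (Polynomial.eval 1) (polynomial_eq_C_of_derivative h1)
  rw [Polynomial.eval_C, eval_restr, eval_restr, edgePt_one, edgePt_zero] at h2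
  simpa using h2

/-- The normal derivative of a polynomial on an edge. -/
def normalDeriv (a b : Plane) (q : Poly) : ℝ[X] :=
  restr a b (∑ i, normal a b i • pderiv i q)

lemma eval_normalDeriv (a b : Plane) (q : Poly) (s : ℝ) : (normalDeriv a b q).eval s =
      ∑ i, normal a b i * ev (pderiv i q) (edgePt a b s) := by
  simp [normalDeriv, eval_restr]

lemma eq_zero_of_hessPoly_eq_zero (hab : a ≠ b) {q : Poly} (h : hessPoly q = 0)
    (h1 : restr a b q = 0) (h2 : normalDeriv a b q = 0) : q = 0 := by
  obtain ⟨e, hc⟩ : ∃ e : Fin 2 → ℝ, ∀ j, pderiv j q = MvPolynomial.C (e j) :=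
    ⟨_, fun j => eq_C_of_pderiv_eq_zero fun m => congrFun (congrFun h m) j⟩
  have h3 := congrArg (Polynomial.eval 0) (derivative_restr a b q)
  have h4 := eval_normalDeriv a b q 0
  rw [h1] at h3
  rw [h2] at h4
  simp only [sum_univ_two, hc] at h3 h4
  simp at h3 h4
  have n0 := dist_mul_tangent hab 0
  have n1 := dist_mul_tangent hab 1
  have hd := dist_sq_eq a b
  have hd0 := pow_ne_zero 2 (dist_pos.2 hab).ne'
  have h5 : (b 1 - a 1) * e 0 - (b 0 - a 0) * e 1 = 0 := by
    linear_combination -dist a b * h4 - e 0 * n1 + e 1 * n0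
  have e0 : dist a b ^ 2 * e 0 = 0 := by
    linear_combination -(b 0 - a 0) * h3 + (b 1 - a 1) * h5 + e 0 * hd
  have e1 : dist a b ^ 2 * e 1 = 0 := by
    linear_combination -(b 1 - a 1) * h3 - (b 0 - a 0) * h5 + e 1 * hd
  have hz : ∀ j, pderiv j q = 0 := by
    intro j
    rw [hc j]
    fin_cases j
    · simp [(mul_eq_zero.1 e0).resolve_left hd0]
    · simp [(mul_eq_zero.1 e1).resolve_left hd0]
  have hq := eq_C_of_pderiv_eq_zero hz
  have h5 := restr_eq_zero_iff.1 h1 0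
  rw [hq, ev_C] at h5
  rw [hq, h5, map_zero]

lemma lineForm_self_nonneg (f : ℝ[X]) : 0 ≤ lineForm f f :=
  intervalIntegral.integral_nonneg zero_le_one fun _ _ => mul_self_nonneg _

lemma eq_zero_of_lineForm_self {f : ℝ[X]} (h : lineForm f f = 0) : f = 0 :=
  polynomial_eq_zero_of_integral (w := 1) (by simp) (by rw [one_mul]; exact h)

lemma lineForm_comp (f q : ℝ[X]) : lineForm (f.comp (1 - X)) q = lineForm f (q.comp (1 - X)) := by
  have := integral_comp_sub_left (a := 0) (b := 1) (fun s => f.eval s * q.eval (1 - s)) 1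
  simpa [lineForm] using this

lemma restr_swap (a b : Plane) (p : Poly) : restr b a p = (restr a b p).comp (1 - X) :=
  Polynomial.funext fun s => by simp [eval_restr, edgePt_swap a b]

lemma normalDeriv_swap (a b : Plane) (p : Poly) :
    normalDeriv b a p = -(normalDeriv a b p).comp (1 - X) := by
  refine Polynomial.funext fun s => ?_
  simp [eval_normalDeriv, edgePt_swap a b, normal_swap a b]

lemma orient_swap (K : Finset Plane) (a b : Plane) : orient K b a = -orient K a b := by
  simp only [orient]
  rw [← Real.sign_neg, ← Finset.sum_neg_distrib]
  exact congrArg _ (sum_congr rfl fun c _ => det_swap a b c)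

lemma edgeTerm_ev_ev (a b : Plane) (p : TensorPoly) (q : Poly) (ha : ∀ i j, ev (p i j) a = 0)
    (hb : ∀ i j, ev (p i j) b = 0) :
    edgeTerm a b (fun i j => ev (p i j)) (ev q) =
      edgeMoment a b (polyNN a b p) (normalDeriv a b q) -
        edgeMoment a b (polyShear a b p) (restr a b q) := by
  rw [edgeTerm_ev]
  simp only [ha, hb, edgeMoment, partialD_ev, ← eval_normalDeriv]
  simp only [← eval_restr, ← eval_nnPoly, ← eval_shearPoly]
  rw [intervalIntegral.integral_sub, mul_sub]
  · simp
  · exact ((nnPoly a b p).continuous.mul (normalDeriv a b q).continuous).intervalIntegrable _ _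
  · exact ((shearPoly a b p).continuous.mul (restr a b q).continuous).intervalIntegrable _ _

lemma normalDeriv_mem {q : Poly} (a b : Plane) (hq : q ∈ polyDeg (m + 1)) :
    normalDeriv a b q ∈ degreeLT ℝ (m + 1) :=
  restr_mem_degreeLT a b (sum_mem fun i _ =>
    smul_mem _ _ (pderiv_mem_polyDeg i hq))

lemma tensorForm_self_nonneg (K : Finset Plane) (p : TensorPoly) : 0 ≤ tensorForm K p p := by
  change 0 ≤ ∑ i, ∑ j, cellForm K (p i j) (p i j)
  exact sum_nonneg fun _ _ => sum_nonneg fun _ _ =>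
    integral_nonneg fun _ => mul_self_nonneg _

lemma IsTriple.eq_zero_of_tensorForm_self {c : Plane} (h : IsTriple K a b c) {p : TensorPoly}
    (hp : tensorForm K p p = 0) : p = 0 := by
  have hn : ∀ i j, 0 ≤ cellForm K (p i j) (p i j) := fun i j =>
    integral_nonneg fun _ => mul_self_nonneg _
  change ∑ i, ∑ j, cellForm K (p i j) (p i j) = 0 at hp
  have h1 := (sum_eq_zero_iff_of_nonneg fun i _ =>
    sum_nonneg fun j _ => hn i j).1 hp
  ext1 i; ext1 j
  exact h.poly_eq_zero_of_integral_sq ((sum_eq_zero_iff_of_nonneg fun j _ => hn i j).1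
    (h1 i (Finset.mem_univ i)) j (Finset.mem_univ j))

section Mesh

variable {c : Finset Plane → Plane}

lemma IsSigmaFamily.of_eq {p : Finset Plane → TensorPoly} (hk : 3 ≤ k) (hℓ : k ≤ ℓ + 1)
    {T : Plane → Fin 2 → Fin 2 → ℝ} {N S : Plane → Plane → ℝ[X] → ℝ}
    (hp : ∀ K ∈ M.cells, p K ∈ SigmaLocal ℓ k (c K))
    (h1 : ∀ K ∈ M.cells, ∀ δ ∈ K, ∀ i j, ev (p K i j) δ = T δ i j) (h2 : ∀ K ∈ M.cells, ∀ a ∈ K, ∀ b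
    ∈ K, a ≠ b → (∀ q ∈ degreeLT ℝ (ℓ - 1), edgeMoment a b (polyNN a b (p K)) q = N a b q) ∧ ∀ q ∈
    degreeLT ℝ ℓ, edgeMoment a b (polyShear a b (p K)) q = S a b q) : IsSigmaFamily M c ℓ k p := by
  refine ⟨hp, fun K hK L hL δ hδ hδ' i j => by rw [h1 K hK δ hδ, h1 L hL δ hδ'],
    fun K hK L hL a b haK haL hbK hbL hab => ?_⟩
  obtain ⟨n1, s1⟩ := h2 K hK a haK b hbK hab
  obtain ⟨n2, s2⟩ := h2 L hL a haL b hbL hab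
  exact ⟨sigmaLocal_polyNN_eq hk hℓ (hp K hK) (hp L hL) hab
      (fun i j => by rw [h1 K hK a haK, h1 L hL a haL])
      (fun i j => by rw [h1 K hK b hbK, h1 L hL b hbL]) fun q hq => by rw [n1 q hq, n2 q hq],
    polyShear_eq_of_moments hab (shearPoly_mem hk hℓ (hp K hK) hab)
      (shearPoly_mem hk hℓ (hp L hL) hab) fun q hq => by rw [s1 q hq, s2 q hq]⟩

lemma polyNN_eq_eval (a b : Plane) (p : TensorPoly) (s : ℝ) :
    polyNN a b p s = (nnLin a b p).eval s := (eval_nnPoly a b p s).symm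

lemma polyShear_eq_eval (a b : Plane) (p : TensorPoly) (s : ℝ) :
    polyShear a b p s = (shearLin a b p).eval s := (eval_shearPoly a b p s).symm

lemma sigmaLocal_add {c : Plane} {p q : TensorPoly} (hp : p ∈ SigmaLocal ℓ k c)
    (hq : q ∈ SigmaLocal ℓ k c) : p + q ∈ SigmaLocal ℓ k c := by
  obtain ⟨v, hv, z, hz, h⟩ := hp
  obtain ⟨w, hw, y, hy, h'⟩ := hq
  refine ⟨v + w, fun i => add_mem (hv i) (hw i), z + y, add_mem hz hy, fun i j => ?_⟩
  simp only [Pi.add_apply, h, h', symCurlPoly_add]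
  ring

lemma sigmaLocal_smul {c : Plane} {p : TensorPoly} (r : ℝ) (hp : p ∈ SigmaLocal ℓ k c) :
    r • p ∈ SigmaLocal ℓ k c := by
  obtain ⟨v, hv, z, hz, h⟩ := hp
  refine ⟨r • v, fun i => smul_mem _ _ (hv i), r • z, smul_mem _ _ hz, fun i j => ?_⟩
  have := congrFun (congrFun (map_smul symCurlLin r v) i) j
  change symCurlPoly (r • v) i j = r • symCurlPoly v i j at this
  simp only [Pi.smul_apply, h, this, smul_add, mul_smul_comm]

lemma IsSigmaFamily.add {p q : Finset Plane → TensorPoly} (hp : IsSigmaFamily M c ℓ k p)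
    (hq : IsSigmaFamily M c ℓ k q) : IsSigmaFamily M c ℓ k (p + q) := by
  refine ⟨fun K hK => sigmaLocal_add (hp.mem K hK) (hq.mem K hK), fun K hK L hL δ h1 h2 i j => ?_,
    fun K hK L hL a b h1 h2 h3 h4 hab => ?_⟩
  · simp [hp.vert K hK L hL δ h1 h2, hq.vert K hK L hL δ h1 h2]
  · obtain ⟨e1, e2⟩ := hp.edge K hK L hL a b h1 h2 h3 h4 hab
    obtain ⟨f1, f2⟩ := hq.edge K hK L hL a b h1 h2 h3 h4 hab
    simp only [polyNN_eq_eval, polyShear_eq_eval] at e1 e2 f1 f2 ⊢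
    exact ⟨fun s => by simp [e1, f1], fun s => by simp [e2, f2]⟩

lemma IsSigmaFamily.smul {p : Finset Plane → TensorPoly} (r : ℝ) (hp : IsSigmaFamily M c ℓ k p) :
    IsSigmaFamily M c ℓ k (r • p) := by
  refine ⟨fun K hK => sigmaLocal_smul r (hp.mem K hK), fun K hK L hL δ h1 h2 i j => ?_,
    fun K hK L hL a b h1 h2 h3 h4 hab => ?_⟩
  · simp [hp.vert K hK L hL δ h1 h2]
  · obtain ⟨e1, e2⟩ := hp.edge K hK L hL a b h1 h2 h3 h4 hab
    simp only [polyNN_eq_eval, polyShear_eq_eval] at e1 e2 ⊢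
    exact ⟨fun s => by simp [e1], fun s => by simp [e2]⟩

variable (hΩ : IsPolygon Ω) (hM : M.IsMeshOf Ω)

include hΩ hM

/-- Some edge lies on the boundary. -/
lemma exists_unshared_edge (hK₀ : K₀ ∈ M.cells) : ∃ K ∈ M.cells, ∃ a ∈ K, ∃ b ∈ K, a ≠ b ∧
      ∀ L ∈ M.cells, a ∈ L → b ∈ L → L = K := by
  by_contra! hcon
  have h0 := sum_orient_mul_eq_zero hΩ hM
    (F := fun _ a b => rot (b - a) 0 * ∫ s in (0 : ℝ)..1, ev (MvPolynomial.X 0) (edgePt a b s))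
    (fun _ _ _ _ _ _ _ _ _ _ _ => rfl) (fun K hK a ha b hb hab hout => by
      obtain ⟨L, hL, haL, hbL, hne⟩ := hcon K hK a ha b hb hab
      exact absurd (edgePt_mem_of_shared hΩ hM hK hL hne hab ha hb haL hbL (s := 1 / 2)
        (by norm_num)) (hout _ (by norm_num)))
  have h1 : ∀ K ∈ M.cells, 1 / 2 * ∑ a ∈ K, ∑ b ∈ K, orient K a b *
      (rot (b - a) 0 * ∫ s in (0 : ℝ)..1, ev (MvPolynomial.X 0) (edgePt a b s)) =
      cellForm K 1 1 := by
    intro K hK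
    obtain ⟨a, b, c, h⟩ := M.isTriple hK
    rw [← h.green ((contDiff_ev _).of_le (by simp)) 0]
    simp
  have h2 : ∑ K ∈ M.cells, cellForm K 1 1 = 0 := by rw [← sum_congr rfl h1, ← mul_sum, h0, mul_zero]
  obtain ⟨a, b, c, h⟩ := M.isTriple hK₀
  exact one_ne_zero (h.poly_eq_zero_of_integral_sq ((sum_eq_zero_iff_of_nonneg fun K _ =>
    integral_nonneg fun _ => mul_self_nonneg _).1 h2 K₀ hK₀))

open Classical in
omit hΩ hM in
/-- The sum over all triangles that contain the edge, with signs. -/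
def jump (M : Triangulation) (G : Finset Plane → Plane → Plane → ℝ[X]) (a b : Plane) :
    ℝ[X] :=
  ∑ K ∈ M.cells, (if a ∈ K ∧ b ∈ K then orient K a b else 0) • G K a b

omit hΩ hM in
lemma jump_swap {G : Finset Plane → Plane → Plane → ℝ[X]} (r : ℝ)
    (h : ∀ K a b, G K b a = r • (G K a b).comp (1 - X)) (a b : Plane) :
    jump M G b a = -(r • (jump M G a b).comp (1 - X)) := by
  simp only [jump, Polynomial.sum_comp, smul_sum, ← Finset.sum_neg_distrib]
  refine sum_congr rfl fun K _ => ?_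
  rw [h K a b, orient_swap K a b]
  by_cases ha : a ∈ K <;> by_cases hb : b ∈ K <;> simp [ha, hb, smul_comm r]

omit hΩ hM in
lemma sum_orient_lineForm (M : Triangulation) (G : Finset Plane → Plane → Plane → ℝ[X]) :
    ∃ V : Finset Plane, (∀ K ∈ M.cells, K ⊆ V) ∧
      ∑ K ∈ M.cells, ∑ a ∈ K, ∑ b ∈ K, orient K a b * lineForm (jump M G a b) (G K a b) =
        ∑ a ∈ V, ∑ b ∈ V, lineForm (jump M G a b) (jump M G a b) := by
  classical
  refine ⟨M.cells.biUnion id, fun K hK => Finset.subset_biUnion_of_mem id hK, ?_⟩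
  set V := M.cells.biUnion id
  have h1 : ∀ K ∈ M.cells, ∑ a ∈ K, ∑ b ∈ K, orient K a b * lineForm (jump M G a b) (G K a b) =
      ∑ a ∈ V, ∑ b ∈ V, lineForm (jump M G a b)
        ((if a ∈ K ∧ b ∈ K then orient K a b else 0) • G K a b) := by
    intro K hK
    have hV : K ⊆ V := Finset.subset_biUnion_of_mem id hK
    rw [← Finset.sum_subset hV]
    · refine sum_congr rfl fun a ha => ?_
      rw [← Finset.sum_subset hV]
      · refine sum_congr rfl fun b hb => ?_
        simp [ha, hb]
      · intro b _ hb; simp [hb]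
    · intro a _ ha; simp [ha]
  rw [sum_congr rfl h1, sum_comm]
  refine sum_congr rfl fun a _ => ?_
  rw [sum_comm]
  refine sum_congr rfl fun b _ => ?_
  conv_rhs => enter [2]; rw [jump]
  rw [map_sum]

omit hΩ hM in
lemma jump_eq_of_unshared {G : Finset Plane → Plane → Plane → ℝ[X]} (hK : K ∈ M.cells) (ha : a ∈ K)
    (hb : b ∈ K) (h : ∀ L ∈ M.cells, a ∈ L → b ∈ L → L = K) :
    jump M G a b = orient K a b • G K a b := by
  classical
  rw [jump, Finset.sum_eq_single_of_mem K hK]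
  · simp [ha, hb]
  · intro L hL hne
    rw [if_neg fun h' => hne (h L hL h'.1 h'.2), zero_smul]

omit hΩ hM in
lemma jump_eq_of_shared {G : Finset Plane → Plane → Plane → ℝ[X]} {L : Finset Plane}
    (hK : K ∈ M.cells) (hL : L ∈ M.cells) (hne : L ≠ K) (hab : a ≠ b) (ha : a ∈ K) (hb : b ∈ K)
    (ha' : a ∈ L) (hb' : b ∈ L) : jump M G a b = orient K a b • (G K a b - G L a b) := by
  classical
  rw [jump, Finset.sum_eq_add K L hne.symm]
  · simp [ha, hb, ha', hb', M.orient_neg hK hL hne hab ha hb ha' hb', sub_eq_add_neg]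
  · rintro P hP ⟨h1, h2⟩
    rw [if_neg, zero_smul]
    rintro ⟨h3, h4⟩
    obtain ⟨c, h⟩ := M.exists_isTriple hK ha hb hab
    have e1 := M.orient_neg hK hL hne hab ha hb ha' hb'
    have e2 := M.orient_neg hK hP h1 hab ha hb h3 h4
    have e3 := M.orient_neg hL hP h2 hab ha' hb' h3 h4
    exact h.orient_ne_zero (by linarith)
  · exact fun h => absurd hK h
  · exact fun h => absurd hL h

/-- A cellwise polynomial that is orthogonal to all `div div` of discrete tensors vanishes. -/
lemma eq_zero_of_orthogonal (hk : 3 ≤ k) (hℓ : k ≤ ℓ + 1)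
    (hq : ∀ K ∈ M.cells, q K ∈ polyDeg (k - 2)) (h : ∀ p, IsSigmaFamily M c ℓ k p → ∑ K ∈ M.cells,
    cellForm K (divDivPoly (p K)) (q K) = 0) : ∀ K ∈ M.cells, q K = 0 := by
  set G : Finset Plane → Plane → Plane → ℝ[X] := fun K a b => normalDeriv a b (q K) with hG
  set H : Finset Plane → Plane → Plane → ℝ[X] := fun K a b => restr a b (q K) with hH
  have hGm : ∀ K ∈ M.cells, ∀ a b, G K a b ∈ degreeLT ℝ (ℓ - 1) := fun K hK a b =>
    degreeLT_mono (by omega) (normalDeriv_mem (m := k - 3) a b (polyDeg_mono (by omega) (hq K hK)))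
  have hHm : ∀ K ∈ M.cells, ∀ a b, H K a b ∈ degreeLT ℝ ℓ := fun K hK a b =>
    degreeLT_mono (by omega) (restr_mem_degreeLT a b (hq K hK))
  have hN : ∀ a b q, (-lineForm (jump M G b a)) q =
      (-lineForm (jump M G a b)) (q.comp (1 - X)) := fun a b q => by
    rw [jump_swap (-1) (fun K a b => by simp [hG, normalDeriv_swap a b])]
    simp [lineForm_comp]
  have hS : ∀ a b q, lineForm (jump M H b a) q =
      -lineForm (jump M H a b) (q.comp (1 - X)) := fun a b q => by
    rw [jump_swap 1 (fun K a b => by simp [hH, restr_swap a b])]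
    simp [lineForm_comp]
  have hex : ∀ K ∈ M.cells, ∃ p ∈ SigmaLocal ℓ k (c K), (∀ δ ∈ K, ∀ i j, ev (p i j) δ = 0) ∧
      (∀ x ∈ K, ∀ y ∈ K, x ≠ y →
        (∀ z ∈ degreeLT ℝ (ℓ - 1), edgeMoment x y (polyNN x y p) z = (-lineForm (jump M G x y)) z) ∧
        ∀ z ∈ degreeLT ℝ ℓ, edgeMoment x y (polyShear x y p) z = lineForm (jump M H x y) z) ∧
      (∀ z ∈ polyDeg (k - 2), tensorForm K p (hessPoly z) =
        tensorForm K (hessPoly (q K)) (hessPoly z)) := by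
    intro K hK
    obtain ⟨x, y, z, ht⟩ := M.isTriple hK
    obtain ⟨p, h1, h2, h3, h4, -⟩ := ht.exists_sigma (c K) hk hℓ 0 (by simp)
      (fun a b => -lineForm (jump M G a b)) (fun a b => lineForm (jump M H a b)) hN hS
      (tensorForm K (hessPoly (q K)) ∘ₗ hessLin)
      (fun z hz => by
        change tensorForm K _ (hessPoly z) = 0
        rw [hessPoly_eq_zero hz, map_zero]) 0
    exact ⟨p, h1, h2, h3, h4⟩
  choose! p h1 h2 h3 h4 using hex
  have hp : IsSigmaFamily M c ℓ k p := IsSigmaFamily.of_eq hk hℓ h1 (T := 0) h2 h3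
  have hcell : ∀ K ∈ M.cells, cellForm K (divDivPoly (p K)) (q K) =
      tensorForm K (hessPoly (q K)) (hessPoly (q K)) +
      1 / 2 * (∑ a ∈ K, ∑ b ∈ K, orient K a b * lineForm (jump M G a b) (G K a b) +
        ∑ a ∈ K, ∑ b ∈ K, orient K a b * lineForm (jump M H a b) (H K a b)) := by
    intro K hK
    obtain ⟨x, y, z, ht⟩ := M.isTriple hK
    have e1 := ht.green_divDivPoly (p K) (contDiff_two_ev (q K))
    simp only [partialD_ev] at e1
    have e2 := h4 K hK (q K) (hq K hK)
    rw [tensorForm_apply] at e2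
    have e3 : ∑ a ∈ K, ∑ b ∈ K, orient K a b * edgeTerm a b (fun i j => ev (p K i j)) (ev (q K)) =
        -(∑ a ∈ K, ∑ b ∈ K, orient K a b * lineForm (jump M G a b) (G K a b) +
        ∑ a ∈ K, ∑ b ∈ K, orient K a b * lineForm (jump M H a b) (H K a b)) := by
      simp only [← sum_add_distrib, ← Finset.sum_neg_distrib]
      refine sum_congr rfl fun a ha => sum_congr rfl fun b hb => ?_
      by_cases hab : a = b
      · simp [hab]
      rw [edgeTerm_ev_ev a b (p K) (q K) (h2 K hK a ha) (h2 K hK b hb),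
        (h3 K hK a ha b hb hab).1 _ (hGm K hK a b), (h3 K hK a ha b hb hab).2 _ (hHm K hK a b)]
      simp only [LinearMap.neg_apply]
      ring
    rw [e3] at e1
    rw [← e2]
    simp only [hessPoly, cellForm_apply]
    linear_combination -e1
  have hsum := h p hp
  obtain ⟨V, hV, eV⟩ := sum_orient_lineForm M G
  obtain ⟨W, hW, eW⟩ := sum_orient_lineForm M H
  rw [sum_congr rfl hcell, sum_add_distrib, ← mul_sum, sum_add_distrib, eV, eW] at hsum
  have n1 : ∀ K ∈ M.cells, 0 ≤ tensorForm K (hessPoly (q K)) (hessPoly (q K)) := fun K _ =>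
    tensorForm_self_nonneg K _
  have n2 := fun a b => lineForm_self_nonneg (jump M G a b)
  have n3 := fun a b => lineForm_self_nonneg (jump M H a b)
  have s1 := sum_nonneg n1
  have s2 : 0 ≤ ∑ a ∈ V, ∑ b ∈ V, lineForm (jump M G a b) (jump M G a b) :=
    sum_nonneg fun a _ => sum_nonneg fun b _ => n2 a b
  have s3 : 0 ≤ ∑ a ∈ W, ∑ b ∈ W, lineForm (jump M H a b) (jump M H a b) :=
    sum_nonneg fun a _ => sum_nonneg fun b _ => n3 a b
  have hess : ∀ K ∈ M.cells, hessPoly (q K) = 0 := by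
    intro K hK
    obtain ⟨x, y, z, ht⟩ := M.isTriple hK
    exact ht.eq_zero_of_tensorForm_self ((sum_eq_zero_iff_of_nonneg n1).1 (by linarith) K hK)
  have hJ : ∀ K ∈ M.cells, ∀ a ∈ K, ∀ b ∈ K, jump M G a b = 0 := fun K hK a ha b hb =>
    eq_zero_of_lineForm_self ((sum_eq_zero_iff_of_nonneg fun b _ => n2 a b).1
      ((sum_eq_zero_iff_of_nonneg fun a _ => sum_nonneg fun b _ => n2 a b).1
        (by linarith) a (hV K hK ha)) b (hV K hK hb))
  have hJ' : ∀ K ∈ M.cells, ∀ a ∈ K, ∀ b ∈ K, jump M H a b = 0 := fun K hK a ha b hb =>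
    eq_zero_of_lineForm_self ((sum_eq_zero_iff_of_nonneg fun b _ => n3 a b).1
      ((sum_eq_zero_iff_of_nonneg fun a _ => sum_nonneg fun b _ => n3 a b).1
        (by linarith) a (hW K hK ha)) b (hW K hK hb))
  have ho : ∀ K ∈ M.cells, ∀ a ∈ K, ∀ b ∈ K, a ≠ b → orient K a b ≠ 0 := fun K hK a ha b hb hab =>
    (M.exists_isTriple hK ha hb hab).choose_spec.orient_ne_zero
  have hshare : ∀ K ∈ M.cells, ∀ L ∈ M.cells, ∀ a b, a ∈ K → b ∈ K → a ∈ L → b ∈ L → a ≠ b →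
      q K = q L := by
    intro K hK L hL a b ha hb ha' hb' hab
    by_cases hne : L = K
    · rw [hne]
    have e1 := hJ K hK a ha b hb
    have e2 := hJ' K hK a ha b hb
    rw [jump_eq_of_shared hK hL hne hab ha hb ha' hb', smul_eq_zero] at e1 e2
    have e3 := e1.resolve_left (ho K hK a ha b hb hab)
    have e4 := e2.resolve_left (ho K hK a ha b hb hab)
    rw [← sub_eq_zero]
    refine eq_zero_of_hessPoly_eq_zero hab ?_ (by rw [map_sub]; exact e4) ?_
    · have := map_sub hessLin (q K) (q L)
      change hessPoly _ = hessPoly _ - hessPoly _ at this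
      rw [this, hess K hK, hess L hL, sub_zero]
    · rw [← e3]
      refine Polynomial.funext fun s => ?_
      simp only [hG, eval_normalDeriv, eval_sub, map_sub, ev_sub, mul_sub, sum_sub_distrib]
  intro K hK
  obtain ⟨L, hL, a, ha, b, hb, hab, hout⟩ := exists_unshared_edge hΩ hM hK
  have e1 := hJ L hL a ha b hb
  have e2 := hJ' L hL a ha b hb
  rw [jump_eq_of_unshared hL ha hb hout, smul_eq_zero] at e1 e2
  rw [eq_of_mesh hΩ hM (F := q) (fun K hK L hL δ h1 h2 => eq_of_common_vertex hΩ hM (δ := δ)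
    (fun K hK L hL h1 h2 b h3 h4 h5 => hshare K hK L hL δ b h1 h3 h2 h4 h5.symm) hK hL h1 h2) hK hL]
  exact eq_zero_of_hessPoly_eq_zero hab (hess L hL) (e2.resolve_left (ho L hL a ha b hb hab))
    (e1.resolve_left (ho L hL a ha b hb hab))

lemma exists_family_divDiv (hk : 3 ≤ k) (hℓ : k ≤ ℓ + 1) (hq : ∀ K ∈ M.cells, q K ∈ polyDeg (k - 2))
    :
    ∃ p, IsSigmaFamily M c ℓ k p ∧ ∀ K ∈ M.cells, divDivPoly (p K) = q K := by
  classical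
  let R : Submodule ℝ (M.cells → polyDeg (k - 2)) :=
    { carrier := {d | ∃ p, IsSigmaFamily M c ℓ k p ∧ ∀ K : M.cells, divDivPoly (p K) = d K}
      add_mem' := by
        rintro d e ⟨p, hp, h⟩ ⟨p', hp', h'⟩
        refine ⟨p + p', hp.add hp', fun K => ?_⟩
        simp only [Pi.add_apply, Submodule.coe_add, ← h, ← h', divDivPoly, map_add, sum_add_distrib]
      zero_mem' := ⟨0, ⟨fun K hK => ⟨0, by simp, 0, by simp, by
        simp [symCurlPoly, symCurlOf, curlOf]⟩, by simp, fun _ _ _ _ _ _ _ _ _ _ _ => by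
        simp [polyNN_eq_eval, polyShear_eq_eval]⟩, fun K => by simp [divDivPoly]⟩
      smul_mem' := by
        rintro r d ⟨p, hp, h⟩
        refine ⟨r • p, hp.smul r, fun K => ?_⟩
        simp only [Pi.smul_apply, Submodule.coe_smul, ← h, divDivPoly, pderiv_smul, smul_sum] }
  have hR : R = ⊤ := by
    by_contra hne
    obtain ⟨f, hf, hle⟩ := R.exists_le_ker_of_lt_top (lt_top_iff_ne_top.2 hne)
    have hrep : ∀ K : M.cells, ∃ z ∈ polyDeg (k - 2), ∀ y : polyDeg (k - 2),
        cellForm K z y = f (Pi.single K y) := by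
      rintro ⟨K, hK⟩
      obtain ⟨a, b, c, ht⟩ := M.isTriple hK
      obtain ⟨g, hg⟩ := (f ∘ₗ LinearMap.single ℝ (fun _ => polyDeg (k - 2)) ⟨K, hK⟩).exists_extend
      obtain ⟨z, hz, h⟩ := ht.exists_cellForm_eq (k - 2) g
      exact ⟨z, hz, fun y => (h y y.2).trans (DFunLike.congr_fun hg y)⟩
    choose z hz hzf using hrep
    have hfsum : ∀ d, f d = ∑ K : M.cells, cellForm K (d K) (z K) := by
      intro d
      conv_lhs => rw [← Finset.univ_sum_single d]
      rw [map_sum]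
      refine sum_congr rfl fun K _ => ?_
      rw [← hzf, cellForm_apply, cellForm_apply]
      simp only [mul_comm]
    let z' : Finset Plane → Poly := fun K => if hK : K ∈ M.cells then z ⟨K, hK⟩ else 0
    have hz' : ∀ K : M.cells, z' K = z K := fun K => by simp [z']
    have h0 := eq_zero_of_orthogonal (c := c) hΩ hM hk hℓ (q := z')
      (fun K hK => by rw [hz' ⟨K, hK⟩]; exact hz _) fun p hp => by
        have hd : (fun K : M.cells => (⟨divDivPoly (p K), divDivPoly_mem (hp.mem K K.2)⟩ :
            polyDeg (k - 2))) ∈ R := ⟨p, hp, fun K => rfl⟩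
        have := hfsum _ ▸ LinearMap.mem_ker.1 (hle hd)
        rw [← this, ← Finset.sum_coe_sort]
        exact sum_congr rfl fun K _ => by rw [hz']
    refine hf (LinearMap.ext fun d => ?_)
    rw [hfsum, sum_eq_zero]
    · rfl
    · intro K _
      rw [← hz', h0 K K.2, map_zero]
  obtain ⟨p, hp, h⟩ : (fun K : M.cells => (⟨q K, hq K K.2⟩ : polyDeg (k - 2))) ∈ R :=
    hR ▸ Submodule.mem_top
  exact ⟨p, hp, fun K hK => h ⟨K, hK⟩⟩

lemma exists_isDivDiv_eq (hk : 3 ≤ k) (hℓ : k ≤ ℓ + 1) {q : ScalarField} (hq : q ∈ Qh Ω M k) :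
    ∃ τ ∈ SigmaH Ω M c ℓ k, IsDivDiv Ω τ q := by
  have h1 := hq.2
  choose! z hz hqz using h1
  obtain ⟨p, hp, h⟩ := exists_family_divDiv (c := c) hΩ hM hk hℓ hz
  have ht : ∀ K ∈ M.cells, ∀ i j, EqOnCell K (piecewise M fun K => p K i j) (p K i j) :=
    fun K hK i j => eqOnCell_piecewise (fun K => p K i j) hK
  exact ⟨fun i j => piecewise M fun K => p K i j, (mem_sigmaH_iff hΩ hM hk hℓ).2 ⟨p, hp, ht⟩,
    isDivDiv_of_cells hΩ hM ht (fun K hK => by rw [h K hK]; exact hqz K hK) hp.vert hp.edge⟩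

end Mesh

variable {y : Plane}

/-! ### Smoothing -/

/-- The convolution of `f` with a normalised bump. -/
def mollify (ρ : ContDiffBump (0 : Plane)) (f : ScalarField) (y : Plane) : ℝ :=
  ∫ t, f t * ρ.normed volume (y - t)

lemma mollify_eq_convolution (ρ : ContDiffBump (0 : Plane)) (f : ScalarField) :
    mollify ρ f = convolution f (ρ.normed volume) (ContinuousLinearMap.mul ℝ ℝ) volume := rfl

lemma mollify_eq (ρ : ContDiffBump (0 : Plane)) (f : ScalarField) (y : Plane) :
    mollify ρ f y = ∫ s, ρ.normed volume s * f (y - s) := by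
  rw [mollify, ← integral_sub_left_eq_self _ volume y]
  simp [mul_comm]

lemma contDiff_mollify (ρ : ContDiffBump (0 : Plane)) (hf : LocallyIntegrable f) :
    ContDiff ℝ ∞ (mollify ρ f) := by
  rw [mollify_eq_convolution]
  exact ρ.hasCompactSupport_normed.contDiff_convolution_right _ hf (ρ.contDiff_normed (n := ⊤))

lemma partialD_mollify (ρ : ContDiffBump (0 : Plane)) (hf : LocallyIntegrable f) (m : Fin 2)
    (y : Plane) : partialD m (mollify ρ f) y = ∫ t, f t * partialD m (ρ.normed volume) (y - t) := by
  have hc : ContDiff ℝ 1 (ρ.normed (volume : Measure Plane)) := ρ.contDiff_normed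
  have h1 := ρ.hasCompactSupport_normed.hasFDerivAt_convolution_right
    (ContinuousLinearMap.mul ℝ ℝ) hf hc y
  rw [← mollify_eq_convolution] at h1
  rw [partialD, h1.fderiv, convolution_precompR_apply _ hf
    (ρ.hasCompactSupport_normed.fderiv ℝ) (hc.continuous_fderiv one_ne_zero)]
  rfl

lemma integrable_mul_normed (ρ : ContDiffBump (0 : Plane)) (hf : LocallyIntegrable f) (y : Plane) :
    Integrable fun t => f t * ρ.normed volume (y - t) :=
  ρ.hasCompactSupport_normed.convolutionExists_right (ContinuousLinearMap.mul ℝ ℝ) hf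
    ρ.continuous_normed y

lemma mollify_sub (ρ : ContDiffBump (0 : Plane)) {g : ScalarField} (hf : LocallyIntegrable f)
    (hg : LocallyIntegrable g) : mollify ρ (f - g) = mollify ρ f - mollify ρ g := by
  funext y
  simp only [mollify, Pi.sub_apply, sub_mul]
  exact integral_sub (integrable_mul_normed ρ hf y) (integrable_mul_normed ρ hg y)

lemma abs_mollify_sub_le (ρ : ContDiffBump (0 : Plane)) (hf : Continuous f) {a ε : ℝ}
    (h : ∀ z, dist z y < ρ.rOut → |f z - a| ≤ ε) : |mollify ρ f y - a| ≤ ε := by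
  have e1 : mollify ρ f y - a = ∫ s, ρ.normed volume s * (f (y - s) - a) := by
    have hi : Integrable fun s => ρ.normed volume s * f (y - s) :=
      (ρ.continuous_normed.mul (hf.comp (continuous_const.sub continuous_id)))
        |>.integrable_of_hasCompactSupport ρ.hasCompactSupport_normed.mul_right
    simp only [mul_sub]
    rw [integral_sub hi (ρ.integrable_normed.mul_const a), integral_mul_const, ρ.integral_normed,
      one_mul, mollify_eq]
  rw [e1, ← Real.norm_eq_abs]
  refine (norm_integral_le_of_norm_le (ρ.integrable_normed.mul_const ε)
    (ae_of_all _ fun s => ?_)).trans ?_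
  · rw [norm_mul, Real.norm_of_nonneg (ρ.nonneg_normed s)]
    by_cases hs : s ∈ Metric.ball (0 : Plane) ρ.rOut
    · refine mul_le_mul_of_nonneg_left (h _ ?_) (ρ.nonneg_normed s)
      simpa [dist_eq_norm] using hs
    · rw [← ρ.support_normed_eq (μ := volume), Function.notMem_support] at hs
      simp [hs]
  · rw [integral_mul_const, ρ.integral_normed, one_mul]

lemma eLpNorm_two_sq {α : Type*} [MeasurableSpace α] (μ : Measure α) (f : α → ℝ) :
    eLpNorm f 2 μ ^ 2 = ∫⁻ x, ‖f x‖ₑ ^ 2 ∂μ := by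
  have := eLpNorm_nnreal_pow_eq_lintegral (μ := μ) (f := f) (p := 2) two_ne_zero
  simpa [ENNReal.rpow_two] using this

lemma lintegral_normed (ρ : ContDiffBump (0 : Plane)) :
    ∫⁻ s, ENNReal.ofReal (ρ.normed volume s) = 1 := by
  rw [← ofReal_integral_eq_lintegral_ofReal ρ.integrable_normed
    (ae_of_all _ fun s => ρ.nonneg_normed s), ρ.integral_normed, ENNReal.ofReal_one]

lemma eLpNorm_mollify_le (ρ : ContDiffBump (0 : Plane)) (hf : MemLp f 2 (volume : Measure Plane)) :
    eLpNorm (mollify ρ f) 2 volume ≤ eLpNorm f 2 volume := by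
  wlog hm : StronglyMeasurable f generalizing f
  · have h1 := this (hf.ae_eq hf.1.ae_eq_mk) hf.1.stronglyMeasurable_mk
    rw [eLpNorm_congr_ae hf.1.ae_eq_mk]
    convert h1 using 2
    funext y
    exact integral_congr_ae (hf.1.ae_eq_mk.mul (ae_eq_refl _))
  let ν : Measure Plane := volume.withDensity fun s => ENNReal.ofReal (ρ.normed volume s)
  have hmd : Measurable fun s => ENNReal.ofReal (ρ.normed (volume : Measure Plane) s) :=
    ρ.continuous_normed.measurable.ennreal_ofReal
  have hν : IsProbabilityMeasure ν := ⟨by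
    rw [withDensity_apply _ MeasurableSet.univ, setLIntegral_univ, lintegral_normed]⟩
  have hpt : ∀ y, ‖mollify ρ f y‖ₑ ^ 2 ≤ ∫⁻ s, ‖f (y - s)‖ₑ ^ 2 ∂ν := by
    intro y
    have hfy : StronglyMeasurable fun s => f (y - s) :=
      hm.comp_measurable (measurable_const.sub measurable_id)
    have h1 : ‖mollify ρ f y‖ₑ ≤ eLpNorm (fun s => f (y - s)) 1 ν := by
      rw [mollify_eq, eLpNorm_one_eq_lintegral_enorm,
        lintegral_withDensity_eq_lintegral_mul _ hmd hfy.measurable.enorm]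
      refine (enorm_integral_le_lintegral_enorm _).trans (lintegral_mono fun s => ?_)
      rw [enorm_mul, Real.enorm_eq_ofReal (ρ.nonneg_normed s)]
      rfl
    rw [← eLpNorm_two_sq]
    exact pow_le_pow_left' (h1.trans (eLpNorm_le_eLpNorm_of_exponent_le (by norm_num)
      hfy.aestronglyMeasurable)) 2
  have h2 : eLpNorm (mollify ρ f) 2 volume ^ 2 ≤ eLpNorm f 2 volume ^ 2 := by
    rw [eLpNorm_two_sq, eLpNorm_two_sq]
    refine (lintegral_mono hpt).trans ?_
    rw [lintegral_lintegral_swap]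
    · simp only [lintegral_sub_right_eq_self (fun y => ‖f y‖ₑ ^ 2)]
      simp
    · have : Measurable fun z : Plane × Plane => f (z.1 - z.2) :=
        hm.measurable.comp (measurable_fst.sub measurable_snd)
      exact (this.enorm.pow_const 2).aemeasurable
  exact (ENNReal.pow_le_pow_left_iff two_ne_zero).1 h2

variable {C : Set Plane} {θ : ℝ}

/-- The contraction with centre `c` and factor `θ`. -/
def contract (c : Plane) (θ : ℝ) (x : Plane) : Plane := c + θ • (x - c)

lemma contDiff_contract (c : Plane) (θ : ℝ) : ContDiff ℝ ∞ (contract c θ) :=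
  contDiff_const.add ((contDiff_id.sub contDiff_const).const_smul θ)

lemma hasFDerivAt_contract (c : Plane) (θ : ℝ) (x : Plane) :
    HasFDerivAt (contract c θ) (θ • ContinuousLinearMap.id ℝ Plane) x :=
  (((hasFDerivAt_id x).sub_const c).const_smul θ).const_add c

lemma partialD_comp_contract (hf : ContDiff ℝ 1 f) (c : Plane) (θ : ℝ) (m : Fin 2) (x : Plane) :
    partialD m (f ∘ contract c θ) x = θ * partialD m f (contract c θ x) := by
  have h1 := ((hf.differentiable one_ne_zero) (contract c θ x)).hasFDerivAt.comp x
    (hasFDerivAt_contract c θ x)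
  rw [partialD, h1.fderiv]
  simp [partialD]

lemma eLpNorm_comp_contract_le (hf : AEStronglyMeasurable f volume) (c : Plane) (hθ : 1 / 2 ≤ θ) :
    eLpNorm (f ∘ contract c θ) 2 volume ≤ 2 * eLpNorm f 2 volume := by
  have hθ0 : θ ≠ 0 := by linarith
  have e0 : contract c θ = (fun y => (c - θ • c) + y) ∘ fun x => θ • x := by
    funext x
    simp only [contract, Function.comp_apply, smul_sub]
    abel
  have hmap : Measure.map (contract c θ) volume = ENNReal.ofReal |(θ ^ 2)⁻¹| • volume := by
    rw [e0, ← Measure.map_map (measurable_const_add _) (measurable_const_smul θ),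
      Measure.map_addHaar_smul _ hθ0, finrank_euclideanSpace_fin, Measure.map_smul]
    congr 1
    exact map_add_left_eq_self volume _
  have hqm : AEStronglyMeasurable f (Measure.map (contract c θ) volume) := by
    rw [hmap]; exact hf.smul_measure _
  have h1 := eLpNorm_map_measure (p := 2) hqm
    ((contDiff_contract c θ).continuous.measurable.aemeasurable (μ := volume))
  rw [← h1, hmap, eLpNorm_smul_measure_of_ne_top (by norm_num)]
  rw [smul_eq_mul]
  gcongr
  have h2 : ENNReal.ofReal |(θ ^ 2)⁻¹| ≤ (2 : ENNReal) ^ (2 : ℝ) := by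
    rw [show (2 : ENNReal) ^ (2 : ℝ) = ENNReal.ofReal 4 by rw [ENNReal.rpow_ofNat]; norm_num]
    refine ENNReal.ofReal_le_ofReal ?_
    rw [abs_of_nonneg (by positivity)]
    rw [inv_le_comm₀ (by positivity) (by norm_num)]
    nlinarith
  calc _ ≤ ((2 : ENNReal) ^ (2 : ℝ)) ^ (1 / (2 : ENNReal)).toReal :=
        ENNReal.rpow_le_rpow h2 (by positivity)
    _ = 2 := by rw [← ENNReal.rpow_mul]; norm_num

lemma MemL2.indicator (hU : MeasurableSet U) (h : MemL2 U u) : MemLp (U.indicator u) 2 volume :=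
  (memLp_indicator_iff_restrict hU).2 h

lemma mollify_indicator (ρ : ContDiffBump (0 : Plane)) (hU : MeasurableSet U) (u : ScalarField)
    (y : Plane) : mollify ρ (U.indicator u) y = ∫ t in U, u t * ρ.normed volume (y - t) := by
  rw [mollify, ← integral_indicator hU]
  congr 1
  funext t
  by_cases ht : t ∈ U <;> simp [ht]

/-- Smoothing on a convex set by contracting it and convolving with a bump;
this commutes with weak derivatives up to a factor tending to one. -/
theorem exists_smoothing (hC : Convex ℝ C) (hne : (interior C).Nonempty) (hb : IsBounded C) :
    ∃ (S : ℕ → ScalarField → ScalarField) (θ : ℕ → ℝ), Tendsto θ atTop (𝓝 1) ∧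
      (∀ n u, MemL2 (interior C) u → ContDiff ℝ ∞ (S n u)) ∧
      (∀ u, MemL2 (interior C) u → Tendsto (fun n => eLpNorm (fun x => S n u x - u x) 2
        (vol (interior C))) atTop (𝓝 0)) ∧
      ∀ n m u g, HasWeakPartial (interior C) m u g →
        ∀ x ∈ C, partialD m (S n u) x = θ n * S n g x := by
  obtain ⟨c, hc⟩ := hne
  set U := interior C with hUdef
  have hUm : MeasurableSet U := isOpen_interior.measurableSet
  obtain ⟨r, hr, hball⟩ := Metric.isOpen_iff.1 isOpen_interior c hc
  let δ : ℕ → ℝ := fun n => 1 / ((n : ℝ) + 2)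
  have hδ : ∀ n, 0 < δ n := fun n => by positivity
  have hδ2 : ∀ n, δ n ≤ 1 / 2 := fun n => by
    refine one_div_le_one_div_of_le (by norm_num) ?_
    linarith [Nat.cast_nonneg (α := ℝ) n]
  have hδ0 : Tendsto δ atTop (𝓝 0) :=
    tendsto_const_nhds.div_atTop (tendsto_atTop_add_const_right _ _ tendsto_natCast_atTop_atTop)
  let ρ : ℕ → ContDiffBump (0 : Plane) := fun n =>
    ⟨δ n * r / 4, δ n * r / 2, by have := hδ n; positivity, by nlinarith [mul_pos (hδ n) hr]⟩
  have hsub : ∀ n, ∀ x ∈ C, ∀ z, dist z (contract c (1 - δ n) x) ≤ δ n * r / 2 → z ∈ U := by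
    intro n x hx z hz
    have hd := hδ n
    let w : Plane := c + (δ n)⁻¹ • (z - contract c (1 - δ n) x)
    have hw : w ∈ interior C := by
      refine hball ?_
      rw [Metric.mem_ball, dist_eq_norm]
      simp only [w, add_sub_cancel_left, norm_smul, norm_inv, Real.norm_of_nonneg hd.le]
      rw [dist_eq_norm] at hz
      calc (δ n)⁻¹ * ‖z - contract c (1 - δ n) x‖ ≤ (δ n)⁻¹ * (δ n * r / 2) := by gcongr
        _ = r / 2 := by field_simp
        _ < r := by linarith
    have h1 := hC.combo_self_interior_mem_interior hx hw (a := 1 - δ n) (b := δ n)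
      (by linarith [hδ2 n]) hd (by ring)
    convert h1 using 1
    simp only [w, smul_add, smul_smul, mul_inv_cancel₀ hd.ne', one_smul, contract]
    module
  let S : ℕ → ScalarField → ScalarField := fun n u =>
    mollify (ρ n) (U.indicator u) ∘ contract c (1 - δ n)
  have hloc : ∀ u, MemL2 U u → LocallyIntegrable (U.indicator u) volume := fun u hu =>
    (hu.indicator hUm).locallyIntegrable (by norm_num)
  refine ⟨S, fun n => 1 - δ n, by simpa using hδ0.const_sub 1, fun n u hu =>
    (contDiff_mollify (ρ n) (hloc u hu)).comp (contDiff_contract _ _), ?_, ?_⟩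
  · intro u hu
    have hui := hu.indicator hUm
    rw [ENNReal.tendsto_nhds_zero]
    intro ε hε
    rcases eq_or_ne ε ⊤ with rfl | hεt
    · simp
    obtain ⟨f, hfs, hfu, hfc, hf2⟩ := hui.exists_hasCompactSupport_eLpNorm_sub_le
      (p := 2) (by norm_num) (ε := ε / 4) (by simp [hε.ne'])
    obtain ⟨R, hR0, hR⟩ := hb.subset_ball_lt 0 c
    have hfun : UniformContinuous f := hfs.uniformContinuous_of_continuous hfc
    have hfin : volume U ≠ ⊤ := ((measure_mono interior_subset).trans_lt hb.measure_lt_top).ne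
    obtain ⟨κ, hκ, hκε⟩ : ∃ κ : ℝ, 0 < κ ∧
        volume U ^ (1 / (2 : ENNReal)).toReal * ENNReal.ofReal κ ≤ ε / 4 := by
      have hV : volume U ^ (1 / (2 : ENNReal)).toReal ≠ ⊤ :=
        ENNReal.rpow_ne_top_of_nonneg (by positivity) hfin
      have ht : Tendsto (fun κ : ℝ => volume U ^ (1 / (2 : ENNReal)).toReal * ENNReal.ofReal κ)
          (𝓝[>] 0) (𝓝 0) := by
        have h0 : Tendsto (fun κ : ℝ => ENNReal.ofReal κ) (𝓝[>] 0) (𝓝 0) := by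
          have := (ENNReal.continuous_ofReal.tendsto 0).mono_left
            (nhdsWithin_le_nhds (s := Set.Ioi (0 : ℝ)))
          simpa using this
        simpa using ENNReal.Tendsto.const_mul h0 (Or.inr hV)
      have h1 := (ENNReal.tendsto_nhds_zero.1 ht (ε / 4) (by simp [hε.ne'])).and self_mem_nhdsWithin
      obtain ⟨κ, h1, h2⟩ := h1.exists
      exact ⟨κ, h2, h1⟩
    obtain ⟨d, hd, hdf⟩ := Metric.uniformContinuous_iff.1 hfun κ hκ
    have hev : ∀ᶠ n in atTop, δ n * (r + R) < d := by
      have := hδ0.mul_const (r + R)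
      rw [zero_mul] at this
      exact this.eventually_lt_const hd
    filter_upwards [hev] with n hn
    have hsplit : ∀ x ∈ U, S n u x - u x =
        (mollify (ρ n) (U.indicator u - f) ∘ contract c (1 - δ n)) x +
          ((mollify (ρ n) f (contract c (1 - δ n) x) - f x) - (U.indicator u - f) x) := by
      intro x hx
      rw [mollify_sub (ρ n) (hloc u hu) hfc.locallyIntegrable]
      simp [S, hx]
    have hcc := (contDiff_contract c (1 - δ n)).continuous
    have hm1 := (contDiff_mollify (ρ n) ((hloc u hu).sub hfc.locallyIntegrable)).continuous
    have hm2 := (((contDiff_mollify (ρ n) hfc.locallyIntegrable).continuous.comp hcc).sub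
      hfc).aestronglyMeasurable (μ := volume)
    have hA : eLpNorm (mollify (ρ n) (U.indicator u - f) ∘ contract c (1 - δ n)) 2
        (vol U) ≤ 2 * (ε / 4) := by
      refine (eLpNorm_mono_measure _ Measure.restrict_le_self).trans ?_
      refine (eLpNorm_comp_contract_le hm1.aestronglyMeasurable c (by linarith [hδ2 n])).trans ?_
      gcongr
      exact (eLpNorm_mollify_le (ρ n) (hui.sub hf2)).trans hfu
    have hB : eLpNorm (fun x => mollify (ρ n) f (contract c (1 - δ n) x) - f x) 2
        (vol U) ≤ ε / 4 := by
      refine le_trans (eLpNorm_le_of_ae_bound (C := κ) ?_) ?_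
      · filter_upwards [ae_restrict_mem hUm] with x hx
        refine abs_mollify_sub_le (ρ n) hfc fun z hz => ?_
        rw [← Real.dist_eq]
        refine (hdf ?_).le
        have hxc : ‖x - c‖ < R := by rw [← dist_eq_norm]; exact hR (interior_subset hx)
        have e1 : dist (contract c (1 - δ n) x) x = δ n * ‖x - c‖ := by
          rw [dist_eq_norm, contract,
            show c + (1 - δ n) • (x - c) - x = -(δ n • (x - c)) by module, norm_neg, norm_smul,
            Real.norm_of_nonneg (hδ n).le]
        have hz' : dist z (contract c (1 - δ n) x) < δ n * r / 2 := hz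
        have := dist_triangle z (contract c (1 - δ n) x) x
        nlinarith [mul_pos (hδ n) hr, mul_le_mul_of_nonneg_left hxc.le (hδ n).le]
      · rw [Measure.restrict_apply_univ]
        simpa using hκε
    have hD : eLpNorm (U.indicator u - f) 2 (vol U) ≤ ε / 4 :=
      (eLpNorm_mono_measure _ Measure.restrict_le_self).trans hfu
    calc eLpNorm (fun x => S n u x - u x) 2 (vol U)
        = eLpNorm (mollify (ρ n) (U.indicator u - f) ∘ contract c (1 - δ n) +
          ((fun x => mollify (ρ n) f (contract c (1 - δ n) x) - f x) - (U.indicator u - f))) 2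
          (vol U) :=
          eLpNorm_congr_ae ((ae_restrict_mem hUm).mono fun x hx => hsplit x hx)
      _ ≤ 2 * (ε / 4) + (ε / 4 + ε / 4) := by
          have hm3 := (hui.sub hf2).1
          refine (eLpNorm_add_le (hm1.comp hcc).aestronglyMeasurable (hm2.sub hm3).restrict
            (by norm_num)).trans (add_le_add hA ?_)
          exact (eLpNorm_sub_le hm2.restrict hm3.restrict (by norm_num)).trans (add_le_add hB hD)
      _ = ε := by
          rw [← two_mul (ε / 4), ← two_mul (2 * (ε / 4)), ← mul_assoc]
          norm_num
          exact ENNReal.mul_div_cancel (by norm_num) (by norm_num)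
  · intro n m u g hug x hx
    set y := contract c (1 - δ n) x with hy
    have hT : IsTest U fun t => (ρ n).normed volume (y - t) := by
      have hcont : ContDiff ℝ ∞ ((ρ n).normed (volume : Measure Plane)) :=
        (ρ n).contDiff_normed (n := ⊤)
      have hts : ∀ t, (ρ n).normed volume (y - t) ≠ 0 → dist t y ≤ δ n * r / 2 := by
        intro t ht
        have : y - t ∈ Metric.ball (0 : Plane) (ρ n).rOut := by
          rw [← (ρ n).support_normed_eq (μ := volume)]; exact ht
        rw [mem_ball_zero_iff, ← dist_eq_norm, dist_comm] at this
        exact this.le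
      have hts' : tsupport (fun t => (ρ n).normed volume (y - t)) ⊆
          Metric.closedBall y (δ n * r / 2) :=
        closure_minimal (fun t ht => hts t ht) Metric.isClosed_closedBall
      exact ⟨hcont.comp (contDiff_const.sub contDiff_id),
        (isCompact_closedBall _ _).of_isClosed_subset (isClosed_tsupport _) hts',
        fun t ht => hsub n x hx t (hts' ht)⟩
    have hd : ∀ t, partialD m (fun t => (ρ n).normed volume (y - t)) t =
        -partialD m ((ρ n).normed volume) (y - t) := by
      intro t
      have hc1 : ContDiff ℝ 1 ((ρ n).normed (volume : Measure Plane)) := (ρ n).contDiff_normed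
      have h1 := ((hc1.differentiable one_ne_zero) (y - t)).hasFDerivAt.comp t
        ((hasFDerivAt_id t).const_sub y)
      rw [partialD, show (fun t => (ρ n).normed volume (y - t)) =
        (ρ n).normed volume ∘ fun t => y - t from rfl, h1.fderiv]
      simp [partialD]
    have hS1 : ContDiff ℝ 1 (mollify (ρ n) (U.indicator u)) :=
      (contDiff_mollify (ρ n) (hloc u hug.1)).of_le (by simp)
    simp only [S]
    rw [partialD_comp_contract hS1, partialD_mollify (ρ n) (hloc u hug.1), Function.comp_apply,
      mollify_indicator _ hUm]
    congr 1
    have h2 := hug.2.2 _ hT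
    simp only [hd, mul_neg, integral_neg, neg_inj] at h2
    rw [← h2, ← integral_indicator hUm]
    congr 1
    funext t
    by_cases ht : t ∈ U <;> simp [ht, hy]

variable {d : ℝ}

/-! ### Traces and point values are controlled by Sobolev norms -/

lemma partialD_coord_sub (c : Plane) (i m : Fin 2) (x : Plane) :
    partialD m (fun y : Plane => y i - c i) x = if i = m then 1 else 0 := by
  have h1 : HasFDerivAt (fun y : Plane => y i - c i) (EuclideanSpace.proj i : Plane →L[ℝ] ℝ) x :=
    ((EuclideanSpace.proj i : Plane →L[ℝ] ℝ).hasFDerivAt).sub_const _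
  rw [partialD, h1.fderiv]
  simp [unitVec]

/-- Green's formula for the field `φ² (x - c)`. -/
lemma IsTriple.trace_identity (h : IsTriple K a b c) (hφ : ContDiff ℝ 1 φ) :
    |det (b - a) (c - a)| * ∫ s in (0 : ℝ)..1, φ (edgePt a b s) ^ 2 =
      ∫ x in hull K, (2 * φ x ^ 2 + ∑ m, 2 * φ x * partialD m φ x * (x m - c m)) := by
  have hc : ∀ m : Fin 2, ContDiff ℝ 1 fun y : Plane => y m - c m := fun m =>
    (EuclideanSpace.proj m : Plane →L[ℝ] ℝ).contDiff.sub contDiff_const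
  have hf : ∀ m : Fin 2, ContDiff ℝ 1 fun y : Plane => (φ y * φ y) * (y m - c m) := fun m =>
    (hφ.mul hφ).mul (hc m)
  have hφd := hφ.differentiable one_ne_zero
  have hd : ∀ (m : Fin 2) x, partialD m (fun y : Plane => (φ y * φ y) * (y m - c m)) x =
      φ x ^ 2 + 2 * φ x * partialD m φ x * (x m - c m) := by
    intro m x
    rw [partialD_mul m ((hφd x).fun_mul (hφd x)) ((hc m).differentiable one_ne_zero x),
      partialD_coord_sub, partialD_mul m (hφd x) (hφd x), if_pos rfl]
    ring
  have hI : ∀ m, IntegrableOn (fun x => partialD m (fun y : Plane => (φ y * φ y) * (y m - c m)) x)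
      (hull K) := fun m =>
    (continuous_partialD (hf m) le_rfl m).continuousOn.integrableOn_compact (isCompact_hull K)
  have hint : ∀ (m : Fin 2) (a b : Plane), IntervalIntegrable (fun s =>
      (φ (edgePt a b s) * φ (edgePt a b s)) * (edgePt a b s m - c m)) volume 0 1 := fun m a b =>
    ((hf m).continuous.comp (continuous_edgePt a b)).intervalIntegrable _ _
  have key : ∀ a' b' : Plane, ∑ m, rot (b' - a') m * ∫ s in (0 : ℝ)..1,
      (φ (edgePt a' b' s) * φ (edgePt a' b' s)) * (edgePt a' b' s m - c m) =
      det (b' - a') (c - a') * ∫ s in (0 : ℝ)..1, φ (edgePt a' b' s) ^ 2 := by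
    intro a' b'
    simp only [sum_univ_two]
    rw [← intervalIntegral.integral_const_mul, ← intervalIntegral.integral_const_mul,
      ← intervalIntegral.integral_add ((hint 0 a' b').const_mul _) ((hint 1 a' b').const_mul _),
      ← intervalIntegral.integral_const_mul]
    congr 1
    funext s
    simp only [edgePt_eq, rot, det, PiLp.sub_apply, PiLp.add_apply, PiLp.smul_apply, smul_eq_mul,
      Matrix.cons_val_zero, Matrix.cons_val_one]
    ring
  have hG : ∑ m, ∫ x in hull K, partialD m (fun y : Plane => (φ y * φ y) * (y m - c m)) x =
      1 / 2 * ∑ a' ∈ K, ∑ b' ∈ K, orient K a' b' *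
        (det (b' - a') (c - a') * ∫ s in (0 : ℝ)..1, φ (edgePt a' b' s) ^ 2) := by
    simp only [h.green (hf _), ← mul_sum, ← key]
    rw [sum_comm]
    congr 1
    refine sum_congr rfl fun a' _ => ?_
    rw [sum_comm]
    exact sum_congr rfl fun b' _ => by rw [mul_sum]
  have hL : ∫ x in hull K, (2 * φ x ^ 2 + ∑ m, 2 * φ x * partialD m φ x * (x m - c m)) =
      ∑ m, ∫ x in hull K, partialD m (fun y : Plane => (φ y * φ y) * (y m - c m)) x := by
    rw [← integral_finsetSum _ fun m _ => hI m]
    congr 1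
    funext x
    simp only [hd, sum_univ_two]
    ring
  rw [hL, hG, h.sum_eq]
  simp only [h.sum_eq, orient_self]
  have e1 : det (c - a) (c - a) = 0 := by simp [det]; ring
  have e2 : det (c - b) (c - b) = 0 := by simp [det]; ring
  have e3 : ∀ d : Plane, det d (c - c) = 0 := fun d => by simp [det]
  rw [e1, e2, e3, e3, h.orient_eq, h.swap.orient_eq, det_swap a b c, Real.sign_neg]
  have e4 : ∫ s in (0 : ℝ)..1, φ (edgePt b a s) ^ 2 = ∫ s in (0 : ℝ)..1, φ (edgePt a b s) ^ 2 :=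
    integral_edgePt_swap (fun x => φ x ^ 2) a b
  have hs : |det (b - a) (c - a)| = Real.sign (det (b - a) (c - a)) * det (b - a) (c - a) := by
    rcases lt_or_gt_of_ne h.det_ne with h | h
    · rw [Real.sign_of_neg h, abs_of_neg h]; ring
    · rw [Real.sign_of_pos h, abs_of_pos h]; ring
  rw [e4, hs]
  ring

lemma integrableOn_hull (hf : Continuous f) : IntegrableOn f (hull K) :=
  hf.continuousOn.integrableOn_compact (isCompact_hull K)

lemma IsTriple.trace_le (h : IsTriple K a b c) (hd : ∀ x ∈ hull K, ∀ m, |x m - c m| ≤ d)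
    (hφ : ContDiff ℝ 1 φ) :
    |det (b - a) (c - a)| * ∫ s in (0 : ℝ)..1, φ (edgePt a b s) ^ 2 ≤
      4 * (∫ x in hull K, φ x ^ 2) + d ^ 2 * ∑ m, ∫ x in hull K, partialD m φ x ^ 2 := by
  rw [h.trace_identity hφ]
  have hc : ∀ m, Continuous (partialD m φ) := fun m => continuous_partialD hφ le_rfl m
  have hx : ∀ m : Fin 2, Continuous fun x : Plane => x m := fun m =>
    (EuclideanSpace.proj m : Plane →L[ℝ] ℝ).continuous
  have i1 : IntegrableOn (fun x => φ x ^ 2) (hull K) := integrableOn_hull (hφ.continuous.pow 2)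
  have i2 : ∀ m, IntegrableOn (fun x => partialD m φ x ^ 2) (hull K) := fun m =>
    integrableOn_hull ((hc m).pow 2)
  have i3 : Continuous fun x => 2 * φ x ^ 2 + ∑ m, 2 * φ x * partialD m φ x * (x m - c m) :=
    (continuous_const.mul (hφ.continuous.pow 2)).add (continuous_finsetSum _ fun m _ =>
      ((continuous_const.mul hφ.continuous).mul (hc m)).mul ((hx m).sub continuous_const))
  have e : 4 * (∫ x in hull K, φ x ^ 2) + d ^ 2 * ∑ m, ∫ x in hull K, partialD m φ x ^ 2 =
      ∫ x in hull K, (4 * φ x ^ 2 + d ^ 2 * ∑ m, partialD m φ x ^ 2) := by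
    rw [integral_add (i1.const_mul _) ((integrable_finsetSum _ fun m _ => i2 m).const_mul _),
      integral_const_mul, integral_const_mul, integral_finsetSum _ fun m _ => i2 m]
  rw [e]
  refine setIntegral_mono_on (integrableOn_hull i3) ((i1.const_mul _).add
    ((integrable_finsetSum _ fun m _ => i2 m).const_mul _)) (measurableSet_hull K) fun x hxK => ?_
  have hm : ∀ m : Fin 2, 2 * φ x * partialD m φ x * (x m - c m) ≤
      φ x ^ 2 + d ^ 2 * partialD m φ x ^ 2 := by
    intro m
    have h1 : (x m - c m) ^ 2 ≤ d ^ 2 := sq_le_sq' (by linarith [abs_le.1 (hd x hxK m)])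
      (abs_le.1 (hd x hxK m)).2
    nlinarith [sq_nonneg (φ x - partialD m φ x * (x m - c m)),
      mul_le_mul_of_nonneg_left h1 (sq_nonneg (partialD m φ x))]
  simp only [sum_univ_two]
  linarith [hm 0, hm 1]

/-- The one-dimensional Sobolev inequality at an end point. -/
lemma sq_le_integral_sq {f f' : ℝ → ℝ} (hf : ∀ s, HasDerivAt f (f' s) s) (hf' : Continuous f') :
    f 0 ^ 2 ≤ 2 * (∫ s in (0 : ℝ)..1, f s ^ 2) + ∫ s in (0 : ℝ)..1, f' s ^ 2 := by
  have hfc : Continuous f := continuous_iff_continuousAt.2 fun s => (hf s).continuousAt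
  have h1 : ∀ s, HasDerivAt (fun s => (s - 1) * f s ^ 2)
      (f s ^ 2 + (s - 1) * (2 * f s * f' s)) s := fun s => by
    have := ((hasDerivAt_id s).sub_const 1).mul ((hf s).pow 2)
    refine this.congr_deriv ?_
    simp
  have hc : Continuous fun s => f s ^ 2 + (s - 1) * (2 * f s * f' s) := by fun_prop
  have h2 := integral_eq_sub_of_hasDerivAt (a := 0) (b := 1) (fun s _ => h1 s)
    (hc.intervalIntegrable _ _)
  have h3 : f 0 ^ 2 = ∫ s in (0 : ℝ)..1, (f s ^ 2 + (s - 1) * (2 * f s * f' s)) := by rw [h2]; ring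
  rw [h3, ← intervalIntegral.integral_const_mul, ← intervalIntegral.integral_add
    (Continuous.intervalIntegrable (by fun_prop) _ _)
    (Continuous.intervalIntegrable (by fun_prop) _ _)]
  refine integral_mono_on zero_le_one (hc.intervalIntegrable _ _)
    (Continuous.intervalIntegrable (by fun_prop) _ _) fun s hs => ?_
  have h4 : (s - 1) ^ 2 ≤ 1 := by nlinarith [hs.1, hs.2]
  nlinarith [sq_nonneg (f s + f' s * (1 - s)), mul_le_mul_of_nonneg_left h4 (sq_nonneg (f' s))]

lemma IsTriple.exists_sub_triple (h : IsTriple K a b c) (hx : x ∈ hull K)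
    (ha : 1 / 3 ≤ bary b c a x) :
    ∃ K' : Finset Plane, IsTriple K' x (x + (1 / 6 : ℝ) • (b - a)) (x + (1 / 6 : ℝ) • (c - a)) ∧
      hull K' ⊆ hull K := by
  classical
  refine ⟨{x, x + (1 / 6 : ℝ) • (b - a), x + (1 / 6 : ℝ) • (c - a)}, ⟨by simp, ?_⟩, ?_⟩
  · have := h.det_ne
    simp only [det, PiLp.sub_apply, PiLp.add_apply, PiLp.smul_apply, smul_eq_mul] at this ⊢
    intro h0
    apply this
    linarith
  · obtain ⟨h1, h2, h3⟩ := h.mem_hull_iff.1 hx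
    have hd := h.det_ne
    have e1 : det (b - a) (b - a) = 0 := by simp [det]; ring
    have e2 : det (c - b) (b - a) = -det (b - a) (c - a) := by simp [det]; ring
    have e3 : det (c - b) (c - a) = -det (b - a) (c - a) := by simp [det]; ring
    have e4 : det (a - c) (b - a) = det (b - a) (c - a) := by simp [det]; ring
    have e5 : det (a - c) (c - a) = 0 := by simp [det]; ring
    refine convexHull_min ?_ (convex_hull K)
    simp only [Finset.coe_insert, Finset.coe_singleton, Set.insert_subset_iff,
      Set.singleton_subset_iff]
    refine ⟨hx, h.mem_hull_iff.2 ?_, h.mem_hull_iff.2 ?_⟩ <;>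
    · simp only [bary_add_smul, det_cycle a b c, det_cycle' a b c, e1, e2, e3, e4, e5,
        div_self hd, neg_div]
      refine ⟨?_, ?_, ?_⟩ <;> norm_num <;> linarith

lemma IsTriple.sq_le_of_bary (h : IsTriple K a b c) :
    ∃ C : ℝ, ∀ φ : ScalarField, ContDiff ℝ 2 φ → ∀ x ∈ hull K, 1 / 3 ≤ bary b c a x →
      φ x ^ 2 ≤ C * ((∫ x in hull K, φ x ^ 2) + ∑ m, (∫ x in hull K, partialD m φ x ^ 2) +
        ∑ m, ∑ i, ∫ x in hull K, partialD i (partialD m φ) x ^ 2) := by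
  obtain ⟨d, hd0, hd⟩ : ∃ d : ℝ, 0 ≤ d ∧ ∀ x ∈ hull K, ∀ y ∈ hull K, ∀ m, |x m - y m| ≤ d := by
    refine ⟨Metric.diam (hull K), Metric.diam_nonneg, fun x hx y hy m => ?_⟩
    refine le_trans ?_ (Metric.dist_le_diam_of_mem (isCompact_hull K).isBounded hx hy)
    rw [dist_eq_norm]
    simpa using PiLp.norm_apply_le (x - y) m
  set D := |det ((1 / 6 : ℝ) • (b - a)) ((1 / 6 : ℝ) • (c - a))| with hD
  have hDpos : 0 < D := by
    rw [hD, abs_pos]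
    intro h0
    apply h.det_ne
    simp only [det, PiLp.sub_apply, PiLp.smul_apply, smul_eq_mul] at h0 ⊢
    linarith
  refine ⟨(2 + 2 * d ^ 2) * (4 + d ^ 2) / D, fun φ hφ x hx hax => ?_⟩
  obtain ⟨K', h', hsub⟩ := h.exists_sub_triple hx hax
  set y := x + (1 / 6 : ℝ) • (b - a) with hy
  set z := x + (1 / 6 : ℝ) • (c - a) with hz
  have hφ1 : ContDiff ℝ 1 φ := hφ.of_le (by norm_num)
  have hφm : ∀ m, ContDiff ℝ 1 (partialD m φ) := fun m =>
    contDiff_partialD (by rwa [one_add_one_eq_two]) m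
  have hDe : |det (y - x) (z - x)| = D := by simp [hy, hz, hD]
  have hz' : ∀ w ∈ hull K', ∀ m, |w m - z m| ≤ d := fun w hw m =>
    hd w (hsub hw) z (hsub (vertex_mem_hull h'.mem_trd)) m
  have hmono : ∀ {f : ScalarField}, Continuous f →
      ∫ x in hull K', f x ^ 2 ≤ ∫ x in hull K, f x ^ 2 := fun hf =>
    setIntegral_mono_set (integrableOn_hull (hf.pow 2)) (ae_of_all _ fun _ => sq_nonneg _)
      (LE.le.eventuallyLE hsub)
  have tr : ∀ {f : ScalarField}, ContDiff ℝ 1 f → D * ∫ s in (0 : ℝ)..1, f (edgePt x y s) ^ 2 ≤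
      (4 + d ^ 2) * ((∫ x in hull K, f x ^ 2) + ∑ m, ∫ x in hull K, partialD m f x ^ 2) := by
    intro f hf
    have t1 := h'.trace_le hz' hf
    rw [hDe] at t1
    have n1 : 0 ≤ ∫ x in hull K, f x ^ 2 := integral_nonneg fun _ => sq_nonneg _
    have n2 : ∀ m, 0 ≤ ∫ x in hull K, partialD m f x ^ 2 := fun m =>
      integral_nonneg fun _ => sq_nonneg _
    have m1 := hmono hf.continuous
    have m2 := fun m => hmono (continuous_partialD hf le_rfl m)
    simp only [sum_univ_two] at t1 ⊢
    nlinarith [m2 0, m2 1, n2 0, n2 1, sq_nonneg d, mul_le_mul_of_nonneg_left (m2 0) (sq_nonneg d),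
      mul_le_mul_of_nonneg_left (m2 1) (sq_nonneg d), mul_nonneg (sq_nonneg d) n1]
  have hs := sq_le_integral_sq (f := fun s => φ (edgePt x y s))
    (f' := fun s => ∑ m, (y - x) m * partialD m φ (edgePt x y s))
    (fun s => by
      simp only [edgePt_eq]
      exact hasDerivAt_comp_line (hφ1.differentiable one_ne_zero _))
    (continuous_finsetSum _ fun m _ => continuous_const.mul
      ((continuous_partialD hφ1 le_rfl m).comp (continuous_edgePt x y)))
  have hx0 : edgePt x y 0 = x := by simp [edgePt]
  have hyx : ∀ m, (y - x) m ^ 2 ≤ d ^ 2 := fun m => by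
    have := abs_le.1 (hd y (hsub (vertex_mem_hull h'.mem_snd)) x hx m)
    exact sq_le_sq' (by simpa using this.1) (by simpa using this.2)
  have cI : ∀ m, Continuous fun s => partialD m φ (edgePt x y s) := fun m =>
    (continuous_partialD hφ1 le_rfl m).comp (continuous_edgePt x y)
  have hI : ∫ s in (0 : ℝ)..1, (∑ m, (y - x) m * partialD m φ (edgePt x y s)) ^ 2 ≤
      2 * d ^ 2 * ∑ m, ∫ s in (0 : ℝ)..1, partialD m φ (edgePt x y s) ^ 2 := by
    have cII : ∀ m, IntervalIntegrable (fun s => partialD m φ (edgePt x y s) ^ 2) volume 0 1 :=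
      fun m => ((cI m).pow 2).intervalIntegrable _ _
    rw [← intervalIntegral.integral_finsetSum fun m _ => cII m,
      ← intervalIntegral.integral_const_mul]
    refine integral_mono_on zero_le_one
      (((continuous_finsetSum _ fun m _ => continuous_const.mul (cI m)).pow 2).intervalIntegrable
        _ _) ((continuous_const.mul (continuous_finsetSum _ fun m _ =>
        (cI m).pow 2)).intervalIntegrable _ _) fun s _ => ?_
    simp only [sum_univ_two]
    have p0 := mul_le_mul_of_nonneg_right (hyx 0) (sq_nonneg (partialD 0 φ (edgePt x y s)))
    have p1 := mul_le_mul_of_nonneg_right (hyx 1) (sq_nonneg (partialD 1 φ (edgePt x y s)))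
    nlinarith [sq_nonneg ((y - x) 0 * partialD 0 φ (edgePt x y s) -
      (y - x) 1 * partialD 1 φ (edgePt x y s))]
  simp only [hx0] at hs
  have t0 := tr hφ1
  have t1 := fun m => tr (hφm m)
  have n0 : 0 ≤ ∫ x in hull K, φ x ^ 2 := integral_nonneg fun _ => sq_nonneg _
  have n1 : ∀ m, 0 ≤ ∫ x in hull K, partialD m φ x ^ 2 := fun m =>
    integral_nonneg fun _ => sq_nonneg _
  have n2 : ∀ m i, 0 ≤ ∫ x in hull K, partialD i (partialD m φ) x ^ 2 := fun m i =>
    integral_nonneg fun _ => sq_nonneg _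
  rw [div_mul_eq_mul_div, le_div_iff₀ hDpos]
  simp only [sum_univ_two] at *
  set A0 := ∫ s in (0 : ℝ)..1, φ (edgePt x y s) ^ 2
  set A1 := ∫ s in (0 : ℝ)..1, partialD 0 φ (edgePt x y s) ^ 2
  set A2 := ∫ s in (0 : ℝ)..1, partialD 1 φ (edgePt x y s) ^ 2
  set B0 := ∫ x in hull K, φ x ^ 2
  set B1 := fun m => ∫ x in hull K, partialD m φ x ^ 2 with hB1
  set B2 := fun m i => ∫ x in hull K, partialD i (partialD m φ) x ^ 2 with hB2
  have t10 := t1 0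
  have t11 := t1 1
  change D * A1 ≤ (4 + d ^ 2) * (B1 0 + (B2 0 0 + B2 0 1)) at t10
  change D * A2 ≤ (4 + d ^ 2) * (B1 1 + (B2 1 0 + B2 1 1)) at t11
  change D * A0 ≤ (4 + d ^ 2) * (B0 + (B1 0 + B1 1)) at t0
  change _ ≤ (2 + 2 * d ^ 2) * (4 + d ^ 2) * (B0 + (B1 0 + B1 1) +
    (B2 0 0 + B2 0 1 + (B2 1 0 + B2 1 1)))
  have hE : φ x ^ 2 * D ≤ 2 * (D * A0) + 2 * d ^ 2 * (D * A1 + D * A2) := by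
    nlinarith [mul_le_mul_of_nonneg_left (hs.trans (add_le_add_right hI (2 * A0))) hDpos.le]
  have d2 := sq_nonneg d
  have q1 := mul_le_mul_of_nonneg_left (add_le_add t10 t11) (mul_nonneg zero_le_two d2)
  set P := 4 + d ^ 2
  have hP : 0 ≤ P := by positivity
  linarith only [hE, t0, q1, mul_nonneg hP (add_nonneg (add_nonneg (n2 0 0) (n2 0 1))
    (add_nonneg (n2 1 0) (n2 1 1))), mul_nonneg (mul_nonneg d2 hP) n0]

/-- On a triangle the values of a function are controlled by its derivatives of order at most
two in `L²`. -/
lemma IsTriple.sq_le (h : IsTriple K a b c) :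
    ∃ C : ℝ, 0 ≤ C ∧ ∀ φ : ScalarField, ContDiff ℝ 2 φ → ∀ x ∈ hull K,
      φ x ^ 2 ≤ C * ((∫ x in hull K, φ x ^ 2) + ∑ m, (∫ x in hull K, partialD m φ x ^ 2) +
        ∑ m, ∑ i, ∫ x in hull K, partialD i (partialD m φ) x ^ 2) := by
  obtain ⟨C1, h1⟩ := h.sq_le_of_bary
  obtain ⟨C2, h2⟩ := h.rotate.sq_le_of_bary
  obtain ⟨C3, h3⟩ := h.rotate.rotate.sq_le_of_bary
  refine ⟨max 0 (max C1 (max C2 C3)), le_max_left _ _, fun φ hφ x hx => ?_⟩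
  have n0 : 0 ≤ (∫ x in hull K, φ x ^ 2) + ∑ m, (∫ x in hull K, partialD m φ x ^ 2) +
        ∑ m, ∑ i, ∫ x in hull K, partialD i (partialD m φ) x ^ 2 :=
    add_nonneg (add_nonneg (integral_nonneg fun _ => sq_nonneg _)
      (sum_nonneg fun m _ => integral_nonneg fun _ => sq_nonneg _))
      (sum_nonneg fun m _ => sum_nonneg fun i _ =>
        integral_nonneg fun _ => sq_nonneg _)
  have hs := h.bary_sum x
  have : 1 / 3 ≤ bary b c a x ∨ 1 / 3 ≤ bary c a b x ∨ 1 / 3 ≤ bary a b c x := by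
    by_contra! hcon
    linarith [hcon.1, hcon.2.1, hcon.2.2]
  rcases this with hb | hb | hb
  · exact (h1 φ hφ x hx hb).trans (mul_le_mul_of_nonneg_right (by simp) n0)
  · exact (h2 φ hφ x hx hb).trans (mul_le_mul_of_nonneg_right (by simp) n0)
  · exact (h3 φ hφ x hx hb).trans (mul_le_mul_of_nonneg_right (by simp) n0)

variable {H : TensorField} {w : VectorField} {φ : ℕ → ScalarField} {C t : ℝ}

/-! ### Convergence in `L²` -/

/-- Convergence in `L²(μ)`. -/
def TendstoL2 {α : Type*} [MeasurableSpace α] (μ : Measure α) (f : ℕ → α → ℝ) (u : α → ℝ) : Prop :=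
  Tendsto (fun n => eLpNorm (fun x => f n x - u x) 2 μ) atTop (𝓝 0)

namespace TendstoL2

variable {α : Type*} [MeasurableSpace α] {μ : Measure α} {f g : ℕ → α → ℝ} {u v : α → ℝ}

lemma congr_right (h : TendstoL2 μ f u) (huv : u =ᵐ[μ] v) : TendstoL2 μ f v :=
  (tendsto_congr fun n => eLpNorm_congr_ae (huv.mono fun x hx => by simp only [hx])).1 h

lemma congr_left (h : TendstoL2 μ f u) (hfg : ∀ n, f n =ᵐ[μ] g n) : TendstoL2 μ g u :=
  (tendsto_congr fun n => eLpNorm_congr_ae ((hfg n).mono fun x hx => by simp only [hx])).1 h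

lemma add (hf : ∀ n, AEStronglyMeasurable (f n) μ) (hu : AEStronglyMeasurable u μ)
    (hg : ∀ n, AEStronglyMeasurable (g n) μ) (hv : AEStronglyMeasurable v μ) (h1 : TendstoL2 μ f u)
    (h2 : TendstoL2 μ g v) : TendstoL2 μ (fun n x => f n x + g n x) fun x => u x + v x := by
  have h3 := Tendsto.add h1 h2
  rw [add_zero] at h3
  refine tendsto_of_tendsto_of_tendsto_of_le_of_le tendsto_const_nhds h3 (fun _ => zero_le)
    fun n => ?_
  refine le_trans (le_of_eq ?_) (eLpNorm_add_le ((hf n).sub hu) ((hg n).sub hv) (by norm_num))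
  congr 1
  funext x
  simp only [Pi.add_apply]
  ring

lemma const_mul {θ : ℕ → ℝ} (hθ : Tendsto θ atTop (𝓝 t)) (hf : ∀ n, MemLp (f n) 2 μ)
    (hu : MemLp u 2 μ) (h : TendstoL2 μ f u) :
    TendstoL2 μ (fun n x => θ n * f n x) fun x => t * u x := by
  have h1 : Tendsto (fun n => ‖θ n‖ₑ * eLpNorm (fun x => f n x - u x) 2 μ +
      ‖θ n - t‖ₑ * eLpNorm u 2 μ) atTop (𝓝 0) := by
    have a1 : Tendsto (fun n => ‖θ n‖ₑ) atTop (𝓝 ‖t‖ₑ) := (continuous_enorm.tendsto t).comp hθ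
    have a2 : Tendsto (fun n => ‖θ n - t‖ₑ) atTop (𝓝 0) := by
      simpa [Function.comp_def] using (continuous_enorm.tendsto (t - t)).comp (hθ.sub_const t)
    have b1 := ENNReal.Tendsto.mul a1 (Or.inr ENNReal.zero_ne_top) h (Or.inr enorm_ne_top)
    have b2 := ENNReal.Tendsto.mul_const (b := eLpNorm u 2 μ) a2 (Or.inr hu.2.ne)
    simpa using b1.add b2
  refine tendsto_of_tendsto_of_tendsto_of_le_of_le tendsto_const_nhds h1 (fun _ => zero_le)
    fun n => ?_
  have e : (fun x => θ n * f n x - t * u x) = θ n • (fun x => f n x - u x) + (θ n - t) • u := by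
    funext x
    simp only [Pi.add_apply, Pi.smul_apply, smul_eq_mul]
    ring
  show eLpNorm (fun x => θ n * f n x - t * u x) 2 μ ≤ _
  rw [e]
  refine (eLpNorm_add_le ((((hf n).1.sub hu.1) : AEStronglyMeasurable (fun x => f n x - u x) μ
    ).const_smul _) (hu.1.const_smul _) (by norm_num)).trans ?_
  exact add_le_add eLpNorm_const_smul_le eLpNorm_const_smul_le

lemma neg (h : TendstoL2 μ f u) : TendstoL2 μ (fun n x => -f n x) fun x => -u x := by
  refine (tendsto_congr fun n => ?_).1 h
  rw [← eLpNorm_neg]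
  congr 1
  funext x
  simp only [Pi.neg_apply]
  ring

lemma unique (hf : ∀ n, AEStronglyMeasurable (f n) μ) (hu : AEStronglyMeasurable u μ)
    (hv : AEStronglyMeasurable v μ) (h1 : TendstoL2 μ f u) (h2 : TendstoL2 μ f v) : u =ᵐ[μ] v := by
  have h3 := add hf hu (fun n => (hf n).neg) hv.neg h1 h2.neg
  have h4 : eLpNorm (fun x => u x - v x) 2 μ = 0 := by
    refine tendsto_nhds_unique (f := fun _ : ℕ => eLpNorm (fun x => u x - v x) 2 μ)
      (l := atTop) tendsto_const_nhds ((tendsto_congr fun n => ?_).1 h3)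
    rw [← eLpNorm_neg]
    congr 1
    funext x
    simp
    ring
  have h5 := (eLpNorm_eq_zero_iff (f := fun x => u x - v x) (hu.sub hv) (by norm_num)).1 h4
  filter_upwards [h5] with x hx
  simpa [sub_eq_zero] using hx

lemma integral_mul (hf : ∀ n, MemLp (f n) 2 μ) (hu : MemLp u 2 μ) {q : α → ℝ} (hq : MemLp q 2 μ)
    (h : TendstoL2 μ f u) :
    Tendsto (fun n => ∫ x, f n x * q x ∂μ) atTop (𝓝 (∫ x, u x * q x ∂μ)) := by
  refine tendsto_integral_of_L1' _ (hu.integrable_mul hq).1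
    (Eventually.of_forall fun n => (hf n).integrable_mul hq) ?_
  have h2 := ENNReal.Tendsto.mul_const (b := eLpNorm q 2 μ) h (Or.inr hq.2.ne)
  rw [zero_mul] at h2
  refine tendsto_of_tendsto_of_tendsto_of_le_of_le tendsto_const_nhds h2 (fun _ => zero_le)
    fun n => ?_
  have h3 := eLpNorm_smul_le_mul_eLpNorm (p := 2) (q := 2) (r := 1) (f := q)
    (φ := fun x => f n x - u x) hq.1 ((hf n).1.sub hu.1)
  refine le_trans (le_of_eq ?_) h3
  congr 1
  funext x
  simp [sub_mul]

lemma sub_self_le (hf : ∀ n, AEStronglyMeasurable (f n) μ) (hu : AEStronglyMeasurable u μ) (n m : ℕ)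
    : eLpNorm (fun x => f n x - f m x) 2 μ ≤
      eLpNorm (fun x => f n x - u x) 2 μ + eLpNorm (fun x => f m x - u x) 2 μ := by
  have h1 := eLpNorm_sub_le (p := 2) ((hf n).sub hu) ((hf m).sub hu) (by norm_num)
  refine le_trans (le_of_eq ?_) h1
  congr 1
  funext x
  simp

/-- A sequence whose differences are controlled by a null sequence converges. -/
lemma exists_of_cauchy (hf : ∀ n, MemLp (f n) 2 μ) {B : ℕ → ENNReal} (hB : Tendsto B atTop (𝓝 0))
    (h : ∀ n m, eLpNorm (fun x => f n x - f m x) 2 μ ≤ B n + B m) :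
    ∃ u, MemLp u 2 μ ∧ TendstoL2 μ f u := by
  have hc : CauchySeq fun n => (hf n).toLp (f n) := by
    rw [EMetric.cauchySeq_iff]
    intro ε hε
    have h2 : ∀ᶠ n in atTop, B n < ε / 2 := hB.eventually_lt_const (by simpa using hε.ne')
    obtain ⟨N, hN⟩ := eventually_atTop.1 h2
    refine ⟨N, fun m hm n hn => ?_⟩
    rw [Lp.edist_toLp_toLp]
    calc _ ≤ B m + B n := h m n
      _ < ε / 2 + ε / 2 := ENNReal.add_lt_add (hN m hm) (hN n hn)
      _ = ε := ENNReal.add_halves ε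
  obtain ⟨u, hu⟩ := cauchySeq_tendsto_of_complete hc
  refine ⟨u, Lp.memLp u, ?_⟩
  have h3 := tendsto_iff_edist_tendsto_0.1 hu
  refine (tendsto_congr fun n => ?_).1 h3
  rw [Lp.edist_def]
  exact eLpNorm_congr_ae ((hf n).coeFn_toLp.mono fun x hx => by simp [hx])

end TendstoL2

lemma MemLp.ofReal_integral_sq {α : Type*} [MeasurableSpace α] {μ : Measure α} {f : α → ℝ}
    (hf : MemLp f 2 μ) : ENNReal.ofReal (∫ x, f x ^ 2 ∂μ) = eLpNorm f 2 μ ^ 2 := by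
  rw [eLpNorm_two_sq, ofReal_integral_eq_lintegral_ofReal hf.integrable_sq
    (ae_of_all _ fun _ => sq_nonneg _)]
  refine lintegral_congr fun x => ?_
  rw [← ofReal_norm, ← ENNReal.ofReal_pow (norm_nonneg _), Real.norm_eq_abs, sq_abs]

/-! ### Smooth approximation on a triangle -/

lemma memL2_interior_hull (hf : Continuous f) : MemL2 K° f :=
  memL2_of_continuousOn (isCompact_hull K) hf.continuousOn interior_subset

lemma memLp_edgePt (hf : Continuous f) (a b : Plane) :
    MemLp (fun s => f (edgePt a b s)) 2 edgeVol := by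
  obtain ⟨C, hC⟩ := (isCompact_Icc (a := (0 : ℝ)) (b := 1)).exists_bound_of_continuousOn
    (hf.comp (continuous_edgePt a b)).continuousOn
  exact MemLp.of_bound ((hf.comp (continuous_edgePt a b)).aestronglyMeasurable) C
    ((ae_restrict_iff' measurableSet_Icc).2 (ae_of_all _ hC))

lemma partialD_congr_of_isOpen (hU : IsOpen U) {g : ScalarField} (h : ∀ x ∈ U, f x = g x)
    (m : Fin 2) : ∀ x ∈ U, partialD m f x = partialD m g x := by
  intro x hx
  have : f =ᶠ[𝓝 x] g := Filter.eventuallyEq_of_mem (hU.mem_nhds hx) h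
  rw [partialD, this.fderiv_eq, partialD]

lemma partialD_const_mul (hf : Differentiable ℝ f) (t : ℝ) (m : Fin 2) (x : Plane) :
    partialD m (fun y => t * f y) x = t * partialD m f x := by
  rw [partialD, fderiv_const_mul (hf x)]
  rfl

lemma contDiff_partialD_top (hf : ContDiff ℝ ∞ f) (m : Fin 2) : ContDiff ℝ ∞ (partialD m f) :=
  contDiff_partialD (hf.of_le (by exact_mod_cast le_top)) m

/-- Smooth approximation in `H³`. -/
lemma IsTriple.exists_approx_three (h : IsTriple K a b c) {g : VectorField}
    {J : Fin 2 → TensorField} (hu : MemL2 K° u) :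
    ∃ φ : ℕ → ScalarField, (∀ n, ContDiff ℝ ∞ (φ n)) ∧ TendstoL2 (vol K°) φ u ∧
      ((∀ m, HasWeakPartial K° m u (g m)) →
        (∀ m, TendstoL2 (vol K°) (fun n => partialD m (φ n)) (g m)) ∧
        ((∀ m i, HasWeakPartial K° i (g m) (H i m)) →
          (∀ m i, TendstoL2 (vol K°) (fun n => partialD i (partialD m (φ n))) (H i m)) ∧
          ((∀ m i j, HasWeakPartial K° j (H i m) (J j i m)) →
            ∀ m i j, TendstoL2 (vol K°)
              (fun n => partialD j (partialD i (partialD m (φ n)))) (J j i m)))) := by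
  obtain ⟨S, θ, hθ, hS, hconv, hd⟩ := exists_smoothing (convex_hull K) h.interior_nonempty
    (isCompact_hull K).isBounded
  have hUm : MeasurableSet K° := isOpen_interior.measurableSet
  have hSL : ∀ n u, MemL2 K° u → MemL2 K° (S n u) :=
    fun n u hu => memL2_interior_hull (hS n u hu).continuous
  have ae_of : ∀ {f g : ScalarField}, (∀ x ∈ K°, f x = g x) →
      f =ᵐ[vol K°] g := fun hfg =>
    (ae_restrict_iff' hUm).2 (ae_of_all _ hfg)
  have lim : ∀ (r : ℕ) {w : ScalarField}, MemL2 K° w →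
      TendstoL2 (vol K°) (fun n x => θ n ^ r * S n w x) w := by
    intro r w hw
    have := TendstoL2.const_mul (by simpa using hθ.pow r : Tendsto (fun n => θ n ^ r) atTop (𝓝 1))
      (fun n => hSL n w hw) hw (hconv w hw)
    simpa using this
  have step : ∀ (n r : ℕ) {f w v : ScalarField} {m : Fin 2}, (∀ x ∈ K°, f x = θ n ^ r * S n w x) →
      HasWeakPartial K° m w v →
      ∀ x ∈ K°, partialD m f x = θ n ^ (r + 1) * S n v x := by
    intro n r f w v m hf hw x hx
    rw [partialD_congr_of_isOpen isOpen_interior hf m x hx, partialD_const_mul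
      ((hS n w hw.1).differentiable (by simp)), hd n m w v hw x (interior_subset hx)]
    ring
  refine ⟨fun n => S n u, fun n => hS n u hu, hconv u hu, fun hg => ?_⟩
  have s1 : ∀ n m, ∀ x ∈ K°, partialD m (S n u) x = θ n ^ 1 * S n (g m) x :=
    fun n m => step n 0 (fun x _ => by simp) (hg m)
  refine ⟨fun m => (lim 1 (hg m).2.1).congr_left fun n => (ae_of (s1 n m)).symm, fun hH => ?_⟩
  have s2 : ∀ n m i, ∀ x ∈ K°, partialD i (partialD m (S n u)) x = θ n ^ 2 * S n (H i m) x :=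
    fun n m i => step n 1 (s1 n m) (hH m i)
  refine ⟨fun m i => (lim 2 (hH m i).2.1).congr_left fun n => (ae_of (s2 n m i)).symm,
    fun hJ m i j => (lim 3 (hJ m i j).2.1).congr_left fun n => (ae_of ?_).symm⟩
  exact step n 2 (s2 n m i) (hJ m i j)

/-! ### Traces -/

lemma le_of_sq_le_mul {x y : ENNReal} (h : x ^ 2 ≤ ENNReal.ofReal C * y ^ 2) :
    x ≤ ENNReal.ofReal (max 1 C) * y := by
  refine (ENNReal.pow_le_pow_left_iff two_ne_zero).1 (h.trans ?_)
  rw [mul_pow]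
  gcongr
  rw [← ENNReal.ofReal_pow (by positivity)]
  refine ENNReal.ofReal_le_ofReal ?_
  nlinarith [le_max_left 1 C, le_max_right 1 C]

/-- The trace inequality. -/
lemma IsTriple.exists_trace_le (h : IsTriple K a b c) : ∃ C : ENNReal, C ≠ ⊤ ∧
    ∀ φ : ScalarField, ContDiff ℝ 1 φ →
      eLpNorm (fun s => φ (edgePt a b s)) 2 edgeVol ≤ C * (eLpNorm φ 2 (vol K°) +
          ∑ m, eLpNorm (partialD m φ) 2 (vol K°)) := by
  set d := Metric.diam (hull K)
  have hd : ∀ x ∈ hull K, ∀ m, |x m - c m| ≤ d := fun x hx m => by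
    refine le_trans ?_ (Metric.dist_le_diam_of_mem (isCompact_hull K).isBounded hx
      (vertex_mem_hull h.mem_trd))
    rw [dist_eq_norm]
    simpa using PiLp.norm_apply_le (x - c) m
  set D := |det (b - a) (c - a)|
  have hD : 0 < D := abs_pos.2 h.det_ne
  refine ⟨ENNReal.ofReal (max 1 ((4 + d ^ 2) / D)), ENNReal.ofReal_ne_top, fun φ hφ => ?_⟩
  refine le_of_sq_le_mul ?_
  have h1 := h.trace_le hd hφ
  have n0 : 0 ≤ ∫ x in hull K, φ x ^ 2 := integral_nonneg fun _ => sq_nonneg _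
  have n1 : ∀ m, 0 ≤ ∫ x in hull K, partialD m φ x ^ 2 := fun m =>
    integral_nonneg fun _ => sq_nonneg _
  have h2 : ∫ s in Icc (0 : ℝ) 1, φ (edgePt a b s) ^ 2 ≤ (4 + d ^ 2) / D *
      ((∫ x in hull K, φ x ^ 2) + ∑ m, ∫ x in hull K, partialD m φ x ^ 2) := by
    rw [integral_Icc_eq_integral_Ioc, ← integral_of_le zero_le_one,
      div_mul_eq_mul_div, le_div_iff₀ hD, mul_comm]
    refine h1.trans ?_
    rw [add_mul, mul_add, mul_add]
    have := mul_nonneg (sq_nonneg d) n0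
    have : 0 ≤ ∑ m, ∫ x in hull K, partialD m φ x ^ 2 := sum_nonneg fun m _ => n1 m
    linarith
  have e1 := MemLp.ofReal_integral_sq (memLp_edgePt hφ.continuous a b)
  have e2 := MemLp.ofReal_integral_sq (memL2_interior_hull (K := K) hφ.continuous)
  have e3 := fun m => MemLp.ofReal_integral_sq
    (memL2_interior_hull (K := K) (continuous_partialD hφ le_rfl m))
  simp only [restrict_interior_hull] at e2 e3 ⊢
  rw [← e1]
  refine (ENNReal.ofReal_le_ofReal h2).trans ?_
  rw [ENNReal.ofReal_mul (by positivity)]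
  gcongr
  rw [ENNReal.ofReal_add n0 (sum_nonneg fun m _ => n1 m),
    ENNReal.ofReal_sum_of_nonneg fun m _ => n1 m, e2]
  simp only [e3]
  rw [add_sq]
  refine add_le_add le_self_add ?_
  rw [sum_univ_two, sum_univ_two, add_sq]
  exact add_le_add le_self_add le_rfl

/-- Smooth functions that converge in `H¹` of the triangle converge on an edge. -/
lemma IsTriple.exists_trace_of_tendsto (h : IsTriple K a b c) (hφ : ∀ n, ContDiff ℝ ∞ (φ n))
    (hu : MemL2 K° u) (hw : ∀ m, MemL2 K° (w m)) (h0 : TendstoL2 (vol K°) φ u)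
    (h1 : ∀ m, TendstoL2 (vol K°) (fun n => partialD m (φ n)) (w m)) :
    ∃ g, MemLp g 2 edgeVol ∧ TendstoL2 edgeVol (fun n s => φ n (edgePt a b s)) g := by
  obtain ⟨C, hC, hle⟩ := h.exists_trace_le
  have hφ1 : ∀ n, ContDiff ℝ 1 (φ n) := fun n => (hφ n).of_le (by simp)
  refine TendstoL2.exists_of_cauchy (fun n => memLp_edgePt (hφ n).continuous a b)
    (B := fun n => C * (eLpNorm (fun x => φ n x - u x) 2 (vol K°) +
      ∑ m, eLpNorm (fun x => partialD m (φ n) x - w m x) 2 (vol K°))) ?_ fun n m => ?_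
  · have := ENNReal.Tendsto.const_mul (a := C) (Tendsto.add h0
      (tendsto_finsetSum Finset.univ fun m _ => h1 m)) (Or.inr hC)
    simpa using this
  · have hd : ∀ i x, partialD i (fun x => φ n x - φ m x) x =
        partialD i (φ n) x - partialD i (φ m) x := fun i x => by
      rw [partialD, fderiv_fun_sub ((hφ1 n).differentiable one_ne_zero x)
        ((hφ1 m).differentiable one_ne_zero x)]
      rfl
    refine (hle (fun x => φ n x - φ m x) ((hφ1 n).sub (hφ1 m))).trans ?_
    rw [← mul_add]
    refine mul_le_mul_right ?_ C
    have e0 := TendstoL2.sub_self_le (fun n => (hφ n).continuous.aestronglyMeasurable) hu.1 n m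
    have e1 := fun i => TendstoL2.sub_self_le (f := fun n => partialD i (φ n))
      (fun n => (continuous_partialD (hφ1 n) le_rfl i).aestronglyMeasurable) (hw i).1 n m
    have e2 : ∀ i, eLpNorm (partialD i fun x => φ n x - φ m x) 2 (vol K°) =
        eLpNorm (fun x => partialD i (φ n) x - partialD i (φ m) x) 2 (vol K°) := fun i => by
      congr 1
      funext x
      exact hd i x
    calc _ ≤ _ := add_le_add e0 (Finset.sum_le_sum fun i _ => (e2 i).trans_le (e1 i))
      _ = _ := by
        rw [sum_add_distrib]
        ring

lemma IsTriple.exists_isEdgeTrace (h : IsTriple K a b c) (hw : ∀ m, HasWeakPartial K° m u (w m)) :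
    ∃ g, IsEdgeTrace K a b u g := by
  obtain ⟨φ, hφ, h0, h1⟩ := h.exists_approx_three (g := w) (H := 0) (J := 0) (hw 0).1
  obtain ⟨g, hg, hgt⟩ := h.exists_trace_of_tendsto hφ (hw 0).1 (fun m => (hw m).2.1) h0 (h1 hw).1
  exact ⟨g, hg, w, hw, φ, hφ, h0, (h1 hw).1, hgt⟩

/-- The trace is the limit of any sequence of smooth functions that converges in `H¹`. -/
lemma IsTriple.tendsto_trace (h : IsTriple K a b c) {g : ℝ → ℝ} (hg : IsEdgeTrace K a b u g)
    (huu : u =ᵐ[vol K°] u') (hw : ∀ m, HasWeakPartial K° m u' (w m)) (hφ : ∀ n, ContDiff ℝ ∞ (φ n))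
    (h0 : TendstoL2 (vol K°) φ u') (h1 : ∀ m, TendstoL2 (vol K°) (fun n => partialD m (φ n)) (w m))
    :
    TendstoL2 edgeVol (fun n s => φ n (edgePt a b s)) g := by
  obtain ⟨hgL, w', hw', ψ, hψ, p0, p1, pg⟩ := hg
  have hφ1 : ∀ n, ContDiff ℝ 1 (φ n) := fun n => (hφ n).of_le (by simp)
  have hψ1 : ∀ n, ContDiff ℝ 1 (ψ n) := fun n => (hψ n).of_le (by simp)
  have ew : ∀ m, w' m =ᵐ[vol K°] w m := fun m =>
    ((hw' m).congr huu (ae_eq_refl _)).unique isOpen_interior (hw m)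
  have q0 : TendstoL2 (vol K°) (fun n x => φ n x + -ψ n x) (fun x => u' x + -u' x) :=
    TendstoL2.add (fun n => (hφ n).continuous.aestronglyMeasurable) (hw 0).1.1
      (fun n => (hψ n).continuous.neg.aestronglyMeasurable) (hw 0).1.1.neg h0
      (TendstoL2.neg (TendstoL2.congr_right p0 huu))
  have q1 : ∀ m, TendstoL2 (vol K°)
      (fun n x => partialD m (φ n) x + -partialD m (ψ n) x) (fun x => w m x + -w m x) := fun m =>
    TendstoL2.add (fun n => (continuous_partialD (hφ1 n) le_rfl m).aestronglyMeasurable)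
      (hw m).2.1.1 (fun n => (continuous_partialD (hψ1 n) le_rfl m).neg.aestronglyMeasurable)
      (hw m).2.1.1.neg (h1 m) (TendstoL2.neg (TendstoL2.congr_right (p1 m) (ew m)))
  have hd : ∀ n m, partialD m (fun x => φ n x + -ψ n x) =
      fun x => partialD m (φ n) x + -partialD m (ψ n) x := fun n m => by
    funext x
    rw [partialD, fderiv_fun_add ((hφ1 n).differentiable one_ne_zero x)
      ((hψ1 n).differentiable one_ne_zero x).fun_neg, fderiv_fun_neg]
    rfl
  obtain ⟨C, hC, hle⟩ := h.exists_trace_le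
  have q2 : TendstoL2 edgeVol (fun n s => φ n (edgePt a b s) + -ψ n (edgePt a b s)) fun _ => 0 := by
    have l1 := ENNReal.Tendsto.const_mul (a := C) (Tendsto.add q0
      (tendsto_finsetSum Finset.univ fun m _ => q1 m)) (Or.inr hC)
    rw [Finset.sum_const_zero, add_zero, mul_zero] at l1
    refine tendsto_of_tendsto_of_tendsto_of_le_of_le tendsto_const_nhds l1 (fun _ => zero_le)
      fun n => ?_
    have := hle (fun x => φ n x + -ψ n x) ((hφ1 n).add (hψ1 n).neg)
    simp only [hd] at this
    simpa using this
  have q3 := TendstoL2.add (fun n => ((memLp_edgePt (hφ n).continuous a b).1.add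
      (memLp_edgePt (hψ n).continuous a b).1.neg)) aestronglyMeasurable_const
    (fun n => (memLp_edgePt (hψ n).continuous a b).1) hgL.1 q2 pg
  simpa using q3

lemma IsTriple.isEdgeTrace_unique (h : IsTriple K a b c) {g g' : ℝ → ℝ} (hg : IsEdgeTrace K a b u g)
    (hg' : IsEdgeTrace K a b u' g') (huu : u =ᵐ[vol K°] u') : g =ᵐ[edgeVol] g' := by
  obtain ⟨hgL, w', hw', ψ, hψ, p0, p1, pg⟩ := hg'
  exact TendstoL2.unique (fun n => (memLp_edgePt (hψ n).continuous a b).1) hg.1.1 hgL.1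
    (h.tendsto_trace hg huu hw' hψ p0 p1) pg

/-! ### Continuous representatives -/

lemma IsTriple.exists_isContRep_of_tendsto (h : IsTriple K a b c) (hφ : ∀ n, ContDiff ℝ ∞ (φ n))
    (hu : MemL2 K° u) (hw : ∀ m, MemL2 K° (w m)) (hH : ∀ m i, MemL2 K° (H i m))
    (h0 : TendstoL2 (vol K°) φ u) (h1 : ∀ m, TendstoL2 (vol K°) (fun n => partialD m (φ n)) (w m))
    (h2 : ∀ m i, TendstoL2 (vol K°) (fun n => partialD i (partialD m (φ n))) (H i m)) :
    ∃ V, IsContRep K u V ∧ TendstoUniformlyOn φ V atTop (hull K) := by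
  obtain ⟨C, hC0, hC⟩ := h.sq_le
  have hφ1 : ∀ n, ContDiff ℝ 1 (φ n) := fun n => (hφ n).of_le (by simp)
  have hφm : ∀ n m, ContDiff ℝ ∞ (partialD m (φ n)) := fun n m => contDiff_partialD_top (hφ n) m
  let N : (ScalarField → ScalarField) → ℕ → ℕ → ℝ := fun T n m =>
    ∫ x in hull K, (T (φ n) x - T (φ m) x) ^ 2
  have hN : ∀ {T : ScalarField → ScalarField} {v : ScalarField}, (∀ n, Continuous (T (φ n))) →
      MemL2 K° v →
      TendstoL2 (vol K°) (fun n => T (φ n)) v →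
      Tendsto (fun p : ℕ × ℕ => N T p.1 p.2) atTop (𝓝 0) := by
    intro T v hT hv hTv
    have hle : ∀ n m, N T n m ≤ (eLpNorm (fun x => T (φ n) x - v x) 2 (vol K°) +
          eLpNorm (fun x => T (φ m) x - v x) 2 (vol K°)).toReal ^ 2 := by
      intro n m
      have hL : ∀ n, MemLp (fun x => T (φ n) x - v x) 2 (vol K°) :=
        fun n => (memL2_interior_hull (hT n)).sub hv
      have e := MemLp.ofReal_integral_sq (memL2_interior_hull (K := K) ((hT n).sub (hT m)))
      rw [restrict_interior_hull] at e
      have nn : 0 ≤ N T n m := integral_nonneg fun _ => sq_nonneg _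
      have e' : N T n m = (eLpNorm (fun x => T (φ n) x - T (φ m) x) 2
          (vol (hull K))).toReal ^ 2 := by
        rw [← ENNReal.toReal_pow]
        change ENNReal.ofReal (N T n m) = eLpNorm (fun x => T (φ n) x - T (φ m) x) 2 _ ^ 2 at e
        rw [← e, ENNReal.toReal_ofReal nn]
      rw [e', ← restrict_interior_hull]
      refine pow_le_pow_left₀ ENNReal.toReal_nonneg (ENNReal.toReal_mono
        (ENNReal.add_ne_top.2 ⟨(hL n).2.ne, (hL m).2.ne⟩) ?_) 2
      exact TendstoL2.sub_self_le (f := fun n => T (φ n))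
        (fun n => (hT n).aestronglyMeasurable) hv.1 n m
    have ht : Tendsto (fun p : ℕ × ℕ =>
        (eLpNorm (fun x => T (φ p.1) x - v x) 2 (vol K°) + eLpNorm (fun x => T (φ p.2) x - v x) 2
            (vol K°)).toReal ^ 2) atTop (𝓝 0) := by
      rw [← prod_atTop_atTop_eq]
      have t1 := (Tendsto.comp hTv (tendsto_fst (f := (atTop : Filter ℕ)) (g := atTop))).add
        (Tendsto.comp hTv (tendsto_snd (f := (atTop : Filter ℕ)) (g := atTop)))
      rw [add_zero] at t1
      have t2 := (ENNReal.tendsto_toReal ENNReal.zero_ne_top).comp t1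
      simpa using t2.pow 2
    exact squeeze_zero (fun p => integral_nonneg fun _ => sq_nonneg _) (fun p => hle p.1 p.2) ht
  have hE : Tendsto (fun p : ℕ × ℕ => C * (N id p.1 p.2 + ∑ m, N (partialD m) p.1 p.2 +
      ∑ m, ∑ i, N (fun f => partialD i (partialD m f)) p.1 p.2)) atTop (𝓝 0) := by
    have t0 := hN (T := id) (fun n => (hφ n).continuous) hu h0
    have t1 := tendsto_finsetSum Finset.univ fun m _ => hN (T := partialD m)
      (fun n => (hφm n m).continuous) (hw m) (h1 m)
    have t2 := tendsto_finsetSum Finset.univ fun m _ => tendsto_finsetSum Finset.univ fun i _ =>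
      hN (T := fun f => partialD i (partialD m f))
      (fun n => (contDiff_partialD_top (hφm n m) i).continuous) (hH m i) (h2 m i)
    simpa using ((t0.add t1).add t2).const_mul C
  have hpt : ∀ n m, ∀ x ∈ hull K, (φ n x - φ m x) ^ 2 ≤ C * (N id n m + ∑ i, N (partialD i) n m +
        ∑ i, ∑ j, N (fun f => partialD j (partialD i f)) n m) := by
    intro n m x hx
    have hs : ∀ {f g : ScalarField}, ContDiff ℝ ∞ f → ContDiff ℝ ∞ g → ∀ i,
        partialD i (fun x => f x - g x) = fun x => partialD i f x - partialD i g x := by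
      intro f g hf hg i
      funext x
      rw [partialD, fderiv_fun_sub (hf.differentiable (by simp) x) (hg.differentiable (by simp) x)]
      rfl
    have := hC (fun x => φ n x - φ m x) (((hφ n).sub (hφ m)).of_le
      (WithTop.coe_le_coe.2 le_top)) x hx
    simp only [hs (hφ n) (hφ m), hs (hφm n _) (hφm m _)] at this
    exact this
  have hU : UniformCauchySeqOn φ atTop (hull K) := by
    rw [Metric.uniformCauchySeqOn_iff]
    intro ε hε
    have hev := hE.eventually_lt_const (by positivity : (0 : ℝ) < ε ^ 2)
    obtain ⟨N', hN'⟩ : ∃ N', ∀ n ≥ N', ∀ m ≥ N', C * (N id n m + ∑ i, N (partialD i) n m +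
        ∑ i, ∑ j, N (fun f => partialD j (partialD i f)) n m) < ε ^ 2 := by
      obtain ⟨⟨p, q⟩, hpq⟩ := eventually_atTop.1 hev
      exact ⟨max p q, fun n hn m hm => hpq (n, m)
        ⟨(le_max_left _ _).trans hn, (le_max_right _ _).trans hm⟩⟩
    refine ⟨N', fun m hm n hn x hx => ?_⟩
    rw [Real.dist_eq]
    exact abs_lt_of_sq_lt_sq ((hpt m n x hx).trans_lt (hN' m hm n hn)) hε.le
  have hex : ∀ x : Plane, ∃ l, x ∈ hull K → Tendsto (fun n => φ n x) atTop (𝓝 l) := by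
    intro x
    by_cases hx : x ∈ hull K
    · obtain ⟨l, hl⟩ := cauchySeq_tendsto_of_complete (hU.cauchySeq hx)
      exact ⟨l, fun _ => hl⟩
    · exact ⟨0, fun h => absurd h hx⟩
  choose V hV using hex
  have hunif : TendstoUniformlyOn φ V atTop (hull K) :=
    hU.tendstoUniformlyOn_of_tendsto fun x hx => hV x hx
  have hcont : ContinuousOn V (hull K) :=
    hunif.continuousOn (Frequently.of_forall fun n => (hφ n).continuous.continuousOn)
  refine ⟨V, ⟨hcont, ?_⟩, hunif⟩
  rw [← restrict_interior_hull]
  obtain ⟨ns, hns, hae⟩ := (tendstoInMeasure_of_tendsto_eLpNorm (p := 2) (by norm_num)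
    (fun n => (hφ n).continuous.aestronglyMeasurable) hu.1 h0).exists_seq_tendsto_ae
  filter_upwards [hae, ae_restrict_mem isOpen_interior.measurableSet] with x hx hxU
  exact tendsto_nhds_unique hx ((hV x (interior_subset hxU)).comp hns.tendsto_atTop)

lemma IsTriple.isContRep_unique (h : IsTriple K a b c) {V V' : ScalarField} (hV : IsContRep K u V)
    (hV' : IsContRep K u' V') (huu : u =ᵐ[vol (hull K)] u') : ∀ x ∈ hull K, V x = V' x := by
  have hae : V =ᵐ[vol K°] V' := by
    rw [restrict_interior_hull]
    exact hV.2.symm.trans (huu.trans hV'.2)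
  have hopen := Measure.eqOn_open_of_ae_eq hae isOpen_interior (hV.1.mono interior_subset)
    (hV'.1.mono interior_subset)
  have hcl : hull K ⊆ closure K° := by
    rw [(convex_hull K).closure_interior_eq_closure_of_nonempty_interior h.interior_nonempty]
    exact subset_closure
  exact hopen.of_subset_closure hV.1 hV'.1 interior_subset hcl

variable {m : Fin 2} {V W : ScalarField} {r : ℕ}

lemma IsTriple.exists_third (h : IsTriple K a b c) (hx : x ∈ K) (hy : y ∈ K) (hxy : x ≠ y) :
    ∃ z, IsTriple K x y z := by
  rcases h.mem_iff.1 hx with rfl | rfl | rfl <;> rcases h.mem_iff.1 hy with rfl | rfl | rfl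
  · exact absurd rfl hxy
  · exact ⟨_, h⟩
  · exact ⟨_, h.rotate.rotate.swap⟩
  · exact ⟨_, h.swap⟩
  · exact absurd rfl hxy
  · exact ⟨_, h.rotate⟩
  · exact ⟨_, h.rotate.rotate⟩
  · exact ⟨_, h.rotate.swap⟩
  · exact absurd rfl hxy

/-! ### Functions in `H²` of a triangle -/

/-- Smooth functions `φ` approximating `u ∈ H²(K)`, whose weak derivatives are `g m` and `H i m`,
in `H²` and uniformly. -/
structure IsApprox (K : Finset Plane) (u : ScalarField) (g : VectorField)
    (H : TensorField) (φ : ℕ → ScalarField) (V : ScalarField) : Prop where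
  smooth : ∀ n, ContDiff ℝ ∞ (φ n)
  weak : ∀ m, HasWeakPartial K° m u (g m)
  weak' : ∀ m i, HasWeakPartial K° i (g m) (H i m)
  tendsto : TendstoL2 (vol K°) φ u
  tendsto' : ∀ m, TendstoL2 (vol K°) (fun n => partialD m (φ n)) (g m)
  tendsto'' : ∀ m i, TendstoL2 (vol K°) (fun n => partialD i (partialD m (φ n))) (H i m)
  rep : IsContRep K u V
  uniform : TendstoUniformlyOn φ V atTop (hull K)

lemma IsTriple.exists_isApprox (h : IsTriple K a b c) (hu : MemH K° 2 u) :
    ∃ g H φ V, IsApprox K u g H φ V := by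
  obtain ⟨g, hg⟩ := hu
  have hg' : ∀ m, ∃ H : VectorField, ∀ i, HasWeakPartial K° i (g m) (H i) := fun m => by
    obtain ⟨H, hH⟩ := (hg m).2
    exact ⟨H, fun i => (hH i).1⟩
  choose H hH using hg'
  obtain ⟨φ, hφ, h0, h1⟩ := h.exists_approx_three (g := g) (H := fun i m => H m i) (J := 0)
    (hg 0).1.1
  obtain ⟨h1, h2⟩ := h1 fun m => (hg m).1
  obtain ⟨h2, -⟩ := h2 fun m i => hH m i
  obtain ⟨V, hV, hunif⟩ := h.exists_isContRep_of_tendsto hφ (hg 0).1.1 (fun m => (hg m).1.2.1)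
    (fun m i => (hH m i).2.1) h0 h1 h2
  exact ⟨g, _, φ, V, hφ, fun m => (hg m).1, fun m i => hH m i, h0, h1, h2, hV, hunif⟩

/-- Functions in `H³` and their derivatives are approximated by smooth functions and their
derivatives. -/
lemma IsTriple.exists_isApprox_three (h : IsTriple K a b c) (hu : MemH K° 3 u) : ∃ (g : VectorField)
      (H : TensorField) (J : Fin 2 → TensorField)
      (φ : ℕ → ScalarField) (V : ScalarField) (D : VectorField), IsApprox K u g H φ V ∧
      ∀ m, IsApprox K (g m) (fun i => H i m) (fun j i => J j i m) (fun n => partialD m (φ n))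
        (D m) := by
  obtain ⟨g, hg⟩ := hu
  have hg' : ∀ m, ∃ H : VectorField, ∀ i, HasWeakPartial K° i (g m) (H i) ∧ MemH K° 1 (H i) :=
    fun m => (hg m).2
  choose H hH using hg'
  have hH' : ∀ m i, ∃ J : VectorField, ∀ j, HasWeakPartial K° j (H m i) (J j) := fun m i => by
    obtain ⟨J, hJ⟩ := (hH m i).2
    exact ⟨J, fun j => (hJ j).1⟩
  choose J hJ using hH'
  obtain ⟨φ, hφ, h0, h1⟩ := h.exists_approx_three (g := g) (H := fun i m => H m i)
    (J := fun j i m => J m i j) (hg 0).1.1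
  obtain ⟨h1, h2⟩ := h1 fun m => (hg m).1
  obtain ⟨h2, h3⟩ := h2 fun m i => (hH m i).1
  have h3 := h3 fun m i j => hJ m i j
  obtain ⟨V, hV, hunif⟩ := h.exists_isContRep_of_tendsto hφ (hg 0).1.1 (fun m => (hg m).1.2.1)
    (fun m i => (hH m i).1.2.1) h0 h1 h2
  have hD := fun m => h.exists_isContRep_of_tendsto (fun n => contDiff_partialD_top (hφ n) m)
    (hg m).1.2.1 (fun i => (hH m i).1.2.1) (fun i j => (hJ m i j).2.1) (h1 m) (h2 m) (h3 m)
  choose D hD hDu using hD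
  exact ⟨g, _, _, φ, V, D, ⟨hφ, fun m => (hg m).1, fun m i => (hH m i).1, h0, h1, h2, hV, hunif⟩,
    fun m => ⟨fun n => contDiff_partialD_top (hφ n) m, fun i => (hH m i).1, fun i j => hJ m i j,
      h1 m, h2 m, h3 m, hD m, hDu m⟩⟩

lemma contRep_memLp_edge (ha : a ∈ K) (hb : b ∈ K) (hV : ContinuousOn V (hull K)) :
    MemLp (fun s => V (edgePt a b s)) 2 edgeVol := by
  have hc : ContinuousOn (fun s => V (edgePt a b s)) (Icc 0 1) :=
    hV.comp (continuous_edgePt a b).continuousOn fun s hs => edgePt_mem_hull ha hb hs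
  obtain ⟨C, hC⟩ := isCompact_Icc.exists_bound_of_continuousOn hc
  exact MemLp.of_bound (hc.aestronglyMeasurable measurableSet_Icc) C
    ((ae_restrict_iff' measurableSet_Icc).2 (ae_of_all _ hC))

namespace IsApprox

variable {g : VectorField}

lemma tendsto_edge (hA : IsApprox K u g H φ V) (ha : a ∈ K) (hb : b ∈ K) :
    TendstoL2 edgeVol (fun n s => φ n (edgePt a b s)) fun s => V (edgePt a b s) := by
  unfold TendstoL2
  rw [ENNReal.tendsto_nhds_zero]
  intro ε hε
  rcases eq_or_ne ε ⊤ with rfl | hεt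
  · simp
  have hε' : 0 < ε.toReal := ENNReal.toReal_pos hε.ne' hεt
  filter_upwards [Metric.tendstoUniformlyOn_iff.1 hA.uniform ε.toReal hε'] with n hn
  refine (eLpNorm_le_of_ae_bound (C := ε.toReal) ?_).trans ?_
  · filter_upwards [ae_restrict_mem measurableSet_Icc] with s hs
    rw [← dist_eq_norm, dist_comm]
    exact (hn _ (edgePt_mem_hull ha hb hs)).le
  · simp [ENNReal.ofReal_toReal hεt]

lemma isEdgeTrace (hA : IsApprox K u g H φ V) (ha : a ∈ K) (hb : b ∈ K) :
    IsEdgeTrace K a b u fun s => V (edgePt a b s) :=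
  ⟨contRep_memLp_edge ha hb hA.rep.1, g, hA.weak, φ, hA.smooth, hA.tendsto, hA.tendsto',
    hA.tendsto_edge ha hb⟩

lemma memH (hA : IsApprox K u g H φ V) : MemH K° 2 u :=
  ⟨g, fun m => ⟨hA.weak m, fun i => H i m, fun i => ⟨hA.weak' m i, (hA.weak' m i).2.1⟩⟩⟩

lemma tendsto_trace (hA : IsApprox K u g H φ V) (h : IsTriple K a b c) {w : ScalarField}
    (hw : HasWeakPartial K° m u w) {G : ℝ → ℝ} (hG : IsEdgeTrace K a b w G) :
    TendstoL2 edgeVol (fun n s => partialD m (φ n) (edgePt a b s)) G :=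
  h.tendsto_trace hG (hw.unique isOpen_interior (hA.weak m)) (hA.weak' m)
    (fun n => contDiff_partialD_top (hA.smooth n) m) (hA.tendsto' m) (hA.tendsto'' m)

end IsApprox

lemma IsTriple.exists_isContRep (h : IsTriple K a b c) (hu : MemH K° 2 u) :
    ∃ V, IsContRep K u V := by
  obtain ⟨g, H, φ, V, hA⟩ := h.exists_isApprox hu
  exact ⟨V, hA.rep⟩

lemma IsTriple.isEdgeTrace_contRep (h : IsTriple K a b c) (hu : MemH K° 2 u) (hV : IsContRep K u V)
    (hx : x ∈ K) (hy : y ∈ K) : IsEdgeTrace K x y u fun s => V (edgePt x y s) := by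
  obtain ⟨g, H, φ, V', hA⟩ := h.exists_isApprox hu
  have e := h.isContRep_unique hA.rep hV (ae_eq_refl _)
  obtain ⟨h1, w, hw, ψ, hψ, p0, p1, p2⟩ := hA.isEdgeTrace hx hy
  refine ⟨contRep_memLp_edge hx hy hV.1, w, hw, ψ, hψ, p0, p1, TendstoL2.congr_right p2 ?_⟩
  filter_upwards [ae_restrict_mem measurableSet_Icc] with s hs
  exact e _ (edgePt_mem_hull hx hy hs)

/-- Reversing the orientation of the edge. -/
lemma IsEdgeTrace.swap {g : ℝ → ℝ} (hg : IsEdgeTrace K a b u g) :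
    IsEdgeTrace K b a u fun s => g (1 - s) := by
  obtain ⟨h1, w, hw, ψ, hψ, p0, p1, p2⟩ := hg
  have hmp : MeasurePreserving (fun s : ℝ => 1 - s) edgeVol edgeVol := by
    have := (Measure.measurePreserving_sub_left (volume : Measure ℝ) 1).restrict_preimage
      (measurableSet_Icc (a := (0 : ℝ)) (b := 1))
    simpa using this
  refine ⟨h1.comp_measurePreserving hmp, w, hw, ψ, hψ, p0, p1, ?_⟩
  refine (tendsto_congr fun n => ?_).1 p2
  have hm : AEStronglyMeasurable (fun s => ψ n (edgePt a b s) - g s)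
      edgeVol := (memLp_edgePt (hψ n).continuous a b).1.sub h1.1
  rw [← eLpNorm_comp_measurePreserving hm hmp]
  congr 1
  funext s
  simp [edgePt_swap a b]

/-! ### Traces from the two sides of an edge -/

lemma IsTriple.green_of_edge (h : IsTriple K a b c) (hf : ContDiff ℝ 1 f)
    (h1 : ∀ s, f (edgePt b c s) = 0) (h2 : ∀ s, f (edgePt c a s) = 0) (m : Fin 2) :
    ∫ x in hull K, partialD m f x =
      orient K a b * (rot (b - a) m * ∫ s in (0 : ℝ)..1, f (edgePt a b s)) := by
  have h1' : ∀ s, f (edgePt c b s) = 0 := fun s => by rw [edgePt_swap b c]; exact h1 _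
  have h2' : ∀ s, f (edgePt a c s) = 0 := fun s => by rw [edgePt_swap c a]; exact h2 _
  have e : rot (a - b) m = -rot (b - a) m := by fin_cases m <;> simp [rot]
  rw [h.green hf m, h.sum_eq]
  simp only [h.sum_eq, orient_self, h1, h2, h1', h2', intervalIntegral.integral_zero,
    orient_swap K a b, integral_edgePt_swap f a b, e]
  ring

lemma integral_Icc_eq (f : ℝ → ℝ) : ∫ s in Icc (0 : ℝ) 1, f s = ∫ s in (0 : ℝ)..1, f s := by
  rw [integral_Icc_eq_integral_Ioc, ← integral_of_le zero_le_one]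

lemma IsTriple.green_trace (h : IsTriple K a b c) (hf : ContDiff ℝ 1 f)
    (h1 : ∀ s, f (edgePt b c s) = 0) (h2 : ∀ s, f (edgePt c a s) = 0)
    (hw : ∀ m, HasWeakPartial K° m u (w m)) {g : ℝ → ℝ} (hg : IsEdgeTrace K a b u g) (m : Fin 2) :
    ∫ x in hull K, (w m x * f x + u x * partialD m f x) =
      orient K a b * (rot (b - a) m * ∫ s in (0 : ℝ)..1, g s * f (edgePt a b s)) := by
  obtain ⟨hgL, w', hw', φ, hφ, p0, p1, p2⟩ := hg
  have hφ1 : ∀ n, ContDiff ℝ 1 (φ n) := fun n => (hφ n).of_le (by simp)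
  have hfm := continuous_partialD hf le_rfl m
  have e : ∀ n, (∫ x in K°, partialD m (φ n) x * f x) + (∫ x in K°, φ n x * partialD m f x) =
      orient K a b * (rot (b - a) m * ∫ s in Icc (0 : ℝ) 1,
        φ n (edgePt a b s) * f (edgePt a b s)) := by
    intro n
    have j1 : IntegrableOn (fun x => partialD m (φ n) x * f x) (hull K) :=
      integrableOn_hull ((continuous_partialD (hφ1 n) le_rfl m).mul hf.continuous)
    have j2 : IntegrableOn (fun x => φ n x * partialD m f x) (hull K) :=
      integrableOn_hull ((hφ n).continuous.mul hfm)
    rw [integral_Icc_eq, ← h.green_of_edge ((hφ1 n).mul hf) (by simp [h1]) (by simp [h2]) m,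
      restrict_interior_hull, ← integral_add j1 j2]
    congr 1
    funext x
    exact (partialD_mul m ((hφ1 n).differentiable one_ne_zero x)
      (hf.differentiable one_ne_zero x)).symm
  have t1 := TendstoL2.integral_mul (fun n => memL2_interior_hull
    (continuous_partialD (hφ1 n) le_rfl m)) (hw m).2.1 (memL2_interior_hull (K := K) hf.continuous)
    (TendstoL2.congr_right (p1 m) ((hw' m).unique isOpen_interior (hw m)))
  have t2 := TendstoL2.integral_mul (fun n => memL2_interior_hull (hφ n).continuous) (hw 0).1
    (memL2_interior_hull (K := K) hfm) p0
  have t3 := TendstoL2.integral_mul (fun n => memLp_edgePt (hφ n).continuous a b) hgL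
    (memLp_edgePt hf.continuous a b) p2
  have t4 := tendsto_nhds_unique ((t1.add t2).congr e)
    ((t3.const_mul (rot (b - a) m)).const_mul (orient K a b))
  rw [integral_Icc_eq] at t4
  rw [← t4, restrict_interior_hull, integral_add]
  · have := MemLp.integrable_mul (p := 2) (q := 2) (hw m).2.1
      (memL2_interior_hull (K := K) hf.continuous)
    rwa [restrict_interior_hull] at this
  · have := MemLp.integrable_mul (p := 2) (q := 2) (hw 0).1 (memL2_interior_hull (K := K) hfm)
    rwa [restrict_interior_hull] at this

section Mesh

variable (hΩ : IsPolygon Ω) (hM : M.IsMeshOf Ω)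

include hΩ hM

lemma HasWeakPartial.cell (hK : K ∈ M.cells) {g : ScalarField} (h : HasWeakPartial Ω m u g) :
    HasWeakPartial K° m u g :=
  h.mono hΩ.isOpen.measurableSet (interior_hull_subset hΩ hM hK)

omit hΩ hM in
lemma rot_ne_zero (hab : a ≠ b) : ∃ m, rot (b - a) m ≠ 0 := by
  by_contra! h0
  have h1 := h0 0
  have h2 := h0 1
  simp only [rot, Matrix.cons_val_zero, Matrix.cons_val_one, PiLp.sub_apply] at h1 h2
  exact hab (by ext i; fin_cases i <;> simp <;> linarith)

/-- The traces of a function in `H¹(Ω)` from the two sides of an interior edge agree. -/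
theorem edgeTrace_eq_of_shared (hK : K ∈ M.cells) (hL : L ∈ M.cells) (hab : a ≠ b) (haK : a ∈ K)
    (hbK : b ∈ K) (haL : a ∈ L) (hbL : b ∈ L) (hw : ∀ m, HasWeakPartial Ω m u (w m)) {gK gL : ℝ → ℝ}
    (hgK : IsEdgeTrace K a b u gK) (hgL : IsEdgeTrace L a b u gL) : gK =ᵐ[edgeVol] gL := by
  obtain ⟨c, h⟩ := M.exists_isTriple hK haK hbK hab
  obtain ⟨d, h'⟩ := M.exists_isTriple hL haL hbL hab
  by_cases hne : L = K
  · subst hne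
    exact h.isEdgeTrace_unique hgK hgL (ae_eq_refl _)
  let O : Set Plane := interior (hull K ∪ hull L) ∩ ({x | bary b c a x ≠ 0} ∩
    {x | bary c a b x ≠ 0} ∩ ({x | bary b d a x ≠ 0} ∩ {x | bary d a b x ≠ 0}))
  have hOo : IsOpen O := isOpen_interior.inter
    (((isOpen_ne_fun (continuous_bary _ _ _) continuous_const).inter
      (isOpen_ne_fun (continuous_bary _ _ _) continuous_const)).inter
      ((isOpen_ne_fun (continuous_bary _ _ _) continuous_const).inter
      (isOpen_ne_fun (continuous_bary _ _ _) continuous_const)))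
  have hOΩ : O ⊆ Ω := by
    rw [← hΩ.regular]
    exact inter_subset_left.trans (interior_mono
      (Set.union_subset (hull_subset_closure hM hK) (hull_subset_closure hM hL)))
  have hmem : ∀ s ∈ Ioo (0 : ℝ) 1, edgePt a b s ∈ O := by
    intro s hs
    obtain ⟨-, e2, e3⟩ := edgePt_eq_iff_bary h s
    obtain ⟨-, e2', e3'⟩ := edgePt_eq_iff_bary h' s
    refine ⟨M.eventually_mem_union hK hL hne hab haK hbK haL hbL hs, ⟨?_, ?_⟩, ?_, ?_⟩ <;>
      simp only [mem_ofPred_eq, e2, e3, e2', e3']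
    · linarith [hs.2]
    · exact hs.1.ne'
    · linarith [hs.2]
    · exact hs.1.ne'
  obtain ⟨m, hm⟩ := rot_ne_zero hab
  have key : ∀ f, IsTest O f → ∫ s in Icc (0 : ℝ) 1, (gK s - gL s) * f (edgePt a b s) = 0 := by
    intro f hf
    have hz : ∀ x ∉ O, f x = 0 := fun x hx => hf.eq_zero hx
    have hf1 : ContDiff ℝ 1 f := hf.1.of_le (by simp)
    have hK0 : (∀ s, f (edgePt b c s) = 0) ∧ ∀ s, f (edgePt c a s) = 0 :=
      ⟨fun s => hz _ fun hx => hx.2.1.1 (edgePt_eq_iff_bary h.rotate s).1,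
        fun s => hz _ fun hx => hx.2.1.2 (edgePt_eq_iff_bary h.rotate.rotate s).1⟩
    have hL0 : (∀ s, f (edgePt b d s) = 0) ∧ ∀ s, f (edgePt d a s) = 0 :=
      ⟨fun s => hz _ fun hx => hx.2.2.1 (edgePt_eq_iff_bary h'.rotate s).1,
        fun s => hz _ fun hx => hx.2.2.2 (edgePt_eq_iff_bary h'.rotate.rotate s).1⟩
    have e1 := h.green_trace hf1 hK0.1 hK0.2 (fun m => (hw m).cell hΩ hM hK) hgK m
    have e2 := h'.green_trace hf1 hL0.1 hL0.2 (fun m => (hw m).cell hΩ hM hL) hgL m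
    rw [M.orient_neg hK hL hne hab haK hbK haL hbL] at e2
    have hfΩ := hf.mono hOΩ
    have i1 : Integrable (fun x => w m x * f x) (vol Ω) := (hw m).2.1.integrable_mul hfΩ
    have i2 : Integrable (fun x => u x * partialD m f x) (vol Ω) :=
      (hw m).1.integrable_mul (isTest_partialD hfΩ m)
    have i3 : IntegrableOn (fun x => w m x * f x + u x * partialD m f x) Ω := i1.add i2
    have e3 : ∫ x in Ω, (w m x * f x + u x * partialD m f x) = 0 := by
      rw [integral_add i1 i2, (hw m).2.2 f hfΩ, add_neg_cancel]
    have hcell : ∀ J ∈ M.cells, IntegrableOn (fun x => w m x * f x + u x * partialD m f x)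
        (hull J) := by
      intro J hJ
      have := i3.mono_set (interior_hull_subset hΩ hM hJ)
      rwa [IntegrableOn, restrict_interior_hull] at this
    rw [integral_eq_sum_cells hΩ hM hcell] at e3
    have e4 : ∑ J ∈ M.cells, ∫ x in hull J, (w m x * f x + u x * partialD m f x) =
        (∫ x in hull K, (w m x * f x + u x * partialD m f x)) +
          ∫ x in hull L, (w m x * f x + u x * partialD m f x) := by
      refine Finset.sum_eq_add_of_mem _ _ hK hL (Ne.symm hne) fun J hJ hJne => ?_
      rw [← restrict_interior_hull]
      refine (setIntegral_congr_fun isOpen_interior.measurableSet fun x hx => ?_).trans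
        (integral_zero _ _)
      have hxO : x ∉ O := fun hxO => by
        rcases interior_subset hxO.1 with h1 | h1
        · exact hJne.1 (M.eq_of_mem_interior hJ hK hx h1).symm
        · exact hJne.2 (M.eq_of_mem_interior hJ hL hx h1).symm
      rw [hz x hxO, (isTest_partialD hf m).eq_zero hxO]
      simp
    rw [e4, e1, e2] at e3
    have hfe := memLp_edgePt hf.continuous a b
    have j1 : Integrable (fun s => gK s * f (edgePt a b s)) edgeVol := hgK.1.integrable_mul hfe
    have j2 : Integrable (fun s => gL s * f (edgePt a b s)) edgeVol := hgL.1.integrable_mul hfe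
    simp only [sub_mul]
    rw [integral_sub j1 j2, integral_Icc_eq, integral_Icc_eq]
    have e5 : orient K a b * rot (b - a) m * ((∫ s in (0 : ℝ)..1, gK s * f (edgePt a b s)) -
        ∫ s in (0 : ℝ)..1, gL s * f (edgePt a b s)) = 0 := by linear_combination e3
    exact (mul_eq_zero.1 e5).resolve_left (mul_ne_zero h.orient_ne_zero hm)
  let β : ScalarField := fun x => (dist a b ^ 2)⁻¹ * ∑ i, (x i - a i) * (b i - a i)
  have hβ : ContDiff ℝ ∞ β := contDiff_const.mul (ContDiff.sum fun i _ =>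
    ((EuclideanSpace.proj i : Plane →L[ℝ] ℝ).contDiff.sub contDiff_const).mul contDiff_const)
  have hβe : ∀ s, β (edgePt a b s) = s := by
    intro s
    have hd : dist a b ^ 2 ≠ 0 := pow_ne_zero _ (dist_pos.2 hab).ne'
    simp only [β, edgePt_eq]
    rw [inv_mul_eq_div, div_eq_iff hd, dist_sq_eq]
    simp only [sum_univ_two, PiLp.add_apply, PiLp.smul_apply, PiLp.sub_apply, smul_eq_mul]
    ring
  have hloc : ∀ s ∈ Ioo (0 : ℝ) 1, ∃ v ∈ 𝓝 s, volume ({s ∈ Icc (0 : ℝ) 1 |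
      gK s ≠ gL s} ∩ v) = 0 := by
    intro s hs
    obtain ⟨χ, hχs, hχc, hχ, -, hχ1⟩ := exists_contDiff_tsupport_subset (n := ⊤)
      (hOo.mem_nhds (hmem s hs))
    refine ⟨{r | χ (edgePt a b r) ≠ 0}, ?_, ?_⟩
    · refine (isOpen_ne_fun (hχ.continuous.comp (continuous_edgePt a b))
        continuous_const).mem_nhds ?_
      simp [hχ1]
    · have hgd : MemLp (fun r => (gK r - gL r) * χ (edgePt a b r)) 1 edgeVol :=
        memLp_one_iff_integrable.2 ((hgK.1.sub hgL.1).integrable_mul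
          (memLp_edgePt hχ.continuous a b))
      have hint : Integrable ((Icc (0 : ℝ) 1).indicator
          fun r => (gK r - gL r) * χ (edgePt a b r)) volume :=
        (integrable_indicator_iff measurableSet_Icc).2 (memLp_one_iff_integrable.1 hgd)
      have hae := ae_eq_zero_of_integral_contDiff_smul_eq_zero hint.locallyIntegrable
        fun ψ hψ _ => by
          have ht : IsTest O fun x => χ x * ψ (β x) :=
            ⟨hχ.mul (hψ.comp hβ), hχc.mul_right, (tsupport_mul_subset_left).trans hχs⟩
          have h1 := key _ ht
          rw [← integral_indicator measurableSet_Icc] at h1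
          refine Eq.trans (integral_congr_ae (ae_of_all _ fun r => ?_)) h1
          by_cases hr : r ∈ Icc (0 : ℝ) 1
          · simp only [indicator_of_mem hr, smul_eq_mul, hβe]
            ring
          · simp only [indicator_of_notMem hr, smul_zero]
      refine measure_mono_null ?_ hae
      rintro r ⟨⟨hr, hne⟩, hχr⟩
      simp only [Set.mem_compl_iff, mem_ofPred_eq, indicator_of_mem hr]
      exact mul_ne_zero (sub_ne_zero.2 hne) hχr
  have hnull : volume ({s ∈ Icc (0 : ℝ) 1 | gK s ≠ gL s} ∩ Ioo 0 1) = 0 := by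
    refine measure_null_of_locally_null _ fun s hs => ?_
    obtain ⟨v, hv, hv0⟩ := hloc s hs.2
    exact ⟨_, inter_mem_nhdsWithin _ hv, measure_mono_null
      (Set.inter_subset_inter_left _ inter_subset_left) hv0⟩
  rw [Filter.EventuallyEq, Measure.restrict_congr_set Ioo_ae_eq_Icc.symm,
    ae_restrict_iff' measurableSet_Ioo]
  refine measure_mono_null ?_ hnull
  intro s hs
  simp only [Set.mem_compl_iff, mem_ofPred_eq, Classical.not_imp] at hs
  exact ⟨⟨Ioo_subset_Icc_self hs.1, hs.2⟩, hs.1⟩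

omit hΩ hM in
lemma MemH.mono {U V : Set Plane} (hU : MeasurableSet U) (h : V ⊆ U) : ∀ {r : ℕ} {u : ScalarField},
    MemH U r u → MemH V r u
  | 0, _, hu => MemL2.mono h hu
  | _ + 1, _, ⟨g, hg⟩ => ⟨g, fun m => ⟨(hg m).1.mono hU h, MemH.mono hU h (hg m).2⟩⟩

lemma MemH.cell (hK : K ∈ M.cells) (h : MemH Ω r u) : MemH K° r u :=
  h.mono hΩ.isOpen.measurableSet (interior_hull_subset hΩ hM hK)

lemma contRep_eq_of_shared (hK : K ∈ M.cells) (hL : L ∈ M.cells) (hab : a ≠ b) (haK : a ∈ K)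
    (hbK : b ∈ K) (haL : a ∈ L) (hbL : b ∈ L) (hu : MemH Ω 2 u) (hV : IsContRep K u V)
    (hW : IsContRep L u W) : ∀ s ∈ Icc (0 : ℝ) 1, V (edgePt a b s) = W (edgePt a b s) := by
  obtain ⟨c, h⟩ := M.exists_isTriple hK haK hbK hab
  obtain ⟨d, h'⟩ := M.exists_isTriple hL haL hbL hab
  have hae := edgeTrace_eq_of_shared hΩ hM hK hL hab haK hbK haL hbL (fun m => (hu.choose_spec m).1)
    (h.isEdgeTrace_contRep (hu.cell hΩ hM hK) hV haK hbK)
    (h'.isEdgeTrace_contRep (hu.cell hΩ hM hL) hW haL hbL)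
  have c1 : ContinuousOn (fun s => V (edgePt a b s)) (Icc 0 1) :=
    hV.1.comp (continuous_edgePt a b).continuousOn fun s hs => edgePt_mem_hull haK hbK hs
  have c2 : ContinuousOn (fun s => W (edgePt a b s)) (Icc 0 1) :=
    hW.1.comp (continuous_edgePt a b).continuousOn fun s hs => edgePt_mem_hull haL hbL hs
  exact Measure.eqOn_Icc_of_ae_eq volume zero_ne_one hae c1 c2

lemma contRep_eq_of_common_vertex (hK : K ∈ M.cells) (hL : L ∈ M.cells) (hδK : δ ∈ K) (hδL : δ ∈ L)
    (hu : MemH Ω 2 u) (hV : IsContRep K u V) (hW : IsContRep L u W) : V δ = W δ := by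
  have hex : ∀ J : Finset Plane, ∃ R, J ∈ M.cells → IsContRep J u R := by
    intro J
    by_cases hJ : J ∈ M.cells
    · obtain ⟨x, y, z, h⟩ := M.isTriple hJ
      obtain ⟨R, hR⟩ := h.exists_isContRep (hu.cell hΩ hM hJ)
      exact ⟨R, fun _ => hR⟩
    · exact ⟨0, fun h => absurd h hJ⟩
  choose R hR using hex
  obtain ⟨x, y, z, h⟩ := M.isTriple hK
  obtain ⟨x', y', z', h'⟩ := M.isTriple hL
  rw [h.isContRep_unique hV (hR K hK) (ae_eq_refl _) δ (vertex_mem_hull hδK),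
    h'.isContRep_unique hW (hR L hL) (ae_eq_refl _) δ (vertex_mem_hull hδL)]
  refine eq_of_common_vertex hΩ hM (F := fun J => R J δ) (fun J hJ J' hJ' hδ hδ' b hb hb' hne => ?_)
    hK hL hδK hδL
  have := contRep_eq_of_shared hΩ hM hJ hJ' hne.symm hδ hb hδ' hb' hu (hR J hJ) (hR J' hJ') 0
    (by simp)
  simpa [edgePt] using this

end Mesh

variable {q : ScalarField} {φ : TensorField}

/-! ### Edge data of tensor fields in `H²` -/

lemma TendstoL2.sum {α ι : Type*} [MeasurableSpace α] {μ : Measure α} {f : ι → ℕ → α → ℝ}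
    {u : ι → α → ℝ} (s : Finset ι) (hf : ∀ i n, AEStronglyMeasurable (f i n) μ)
    (hu : ∀ i, AEStronglyMeasurable (u i) μ) (h : ∀ i, TendstoL2 μ (f i) (u i)) :
    TendstoL2 μ (fun n x => ∑ i ∈ s, f i n x) fun x => ∑ i ∈ s, u i x := by
  classical
  induction s using Finset.induction_on with
  | empty => simp [TendstoL2]
  | insert i s hi ih =>
    simp only [sum_insert hi]
    exact TendstoL2.add (hf i) (hu i)
      (fun n => Finset.aestronglyMeasurable_fun_sum _ fun j _ => hf j n)
      (Finset.aestronglyMeasurable_fun_sum _ fun j _ => hu j) (h i) ih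

lemma TendstoL2.const_mul' {α : Type*} [MeasurableSpace α] {μ : Measure α} {f : ℕ → α → ℝ}
    {u : α → ℝ} (t : ℝ) (hf : ∀ n, MemLp (f n) 2 μ) (hu : MemLp u 2 μ) (h : TendstoL2 μ f u) :
    TendstoL2 μ (fun n x => t * f n x) fun x => t * u x :=
  TendstoL2.const_mul tendsto_const_nhds hf hu h

lemma normalNormal_eq_sum (a b : Plane) (T : Fin 2 → Fin 2 → ℝ) :
    normalNormal a b T = ∑ p : Fin 2 × Fin 2, normal a b p.1 * normal a b p.2 * T p.1 p.2 := by
  rw [Fintype.sum_prod_type]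
  exact sum_congr rfl fun i _ => sum_congr rfl fun j _ => by ring

lemma shear_eq_sum (a b : Plane) : ∃ κ : Fin 2 × Fin 2 × Fin 2 → ℝ,
    ∀ D : Fin 2 → Fin 2 → Fin 2 → ℝ, shear a b D = ∑ p, κ p * D p.1 p.2.1 p.2.2 := by
  refine ⟨fun p => tangent a b p.1 * tangent a b p.2.1 * normal a b p.2.2 +
    if p.1 = p.2.2 then normal a b p.2.1 else 0, fun D => ?_⟩
  simp only [shear, Fintype.sum_prod_type, sum_univ_two, Fin.isValue, zero_ne_one, one_ne_zero,
    if_true, if_false]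
  ring

section EdgeFunctions

variable {μ : Measure ℝ}

lemma memLp_normalNormal {T : Fin 2 → Fin 2 → ℝ → ℝ} (hT : ∀ i j, MemLp (T i j) 2 μ) (a b : Plane) :
    MemLp (fun s => normalNormal a b fun i j => T i j s) 2 μ := by
  simp only [normalNormal_eq_sum]
  exact memLp_finsetSum _ fun p _ => (hT p.1 p.2).const_mul _

lemma memLp_shear {G : Fin 2 → Fin 2 → Fin 2 → ℝ → ℝ} (hG : ∀ m i j, MemLp (G m i j) 2 μ)
    (a b : Plane) : MemLp (fun s => shear a b fun m i j => G m i j s) 2 μ := by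
  obtain ⟨κ, hκ⟩ := shear_eq_sum a b
  simp only [hκ]
  exact memLp_finsetSum _ fun p _ => (hG p.1 p.2.1 p.2.2).const_mul _

lemma tendstoL2_normalNormal {T : Fin 2 → Fin 2 → ℝ → ℝ} {F : ℕ → Fin 2 → Fin 2 → ℝ → ℝ}
    (hF : ∀ n i j, MemLp (F n i j) 2 μ) (hT : ∀ i j, MemLp (T i j) 2 μ)
    (h : ∀ i j, TendstoL2 μ (fun n => F n i j) (T i j)) (a b : Plane) :
    TendstoL2 μ (fun n s => normalNormal a b fun i j => F n i j s)
      fun s => normalNormal a b fun i j => T i j s := by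
  simp only [normalNormal_eq_sum]
  exact TendstoL2.sum _ (fun p n => ((hF n p.1 p.2).const_mul _).1)
    (fun p => ((hT p.1 p.2).const_mul _).1)
    fun p => TendstoL2.const_mul' _ (fun n => hF n p.1 p.2) (hT p.1 p.2) (h p.1 p.2)

lemma tendstoL2_shear {G : Fin 2 → Fin 2 → Fin 2 → ℝ → ℝ} {F : ℕ → Fin 2 → Fin 2 → Fin 2 → ℝ → ℝ}
    (hF : ∀ n m i j, MemLp (F n m i j) 2 μ) (hG : ∀ m i j, MemLp (G m i j) 2 μ)
    (h : ∀ m i j, TendstoL2 μ (fun n => F n m i j) (G m i j)) (a b : Plane) :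
    TendstoL2 μ (fun n s => shear a b fun m i j => F n m i j s)
      fun s => shear a b fun m i j => G m i j s := by
  obtain ⟨κ, hκ⟩ := shear_eq_sum a b
  simp only [hκ]
  exact TendstoL2.sum _ (fun p n => ((hF n p.1 p.2.1 p.2.2).const_mul _).1)
    (fun p => ((hG p.1 p.2.1 p.2.2).const_mul _).1)
    fun p => TendstoL2.const_mul' _ (fun n => hF n p.1 p.2.1 p.2.2) (hG p.1 p.2.1 p.2.2)
      (h p.1 p.2.1 p.2.2)

end EdgeFunctions

lemma memLp_eval (q : ℝ[X]) : MemLp (fun s => q.eval s) 2 edgeVol := by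
  obtain ⟨C, hC⟩ := (isCompact_Icc (a := (0 : ℝ)) (b := 1)).exists_bound_of_continuousOn
    q.continuous.continuousOn
  exact MemLp.of_bound q.continuous.aestronglyMeasurable C
    ((ae_restrict_iff' measurableSet_Icc).2 (ae_of_all _ hC))

lemma edgeMoment_eq (a b : Plane) (f : ℝ → ℝ) (q : ℝ[X]) :
    edgeMoment a b f q = dist a b * ∫ s in Icc (0 : ℝ) 1, f s * q.eval s := by
  rw [edgeMoment, integral_Icc_eq]

lemma edgeMoment_congr {f g : ℝ → ℝ} (h : f =ᵐ[edgeVol] g) (a b : Plane) (q : ℝ[X]) :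
    edgeMoment a b f q = edgeMoment a b g q := by
  rw [edgeMoment_eq, edgeMoment_eq]
  congr 1
  exact integral_congr_ae (h.mono fun s hs => by simp only [hs])

lemma tendsto_edgeMoment {F : ℕ → ℝ → ℝ} {f : ℝ → ℝ} (hF : ∀ n, MemLp (F n) 2 edgeVol)
    (hf : MemLp f 2 edgeVol) (h : TendstoL2 edgeVol F f) (a b : Plane) (q : ℝ[X]) :
    Tendsto (fun n => edgeMoment a b (F n) q) atTop (𝓝 (edgeMoment a b f q)) := by
  simp only [edgeMoment_eq]
  exact (TendstoL2.integral_mul hF hf (memLp_eval q) h).const_mul _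

/-- The moments of a square integrable function on an edge. -/
def momentLin (a b : Plane) (f : ℝ → ℝ)
    (hf : MemLp f 2 edgeVol) : ℝ[X] →ₗ[ℝ] ℝ :=
  have hi (q : ℝ[X]) : Integrable (fun s => f s * q.eval s)
      edgeVol := hf.integrable_mul (memLp_eval q)
  { toFun := edgeMoment a b f
    map_add' := fun p q => by
      simp only [edgeMoment_eq, Polynomial.eval_add, mul_add]
      rw [integral_add (hi p) (hi q), mul_add]
    map_smul' := fun r q => by
      simp only [edgeMoment_eq, eval_smul, smul_eq_mul, RingHom.id_apply]
      simp only [mul_left_comm _ r, integral_const_mul] }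

lemma IsEdgeTrace.congr {u u' : ScalarField} {g : ℝ → ℝ} (hg : IsEdgeTrace K a b u g)
    (h : u =ᵐ[vol K°] u') : IsEdgeTrace K a b u' g := by
  obtain ⟨h1, w, hw, ψ, hψ, p0, p1, p2⟩ := hg
  exact ⟨h1, w, fun m => (hw m).congr h (ae_eq_refl _), ψ, hψ, TendstoL2.congr_right p0 h, p1, p2⟩

/-- Continuous representatives, weak derivatives and traces of the derivatives of a tensor field
on `K`. -/
structure IsSigmaData (K : Finset Plane) (τ T : TensorField) (D : Fin 2 → TensorField)
    (G : Plane → Plane → Fin 2 → Fin 2 → Fin 2 → ℝ → ℝ) : Prop where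
  rep : ∀ i j, IsContRep K (τ i j) (T i j)
  weak : ∀ m i j, HasWeakPartial K° m (τ i j) (D m i j)
  trace : ∀ a ∈ K, ∀ b ∈ K, a ≠ b → ∀ m i j, IsEdgeTrace K a b (D m i j) (G a b m i j)

lemma IsTriple.exists_sigmaData (h : IsTriple K a b c) (hτ : ∀ i j, MemH K° 2 (τ i j))
    {D : Fin 2 → TensorField} (hD : ∀ m i j, HasWeakPartial K° m (τ i j) (D m i j)) :
    ∃ T G, IsSigmaData K τ T D G := by
  have h1 := fun i j => h.exists_isContRep (hτ i j)
  choose T hT using h1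
  have h2 : ∀ x y m i j, ∃ G, x ∈ K → y ∈ K → x ≠ y → IsEdgeTrace K x y (D m i j) G := by
    intro x y m i j
    by_cases hxy : x ∈ K ∧ y ∈ K ∧ x ≠ y
    · obtain ⟨z, hz⟩ := h.exists_third hxy.1 hxy.2.1 hxy.2.2
      obtain ⟨g, hg⟩ := hτ i j
      obtain ⟨H, hH⟩ := (hg m).2
      obtain ⟨G, hG⟩ := hz.exists_isEdgeTrace fun n => (hH n).1
      exact ⟨G, fun _ _ _ => hG.congr ((hg m).1.unique isOpen_interior (hD m i j))⟩
    · exact ⟨0, fun h1 h2 h3 => absurd ⟨h1, h2, h3⟩ hxy⟩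
  choose G hG using h2
  exact ⟨T, G, hT, hD, fun x hx y hy hxy m i j => hG x y m i j hx hy hxy⟩

lemma IsTriple.exists_sigmaData' (h : IsTriple K a b c) (hτ : ∀ i j, MemH K° 2 (τ i j)) :
    ∃ T D G, IsSigmaData K τ T D G := by
  have h0 := fun i j => hτ i j
  choose D hD using h0
  obtain ⟨T, G, hG⟩ := h.exists_sigmaData hτ fun m i j => (hD i j m).1
  exact ⟨T, _, G, hG⟩

/-- The moments of the interpolant, for any choice of representatives. -/
structure HasSigmaMoments (ℓ k : ℕ) (c : Plane) (K : Finset Plane) (τ T : TensorField)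
    (G : Plane → Plane → Fin 2 → Fin 2 → Fin 2 → ℝ → ℝ) (p : TensorPoly) : Prop where
  mem : p ∈ SigmaLocal ℓ k c
  vert : ∀ δ ∈ K, ∀ i j, ev (p i j) δ = T i j δ
  nn : ∀ a ∈ K, ∀ b ∈ K, a ≠ b → ∀ q ∈ degreeLT ℝ (ℓ - 1), edgeMoment a b (polyNN a b p) q =
      edgeMoment a b (fun s => normalNormal a b fun i j => T i j (edgePt a b s)) q
  sh : ∀ a ∈ K, ∀ b ∈ K, a ≠ b → ∀ q ∈ degreeLT ℝ ℓ, edgeMoment a b (polyShear a b p) q =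
      edgeMoment a b (fun s => shear a b fun m i j => G a b m i j s) q
  int : ∀ ς ∈ InteriorTests ℓ k c, ∫ x in hull K, ∑ i, ∑ j, ev (p i j) x * ev (ς i j) x =
    ∫ x in hull K, ∑ i, ∑ j, τ i j x * ev (ς i j) x

variable {c₀ : Plane} {τ' T : TensorField} {D : Fin 2 → TensorField}
  {G : Plane → Plane → Fin 2 → Fin 2 → Fin 2 → ℝ → ℝ} {p : TensorPoly}

lemma IsTriple.hasSigmaMoments (h : IsTriple K a b c) (hp : IsSigmaInterp ℓ k c₀ K τ p)
    (hd : IsSigmaData K τ' T D G) (hττ : ∀ i j, τ i j =ᵐ[vol K°] τ' i j) :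
    HasSigmaMoments ℓ k c₀ K τ' T G p := by
  obtain ⟨hm, T', D', hT', hD', hv, he, hint⟩ := hp
  have hττ' := hττ
  simp only [restrict_interior_hull] at hττ'
  have eT : ∀ i j, ∀ x ∈ hull K, T' i j x = T i j x := fun i j =>
    h.isContRep_unique (hT' i j) (hd.rep i j) (hττ' i j)
  refine ⟨hm, fun δ hδ i j => by rw [hv δ hδ, eT i j δ (vertex_mem_hull hδ)],
    fun x hx y hy hxy q hq => ?_, fun x hx y hy hxy q hq => ?_, fun ς hς => ?_⟩
  · rw [(he x hx y hy hxy).1 q hq]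
    refine edgeMoment_congr ?_ _ _ _
    filter_upwards [ae_restrict_mem measurableSet_Icc] with s hs
    simp only [eT _ _ _ (edgePt_mem_hull hx hy hs)]
  · obtain ⟨G', hG', hs⟩ := (he x hx y hy hxy).2
    rw [hs q hq]
    refine edgeMoment_congr ?_ _ _ _
    obtain ⟨z, hz⟩ := h.exists_third hx hy hxy
    have e : ∀ m i j, G' m i j =ᵐ[edgeVol] G x y m i j :=
      fun m i j => hz.isEdgeTrace_unique (hG' m i j) (hd.trace x hx y hy hxy m i j)
        (((hD' m i j).congr (hττ i j) (ae_eq_refl _)).unique isOpen_interior (hd.weak m i j))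
    have e' : ∀ᵐ s ∂edgeVol, ∀ m i j, G' m i j s = G x y m i j s := by
      simp only [ae_all_iff]
      exact e
    filter_upwards [e'] with s hs
    simp only [hs]
  · rw [hint ς hς]
    have e' : ∀ᵐ x ∂(vol (hull K)), ∀ i j, τ i j x = τ' i j x := by
      simp only [ae_all_iff]
      exact hττ'
    exact integral_congr_ae (e'.mono fun x hx => by simp only [hx])

lemma HasSigmaMoments.isSigmaInterp (hp : HasSigmaMoments ℓ k c₀ K τ T G p)
    (hd : IsSigmaData K τ T D G) : IsSigmaInterp ℓ k c₀ K τ p :=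
  ⟨hp.mem, T, D, hd.rep, hd.weak, hp.vert, fun a ha b hb hab => ⟨hp.nn a ha b hb hab,
    G a b, hd.trace a ha b hb hab, hp.sh a ha b hb hab⟩, hp.int⟩

lemma sigmaLocal_sub {q : TensorPoly} (hp : p ∈ SigmaLocal ℓ k c) (hq : q ∈ SigmaLocal ℓ k c) :
    p - q ∈ SigmaLocal ℓ k c := by
  have := sigmaLocal_add hp (sigmaLocal_smul (-1) hq)
  simpa [sub_eq_add_neg] using this

lemma sum_ev_mul_sub_integral (K : Finset Plane) (p p' ς : TensorPoly) :
    ∫ x in hull K, ∑ i, ∑ j, ev ((p - p') i j) x * ev (ς i j) x =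
      (∫ x in hull K, ∑ i, ∑ j, ev (p i j) x * ev (ς i j) x) -
        ∫ x in hull K, ∑ i, ∑ j, ev (p' i j) x * ev (ς i j) x := by
  simp only [← tensorForm_apply, map_sub, LinearMap.sub_apply]

lemma HasSigmaMoments.unique (h : IsTriple K a b c) (hk : 3 ≤ k) (hℓ : k ≤ ℓ + 1)
    (hp : HasSigmaMoments ℓ k c₀ K τ T G p) (hp' : HasSigmaMoments ℓ k c₀ K τ T G p') : p = p' := by
  have hvert : ∀ δ ∈ K, ∀ i j, ev (p i j) δ = ev (p' i j) δ := fun δ hδ i j => by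
    rw [hp.vert δ hδ, hp'.vert δ hδ]
  refine sub_eq_zero.1 (h.sigma_unisolvent c₀ hk hℓ (sigmaLocal_sub hp.mem hp'.mem) ?_ ?_ ?_ ?_)
  · intro δ hδ i j
    simp [hvert δ hδ]
  · intro x hx y hy hxy s
    rw [polyNN_sub, sub_eq_zero]
    exact sigmaLocal_polyNN_eq hk hℓ hp.mem hp'.mem hxy (hvert x hx) (hvert y hy)
      (fun q hq => by rw [hp.nn x hx y hy hxy q hq, hp'.nn x hx y hy hxy q hq]) s
  · intro x hx y hy hxy s
    rw [polyShear_sub, sub_eq_zero]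
    exact polyShear_eq_of_moments hxy (shearPoly_mem hk hℓ hp.mem hxy)
      (shearPoly_mem hk hℓ hp'.mem hxy)
      (fun q hq => by rw [hp.sh x hx y hy hxy q hq, hp'.sh x hx y hy hxy q hq]) s
  · intro ς hς
    rw [sum_ev_mul_sub_integral, hp.int ς hς, hp'.int ς hς, sub_self]

/-- The moments of a tensor field on a triangle. -/
def fieldLin (K : Finset Plane) (τ : TensorField) (hτ : ∀ i j, MemL2 K° (τ i j)) :
    TensorPoly →ₗ[ℝ] ℝ :=
  have hi (i j : Fin 2) (q : Poly) : Integrable (fun x => τ i j x * ev q x) (vol K°) :=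
    MemLp.integrable_mul (p := 2) (q := 2) (hτ i j) (memL2_interior_hull (continuous_ev q))
  { toFun := fun ς => ∑ i, ∑ j, ∫ x in K°, τ i j x * ev (ς i j) x
    map_add' := fun p q => by
      simp only [Pi.add_apply, ev_add, mul_add, ← sum_add_distrib]
      exact sum_congr rfl fun i _ => sum_congr rfl fun j _ =>
        integral_add (hi i j _) (hi i j _)
    map_smul' := fun r q => by
      simp only [Pi.smul_apply, ev_smul, RingHom.id_apply, smul_eq_mul, mul_sum,
        mul_left_comm _ r, integral_const_mul] }

lemma fieldLin_apply (hτ : ∀ i j, MemL2 K° (τ i j)) (ς : TensorPoly) :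
    fieldLin K τ hτ ς = ∫ x in hull K, ∑ i, ∑ j, τ i j x * ev (ς i j) x := by
  have hi : ∀ i j, Integrable (fun x => τ i j x * ev (ς i j) x) (vol K°) := fun i j =>
    MemLp.integrable_mul (p := 2) (q := 2) (hτ i j) (memL2_interior_hull (continuous_ev _))
  rw [← restrict_interior_hull,
    integral_finsetSum _ fun i _ => integrable_finsetSum _ fun j _ => hi i j]
  change ∑ i, ∑ j, ∫ x in K°, τ i j x * ev (ς i j) x = _
  exact sum_congr rfl fun i _ => (integral_finsetSum _ fun j _ => hi i j).symm

lemma IsTriple.exists_hasSigmaMoments (h : IsTriple K a b c) (c₀ : Plane) (hk : 3 ≤ k)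
    (hℓ : k ≤ ℓ + 1) (hsymm : ∀ i j, τ i j =ᵐ[vol K°] τ j i) (hd : IsSigmaData K τ T D G) :
    ∃ p, HasSigmaMoments ℓ k c₀ K τ T G p := by
  classical
  simp only [restrict_interior_hull] at hsymm
  have hTs : ∀ i j, ∀ x ∈ hull K, T i j x = T j i x := fun i j =>
    h.isContRep_unique (hd.rep i j) (hd.rep j i) (hsymm i j)
  have hτL : ∀ i j, MemL2 K° (τ i j) := fun i j => (hd.weak 0 i j).1
  let fN : Plane → Plane → ℝ → ℝ := fun x y => if x ∈ K ∧ y ∈ K ∧ x ≠ y then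
    fun s => normalNormal x y fun i j => T i j (edgePt x y s) else 0
  let fS : Plane → Plane → ℝ → ℝ := fun x y => if x ∈ K ∧ y ∈ K ∧ x ≠ y then
    fun s => shear x y fun m i j => G x y m i j s else 0
  have hfN : ∀ x y, MemLp (fN x y) 2 edgeVol := by
    intro x y
    by_cases hxy : x ∈ K ∧ y ∈ K ∧ x ≠ y
    · simp only [fN, if_pos hxy]
      exact memLp_normalNormal (fun i j => contRep_memLp_edge hxy.1 hxy.2.1 (hd.rep i j).1) _ _
    · simp only [fN, if_neg hxy]
      exact MemLp.zero
  have hfS : ∀ x y, MemLp (fS x y) 2 edgeVol := by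
    intro x y
    by_cases hxy : x ∈ K ∧ y ∈ K ∧ x ≠ y
    · simp only [fS, if_pos hxy]
      exact memLp_shear (fun m i j => (hd.trace x hxy.1 y hxy.2.1 hxy.2.2 m i j).1) _ _
    · simp only [fS, if_neg hxy]
      exact MemLp.zero
  have hsw : ∀ x y : Plane, (y ∈ K ∧ x ∈ K ∧ y ≠ x) ↔ (x ∈ K ∧ y ∈ K ∧ x ≠ y) := fun x y =>
    ⟨fun h => ⟨h.2.1, h.1, h.2.2.symm⟩, fun h => ⟨h.2.1, h.1, h.2.2.symm⟩⟩
  obtain ⟨p, hp, h1, h2, h3, h4⟩ := h.exists_sigma c₀ hk hℓ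
    (fun δ i j => if δ ∈ K then T i j δ else 0)
    (fun δ i j => by
      by_cases hδ : δ ∈ K
      · simp only [if_pos hδ, hTs i j δ (vertex_mem_hull hδ)]
      · simp only [if_neg hδ])
    (fun x y => momentLin x y (fN x y) (hfN x y)) (fun x y => momentLin x y (fS x y) (hfS x y))
    (fun x y q => by
      change edgeMoment y x (fN y x) q = edgeMoment x y (fN x y) _
      rw [← edgeMoment_swap]
      congr 1
      funext s
      by_cases hxy : x ∈ K ∧ y ∈ K ∧ x ≠ y
      · simp only [fN, if_pos hxy, if_pos ((hsw x y).2 hxy), normalNormal_swap x y, edgePt_swap x y]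
      · simp only [fN, if_neg hxy, if_neg (mt (hsw x y).1 hxy), Pi.zero_apply])
    (fun x y q => by
      change edgeMoment y x (fS y x) q = -edgeMoment x y (fS x y) _
      rw [← edgeMoment_swap]
      have e : fS y x =ᵐ[edgeVol] fun s => -fS x y (1 - s) := by
        by_cases hxy : x ∈ K ∧ y ∈ K ∧ x ≠ y
        · obtain ⟨z, hz⟩ := h.exists_third hxy.2.1 hxy.1 hxy.2.2.symm
          have e1 : ∀ᵐ s ∂edgeVol, ∀ m i j, G y x m i j s = G x y m i j (1 - s) := by
            simp only [ae_all_iff]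
            exact fun m i j => hz.isEdgeTrace_unique (hd.trace y hxy.2.1 x hxy.1 hxy.2.2.symm m i j)
              (hd.trace x hxy.1 y hxy.2.1 hxy.2.2 m i j).swap (ae_eq_refl _)
          filter_upwards [e1] with s hs
          simp only [fS, if_pos hxy, if_pos ((hsw x y).2 hxy), shear_swap x y, hs]
        · simp only [fS, if_neg hxy, if_neg (mt (hsw x y).1 hxy), Pi.zero_apply, neg_zero]
          exact ae_eq_refl _
      rw [edgeMoment_congr e]
      simp only [edgeMoment, neg_mul, intervalIntegral.integral_neg, mul_neg])
    (fieldLin K τ hτL ∘ₗ hessLin) (fun q hq => by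
      change fieldLin K τ hτL (hessPoly q) = 0
      rw [hessPoly_eq_zero hq, map_zero])
    (fieldLin K τ hτL ∘ₗ symPerpLin c₀)
  refine ⟨p, hp, fun δ hδ i j => by rw [h1 δ hδ, if_pos hδ], fun x hx y hy hxy q hq => ?_,
    fun x hx y hy hxy q hq => ?_, ?_⟩
  · rw [(h2 x hx y hy hxy).1 q hq]
    change edgeMoment x y (fN x y) q = _
    simp only [fN, if_pos (show x ∈ K ∧ y ∈ K ∧ x ≠ y from ⟨hx, hy, hxy⟩)]
  · rw [(h2 x hx y hy hxy).2 q hq]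
    change edgeMoment x y (fS x y) q = _
    simp only [fS, if_pos (show x ∈ K ∧ y ∈ K ∧ x ≠ y from ⟨hx, hy, hxy⟩)]
  · rintro ς ⟨q, hq, w, hw, hς⟩
    have e : ς = hessPoly q + symPerp c₀ w := by
      ext1 i; ext1 j
      exact hς i j
    rw [← tensorForm_apply, ← fieldLin_apply hτL, e, map_add, map_add, h3 q hq, h4 w hw]
    rfl

/-- The interpolation operator `Π_K` is well defined. -/
theorem IsTriple.existsUnique_isSigmaInterp (h : IsTriple K a b c) (c₀ : Plane) (hk : 3 ≤ k)
    (hℓ : k ≤ ℓ + 1) (hτ : MemHSym K° 2 τ) : ∃! p, IsSigmaInterp ℓ k c₀ K τ p := by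
  obtain ⟨T, D, G, hd⟩ := h.exists_sigmaData' hτ.1
  obtain ⟨p, hp⟩ := h.exists_hasSigmaMoments c₀ hk hℓ hτ.2 hd
  exact ⟨p, hp.isSigmaInterp hd, fun p' hp' =>
    (h.hasSigmaMoments hp' hd fun _ _ => ae_eq_refl _).unique h hk hℓ hp⟩

/-! ### Green's formula for tensor fields in `H²` -/

lemma isDivDiv_of_hasWeakPartial {g : Fin 2 → TensorField} {H : Fin 2 → Fin 2 → TensorField}
    (hg : ∀ i j m, HasWeakPartial U m (τ i j) (g i j m))
    (hH : ∀ i j m n, HasWeakPartial U n (g i j m) (H i j n m)) :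
    IsDivDiv U τ fun x => ∑ i, ∑ j, H i j j i x := by
  refine ⟨fun i j => (hg i j 0).1, memLp_finsetSum _ fun i _ => memLp_finsetSum _ fun j _ =>
    (hH i j i j).2.1, fun φ hφ => ?_⟩
  have i1 : ∀ i j, IntegrableOn (fun x => τ i j x * partialD i (partialD j φ) x) U := fun i j =>
    (hg i j 0).1.integrable_mul (isTest_partialD (isTest_partialD hφ j) i)
  have i2 : ∀ i j, IntegrableOn (fun x => H i j j i x * φ x) U := fun i j =>
    (hH i j i j).2.1.integrable_mul hφ
  simp only [sum_mul]
  rw [integral_finsetSum _ fun i _ => integrable_finsetSum _ fun j _ => i1 i j,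
    integral_finsetSum _ fun i _ => integrable_finsetSum _ fun j _ => i2 i j]
  refine sum_congr rfl fun i _ => ?_
  rw [integral_finsetSum _ fun j _ => i1 i j, integral_finsetSum _ fun j _ => i2 i j]
  refine sum_congr rfl fun j _ => ?_
  rw [(hg i j i).2.2 _ (isTest_partialD hφ j), (hH i j i j).2.2 φ hφ, neg_neg]

/-- The boundary contribution of an edge in Green's formula, for point values `T` and traces `G`. -/
def edgePairing (a b : Plane) (T : TensorField) (G : Fin 2 → Fin 2 → Fin 2 → ℝ → ℝ) (z : Poly) : ℝ :=
  edgeMoment a b (fun s => normalNormal a b fun i j => T i j (edgePt a b s)) (normalDeriv a b z) -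
    edgeMoment a b (fun s => shear a b fun m i j => G m i j s) (restr a b z) +
  ((∑ i, ∑ j, tangent a b i * T i j b * normal a b j) * ev z b -
    (∑ i, ∑ j, tangent a b i * T i j a * normal a b j) * ev z a)

lemma edgeTerm_eq_edgePairing (a b : Plane) (hφ : ∀ i j, ContDiff ℝ 1 (φ i j)) (z : Poly) :
    edgeTerm a b φ (ev z) =
      edgePairing a b φ (fun m i j s => partialD m (φ i j) (edgePt a b s)) z := by
  have h1 : MemLp (fun s => normalNormal a b fun i j => φ i j (edgePt a b s)) 2 edgeVol :=
    memLp_normalNormal (fun i j => memLp_edgePt (hφ i j).continuous a b) a b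
  have h2 : MemLp (fun s => shear a b fun m i j => partialD m (φ i j) (edgePt a b s)) 2 edgeVol :=
    memLp_shear (fun m i j => memLp_edgePt (continuous_partialD (hφ i j) le_rfl m) a b) a b
  have j1 : Integrable (fun s => normalNormal a b (fun i j => φ i j (edgePt a b s)) *
      (normalDeriv a b z).eval s) edgeVol :=
    h1.integrable_mul (memLp_eval (normalDeriv a b z))
  have j2 : Integrable (fun s => shear a b (fun m i j => partialD m (φ i j) (edgePt a b s)) *
      (restr a b z).eval s) edgeVol :=
    h2.integrable_mul (memLp_eval (restr a b z))
  have e : ∫ s in (0 : ℝ)..1, (normalNormal a b (fun i j => φ i j (edgePt a b s)) *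
        ∑ i, normal a b i * partialD i (ev z) (edgePt a b s) -
      shear a b (fun m i j => partialD m (φ i j) (edgePt a b s)) * ev z (edgePt a b s)) =
      (∫ s in Icc (0 : ℝ) 1, normalNormal a b (fun i j => φ i j (edgePt a b s)) *
        (normalDeriv a b z).eval s) - ∫ s in Icc (0 : ℝ) 1,
        shear a b (fun m i j => partialD m (φ i j) (edgePt a b s)) * (restr a b z).eval s := by
    rw [← integral_sub j1 j2, integral_Icc_eq]
    simp only [partialD_ev, eval_normalDeriv, eval_restr]
  rw [edgeTerm, edgePairing, e, edgeMoment_eq, edgeMoment_eq]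
  ring

lemma IsTriple.green_sigmaData (h : IsTriple K a b c) (hτ : ∀ i j, MemH K° 2 (τ i j))
    (hd : IsSigmaData K τ T D G) (hq : IsDivDiv K° τ q) (z : Poly) :
    (∫ x in hull K, ∑ i, ∑ j, τ i j x * ev (hessPoly z i j) x) - ∫ x in hull K, q x * ev z x =
      1 / 2 * ∑ a ∈ K, ∑ b ∈ K, orient K a b * edgePairing a b T (G a b) z := by
  have hA := fun i j => h.exists_isApprox (hτ i j)
  choose g H φ V hA using hA
  have hqH := hq.unique isOpen_interior (isDivDiv_of_hasWeakPartial
    (fun i j => (hA i j).weak) (fun i j => (hA i j).weak'))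
  have hV : ∀ i j, ∀ x ∈ hull K, V i j x = T i j x := fun i j =>
    h.isContRep_unique (hA i j).rep (hd.rep i j) (ae_eq_refl _)
  have s1 : ∀ i j n, ContDiff ℝ 1 (φ i j n) := fun i j n => ((hA i j).smooth n).of_le (by simp)
  have s2 : ∀ i j n, ContDiff ℝ 2 (φ i j n) := fun i j n =>
    ((hA i j).smooth n).of_le (WithTop.coe_le_coe.2 le_top)
  have sd : ∀ i j n m l, Continuous (partialD m (partialD l (φ i j n))) := fun i j n m l =>
    (contDiff_partialD_top (contDiff_partialD_top ((hA i j).smooth n) l) m).continuous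
  have hG := fun n => h.green_divDiv (fun i j => s2 i j n) (contDiff_two_ev z)
  -- the three limits
  have l1 : Tendsto (fun n => ∫ x in hull K, ∑ i, ∑ j, φ i j n x * partialD i (partialD j (ev z)) x)
      atTop (𝓝 (∫ x in hull K, ∑ i, ∑ j, τ i j x * ev (hessPoly z i j) x)) := by
    have hφL : ∀ n i j, MemL2 K° (φ i j n) := fun n i j =>
      memL2_interior_hull (s1 i j n).continuous
    have e : ∀ n, ∫ x in hull K, ∑ i, ∑ j, φ i j n x * partialD i (partialD j (ev z)) x =
        ∑ i, ∑ j, ∫ x in K°, φ i j n x * ev (hessPoly z i j) x := fun n => by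
      have := fieldLin_apply (τ := fun i j => φ i j n) (hφL n) (hessPoly z)
      simp only [partialD_ev]
      exact this.symm
    simp only [e]
    rw [← fieldLin_apply fun i j => ((hA i j).weak 0).1]
    exact tendsto_finsetSum _ fun i _ => tendsto_finsetSum _ fun j _ =>
      TendstoL2.integral_mul (fun n => hφL n i j) ((hA i j).weak 0).1
        (memL2_interior_hull (continuous_ev _)) (hA i j).tendsto
  have l2 : Tendsto (fun n => ∫ x in hull K, (∑ i, ∑ j, partialD i (partialD j (φ i j n)) x) * ev z x)
      atTop (𝓝 (∫ x in hull K, q x * ev z x)) := by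
    rw [← restrict_interior_hull]
    refine TendstoL2.integral_mul (fun n => memL2_interior_hull (continuous_finsetSum _ fun i _ =>
      continuous_finsetSum _ fun j _ => sd i j n i j)) hq.2.1 (memL2_interior_hull (continuous_ev _))
      (TendstoL2.congr_right ?_ hqH.symm)
    have hc : ∀ i j n, partialD i (partialD j (φ i j n)) = partialD j (partialD i (φ i j n)) :=
      fun i j n => funext fun x => by rw [partialD_comm (s2 i j n)]
    have hs : (fun n x => ∑ i, ∑ j, partialD i (partialD j (φ i j n)) x) =
        fun n x => ∑ i, ∑ j, partialD j (partialD i (φ i j n)) x := by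
      funext n x
      exact sum_congr rfl fun i _ => sum_congr rfl fun j _ => by rw [hc]
    rw [hs]
    exact TendstoL2.sum _ (fun i n => (continuous_finsetSum _ fun j _ =>
        sd i j n j i).aestronglyMeasurable)
      (fun i => Finset.aestronglyMeasurable_fun_sum _ fun j _ => ((hA i j).weak' i j).2.1.1)
      fun i => TendstoL2.sum _ (fun j n => (sd i j n j i).aestronglyMeasurable)
        (fun j => ((hA i j).weak' i j).2.1.1) fun j => (hA i j).tendsto'' i j
  have l3 : Tendsto (fun n => 1 / 2 * ∑ a ∈ K, ∑ b ∈ K, orient K a b *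
      edgeTerm a b (fun i j => φ i j n) (ev z)) atTop
      (𝓝 (1 / 2 * ∑ a ∈ K, ∑ b ∈ K, orient K a b * edgePairing a b T (G a b) z)) := by
    refine (tendsto_finsetSum _ fun x hx => tendsto_finsetSum _ fun y hy => ?_).const_mul _
    by_cases hxy : x = y
    · subst hxy
      simp
    obtain ⟨w, hw⟩ := h.exists_third hx hy hxy
    refine Tendsto.const_mul _ ?_
    simp only [edgeTerm_eq_edgePairing x y (fun i j => s1 i j _)]
    have c1 : Tendsto (fun n => edgeMoment x y (fun s => normalNormal x y fun i j =>
        φ i j n (edgePt x y s)) (normalDeriv x y z)) atTop (𝓝 (edgeMoment x y (fun s =>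
          normalNormal x y fun i j => T i j (edgePt x y s)) (normalDeriv x y z))) := by
      have m1 : ∀ n i j, MemLp (fun s => φ i j n (edgePt x y s)) 2 edgeVol := fun n i j =>
        memLp_edgePt (s1 i j n).continuous x y
      have m2 : ∀ i j, MemLp (fun s => T i j (edgePt x y s)) 2 edgeVol := fun i j =>
        contRep_memLp_edge hx hy (hd.rep i j).1
      refine tendsto_edgeMoment (fun n => memLp_normalNormal (m1 n) x y)
        (memLp_normalNormal m2 x y) (tendstoL2_normalNormal m1 m2 (fun i j => ?_) x y) _ _ _
      refine TendstoL2.congr_right ((hA i j).tendsto_edge hx hy) ?_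
      filter_upwards [ae_restrict_mem measurableSet_Icc] with s hs
      exact hV i j _ (edgePt_mem_hull hx hy hs)
    have c2 : Tendsto (fun n => edgeMoment x y (fun s => shear x y fun m i j =>
        partialD m (φ i j n) (edgePt x y s)) (restr x y z)) atTop (𝓝 (edgeMoment x y (fun s =>
          shear x y fun m i j => G x y m i j s) (restr x y z))) := by
      have m1 : ∀ n m i j, MemLp (fun s => partialD m (φ i j n) (edgePt x y s)) 2
          edgeVol := fun n m i j =>
        memLp_edgePt (continuous_partialD (s1 i j n) le_rfl m) x y
      have m2 := fun m i j => (hd.trace x hx y hy hxy m i j).1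
      exact tendsto_edgeMoment (fun n => memLp_shear (m1 n) x y) (memLp_shear m2 x y)
        (tendstoL2_shear m1 m2 (fun m i j =>
          (hA i j).tendsto_trace hw (hd.weak m i j) (hd.trace x hx y hy hxy m i j)) x y) _ _ _
    have c3 : ∀ δ ∈ K, ∀ i j, Tendsto (fun n => φ i j n δ) atTop (𝓝 (T i j δ)) := fun δ hδ i j => by
      rw [← hV i j δ (vertex_mem_hull hδ)]
      exact (hA i j).uniform.tendsto_at (vertex_mem_hull hδ)
    have c4 : ∀ δ ∈ K, Tendsto (fun n => (∑ i, ∑ j, tangent x y i * φ i j n δ * normal x y j) *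
        ev z δ) atTop (𝓝 ((∑ i, ∑ j, tangent x y i * T i j δ * normal x y j) * ev z δ)) :=
      fun δ hδ => (tendsto_finsetSum _ fun i _ => tendsto_finsetSum _ fun j _ =>
        ((c3 δ hδ i j).const_mul _).mul_const _).mul_const _
    exact (c1.sub c2).add ((c4 y hy).sub (c4 x hx))
  exact tendsto_nhds_unique ((l1.sub l2).congr hG) l3

/-- `div div` of the interpolant is the `L²` projection of `div div` of the tensor field. -/
theorem IsTriple.isL2Proj_divDivPoly (h : IsTriple K a b c) (hk : 3 ≤ k) (hℓ : k ≤ ℓ + 1)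
    (hτ : ∀ i j, MemH K° 2 (τ i j)) (hq : IsDivDiv K° τ q) (hp : IsSigmaInterp ℓ k c₀ K τ p) :
    IsL2Proj (k - 2) K q (divDivPoly p) := by
  obtain ⟨T, D, G, hd⟩ := h.exists_sigmaData' hτ
  have hm := h.hasSigmaMoments hp hd fun _ _ => ae_eq_refl _
  refine ⟨divDivPoly_mem hm.mem, fun z hz => ?_⟩
  have e1 := h.green_sigmaData hτ hd hq z
  have e2 := h.green_divDivPoly p (contDiff_two_ev z)
  have e3 := hm.int _ (hessPoly_mem_tests c₀ hz)
  have e4 : ∑ a ∈ K, ∑ b ∈ K, orient K a b * edgePairing a b T (G a b) z =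
      ∑ a ∈ K, ∑ b ∈ K, orient K a b * edgeTerm a b (fun i j => ev (p i j)) (ev z) := by
    refine sum_congr rfl fun x hx => sum_congr rfl fun y hy => ?_
    by_cases hxy : x = y
    · simp [hxy]
    have d1 : normalDeriv x y z ∈ degreeLT ℝ (ℓ - 1) := by
      obtain ⟨r, hr⟩ : ∃ r, k - 2 = r + 1 := ⟨k - 3, by omega⟩
      rw [hr] at hz
      exact degreeLT_mono (by omega) (normalDeriv_mem x y hz)
    have d2 : restr x y z ∈ degreeLT ℝ ℓ := degreeLT_mono (by omega) (restr_mem_degreeLT x y hz)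
    rw [edgeTerm_eq_edgePairing x y (fun i j => (contDiff_two_ev _).of_le (by norm_num)),
      edgePairing, edgePairing, ← hm.nn x hx y hy hxy _ d1, ← hm.sh x hx y hy hxy _ d2]
    simp only [← hm.vert x hx, ← hm.vert y hy, partialD_ev]
    rfl
  simp only [partialD_ev] at e2
  simp only [hessPoly] at e1 e3
  rw [e4, ← e2, ← e3] at e1
  linarith

variable {ψ : VectorField}

/-! ### Linear combinations -/

lemma symCurlOf_eq_smul_add (i j : Fin 2) : ∃ (s t : ℝ) (m m' : Fin 2),
    ∀ {R : Type} [AddCommGroup R] [Module ℝ R] (D : Fin 2 → Fin 2 → R),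
      symCurlOf D i j = s • D m i + t • D m' j := by
  have h : ∀ j, ∃ (s : ℝ) (m : Fin 2), ∀ {R : Type} [AddCommGroup R] [Module ℝ R]
      (D : Fin 2 → Fin 2 → R) (i : Fin 2), (1 / 2 : ℝ) • curlOf D i j = s • D m i := fun j => by
    fin_cases j
    · exact ⟨1 / 2, 1, fun _ _ => rfl⟩
    · exact ⟨-(1 / 2), 0, fun D i => by simp [curlOf]⟩
  obtain ⟨s, m, e⟩ := h j
  obtain ⟨t, m', e'⟩ := h i
  exact ⟨s, t, m, m', fun D => by rw [symCurlOf, smul_add, e, e']⟩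

lemma symCurlOf_apply (D : TensorField) (i j : Fin 2) (x : Plane) :
    symCurlOf D i j x = symCurlOf (fun m i => D m i x) i j := by
  obtain ⟨s, t, m, m', e⟩ := symCurlOf_eq_smul_add i j
  rw [e, e]
  rfl

lemma symCurlOf_symm {R : Type*} [AddCommGroup R] [Module ℝ R] (D : Fin 2 → Fin 2 → R) (i j : Fin 2)
    : symCurlOf D i j = symCurlOf D j i := by
  rw [symCurlOf, symCurlOf, add_comm]

lemma HasWeakPartial.smul_add {u g g' : ScalarField} (h : HasWeakPartial U m u g)
    (h' : HasWeakPartial U m u' g') (s t : ℝ) :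
    HasWeakPartial U m (s • u + t • u') (s • g + t • g') := by
  refine ⟨(h.1.const_smul s).add (h'.1.const_smul t),
    (h.2.1.const_smul s).add (h'.2.1.const_smul t), fun φ hφ => ?_⟩
  have e : ∀ {f f' ψ : ScalarField}, MemL2 U f → MemL2 U f' → IsTest U ψ →
      ∫ x in U, (s • f + t • f') x * ψ x =
        s * (∫ x in U, f x * ψ x) + t * ∫ x in U, f' x * ψ x := fun hf hf' hψ => by
    rw [← integral_const_mul, ← integral_const_mul,
      ← integral_add ((hf.integrable_mul hψ).const_mul s) ((hf'.integrable_mul hψ).const_mul t)]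
    simp only [Pi.add_apply, Pi.smul_apply, smul_eq_mul, add_mul, mul_assoc]
  rw [e h.1 h'.1 (isTest_partialD hφ m), e h.2.1 h'.2.1 hφ, h.2.2 φ hφ, h'.2.2 φ hφ]
  ring

lemma MemH.smul_add (s t : ℝ) : ∀ {r : ℕ} {u u' : ScalarField},
    MemH U r u → MemH U r u' → MemH U r (s • u + t • u')
  | 0, _, _, h, h' => MemLp.add (MemLp.const_smul h s) (MemLp.const_smul h' t)
  | _ + 1, _, _, ⟨g, hg⟩, ⟨g', hg'⟩ => ⟨fun m => s • g m + t • g' m, fun m =>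
      ⟨(hg m).1.smul_add (hg' m).1 s t, MemH.smul_add s t (hg m).2 (hg' m).2⟩⟩

lemma MemH.congr {u : ScalarField} (h : MemH U r u) (e : u =ᵐ[vol U] u') : MemH U r u' := by
  cases r with
  | zero => exact MemL2.congr h e
  | succ r =>
    obtain ⟨g, hg⟩ := h
    exact ⟨g, fun m => ⟨(hg m).1.congr e (ae_eq_refl _), (hg m).2⟩⟩

lemma IsSymCurl.unique (hU : IsOpen U) {τ τ' : TensorField} (h : IsSymCurl U v τ)
    (h' : IsSymCurl U v τ') (i j : Fin 2) : τ i j =ᵐ[vol U] τ' i j := by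
  obtain ⟨D, hD, e⟩ := h
  obtain ⟨D', hD', e'⟩ := h'
  obtain ⟨s, t, m, m', hs⟩ := symCurlOf_eq_smul_add i j
  filter_upwards [e i j, e' i j, (hD m i).unique hU (hD' m i), (hD m' j).unique hU (hD' m' j)]
    with x h1 h2 h3 h4
  simp [h1, h2, hs, h3, h4]

lemma TendstoL2.smul_add {α : Type*} [MeasurableSpace α] {μ : Measure α} {f f' : ℕ → α → ℝ}
    {u u' : α → ℝ} (hf : ∀ n, MemLp (f n) 2 μ) (hf' : ∀ n, MemLp (f' n) 2 μ) (hu : MemLp u 2 μ)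
    (hu' : MemLp u' 2 μ) (h : TendstoL2 μ f u) (h' : TendstoL2 μ f' u') (s t : ℝ) :
    TendstoL2 μ (fun n => s • f n + t • f' n) (s • u + t • u') :=
  TendstoL2.add (fun n => ((hf n).const_smul s).1) (hu.const_smul s).1
    (fun n => ((hf' n).const_smul t).1) (hu'.const_smul t).1
    (TendstoL2.const_mul' s hf hu h) (TendstoL2.const_mul' t hf' hu' h')

lemma partialD_smul_add {f f' : ScalarField} (hf : ContDiff ℝ ∞ f) (hf' : ContDiff ℝ ∞ f') (s t : ℝ)
    (m : Fin 2) : partialD m (s • f + t • f') = s • partialD m f + t • partialD m f' := by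
  funext x
  have h1 : DifferentiableAt ℝ f x := hf.differentiable (by simp) x
  have h2 : DifferentiableAt ℝ f' x := hf'.differentiable (by simp) x
  simp [partialD, fderiv_add (h1.const_smul s) (h2.const_smul t), fderiv_const_smul h1,
    fderiv_const_smul h2]

lemma IsApprox.smul_add {u : ScalarField} {g g' : VectorField} {H H' : TensorField}
    {φ φ' : ℕ → ScalarField} {V V' : ScalarField} (h : IsApprox K u g H φ V)
    (h' : IsApprox K u' g' H' φ' V') (s t : ℝ) :
    IsApprox K (s • u + t • u') (fun m => s • g m + t • g' m)
      (fun i m => s • H i m + t • H' i m) (fun n => s • φ n + t • φ' n) (s • V + t • V') := by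
  have hd : ∀ m n, partialD m (s • φ n + t • φ' n) = s • partialD m (φ n) + t • partialD m (φ' n) :=
    fun m n => partialD_smul_add (h.smooth n) (h'.smooth n) s t m
  have hd' : ∀ m i n, partialD i (partialD m (s • φ n + t • φ' n)) =
      s • partialD i (partialD m (φ n)) + t • partialD i (partialD m (φ' n)) := fun m i n => by
    rw [hd, partialD_smul_add (contDiff_partialD_top (h.smooth n) m)
      (contDiff_partialD_top (h'.smooth n) m)]
  have l {f : ScalarField} (hf : ContDiff ℝ ∞ f) : MemL2 K° f := memL2_interior_hull hf.continuous
  have p {f : ScalarField} (hf : ContDiff ℝ ∞ f) (m : Fin 2) := contDiff_partialD_top hf m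
  refine ⟨fun n => ((h.smooth n).const_smul s).add ((h'.smooth n).const_smul t),
    fun m => (h.weak m).smul_add (h'.weak m) s t, fun m i => (h.weak' m i).smul_add (h'.weak' m i) s t,
    TendstoL2.smul_add (fun n => l (h.smooth n)) (fun n => l (h'.smooth n)) (h.weak 0).1
      (h'.weak 0).1 h.tendsto h'.tendsto s t, fun m => ?_, fun m i => ?_,
    ⟨(h.rep.1.const_smul s).add (h'.rep.1.const_smul t),
      (h.rep.2.const_smul s).add (h'.rep.2.const_smul t)⟩, ?_⟩
  · simp only [hd]
    exact TendstoL2.smul_add (fun n => l (p (h.smooth n) m)) (fun n => l (p (h'.smooth n) m))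
      (h.weak m).2.1 (h'.weak m).2.1 (h.tendsto' m) (h'.tendsto' m) s t
  · simp only [hd']
    exact TendstoL2.smul_add (fun n => l (p (p (h.smooth n) m) i))
      (fun n => l (p (p (h'.smooth n) m) i)) (h.weak' m i).2.1 (h'.weak' m i).2.1
      (h.tendsto'' m i) (h'.tendsto'' m i) s t
  · exact ((uniformContinuous_const_smul s).comp_tendstoUniformlyOn h.uniform).add
      ((uniformContinuous_const_smul t).comp_tendstoUniformlyOn h'.uniform)

/-! ### Integration by parts on an edge -/

/-- `F` is the tangential derivative of `f`, tested with polynomials. -/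
def IsEdgeDeriv (a b : Plane) (f F : ℝ → ℝ) : Prop :=
  MemLp f 2 edgeVol ∧ MemLp F 2 edgeVol ∧
    ∀ q : ℝ[X], edgeMoment a b F q = f 1 * q.eval 1 - f 0 * q.eval 0 -
      ∫ s in Icc (0 : ℝ) 1, f s * (derivative q).eval s

lemma edgeMoment_sum {ι : Type*} [Fintype ι] (κ : ι → ℝ) {f : ι → ℝ → ℝ}
    (hf : ∀ i, MemLp (f i) 2 edgeVol) (a b : Plane) (q : ℝ[X]) :
    edgeMoment a b (fun s => ∑ i, κ i * f i s) q = ∑ i, κ i * edgeMoment a b (f i) q := by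
  have hi : ∀ i, Integrable (fun s => f i s * q.eval s) edgeVol :=
    fun i => (hf i).integrable_mul (memLp_eval q)
  simp only [edgeMoment_eq, sum_mul, mul_assoc]
  rw [integral_finsetSum _ fun i _ => (hi i).const_mul _, mul_sum]
  simp only [integral_const_mul, mul_left_comm]

lemma IsEdgeDeriv.sum {ι : Type*} [Fintype ι] (κ : ι → ℝ) {f F : ι → ℝ → ℝ}
    (h : ∀ i, IsEdgeDeriv a b (f i) (F i)) :
    IsEdgeDeriv a b (fun s => ∑ i, κ i * f i s) fun s => ∑ i, κ i * F i s := by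
  refine ⟨memLp_finsetSum _ fun i _ => (h i).1.const_mul _,
    memLp_finsetSum _ fun i _ => (h i).2.1.const_mul _, fun q => ?_⟩
  have hi : ∀ i, Integrable (fun s => f i s * (derivative q).eval s)
      edgeVol := fun i => (h i).1.integrable_mul (memLp_eval _)
  rw [edgeMoment_sum κ fun i => (h i).2.1]
  simp only [(h _).2.2 q, sum_mul, mul_assoc]
  rw [integral_finsetSum _ fun i _ => (hi i).const_mul _, ← sum_sub_distrib, ← sum_sub_distrib]
  exact sum_congr rfl fun i _ => by rw [integral_const_mul]; ring

lemma IsEdgeDeriv.moment_eq {f F f' F' : ℝ → ℝ} (hab : a ≠ b) (h : IsEdgeDeriv a b f F)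
    (h' : IsEdgeDeriv a b f' F') (h0 : f 0 = f' 0) (h1 : f 1 = f' 1)
    (hm : ∀ q ∈ degreeLT ℝ n, edgeMoment a b f q = edgeMoment a b f' q) {q : ℝ[X]}
    (hq : q ∈ degreeLT ℝ (n + 1)) : edgeMoment a b F q = edgeMoment a b F' q := by
  have hq' : derivative q ∈ degreeLT ℝ n := by
    rw [mem_degreeLT, Polynomial.degree_lt_iff_coeff_zero] at *
    exact fun m hm => by rw [Polynomial.coeff_derivative, hq _ (by omega), zero_mul]
  have e := hm _ hq'
  rw [edgeMoment_eq, edgeMoment_eq] at e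
  rw [h.2.2, h'.2.2, h0, h1, mul_left_cancel₀ (dist_pos.2 hab).ne' e]

lemma isEdgeDeriv_of_contDiff (hab : a ≠ b) {f : ScalarField} (hf : ContDiff ℝ 1 f) :
    IsEdgeDeriv a b (fun s => f (edgePt a b s))
      fun s => ∑ m, tangent a b m * partialD m f (edgePt a b s) := by
  have hc : Continuous fun x => ∑ m, tangent a b m * partialD m f x :=
    continuous_finsetSum _ fun m _ => (continuous_partialD hf le_rfl m).const_mul _
  refine ⟨memLp_edgePt hf.continuous a b, memLp_edgePt hc a b, fun q => ?_⟩
  have hd : ∀ s, HasDerivAt (fun s => f (edgePt a b s))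
      (dist a b * ∑ m, tangent a b m * partialD m f (edgePt a b s)) s := fun s =>
    hasDerivAt_edgePt hab (hf.differentiable (by simp)) s
  rw [edgeMoment, integral_Icc_eq, ← intervalIntegral.integral_const_mul]
  have := intervalIntegral.integral_mul_deriv_eq_deriv_mul (a := 0) (b := 1) (u := fun s => q.eval s)
    (v := fun s => f (edgePt a b s)) (fun s _ => q.hasDerivAt s) (fun s _ => hd s)
    (q.derivative.continuous.intervalIntegrable _ _)
    ((continuous_const.mul (hc.comp (continuous_edgePt a b))).intervalIntegrable _ _)
  simp only [edgePt, AffineMap.lineMap_apply_zero, AffineMap.lineMap_apply_one] at this ⊢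
  convert this using 1
  · congr 1; funext s; ring
  · simp only [mul_comm]

lemma IsApprox.isEdgeDeriv {ι : Type*} [Fintype ι] (κ : ι → ℝ) {u : ι → ScalarField}
    {g : ι → VectorField} {H : ι → TensorField} {φ : ι → ℕ → ScalarField} {V : ι → ScalarField}
    (hA : ∀ i, IsApprox K (u i) (g i) (H i) (φ i) (V i)) (ha : a ∈ K) (hb : b ∈ K) {F : ℕ → ℝ → ℝ}
    {F' : ℝ → ℝ} (hF : ∀ n, IsEdgeDeriv a b (fun s => ∑ i, κ i * φ i n (edgePt a b s)) (F n))
    (hF' : MemLp F' 2 edgeVol) (h : TendstoL2 edgeVol F F') :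
    IsEdgeDeriv a b (fun s => ∑ i, κ i * V i (edgePt a b s)) F' := by
  have hV : ∀ i, MemLp (fun s => V i (edgePt a b s)) 2 edgeVol :=
    fun i => contRep_memLp_edge ha hb (hA i).rep.1
  have hs := memLp_finsetSum (f := fun i s => κ i * V i (edgePt a b s)) Finset.univ
    fun i _ => (hV i).const_mul (κ i)
  have hφ : ∀ i n, MemLp (fun s => φ i n (edgePt a b s)) 2 edgeVol :=
    fun i n => memLp_edgePt ((hA i).smooth n).continuous a b
  have ht := TendstoL2.sum Finset.univ (fun i n => ((hφ i n).const_mul (κ i)).1)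
    (fun i => ((hV i).const_mul (κ i)).1)
    fun i => TendstoL2.const_mul' (κ i) (hφ i) (hV i) ((hA i).tendsto_edge ha hb)
  refine ⟨hs, hF', fun q => ?_⟩
  have hp : ∀ t ∈ Icc (0 : ℝ) 1, Tendsto (fun n => ∑ i, κ i * φ i n (edgePt a b t)) atTop
      (𝓝 (∑ i, κ i * V i (edgePt a b t))) := fun t ht => tendsto_finsetSum _ fun i _ =>
    ((hA i).uniform.tendsto_at (edgePt_mem_hull ha hb ht)).const_mul _
  have l1 := tendsto_edgeMoment (fun n => (hF n).2.1) hF' h a b q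
  simp only [fun n => (hF n).2.2 q] at l1
  exact tendsto_nhds_unique l1 ((((hp 1 (by simp)).mul_const _).sub ((hp 0 (by simp)).mul_const _)).sub
    (TendstoL2.integral_mul (fun n => (hF n).1) hs (memLp_eval _) ht))

lemma isEdgeDeriv_normalNormal (hab : a ≠ b) (hψ : ∀ i, ContDiff ℝ 1 (ψ i)) :
    IsEdgeDeriv a b (fun s => ∑ i, normal a b i * ψ i (edgePt a b s)) fun s =>
      normalNormal a b fun i j => symCurlOf (fun m i => partialD m (ψ i)) i j (edgePt a b s) := by
  convert IsEdgeDeriv.sum (normal a b) fun i => isEdgeDeriv_of_contDiff hab (hψ i) using 2 with s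
  simp only [symCurlOf_apply]
  change normalNormal a b (symCurlOf _) = _
  rw [normalNormal_symCurlOf]
  simp only [sum_univ_two]
  ring

lemma isEdgeDeriv_tangent (hab : a ≠ b) (hψ : ∀ i, ContDiff ℝ 1 (ψ i)) :
    IsEdgeDeriv a b (fun s => ∑ i, tangent a b i * ψ i (edgePt a b s)) fun s =>
      ∑ p : Fin 2 × Fin 2, tangent a b p.1 * tangent a b p.2 * partialD p.1 (ψ p.2) (edgePt a b s) := by
  convert IsEdgeDeriv.sum (tangent a b) fun i => isEdgeDeriv_of_contDiff hab (hψ i) using 2 with s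
  simp only [sum_univ_two, Fintype.sum_prod_type]
  ring

lemma isEdgeDeriv_shear (hab : a ≠ b) (hψ : ∀ i, ContDiff ℝ ∞ (ψ i)) :
    IsEdgeDeriv a b (fun s => ∑ p : Fin 2 × Fin 2,
        tangent a b p.1 * tangent a b p.2 * partialD p.1 (ψ p.2) (edgePt a b s)) fun s =>
      shear a b fun m i j => partialD m (symCurlOf (fun m i => partialD m (ψ i)) i j)
        (edgePt a b s) := by
  have h1 := fun i l => contDiff_partialD_top (hψ i) l
  convert IsEdgeDeriv.sum (fun p : Fin 2 × Fin 2 => tangent a b p.1 * tangent a b p.2)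
    fun p => isEdgeDeriv_of_contDiff hab ((h1 p.2 p.1).of_le (by simp)) using 2 with s
  have e : ∀ m i j, partialD m (symCurlOf (fun m i => partialD m (ψ i)) i j) (edgePt a b s) =
      symCurlOf (fun l i => partialD m (partialD l (ψ i)) (edgePt a b s)) i j := fun m i j => by
    obtain ⟨s, t, m, m', e⟩ := symCurlOf_eq_smul_add i j
    rw [e, e, partialD_smul_add (h1 _ _) (h1 _ _)]
    rfl
  simp only [e]
  change shear a b (fun m => symCurlOf _) = _
  rw [shear_symCurlOf hab _ fun i => by
    rw [partialD_comm ((hψ i).of_le (WithTop.coe_le_coe.2 le_top))]]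
  simp only [sum_univ_two, Fintype.sum_prod_type]
  ring

/-- Approximations of a field in `H³` and of its derivatives. -/
structure IsVApprox (K : Finset Plane) (v : VectorField) (g : TensorField)
    (H : Fin 2 → TensorField) (J : Fin 2 → Fin 2 → TensorField)
    (φ : Fin 2 → ℕ → ScalarField) (V : VectorField) (D : TensorField) : Prop where
  app (i) : IsApprox K (v i) (fun m => g m i) (fun l m => H l m i) (φ i) (V i)
  app' (m i) : IsApprox K (g m i) (fun l => H l m i) (fun j l => J j l m i)
    (fun n => partialD m (φ i n)) (D m i)

lemma IsTriple.exists_isVApprox (h : IsTriple K a b c) (hv : MemHVec K° 3 v) :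
    ∃ g H J φ V D, IsVApprox K v g H J φ V D := by
  choose g H J φ V D hA hB using fun i => h.exists_isApprox_three (hv i)
  exact ⟨fun m i => g i m, fun l m i => H i l m, fun j l m i => J i j l m, φ, V, fun m i => D i m,
    fun i => hA i, fun m i => hB i m⟩

/-- The polynomials in `ℙ_{ℓ+1}` with the vertex and edge data of a field. -/
structure HasVMoments (ℓ : ℕ) (K : Finset Plane) (V : VectorField) (D : TensorField)
    (p : Fin 2 → Poly) : Prop where
  mem (i) : p i ∈ polyDeg (ℓ + 1)
  vert : ∀ δ ∈ K, ∀ i, ev (p i) δ = V i δ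
  grad : ∀ δ ∈ K, ∀ m i, ev (pderiv m (p i)) δ = D m i δ
  edge : ∀ a ∈ K, ∀ b ∈ K, a ≠ b → ∀ q ∈ degreeLT ℝ (ℓ - 2), ∀ i,
    edgeMoment a b (fun s => ev (p i) (edgePt a b s)) q =
      edgeMoment a b (fun s => V i (edgePt a b s)) q

namespace IsVApprox

variable {V : VectorField} {g D : TensorField} {H : Fin 2 → TensorField}
  {J : Fin 2 → Fin 2 → TensorField} {φ : Fin 2 → ℕ → ScalarField} {p : Fin 2 → Poly}

lemma symCurl (h : IsVApprox K v g H J φ V D) (i j : Fin 2) :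
    IsApprox K (symCurlOf g i j) (fun l => symCurlOf (H l) i j) (fun k l => symCurlOf (J k l) i j)
      (fun n => symCurlOf (fun m i => partialD m (φ i n)) i j) (symCurlOf D i j) := by
  obtain ⟨s, t, m, m', e⟩ := symCurlOf_eq_smul_add i j
  simp only [e]
  exact (h.app' m i).smul_add (h.app' m' j) s t

lemma isSymCurl (h : IsVApprox K v g H J φ V D) : IsSymCurl K° v (symCurlOf g) :=
  ⟨g, fun m i => (h.app i).weak m, fun _ _ => ae_eq_refl _⟩

lemma ev_symCurlPoly (p : Fin 2 → Poly) (i j : Fin 2) :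
    ev (symCurlPoly p i j) = symCurlOf (fun m i => partialD m (ev (p i))) i j := by
  obtain ⟨s, t, m, m', e⟩ := symCurlOf_eq_smul_add i j
  rw [symCurlPoly, e, e]
  funext x
  simp [partialD_ev]

lemma nn_moment (h : IsVApprox K v g H J φ V D) (hp : HasVMoments ℓ K V D p) (hℓ : 2 ≤ ℓ)
    (ha : a ∈ K) (hb : b ∈ K) (hab : a ≠ b) {q : ℝ[X]} (hq : q ∈ degreeLT ℝ (ℓ - 1)) :
    edgeMoment a b (polyNN a b (symCurlPoly p)) q =
      edgeMoment a b (fun s => normalNormal a b fun i j => symCurlOf D i j (edgePt a b s)) q := by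
  have d1 := isEdgeDeriv_normalNormal hab fun i => (contDiff_ev (p i)).of_le (by simp)
  simp only [← ev_symCurlPoly] at d1
  have d2 := IsApprox.isEdgeDeriv (normal a b) h.app ha hb
    (fun n => isEdgeDeriv_normalNormal hab fun i => ((h.app i).smooth n).of_le (by simp))
    (memLp_normalNormal (fun i j => contRep_memLp_edge ha hb (h.symCurl i j).rep.1) a b)
    (tendstoL2_normalNormal (fun n i j => memLp_edgePt ((h.symCurl i j).smooth n).continuous a b)
      (fun i j => contRep_memLp_edge ha hb (h.symCurl i j).rep.1)
      (fun i j => (h.symCurl i j).tendsto_edge ha hb) a b)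
  refine d1.moment_eq hab d2 ?_ ?_ (n := ℓ - 2) (fun q hq => ?_) (by rwa [show ℓ - 2 + 1 = ℓ - 1 by omega])
  · simp [edgePt, hp.vert a ha]
  · simp [edgePt, hp.vert b hb]
  · rw [edgeMoment_sum _ fun i => memLp_edgePt (continuous_ev _) a b,
      edgeMoment_sum _ fun i => contRep_memLp_edge ha hb (h.app i).rep.1]
    simp only [hp.edge a ha b hb hab q hq]

set_option maxHeartbeats 400000 in
lemma shear_moment (h : IsVApprox K v g H J φ V D) (ht : IsTriple K a b c)
    (hp : HasVMoments ℓ K V D p) (hℓ : 2 ≤ ℓ) (hab : a ≠ b) (ha : a ∈ K) (hb : b ∈ K)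
    {G : Fin 2 → Fin 2 → Fin 2 → ℝ → ℝ}
    (hG : ∀ m i j, IsEdgeTrace K a b (symCurlOf (H m) i j) (G m i j)) {q : ℝ[X]}
    (hq : q ∈ degreeLT ℝ ℓ) :
    edgeMoment a b (polyShear a b (symCurlPoly p)) q =
      edgeMoment a b (fun s => shear a b fun m i j => G m i j s) q := by
  have hs : ∀ i, ContDiff ℝ ∞ (ev (p i)) := fun i => contDiff_ev (p i)
  have d1 := isEdgeDeriv_shear hab hs
  simp only [← ev_symCurlPoly] at d1
  simp only [partialD_ev] at d1
  have c1 := isEdgeDeriv_tangent hab fun i => (hs i).of_le (by simp)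
  simp only [partialD_ev] at c1
  have d2 := IsApprox.isEdgeDeriv (fun p : Fin 2 × Fin 2 => tangent a b p.1 * tangent a b p.2)
    (fun p => h.app' p.1 p.2) ha hb (fun n => isEdgeDeriv_shear hab fun i => (h.app i).smooth n)
    (memLp_shear (fun m i j => (hG m i j).1) a b)
    (tendstoL2_shear (fun n m i j => memLp_edgePt
      (contDiff_partialD_top ((h.symCurl i j).smooth n) m).continuous a b)
      (fun m i j => (hG m i j).1)
      (fun m i j => (h.symCurl i j).tendsto_trace ht ((h.symCurl i j).weak m) (hG m i j)) a b)
  have hD := fun p : Fin 2 × Fin 2 => contRep_memLp_edge ha hb (h.app' p.1 p.2).rep.1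
  have hDn := fun (p : Fin 2 × Fin 2) n =>
    memLp_edgePt ((h.app' p.1 p.2).smooth n).continuous a b
  have c2 := IsApprox.isEdgeDeriv (tangent a b) h.app ha hb
    (fun n => isEdgeDeriv_tangent hab fun i => ((h.app i).smooth n).of_le (by simp))
    (memLp_finsetSum _ fun p _ => (hD p).const_mul (tangent a b p.1 * tangent a b p.2))
    (TendstoL2.sum _ (fun p n => ((hDn p n).const_mul _).1) (fun p => ((hD p).const_mul _).1)
      fun p => TendstoL2.const_mul' _ (hDn p) (hD p) ((h.app' p.1 p.2).tendsto_edge ha hb))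
  refine d1.moment_eq hab d2 ?_ ?_ (n := ℓ - 1) (fun q hq => ?_) (by rwa [show ℓ - 1 + 1 = ℓ by omega])
  · simp [edgePt, hp.grad a ha]
  · simp [edgePt, hp.grad b hb]
  refine c1.moment_eq hab c2 ?_ ?_ (n := ℓ - 2) (fun q hq => ?_) (by rwa [show ℓ - 2 + 1 = ℓ - 1 by omega])
  · simp [edgePt, hp.vert a ha]
  · simp [edgePt, hp.vert b hb]
  · rw [edgeMoment_sum _ fun i => memLp_edgePt (continuous_ev _) a b,
      edgeMoment_sum _ fun i => contRep_memLp_edge ha hb (h.app i).rep.1]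
    simp only [hp.edge a ha b hb hab q hq]

end IsVApprox

/-! ### The interpolation operator for vector fields on a triangle -/

/-- The moments of a function on a triangle. -/
def momentForm (K : Finset Plane) (u : ScalarField) (hu : MemL2 K° u) :
    Poly →ₗ[ℝ] ℝ :=
  fieldLin K (fun _ _ => u) (fun _ _ => hu) ∘ₗ LinearMap.single ℝ (fun _ => Fin 2 → Poly) 0 ∘ₗ
    LinearMap.single ℝ (fun _ => Poly) 0

lemma momentForm_apply (hu : MemL2 K° u) (q : Poly) :
    momentForm K u hu q = ∫ x in hull K, u x * ev q x := by
  simp [momentForm, fieldLin_apply, sum_univ_two]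

lemma IsTriple.existsUnique_isL2Proj (h : IsTriple K a b c) (r : ℕ) (hq : MemL2 K° q) :
    ∃! p, IsL2Proj r K q p := by
  obtain ⟨p, hp, hpq⟩ := h.exists_cellForm_eq r (momentForm K q hq)
  refine ⟨p, ⟨hp, fun z hz => by rw [← momentForm_apply hq, ← hpq z hz, cellForm_apply]⟩,
    fun p' hp' => sub_eq_zero.1 (h.poly_eq_zero_of_integral_sq ?_)⟩
  have hz := sub_mem hp'.1 hp
  rw [← cellForm_apply, LinearMap.map_sub₂, hpq _ hz, momentForm_apply, ← hp'.2 _ hz,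
    cellForm_apply, sub_self]

variable {D : TensorField}

lemma IsTriple.exists_isHermiteInterp (h : IsTriple K a b c) (hℓ : 2 ≤ ℓ) {V : VectorField}
    (hV : ∀ i, IsContRep K (v i) (V i))
    (hD : ∀ m i, HasWeakPartial K° m (v i) (D m i) ∧ ContinuousOn (D m i) (hull K)) :
    ∃ p, HasVMoments ℓ K V D p ∧ IsHermiteInterp ℓ K v p := by
  have hp : ∀ i, ∃ p ∈ polyDeg (ℓ + 1), (∀ δ ∈ K, ev p δ = V i δ ∧
      ∀ m, ev (pderiv m p) δ = D m i δ) ∧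
      (∀ x ∈ K, ∀ y ∈ K, x ≠ y → ∀ q ∈ degreeLT ℝ (ℓ - 2),
        edgeMoment x y (fun s => ev p (edgePt x y s)) q =
          edgeMoment x y (fun s => V i (edgePt x y s)) q) ∧
      ∀ q ∈ polyDeg (ℓ - 2), ∫ x in hull K, ev p x * ev q x = ∫ x in hull K, v i x * ev q x := by
    intro i
    obtain ⟨W, hW⟩ := ContinuousMap.exists_restrict_eq (isCompact_hull K).isClosed
      ⟨_, (hV i).1.domRestrict⟩
    have hW' : ∀ x ∈ hull K, W x = V i x := fun x hx => (DFunLike.congr_fun hW ⟨x, hx⟩ :)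
    obtain ⟨p, hp, h1, h2, h3⟩ := h.exists_hermite hℓ (V i) (fun m => D m i)
      (fun x y => momentLin x y _ (memLp_edgePt W.continuous x y))
      (fun x y q => by
        change edgeMoment y x _ q = edgeMoment x y _ _
        rw [← edgeMoment_swap]
        simp only [edgePt_swap x y])
      (momentForm K (v i) (hD 0 i).1.1)
    refine ⟨p, hp, h1, fun x hx y hy hxy q hq => (h2 x hx y hy hxy q hq).trans
      (edgeMoment_congr ?_ x y q), fun q hq => by rw [← cellForm_apply, h3 q hq, momentForm_apply]⟩
    filter_upwards [ae_restrict_mem measurableSet_Icc] with s hs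
    exact hW' _ (edgePt_mem_hull hx hy hs)
  choose p hp h1 h2 h3 using hp
  exact ⟨p, ⟨hp, fun δ hδ i => (h1 i δ hδ).1, fun δ hδ m i => (h1 i δ hδ).2 m,
    fun x hx y hy hxy q hq i => h2 i x hx y hy hxy q hq⟩, hp, V, D, hV, hD,
    fun δ hδ i => h1 i δ hδ, fun x hx y hy hxy q hq i => h2 i x hx y hy hxy q hq,
    fun q hq i => h3 i q hq⟩

namespace IsVApprox

variable {V : VectorField} {g : TensorField} {H : Fin 2 → TensorField}
  {J : Fin 2 → Fin 2 → TensorField} {φ : Fin 2 → ℕ → ScalarField} {p : Fin 2 → Poly}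
  {σ : TensorPoly}

lemma exists_sigmaData (h : IsVApprox K v g H J φ V D) (ht : IsTriple K a b c) :
    ∃ G, IsSigmaData K (symCurlOf g) (symCurlOf D) (fun m => symCurlOf (H m)) G := by
  obtain ⟨T, G, hd⟩ := ht.exists_sigmaData (fun i j => (h.symCurl i j).memH)
    fun m i j => (h.symCurl i j).weak m
  exact ⟨G, fun i j => (h.symCurl i j).rep, hd.weak, hd.trace⟩

lemma ev_symCurlPoly_vertex (hp : HasVMoments ℓ K V D p) (hδ : δ ∈ K) (i j : Fin 2) :
    ev (symCurlPoly p i j) δ = symCurlOf D i j δ := by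
  rw [ev_symCurlPoly, symCurlOf_apply, symCurlOf_apply]
  simp only [partialD_ev, hp.grad δ hδ]

lemma exists_bubble (h : IsVApprox K v g H J φ V D) (ht : IsTriple K a b c) (hk : 3 ≤ k)
    (hℓ : k ≤ ℓ + 1) (hp : HasVMoments ℓ K V D p)
    (hd : IsSigmaData K (symCurlOf g) (symCurlOf D) (fun m => symCurlOf (H m)) G)
    (hσ : HasSigmaMoments ℓ k c₀ K (symCurlOf g) (symCurlOf D) G σ) (h0 : divDivPoly σ = 0) :
    ∃ w ∈ VBubble ℓ K, symCurlPoly w = σ - symCurlPoly p := by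
  obtain ⟨u, hu, rfl⟩ := exists_symCurlPoly_of_divDivPoly_eq_zero hσ.mem h0
  have hm := symCurlPoly_mem_sigmaLocal (k := k) c₀ hp.mem
  have hv : ∀ δ ∈ K, ∀ i j, ev (symCurlPoly u i j) δ = ev (symCurlPoly p i j) δ :=
    fun δ hδ i j => by rw [hσ.vert δ hδ, ev_symCurlPoly_vertex hp hδ]
  have hv' : ∀ δ ∈ K, ∀ i j, ev (symCurlPoly (u - p) i j) δ = 0 := fun δ hδ i j => by
    simp [symCurlPoly_sub, hv δ hδ]
  have he : ∀ x ∈ K, ∀ y ∈ K, x ≠ y → rtJet (u - p) x = rtJet (u - p) y ∧ ∀ i s,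
      ev ((u - p) i) (edgePt x y s) =
        (rtJet (u - p) x).1 i + (rtJet (u - p) x).2 * edgePt x y s i := by
    intro x hx y hy hxy
    obtain ⟨z, hz⟩ := ht.exists_third hx hy hxy
    refine edge_rigid hxy (fun s => ?_) (fun s => ?_) (hv' x hx) (hv' y hy)
    · rw [symCurlPoly_sub, polyNN_sub, sub_eq_zero]
      exact sigmaLocal_polyNN_eq hk hℓ hσ.mem hm hxy (hv x hx) (hv y hy) (fun q hq => by
        rw [hσ.nn x hx y hy hxy q hq, h.nn_moment hp (by omega) hx hy hxy hq]) s
    · rw [symCurlPoly_sub, polyShear_sub, sub_eq_zero]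
      exact polyShear_eq_of_moments hxy (shearPoly_mem hk hℓ hσ.mem hxy)
        (shearPoly_mem hk hℓ hm hxy) (fun q hq => by
          rw [hσ.sh x hx y hy hxy q hq, h.shear_moment hz hp (by omega) hxy hx hy
            (hd.trace x hx y hy hxy) hq]) s
  have ha : a ∈ K := ht.mem_iff.2 (Or.inl rfl)
  have hj : ∀ δ ∈ K, rtJet (u - p) δ = rtJet (u - p) a := fun δ hδ => by
    by_cases e : δ = a
    · rw [e]
    · exact (he δ hδ a ha e).1
  refine ⟨u - p - rtPoly (rtJet (u - p) a), ⟨fun i => Submodule.sub_mem _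
    (sub_mem (hu i) (hp.mem i)) (rtPoly_mem_polyDeg _ i ℓ), fun δ hδ i => ⟨?_, fun m => ?_⟩,
    fun x hx y hy hxy q _ i => ?_⟩, by simp [symCurlPoly_sub]⟩
  · rw [Pi.sub_apply, ev_sub, ev_eq_of_rtJet, hj δ hδ, ev_rtPoly, sub_self]
  · rw [Pi.sub_apply, map_sub, ev_sub, pderiv_eq_of_symCurlPoly_eq_zero (hv' δ hδ), hj δ hδ,
      pderiv_rtPoly]
    split_ifs <;> simp
  · simp only [Pi.sub_apply _ (rtPoly _), ev_sub _ (rtPoly _ _), (he x hx y hy hxy).2, hj x hx,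
      ev_rtPoly, sub_self]
    simp [edgeMoment]

/-- The data of the interpolant and of its `sym curl`. -/
lemma spec (h : IsVApprox K v g H J φ V D) (ht : IsTriple K a b c)
    (hd : IsSigmaData K (symCurlOf g) (symCurlOf D) (fun m => symCurlOf (H m)) G)
    (hp : IsVInterp ℓ k c₀ K v p) : HasVMoments ℓ K V D p ∧
      HasSigmaMoments ℓ k c₀ K (symCurlOf g) (symCurlOf D) G (symCurlPoly p) := by
  obtain ⟨p₀, w, τ, σ, ⟨hm, V', D', hV', hD', hvert, hedge, -⟩, hτ, hσ, hw, e, rfl⟩ := hp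
  have eV := fun i => ht.isContRep_unique (hV' i) (h.app i).rep (ae_eq_refl _)
  have eD := fun m i => ht.isContRep_unique ⟨(hD' m i).2, ae_eq_refl _⟩ (h.app' m i).rep (by
    rw [← restrict_interior_hull]
    exact (hD' m i).1.unique isOpen_interior ((h.app i).weak m))
  refine ⟨⟨fun i => add_mem (hm i) (hw.1 i), fun δ hδ i => ?_, fun δ hδ m i => ?_,
    fun x hx y hy hxy q hq i => ?_⟩, ?_⟩
  · rw [Pi.add_apply, ev_add, (hvert δ hδ i).1, (hw.2.1 δ hδ i).1, add_zero,
      eV i δ (vertex_mem_hull hδ)]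
  · rw [Pi.add_apply, map_add, ev_add, (hvert δ hδ i).2, (hw.2.1 δ hδ i).2, add_zero,
      eD m i δ (vertex_mem_hull hδ)]
  · have h1 := hedge x hx y hy hxy q hq i
    have h2 := hw.2.2 x hx y hy hxy q hq i
    have h3 : edgeMoment x y (fun s => V' i (edgePt x y s)) q =
        edgeMoment x y (fun s => V i (edgePt x y s)) q := edgeMoment_congr (by
      filter_upwards [ae_restrict_mem measurableSet_Icc] with s hs
      exact eV i _ (edgePt_mem_hull hx hy hs)) x y q
    rw [← h3, ← h1]
    simp only [← eval_restr] at h2 ⊢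
    change dist x y * lineForm _ q = 0 at h2
    change dist x y * lineForm _ q = dist x y * lineForm _ q
    rw [Pi.add_apply, map_add, map_add, LinearMap.add_apply, mul_add, h2, add_zero]
  · rw [symCurlPoly_add, e, add_sub_cancel]
    exact ht.hasSigmaMoments hσ hd (hτ.unique isOpen_interior h.isSymCurl)

end IsVApprox

/-- The interpolation operator `I_K` is well defined. -/
theorem IsTriple.existsUnique_isVInterp (ht : IsTriple K a b c) (c₀ : Plane) (hk : 3 ≤ k)
    (hℓ : k ≤ ℓ + 1) (hv : MemHVec K° 3 v) : ∃! p, IsVInterp ℓ k c₀ K v p := by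
  obtain ⟨g, H, J, φ, V, D, h⟩ := ht.exists_isVApprox hv
  obtain ⟨G, hd⟩ := h.exists_sigmaData ht
  have hrep : ∀ m i, g m i =ᵐ[vol K°] D m i := fun m i => by
    rw [restrict_interior_hull]
    exact (h.app' m i).rep.2
  obtain ⟨p₀, hp₀, hH⟩ := ht.exists_isHermiteInterp (by omega : 2 ≤ ℓ) (fun i => (h.app i).rep)
    fun m i => ⟨((h.app i).weak m).congr (ae_eq_refl _) (hrep m i), (h.app' m i).rep.1⟩
  obtain ⟨σ, hσ⟩ := ht.exists_hasSigmaMoments (ℓ := ℓ) c₀ hk hℓ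
    (fun i j => by rw [symCurlOf_symm]) hd
  have hσ' := hσ.isSigmaInterp hd
  have h0 := ht.isL2Proj_divDivPoly hk hℓ (fun i j => (h.symCurl i j).memH) h.isSymCurl.isDivDiv hσ'
  obtain ⟨w, hw, e⟩ := h.exists_bubble ht hk hℓ hp₀ hd hσ
    (ht.poly_eq_zero_of_integral_sq ((h0.2 _ h0.1).trans (by simp)))
  refine ⟨p₀ + w, ⟨p₀, w, _, σ, hH, h.isSymCurl, hσ', hw, e, rfl⟩, fun p' hp' => ?_⟩
  obtain ⟨m1, s1⟩ := h.spec ht hd ⟨p₀, w, _, σ, hH, h.isSymCurl, hσ', hw, e, rfl⟩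
  obtain ⟨m2, s2⟩ := h.spec ht hd hp'
  obtain ⟨r, hr⟩ := eq_rtPoly_of_symCurlPoly_eq_zero
    (by rw [symCurlPoly_sub, s2.unique ht hk hℓ s1, sub_self] : symCurlPoly (p' - (p₀ + w)) = 0)
  have ha : a ∈ K := ht.mem_iff.2 (Or.inl rfl)
  have e1 : ∀ i, ev (rtPoly r i) a = 0 := fun i => by
    rw [← hr, Pi.sub_apply, ev_sub, m1.vert a ha, m2.vert a ha, sub_self]
  have e2 : ev (pderiv 0 (rtPoly r 0)) a = 0 := by
    rw [← hr, Pi.sub_apply, map_sub, ev_sub, m1.grad a ha, m2.grad a ha, sub_self]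
  simp only [ev_rtPoly] at e1
  simp only [pderiv_rtPoly, if_true, ev_C] at e2
  have e3 : rtPoly r = 0 := funext fun i => ev_injective fun x => by
    have := e1 i
    simp only [e2, zero_mul, add_zero] at this
    simp [this, e2]
  rw [← sub_eq_zero, hr, e3]

variable {p : Fin 2 → Poly} {σ : TensorPoly} {r : VectorField}

/-! ### The Sobolev complex -/

lemma memH_ev (hU : IsBounded U) (p : Poly) (r : ℕ) : MemH U r (ev p) := by
  induction r generalizing p with
  | zero => exact (hasWeakPartial_ev hU p 0).1
  | succ r ih => exact ⟨_, fun m => ⟨hasWeakPartial_ev hU p m, ih _⟩⟩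

lemma isSymCurl_rtPoly (hU : IsBounded U) (g : (Fin 2 → ℝ) × ℝ) :
    IsSymCurl U (fun i => ev (rtPoly g i)) 0 :=
  ⟨_, fun m i => hasWeakPartial_ev hU (rtPoly g i) m, fun i j => by
    have e := IsVApprox.ev_symCurlPoly (rtPoly g) i j
    simp only [partialD_ev] at e
    rw [← e, symCurlPoly_rtPoly]
    exact ae_of_all _ fun x => by simp⟩

lemma exists_isSymCurl (hv : MemHVec U 3 v) : ∃ τ, MemHSym U 2 τ ∧ IsSymCurl U v τ := by
  choose g hg using hv
  refine ⟨symCurlOf fun m i => g i m, ⟨fun i j => ?_, fun i j => by rw [symCurlOf_symm]⟩, _,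
    fun m i => (hg i m).1, fun _ _ => ae_eq_refl _⟩
  obtain ⟨s, t, m, m', e⟩ := symCurlOf_eq_smul_add i j
  rw [e]
  exact (hg i m).2.smul_add s t (hg j m').2

lemma exists_isDivDiv (hτ : MemHSym U 2 τ) : ∃ q, IsDivDiv U τ q := by
  choose g hg using hτ.1
  choose H hH using fun i j m => (hg i j m).2
  exact ⟨_, isDivDiv_of_hasWeakPartial (fun i j m => (hg i j m).1) fun i j m n => (hH i j m n).1⟩

/-! ### Interpolation of Raviart-Thomas fields on a triangle -/

section Local

lemma isSigmaInterp_zero (c₀ : Plane) : IsSigmaInterp ℓ k c₀ K 0 0 := by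
  have hw : ∀ m, HasWeakPartial K° m 0 0 := fun m => by
    have := hasWeakPartial_ev (isBounded_interior_hull K) 0 m
    rwa [map_zero, show ev 0 = 0 from funext fun x => by simp] at this
  refine ⟨⟨0, by simp, 0, by simp, by simp [symCurlPoly, symCurlOf, curlOf]⟩, 0, 0,
    fun _ _ => ⟨continuousOn_const, ae_eq_refl _⟩, fun m _ _ => hw m, by simp, fun a _ b _ _ =>
      ⟨by simp [edgeMoment, polyNN, normalNormal], 0, fun m i j => ⟨MemLp.zero, 0, hw,
        0, fun _ => contDiff_const, by simp, by simp [partialD], by simp⟩,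
        by simp [edgeMoment, polyShear, shear]⟩, by simp⟩

lemma isVInterp_rtPoly (c₀ : Plane) (g : (Fin 2 → ℝ) × ℝ) :
    IsVInterp ℓ k c₀ K (fun i => ev (rtPoly g i)) (rtPoly g) := by
  have hU := isBounded_interior_hull K
  refine ⟨rtPoly g, 0, 0, 0, ⟨fun i => rtPoly_mem_polyDeg g i ℓ, fun i => ev (rtPoly g i),
    fun m i => ev (pderiv m (rtPoly g i)),
    fun i => ⟨(continuous_ev _).continuousOn, ae_eq_refl _⟩,
    fun m i => ⟨hasWeakPartial_ev hU _ m, (continuous_ev _).continuousOn⟩, fun _ _ _ =>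
      ⟨rfl, fun _ => rfl⟩, fun _ _ _ _ _ _ _ _ => rfl, fun _ _ _ => rfl⟩, isSymCurl_rtPoly hU g,
    isSigmaInterp_zero c₀, ⟨by simp, by simp, by simp [edgeMoment]⟩, ?_, by simp⟩
  simpa using symCurlPoly_sub 0 0

/-- The interpolants of a field and of its `sym curl` commute. -/
lemma IsTriple.symCurlPoly_eq (ht : IsTriple K a b c) (hk : 3 ≤ k) (hℓ : k ≤ ℓ + 1)
    (hv : MemHVec K° 3 v) (hτ : IsSymCurl K° v τ) (hp : IsVInterp ℓ k c₀ K v p)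
    (hσ : IsSigmaInterp ℓ k c₀ K τ σ) : symCurlPoly p = σ := by
  obtain ⟨g, H, J, φ, V, D, h⟩ := ht.exists_isVApprox hv
  obtain ⟨G, hd⟩ := h.exists_sigmaData ht
  exact (h.spec ht hd hp).2.unique ht hk hℓ
    (ht.hasSigmaMoments hσ hd (hτ.unique isOpen_interior h.isSymCurl))

end Local

/-! ### The global interpolation operators -/

section Mesh

variable {c : Finset Plane → Plane}

variable (hΩ : IsPolygon Ω) (hM : M.IsMeshOf Ω) (hk : 3 ≤ k) (hℓ : k ≤ ℓ + 1)

include hΩ hM hk hℓ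

lemma existsUnique_isVInterp (hv : MemHVec Ω 3 v) (hK : K ∈ M.cells) :
    ∃! p, IsVInterp ℓ k (c K) K v p := by
  obtain ⟨x, y, z, h⟩ := M.isTriple hK
  exact h.existsUnique_isVInterp _ hk hℓ fun i => (hv i).cell hΩ hM hK

lemma existsUnique_isSigmaInterp (hτ : MemHSym Ω 2 τ)
    (hK : K ∈ M.cells) : ∃! p, IsSigmaInterp ℓ k (c K) K τ p := by
  obtain ⟨x, y, z, h⟩ := M.isTriple hK
  exact h.existsUnique_isSigmaInterp _ hk hℓ ⟨fun i j => (hτ.1 i j).cell hΩ hM hK,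
    fun i j => ae_mono (Measure.restrict_mono_set _ (interior_hull_subset hΩ hM hK)) (hτ.2 i j)⟩

omit hk hℓ in
lemma existsUnique_isL2Proj (r : ℕ) (hq : MemL2 Ω q) (hK : K ∈ M.cells) :
    ∃! p, IsL2Proj r K q p := by
  obtain ⟨x, y, z, h⟩ := M.isTriple hK
  exact h.existsUnique_isL2Proj r (hq.mono (interior_hull_subset hΩ hM hK))

lemma vInterp_spec (hv : MemHVec Ω 3 v) (hK : K ∈ M.cells) :
    IsVInterp ℓ k (c K) K v (vInterp ℓ k (c K) K v) :=
  Classical.epsilon_spec (existsUnique_isVInterp hΩ hM hk hℓ hv hK).exists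

lemma sigmaInterp_spec (hτ : MemHSym Ω 2 τ) (hK : K ∈ M.cells) :
    IsSigmaInterp ℓ k (c K) K τ (sigmaInterp ℓ k (c K) K τ) :=
  Classical.epsilon_spec (existsUnique_isSigmaInterp hΩ hM hk hℓ hτ hK).exists

omit hk hℓ in
lemma l2Proj_spec (r : ℕ) (hq : MemL2 Ω q) (hK : K ∈ M.cells) : IsL2Proj r K q (l2Proj r K q) :=
  Classical.epsilon_spec (existsUnique_isL2Proj hΩ hM r hq hK).exists

lemma interpV_mem (hv : MemHVec Ω 3 v) :
    IsVFamily M ℓ (fun K => vInterp ℓ k (c K) K v) ∧ interpV M c ℓ k v ∈ Vh Ω M ℓ := by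
  choose g hg using id hv
  have hd : ∀ K ∈ M.cells, ∃ V D, (∀ i, IsContRep K (v i) (V i)) ∧
      (∀ m i, IsContRep K (g i m) (D m i)) ∧ HasVMoments ℓ K V D (vInterp ℓ k (c K) K v) :=
    fun K hK => by
      obtain ⟨x, y, z, ht⟩ := M.isTriple hK
      obtain ⟨g', H, J, φ, V, D, h⟩ := ht.exists_isVApprox fun i => (hv i).cell hΩ hM hK
      obtain ⟨G, hd⟩ := h.exists_sigmaData ht
      refine ⟨V, D, fun i => (h.app i).rep, fun m i => ⟨(h.app' m i).rep.1, ?_⟩,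
        (h.spec ht hd (vInterp_spec hΩ hM hk hℓ hv hK)).1⟩
      have e := ((hg i m).1.cell hΩ hM hK).unique isOpen_interior ((h.app i).weak m)
      rw [restrict_interior_hull] at e
      exact e.trans (h.app' m i).rep.2
  choose! V D hV hD hm using hd
  have hu : ∀ i, MemH Ω 2 (v i) := fun i =>
    ⟨g i, fun m => ⟨(hg i m).1, (hg i m).2.imp fun _ h n => ⟨(h n).1, (h n).1.2.1⟩⟩⟩
  have hf : IsVFamily M ℓ fun K => vInterp ℓ k (c K) K v := by
    refine isVFamily_of_moments (by omega) (fun K hK => (hm K hK).mem)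
      (fun K hK L hL δ h1 h2 i => ⟨?_, fun m => ?_⟩)
      fun K hK L hL a b h1 h2 h3 h4 hab q hq i => ?_
    · rw [(hm K hK).vert δ h1, (hm L hL).vert δ h2]
      exact contRep_eq_of_common_vertex hΩ hM hK hL h1 h2 (hu i) (hV K hK i) (hV L hL i)
    · rw [(hm K hK).grad δ h1, (hm L hL).grad δ h2]
      exact contRep_eq_of_common_vertex hΩ hM hK hL h1 h2 (hg i m).2 (hD K hK m i) (hD L hL m i)
    · rw [(hm K hK).edge a h1 b h3 hab q hq, (hm L hL).edge a h2 b h4 hab q hq]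
      refine edgeMoment_congr ?_ a b q
      filter_upwards [ae_restrict_mem measurableSet_Icc] with s hs
      exact contRep_eq_of_shared hΩ hM hK hL hab h1 h3 h2 h4 (hu i) (hV K hK i) (hV L hL i) s hs
  exact ⟨hf, (mem_vh_iff hΩ hM (by omega)).2
    ⟨_, hf, fun K hK i => eqOnCell_piecewise (fun K => vInterp ℓ k (c K) K v i) hK⟩⟩

lemma interpSigma_mem (hτ : MemHSym Ω 2 τ) : interpSigma M c ℓ k τ ∈ SigmaH Ω M c ℓ k := by
  choose D hD using hτ.1
  have hd : ∀ K ∈ M.cells, ∃ T G, IsSigmaData K τ T (fun m i j => D i j m) G := fun K hK => by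
    obtain ⟨x, y, z, h⟩ := M.isTriple hK
    exact h.exists_sigmaData (fun i j => (hτ.1 i j).cell hΩ hM hK)
      fun m i j => (hD i j m).1.cell hΩ hM hK
  choose! T G hd using hd
  have hm : ∀ K ∈ M.cells, HasSigmaMoments ℓ k (c K) K τ (T K) (G K) (sigmaInterp ℓ k (c K) K τ) :=
    fun K hK => by
      obtain ⟨x, y, z, h⟩ := M.isTriple hK
      exact h.hasSigmaMoments (sigmaInterp_spec hΩ hM hk hℓ hτ hK) (hd K hK) fun _ _ => ae_eq_refl _
  have he : ∀ K ∈ M.cells, ∀ i j, EqOnCell K (interpSigma M c ℓ k τ i j)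
      (sigmaInterp ℓ k (c K) K τ i j) := fun K hK i j =>
    eqOnCell_piecewise (fun K => sigmaInterp ℓ k (c K) K τ i j) hK
  refine ⟨fun i j => memL2_of_cells hΩ hM fun K hK => (he K hK i j).memL2,
    fun K => sigmaInterp ℓ k (c K) K τ, fun K hK => ⟨(hm K hK).mem, he K hK⟩, fun K hK L hL =>
    ⟨fun δ h1 h2 i j => ?_, fun a b h1 h2 h3 h4 hab => ⟨fun q hq => ?_, fun q hq => ?_⟩⟩⟩
  · rw [(hm K hK).vert δ h1, (hm L hL).vert δ h2]
    exact contRep_eq_of_common_vertex hΩ hM hK hL h1 h2 (hτ.1 i j) ((hd K hK).rep i j)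
      ((hd L hL).rep i j)
  · rw [(hm K hK).nn a h1 b h3 hab q hq, (hm L hL).nn a h2 b h4 hab q hq]
    refine edgeMoment_congr ?_ a b q
    filter_upwards [ae_restrict_mem measurableSet_Icc] with s hs
    congr 1
    funext i j
    exact contRep_eq_of_shared hΩ hM hK hL hab h1 h3 h2 h4 (hτ.1 i j) ((hd K hK).rep i j)
      ((hd L hL).rep i j) s hs
  · rw [(hm K hK).sh a h1 b h3 hab q hq, (hm L hL).sh a h2 b h4 hab q hq]
    refine edgeMoment_congr ?_ a b q
    have e : ∀ᵐ s ∂edgeVol, ∀ m i j, G K a b m i j s = G L a b m i j s := by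
      simp only [ae_all_iff]
      exact fun m i j => edgeTrace_eq_of_shared hΩ hM hK hL hab h1 h3 h2 h4
        (fun n => ((hD i j m).2.choose_spec n).1) ((hd K hK).trace a h1 b h3 hab m i j)
        ((hd L hL).trace a h2 b h4 hab m i j)
    filter_upwards [e] with s hs
    simp only [hs]

omit hk hℓ in
lemma projQ_mem (hq : MemL2 Ω q) : projQ M k q ∈ Qh Ω M k := by
  have h : ∀ K ∈ M.cells, EqOnCell K (projQ M k q) (l2Proj (k - 2) K q) := fun K hK =>
    eqOnCell_piecewise (fun K => l2Proj (k - 2) K q) hK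
  exact ⟨memL2_of_cells hΩ hM fun K hK => (h K hK).memL2, fun K hK =>
    ⟨_, (l2Proj_spec hΩ hM _ hq hK).1, h K hK⟩⟩

lemma interpV_rt (hr : r ∈ RT) (i : Fin 2) : interpV M c ℓ k r i =ᵐ[vol Ω] r i := by
  obtain ⟨g, hg⟩ := rt_eq_rtPoly hr
  obtain rfl : r = fun i => ev (rtPoly g i) := funext hg
  refine ae_eq_of_cells hΩ hM (fun K hK =>
    eqOnCell_piecewise (fun K => vInterp ℓ k (c K) K (fun i => ev (rtPoly g i)) i) hK) fun K hK => ?_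
  have hp := isVInterp_rtPoly (ℓ := ℓ) (k := k) (K := K) (c K) g
  obtain ⟨x, y, z, h⟩ := M.isTriple hK
  rw [vInterp, (h.existsUnique_isVInterp (c K) hk hℓ fun i =>
    memH_ev (isBounded_interior_hull K) _ 3).unique (Classical.epsilon_spec ⟨_, hp⟩) hp]
  exact ae_eq_refl _

lemma isSymCurl_interp (hv : MemHVec Ω 3 v) (hτ : IsSymCurl Ω v τ) :
    IsSymCurl Ω (interpV M c ℓ k v) (interpSigma M c ℓ k τ) := by
  refine isSymCurl_of_family hΩ hM (interpV_mem hΩ hM hk hℓ hv).1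
    (fun K hK i => eqOnCell_piecewise (fun K => vInterp ℓ k (c K) K v i) hK) fun K hK i j => ?_
  obtain ⟨τ', hs, hτ'⟩ := exists_isSymCurl hv
  have e := hτ'.unique hΩ.isOpen hτ
  obtain ⟨x, y, z, h⟩ := M.isTriple hK
  obtain ⟨D, hD, hτD⟩ := hτ
  rw [h.symCurlPoly_eq hk hℓ (fun i => (hv i).cell hΩ hM hK)
    ⟨D, fun m i => (hD m i).cell hΩ hM hK, fun i j =>
      ae_mono (Measure.restrict_mono_set _ (interior_hull_subset hΩ hM hK)) (hτD i j)⟩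
    (vInterp_spec hΩ hM hk hℓ hv hK) (sigmaInterp_spec hΩ hM hk hℓ
      ⟨fun i j => (hs.1 i j).congr (e i j),
        fun i j => (e i j).symm.trans ((hs.2 i j).trans (e j i))⟩ hK)]
  exact eqOnCell_piecewise (fun K => sigmaInterp ℓ k (c K) K τ i j) hK

lemma isDivDiv_interp (hτ : MemHSym Ω 2 τ) (hq : IsDivDiv Ω τ q) :
    IsDivDiv Ω (interpSigma M c ℓ k τ) (projQ M k q) := by
  obtain ⟨q', -, h'⟩ := exists_isDivDiv_of_mem_sigmaH hΩ hM hk hℓ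
    (interpSigma_mem (c := c) hΩ hM hk hℓ hτ)
  refine h'.congr (fun _ _ => ae_eq_refl _) (ae_eq_of_cells hΩ hM (fun K hK =>
    h'.eqOnCell hΩ.isOpen (interior_hull_subset hΩ hM hK) fun i j =>
      eqOnCell_piecewise (fun K => sigmaInterp ℓ k (c K) K τ i j) hK) fun K hK => ?_)
  obtain ⟨x, y, z, h⟩ := M.isTriple hK
  rw [(existsUnique_isL2Proj hΩ hM (k - 2) hq.2.1 hK).unique (h.isL2Proj_divDivPoly hk hℓ
    (fun i j => (hτ.1 i j).cell hΩ hM hK)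
    (hq.mono hΩ.isOpen.measurableSet (interior_hull_subset hΩ hM hK))
    (sigmaInterp_spec hΩ hM hk hℓ hτ hK)) (l2Proj_spec hΩ hM _ hq.2.1 hK)]
  exact eqOnCell_piecewise (fun K => l2Proj (k - 2) K q) hK

end Mesh

end DivDiv

end

theorem mainTheorem2 (Ω : Set Plane) (hΩ : IsPolygon Ω) (M : Triangulation) (hM : M.IsMeshOf Ω)
    (c : Finset Plane → Plane) (ℓ k : ℕ) (hk : 3 ≤ k) (hℓ : k ≤ ℓ + 1) :
    -- the discrete complex is well defined ...
    (RT ⊆ Vh Ω M ℓ ∧ (∀ v ∈ Vh Ω M ℓ, ∃ τ ∈ SigmaH Ω M c ℓ k, IsSymCurl Ω v τ) ∧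
      (∀ τ ∈ SigmaH Ω M c ℓ k, ∃ q ∈ Qh Ω M k, IsDivDiv Ω τ q)) ∧
    -- ... and exact at each of its three spaces
    ((∀ v ∈ Vh Ω M ℓ, IsSymCurl Ω v 0 ↔ ∃ r ∈ RT, ∀ i, v i =ᵐ[volume.restrict Ω] r i) ∧
      (∀ τ ∈ SigmaH Ω M c ℓ k, IsDivDiv Ω τ 0 ↔ ∃ v ∈ Vh Ω M ℓ, IsSymCurl Ω v τ) ∧
      (∀ q ∈ Qh Ω M k, ∃ τ ∈ SigmaH Ω M c ℓ k, IsDivDiv Ω τ q)) ∧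
    -- the top row of the diagram is a well-defined complex
    ((∀ r ∈ RT, MemHVec Ω 3 r ∧ IsSymCurl Ω r 0) ∧
      (∀ v, MemHVec Ω 3 v → ∃ τ, MemHSym Ω 2 τ ∧ IsSymCurl Ω v τ ∧ IsDivDiv Ω τ 0) ∧
      (∀ τ, MemHSym Ω 2 τ → ∃ q, IsDivDiv Ω τ q)) ∧
    -- the local operators are well defined, and the global ones map into the discrete spaces
    ((∀ v, MemHVec Ω 3 v →
        (∀ K ∈ M.cells, ∃! p, IsVInterp ℓ k (c K) K v p) ∧ interpV M c ℓ k v ∈ Vh Ω M ℓ) ∧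
      (∀ τ, MemHSym Ω 2 τ →
        (∀ K ∈ M.cells, ∃! p, IsSigmaInterp ℓ k (c K) K τ p) ∧
          interpSigma M c ℓ k τ ∈ SigmaH Ω M c ℓ k) ∧
      (∀ q, MemL2 Ω q →
        (∀ K ∈ M.cells, ∃! p, IsL2Proj (k - 2) K q p) ∧ projQ M k q ∈ Qh Ω M k)) ∧
    -- the three squares of the diagram commute
    ((∀ r ∈ RT, ∀ i, interpV M c ℓ k r i =ᵐ[volume.restrict Ω] r i) ∧
      (∀ v, MemHVec Ω 3 v → ∀ τ, IsSymCurl Ω v τ →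
        IsSymCurl Ω (interpV M c ℓ k v) (interpSigma M c ℓ k τ)) ∧
      (∀ τ, MemHSym Ω 2 τ → ∀ q, IsDivDiv Ω τ q →
        IsDivDiv Ω (interpSigma M c ℓ k τ) (projQ M k q))) := by
  refine ⟨⟨rt_subset_vh hΩ hM (by omega), fun v hv => exists_isSymCurl_of_mem_vh hΩ hM hk hℓ hv,
      fun τ hτ => exists_isDivDiv_of_mem_sigmaH hΩ hM hk hℓ hτ⟩,
    ⟨fun v hv => isSymCurl_zero_iff hΩ hM (by omega) hv,
      fun τ hτ => isDivDiv_zero_iff hΩ hM hk hℓ hτ,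
      fun q hq => exists_isDivDiv_eq hΩ hM hk hℓ hq⟩,
    ⟨fun r hr => ?_, fun v hv => ?_, fun τ hτ => exists_isDivDiv hτ⟩,
    ⟨fun v hv => ⟨fun K hK => existsUnique_isVInterp hΩ hM hk hℓ hv hK,
        (interpV_mem hΩ hM hk hℓ hv).2⟩,
      fun τ hτ => ⟨fun K hK => existsUnique_isSigmaInterp hΩ hM hk hℓ hτ hK,
        interpSigma_mem hΩ hM hk hℓ hτ⟩,
      fun q hq => ⟨fun K hK => existsUnique_isL2Proj hΩ hM _ hq hK, projQ_mem hΩ hM hq⟩⟩,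
    fun r hr i => interpV_rt hΩ hM hk hℓ hr i, fun v hv τ hτ => isSymCurl_interp hΩ hM hk hℓ hv hτ,
    fun τ hτ q hq => isDivDiv_interp hΩ hM hk hℓ hτ hq⟩
  · obtain ⟨g, hg⟩ := rt_eq_rtPoly hr
    obtain rfl : r = fun i => ev (rtPoly g i) := funext hg
    exact ⟨fun i => memH_ev hΩ.bounded _ 3, isSymCurl_rtPoly hΩ.bounded g⟩
  · obtain ⟨τ, h1, h2⟩ := exists_isSymCurl hv
    exact ⟨τ, h1, h2, h2.isDivDiv⟩
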